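/- Model and conventions. The computation model is a unit-cost word RAM: words are natural numbers below a bound $W$, addition, truncated subtraction, multiplication, comparison and memory access on words cost one step each, and producing a value that is not below $W$ is not allowed. For a linear code $C\subseteq\mathbb F_2^N$, the relative distance $\delta$ is the least Hamming distance of two distinct codewords divided by $N$, and for $1\le r\le \dim C$ the $r$-th generalized distance $\delta_r$ is $\frac1N$ times the minimum, over the $r$-dimensional subspaces $V\subseteq C$, of the number of coordinates $i$ such that $v_i\ne0$ for some $v\in V$. For $z\in(\mathbb F_2\cup\{\bot\})^N$ let $\mathrm{List}_C(z)$ be the set of $c\in C$ with $c_i=z_i$ whenever $z_i\ne\bot$. The expansion of a graph on $n\geq 2$ vertices whose adjacency matrix has eigenvalues $\lambda_1\ge\dots\ge\lambda_n$ is $\lambda=\max\{\lambda_2,|\lambda_n|\}$. The double cover of a $d$-regular graph $\tilde G=(\tilde V,\tilde E)$ on $n$ vertices (undirected, without multiple edges, loops allowed) has as its left and right vertices two copies of $\tilde V$, and an edge $(u,v)$ from the left vertex $u$ to the right vertex $v$ if and only if $(u,v)\in\tilde E$; it has $nd$ edges. Fix an order on the $d$ edges at every vertex of the double cover $G$, with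 edge set $E$. Given a linear code $C_0\subseteq\mathbb F_2^d$, the expander code $C(G,C_0)\subseteq\mathbb F_2^E$ consists of all labelings of the edges such that the labels of the $d$ edges at each left and each right vertex, read in the given order, form a word of $C_0$. Theorem. There are an algorithm ListDecode (a single word-RAM program) and a universal polynomial $\mathrm{poly}$ such that the following holds. Let $C_0\subseteq\mathbb F_2^d$ be a linear code with distance $\delta$, let $1\le r\le\dim C_0$, and let $\delta_r$ be the $r$-th generalized distance of $C_0$. Let $G$ be the double cover of a $d$-regular graph on $n\ge2$ vertices with expansion $\lambda$, let $C=C(G,C_0)$, let $\varepsilon>0$, and suppose that $$\frac{\lambda}{d}\le\frac{\varepsilon^2\delta^2}{2^{r+4}}.$$ Given $n$, $d$, a parity-check matrix of $C_0$ with at most $d$ rows, the ordered neighbour lists of $G$, and a received word $z\in(\mathbb F_2\cup\{\bot\})^E$ with at most $(1-\varepsilon)\,\delta\,\delta_r\,dn$ erasures, ListDecode, using words of $O(\log(nd+2))$ bits, halts after at most $$n\cdot\mathrm{poly}\!\left(\frac{2^r d}{\varepsilon\delta}\right)$$ steps. If $\mathrm{List}_C(z)=\emptyset$, it returns $\bot$.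 Otherwise it returns a matrix $L\in\mathbb F_2^{nd\times a}$ and a vector $\ell\in\mathbb F_2^{nd}$ with $$\mathrm{List}_C(z)=\{Lx+\ell : x\in\mathbb F_2^a\},$$ where $a$ is the dimension of the affine space $\mathrm{List}_C(z)$ and satisfies $$a\le\frac{2^{2r+7}}{\varepsilon^4\delta^4}.$$ -/

import Mathlib

/-! ## Linear codes, distances, erasure lists -/

/-- Relative distance of a code of length `|ι|`: the least Hamming distance of two distinct
codewords, divided by the length. (Meaningful for codes with at least two words.) -/
noncomputable def relDist {ι : Type*} [Fintype ι] (C : Submodule (ZMod 2) (ι → ZMod 2)) : ℝ :=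
  ((sInf {k : ℕ | ∃ x ∈ C, ∃ y ∈ C, x ≠ y ∧ k = hammingDist x y} : ℕ) : ℝ) / (Fintype.card ι : ℝ)

/-- The `r`-th relative generalized distance: the least fraction of coordinates that are not
identically zero on an `r`-dimensional subspace of `C`. (Meaningful for `r ≤ dim C`.) -/
noncomputable def genDist {ι : Type*} [Fintype ι] (r : ℕ)
    (C : Submodule (ZMod 2) (ι → ZMod 2)) : ℝ :=
  ((sInf {k : ℕ | ∃ V : Submodule (ZMod 2) (ι → ZMod 2), V ≤ C ∧ Module.finrank (ZMod 2) V = r ∧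
      k = {i : ι | ∃ v ∈ V, v i ≠ 0}.ncard} : ℕ) : ℝ) / (Fintype.card ι : ℝ)

/-- The codewords that agree with the received word `z` off the erasures (`none` = erased). -/
def erasureList {ι : Type*} (C : Submodule (ZMod 2) (ι → ZMod 2)) (z : ι → Option (ZMod 2)) :
    Set (ι → ZMod 2) :=
  {c | c ∈ C ∧ ∀ i a, z i = some a → c i = a}

/-! ## Regular graphs, double covers, expansion, expander codes -/

/-- An undirected `d`-regular graph on `n` vertices (loops allowed, no multiple edges), together
with an order of the `d` edges at every vertex of its double cover. The left and the right vertices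
of the double cover are two copies of `Fin n`; its edges are the pairs (left `u`, right `v`) with
`Adj u v`. `nbrL u i` is the `i`-th neighbour of the left vertex `u`, `nbrR v i` the `i`-th
neighbour of the right vertex `v`. -/
structure OrderedRegularGraph (n d : ℕ) where
  Adj : Fin n → Fin n → Prop
  symm : ∀ u v, Adj u v → Adj v u
  nbrL : ∀ u : Fin n, Fin d ≃ {v : Fin n // Adj u v}
  nbrR : ∀ v : Fin n, Fin d ≃ {u : Fin n // Adj u v}

namespace OrderedRegularGraph

variable {n d : ℕ} (G : OrderedRegularGraph n d)

open Classical in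
/-- The adjacency matrix of the (uncovered) graph. -/
noncomputable def adjMat : Matrix (Fin n) (Fin n) ℝ :=
  Matrix.of fun u v => if G.Adj u v then 1 else 0

theorem adjMat_isHermitian : G.adjMat.IsHermitian := by
  ext u v
  have h : G.Adj v u ↔ G.Adj u v := ⟨G.symm v u, G.symm u v⟩
  simp only [adjMat, Matrix.conjTranspose_apply, Matrix.of_apply, star_trivial]
  by_cases huv : G.Adj u v
  · rw [if_pos huv, if_pos (h.2 huv)]
  · rw [if_neg huv, if_neg fun hvu => huv (h.1 hvu)]

/-- The expansion `max {λ₂, |λₙ|}`, where `λ₁ ≥ λ₂ ≥ … ≥ λₙ` are the eigenvalues of the adjacency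
matrix (`eigenvalues₀` lists them in decreasing order, with multiplicity, from index `0`). -/
noncomputable def expansion (hn : 2 ≤ n) : ℝ :=
  max (G.adjMat_isHermitian.eigenvalues₀ ⟨1, by rw [Fintype.card_fin]; omega⟩)
    |G.adjMat_isHermitian.eigenvalues₀ ⟨n - 1, by rw [Fintype.card_fin]; omega⟩|

/-- The edges of the double cover. -/
abbrev Edge : Type := {e : Fin n × Fin n // G.Adj e.1 e.2}

/-- The `i`-th edge at the left vertex `u`. -/
def edgeL (u : Fin n) (i : Fin d) : G.Edge := ⟨(u, (G.nbrL u i).1), (G.nbrL u i).2⟩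

/-- The `i`-th edge at the right vertex `v`. -/
def edgeR (v : Fin n) (i : Fin d) : G.Edge := ⟨((G.nbrR v i).1, v), (G.nbrR v i).2⟩

/-- The expander code: the edge labelings of the double cover whose restriction to the edges at
each (left or right) vertex, read in the given order, is a word of the inner code. -/
def expanderCode (C₀ : Submodule (ZMod 2) (Fin d → ZMod 2)) :
    Submodule (ZMod 2) (G.Edge → ZMod 2) :=
  (⨅ u : Fin n, C₀.comap (LinearMap.funLeft (ZMod 2) (ZMod 2) (G.edgeL u))) ⊓
    ⨅ v : Fin n, C₀.comap (LinearMap.funLeft (ZMod 2) (ZMod 2) (G.edgeR v))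

theorem mem_expanderCode (C₀ : Submodule (ZMod 2) (Fin d → ZMod 2)) (c : G.Edge → ZMod 2) :
    c ∈ G.expanderCode C₀ ↔
      (∀ u, (fun i => c (G.edgeL u i)) ∈ C₀) ∧ ∀ v, (fun i => c (G.edgeR v i)) ∈ C₀ := by
  simp only [expanderCode, Submodule.mem_inf, Submodule.mem_iInf, Submodule.mem_comap]
  rfl

end OrderedRegularGraph

/-! ## A word RAM with a step count

Programs are structured random access programs. The machine has registers and a memory, both
indexed by `ℕ` and holding words, that is, natural numbers below a bound `W`. A program has no
execution if it ever produces a value that is not below `W`. -/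

namespace RAM

/-- Machine states. -/
structure State where
  reg : ℕ → ℕ
  mem : ℕ → ℕ

/-- Expressions; `load e` is the content of the memory cell whose address is the value of `e`. -/
inductive Expr where
  | const (c : ℕ)
  | reg (x : ℕ)
  | load (e : Expr)
  | add (e₁ e₂ : Expr)
  | sub (e₁ e₂ : Expr)
  | mul (e₁ e₂ : Expr)
  | lt (e₁ e₂ : Expr)
  | eq (e₁ e₂ : Expr)

/-- A value that fits into a word. -/
def word (W v : ℕ) : Option ℕ := if v < W then some v else none

namespace Expr

/-- The value of an expression, `none` in case of an overflow in some subexpression. Subtraction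
is truncated; comparisons have value `1` or `0`. -/
def eval (W : ℕ) (σ : State) : Expr → Option ℕ
  | const c => word W c
  | reg x => word W (σ.reg x)
  | load e => (eval W σ e).bind fun a => word W (σ.mem a)
  | add e₁ e₂ => (eval W σ e₁).bind fun a => (eval W σ e₂).bind fun b => word W (a + b)
  | sub e₁ e₂ => (eval W σ e₁).bind fun a => (eval W σ e₂).bind fun b => word W (a - b)
  | mul e₁ e₂ => (eval W σ e₁).bind fun a => (eval W σ e₂).bind fun b => word W (a * b)
  | lt e₁ e₂ => (eval W σ e₁).bind fun a => (eval W σ e₂).bind fun b =>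
      word W (if a < b then 1 else 0)
  | eq e₁ e₂ => (eval W σ e₁).bind fun a => (eval W σ e₂).bind fun b =>
      word W (if a = b then 1 else 0)

/-- The time to evaluate an expression: one step for every constant, access and operation. -/
def cost : Expr → ℕ
  | const _ => 1
  | reg _ => 1
  | load e => cost e + 1
  | add e₁ e₂ => cost e₁ + cost e₂ + 1
  | sub e₁ e₂ => cost e₁ + cost e₂ + 1
  | mul e₁ e₂ => cost e₁ + cost e₂ + 1
  | lt e₁ e₂ => cost e₁ + cost e₂ + 1
  | eq e₁ e₂ => cost e₁ + cost e₂ + 1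

end Expr

/-- Programs. `set x e` assigns to register `x`, `store e₁ e₂` writes the value of `e₂` to the
memory cell whose address is the value of `e₁`; a condition holds if its value is not `0`. -/
inductive Prog where
  | skip
  | set (x : ℕ) (e : Expr)
  | store (e₁ e₂ : Expr)
  | seq (p q : Prog)
  | ite (e : Expr) (p q : Prog)
  | loop (e : Expr) (p : Prog)

/-- `Exec W p σ σ' t`: with words below `W`, the program `p` started in the state `σ` halts in the
state `σ'` after exactly `t` steps. -/
inductive Exec (W : ℕ) : Prog → State → State → ℕ → Prop where
  | skip (σ : State) : Exec W Prog.skip σ σ 1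
  | set {x : ℕ} {e : Expr} {σ : State} {v : ℕ} (he : e.eval W σ = some v) :
      Exec W (Prog.set x e) σ ⟨Function.update σ.reg x v, σ.mem⟩ (e.cost + 1)
  | store {e₁ e₂ : Expr} {σ : State} {a v : ℕ} (ha : e₁.eval W σ = some a)
      (hv : e₂.eval W σ = some v) :
      Exec W (Prog.store e₁ e₂) σ ⟨σ.reg, Function.update σ.mem a v⟩ (e₁.cost + e₂.cost + 1)
  | seq {p q : Prog} {σ σ₁ σ₂ : State} {t₁ t₂ : ℕ} (hp : Exec W p σ σ₁ t₁)
      (hq : Exec W q σ₁ σ₂ t₂) : Exec W (Prog.seq p q) σ σ₂ (t₁ + t₂)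
  | ite_true {e : Expr} {p q : Prog} {σ σ₁ : State} {v t : ℕ} (he : e.eval W σ = some v)
      (hv : v ≠ 0) (hp : Exec W p σ σ₁ t) : Exec W (Prog.ite e p q) σ σ₁ (e.cost + 1 + t)
  | ite_false {e : Expr} {p q : Prog} {σ σ₁ : State} {t : ℕ} (he : e.eval W σ = some 0)
      (hq : Exec W q σ σ₁ t) : Exec W (Prog.ite e p q) σ σ₁ (e.cost + 1 + t)
  | loop_done {e : Expr} {p : Prog} {σ : State} (he : e.eval W σ = some 0) :
      Exec W (Prog.loop e p) σ σ (e.cost + 1)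
  | loop_step {e : Expr} {p : Prog} {σ σ₁ σ₂ : State} {v t₁ t₂ : ℕ} (he : e.eval W σ = some v)
      (hv : v ≠ 0) (hp : Exec W p σ σ₁ t₁) (hl : Exec W (Prog.loop e p) σ₁ σ₂ t₂) :
      Exec W (Prog.loop e p) σ σ₂ (e.cost + 1 + t₁ + t₂)

/-- The initial state: registers `0`, the input in memory from address `0` on, `0` elsewhere. -/
def State.init (input : List ℕ) : State := ⟨fun _ => 0, fun k => input.getD k 0⟩

end RAM

/-! ## Input and output format of the decoder -/

/-- A received symbol as a word: `0`, `1`, or `2` for an erasure. -/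
def symbolWord : Option (ZMod 2) → ℕ
  | none => 2
  | some a => a.val

/-- The input: `n`, `d`, the number `m` of rows of the parity-check matrix `H` of the inner code,
the entries of `H` row by row, the neighbours of the left vertices, the neighbours of the right
vertices, and the received word (edges listed by left vertex, in the order at that vertex). -/
def decoderInput {n d m : ℕ} (H : Matrix (Fin m) (Fin d) (ZMod 2)) (G : OrderedRegularGraph n d)
    (z : G.Edge → Option (ZMod 2)) : List ℕ :=
  [n, d, m] ++
  List.ofFn (fun k : Fin (m * d) => (H k.divNat k.modNat).val) ++
  List.ofFn (fun k : Fin (n * d) => (G.nbrL k.divNat k.modNat).1.val) ++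
  List.ofFn (fun k : Fin (n * d) => (G.nbrR k.divNat k.modNat).1.val) ++
  List.ofFn (fun k : Fin (n * d) => symbolWord (z (G.edgeL k.divNat k.modNat)))

/-- The final state reports "no codeword": the memory cell addressed by register `0` holds `0`. -/
def ReturnsBot (σ : RAM.State) : Prop := σ.mem (σ.reg 0) = 0

/-- The final state reports the matrix `M` and the vector `ℓ`: from the address `p` in register `0`
on, the memory holds `1`, the number `a` of columns of `M`, the `n * d` entries of `ℓ`, and the
entries of `M` row by row (edges listed by left vertex, in the order at that vertex). -/
def ReturnsAffine {n d a : ℕ} (G : OrderedRegularGraph n d) (σ : RAM.State)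
    (M : Matrix G.Edge (Fin a) (ZMod 2)) (ℓ : G.Edge → ZMod 2) : Prop :=
  σ.mem (σ.reg 0) = 1 ∧ σ.mem (σ.reg 0 + 1) = a ∧
  (∀ (u : Fin n) (i : Fin d),
    σ.mem (σ.reg 0 + 2 + (u.val * d + i.val)) = (ℓ (G.edgeL u i)).val) ∧
  ∀ (u : Fin n) (i : Fin d) (j : Fin a),
    σ.mem (σ.reg 0 + 2 + n * d + ((u.val * d + i.val) * a + j.val)) = (M (G.edgeL u i) j).val

/-! Every edge whose symbol has been determined carries an affine form over F₂ in a few guessed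
variables. The symbols that are possible at a vertex form a coset of its local code, the words of C₀
supported on the unknown edges there. So an unknown edge on whose coordinate the local code vanishes
is determined by the known edges, and two unknown edges whose coordinates agree on the local code
differ by a known form. Deductions are propagated until no vertex yields a new edge. Then one edge
of a largest class of the equivalence relation generated by the local agreements receives a fresh
variable, and propagation resumes. At the next standstill that whole class is known
(`card_unkSet_of_guess`), so everything rests on a lower bound for the largest class.

This bound is `EdgeSide.exists_large_class`. At a standstill every vertex that meets the set U of
unknown edges meets at least δd of them, so on each side at most (1-ε)δ_r n vertices are touched. A
vertex whose local code has dimension at least r sends δ_r d edges into the touched vertices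
opposite, which is more than the density predicts; by the expander mixing lemma
(`OrderedRegularGraph.mixing`) such vertices are rare (`EdgeSide.card_small_le`). At any other
vertex the coordinates are functionals on a space with at most 2^(r-1) elements, so all but an
eighth of its unknown edges lie in local classes of at least τd edges, τ = δ/2^(r+2)
(`card_small_classes`). Hence at least 7/10 of U lies in large local classes at both ends. Within a
global class of x edges, these edges meet at most x/(τd) vertices on either side, and if x <
(2/5)τ²dn, then mixing leaves room for at most (13/20)x edges between them. If all classes were that
small, summation would contradict 7/10. As every later unknown set is contained in the first one,
each guess removes at least (2/5)τ²dn edges, and at most s ≤ 40(2^r/δ)² guesses are made.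

The labels only record necessary conditions: a check in which no scratch variable occurs restricts
the guessed variables, and this restriction is postponed. When all edges are labelled, all checks
are imposed by Gaussian elimination on the guessed variables (`EdgeTable.Reduced`). A nonzero
constant shows that the list is empty. Otherwise the free variables parametrize the list, and each
of them has an edge whose row is the corresponding unit vector, so the parametrization is injective
and the number a ≤ s of free variables is the dimension.

With K = d+1+s columns, processing a vertex takes time O(d²K). A deduction starts with all vertices
and revisits a vertex only when an incident edge has become known, so it takes O(nd³K), and there
are at most s+1 deductions. In the final elimination a check costs O(dK), and only the at most K
pivots require a pass over all edges. The programs are verified by Hoare-style rules with time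
bounds (`Run`) for machines with registers and two-dimensional arrays, which the word RAM simulates
with constant overhead. -/

namespace ArrayRAM

open RAM

/-! ## A layer of programs with registers and two-dimensional arrays on top of the word RAM -/

/-- States with registers and a family of two-dimensional arrays. -/
structure HState where
  reg : ℕ → ℕ
  arr : ℕ → ℕ → ℕ → ℕ

namespace HState

/-- Assignment to a register. -/
def setR (h : HState) (x v : ℕ) : HState :=
  ⟨fun y => if y = x then v else h.reg y, h.arr⟩

/-- Assignment to an array entry. -/
def setA (h : HState) (a i j v : ℕ) : HState :=
  ⟨h.reg, fun a' i' j' => if a' = a ∧ i' = i ∧ j' = j then v else h.arr a' i' j'⟩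

@[simp] theorem setR_reg (h : HState) (x v y : ℕ) :
    (h.setR x v).reg y = if y = x then v else h.reg y := rfl

@[simp] theorem setR_arr (h : HState) (x v : ℕ) : (h.setR x v).arr = h.arr := rfl

@[simp] theorem setA_reg (h : HState) (a i j v : ℕ) : (h.setA a i j v).reg = h.reg := rfl

@[simp] theorem setA_arr (h : HState) (a i j v a' i' j' : ℕ) :
    (h.setA a i j v).arr a' i' j' = if a' = a ∧ i' = i ∧ j' = j then v else h.arr a' i' j' := rfl

theorem setA_arr_of_ne (h : HState) {a a' : ℕ} (i j v : ℕ) (ha : a' ≠ a) :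
    (h.setA a i j v).arr a' = h.arr a' := by
  funext i' j'
  simp [ha]

end HState

/-- Expressions over registers and arrays. -/
inductive HExpr where
  | c (k : ℕ)
  | r (x : ℕ)
  | ld (a : ℕ) (i j : HExpr)
  | add (e f : HExpr)
  | sub (e f : HExpr)
  | mul (e f : HExpr)
  | lt (e f : HExpr)
  | eq (e f : HExpr)

namespace HExpr

/-- The value of an expression. -/
@[simp] def val (h : HState) : HExpr → ℕ
  | c k => k
  | r x => h.reg x
  | ld a i j => h.arr a (i.val h) (j.val h)
  | add e f => e.val h + f.val h
  | sub e f => e.val h - f.val h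
  | mul e f => e.val h * f.val h
  | lt e f => if e.val h < f.val h then 1 else 0
  | eq e f => if e.val h = f.val h then 1 else 0

/-- All array accesses stay in range. -/
@[simp] def ok (S : ℕ) (h : HState) : HExpr → Prop
  | c _ => True
  | r _ => True
  | ld _ i j => i.ok S h ∧ j.ok S h ∧ i.val h < S ∧ j.val h < S
  | add e f => e.ok S h ∧ f.ok S h
  | sub e f => e.ok S h ∧ f.ok S h
  | mul e f => e.ok S h ∧ f.ok S h
  | lt e f => e.ok S h ∧ f.ok S h
  | eq e f => e.ok S h ∧ f.ok S h

/-- A bound for the growth of the value: it is less than `S ^ deg`. -/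
def deg : HExpr → ℕ
  | c _ => 1
  | r _ => 1
  | ld _ _ _ => 1
  | add e f => max e.deg f.deg + 1
  | sub e _ => e.deg
  | mul e f => e.deg + f.deg
  | lt _ _ => 1
  | eq _ _ => 1

/-- Translation into RAM expressions. -/
def compile : HExpr → Expr
  | c k => .const k
  | r x => .reg (x + 2)
  | ld a i j => .load (.add (.mul (.add (.mul (.const a) (.reg 1)) i.compile) (.reg 1)) j.compile)
  | add e f => .add e.compile f.compile
  | sub e f => .sub e.compile f.compile
  | mul e f => .mul e.compile f.compile
  | lt e f => .lt e.compile f.compile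
  | eq e f => .eq e.compile f.compile

/-- Constants are small and all subexpressions have small degree. -/
def small : HExpr → Bool
  | c k => decide (k ≤ 200)
  | r _ => true
  | ld a i j => decide (a ≤ 200) && i.small && j.small
  | add e f => decide (max e.deg f.deg + 1 ≤ 6) && e.small && f.small
  | sub e f => e.small && f.small
  | mul e f => decide (e.deg + f.deg ≤ 6) && e.small && f.small
  | lt e f => e.small && f.small
  | eq e f => e.small && f.small

/-- Small expressions that are evaluated in at most 60 steps. -/
def wf (e : HExpr) : Bool := e.small && decide (e.compile.cost ≤ 60)

end HExpr

/-- The RAM state `σ` represents the state `h`: the entry `(i, j)` of the array `a` is stored at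
the address `(a * S + i) * S + j`, and all values are below `S`. -/
def Sim (S : ℕ) (h : HState) (σ : State) : Prop :=
  σ.reg 1 = S ∧ (∀ x, σ.reg (x + 2) = h.reg x ∧ h.reg x < S) ∧
    ∀ a i j, i < S → j < S → σ.mem ((a * S + i) * S + j) = h.arr a i j ∧ h.arr a i j < S

/-- The cap 6 on the degree of small expressions is what fixes the word bound as S^6. -/
theorem pow_bound {S W p v : ℕ} (hS : 256 ≤ S) (hW : S ^ 6 ≤ W) (hp : p ≤ 6) (hv : v < S ^ p) :
    v < W :=
  hv.trans_le ((Nat.pow_le_pow_right (by omega) hp).trans hW)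

theorem word_of_lt {W v : ℕ} (h : v < W) : word W v = some v := if_pos h

theorem address_inj {S a i j a' i' j' : ℕ} (hi : i < S) (hj : j < S) (hi' : i' < S) (hj' : j' < S)
    (h : (a * S + i) * S + j = (a' * S + i') * S + j') : a = a' ∧ i = i' ∧ j = j' := by
  have key : ∀ {x y x' y' : ℕ}, y < S → y' < S → x * S + y = x' * S + y' → x = x' ∧ y = y' := by
    intro x y x' y' hy hy' hxy
    have h1 : x = x' := by
      have := congrArg (· / S) hxy
      simp only [Nat.add_div_of_dvd_right (Dvd.intro_left _ rfl),
        Nat.mul_div_cancel _ (by omega : 0 < S), Nat.div_eq_of_lt hy, Nat.div_eq_of_lt hy',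
        add_zero] at this
      exact this
    subst h1
    exact ⟨rfl, by omega⟩
  obtain ⟨h1, h2⟩ := key hj hj' h
  obtain ⟨h3, h4⟩ := key hi hi' h1
  exact ⟨h3, h4, h2⟩

/-- Registers and array entries stay below S under the simulation, so only arithmetic raises the
degree. A sum of two values below S^p is below 2·S^p ≤ S^(p+1), degrees add in products, and
truncated subtraction does not exceed its first argument. -/
theorem HExpr.val_lt {S : ℕ} {h : HState} {σ : State} (hS : 256 ≤ S) (hs : Sim S h σ) :
    ∀ e : HExpr, e.small = true → e.ok S h → e.val h < S ^ e.deg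
  | c k, hw, _ => by
    simp only [small, decide_eq_true_eq] at hw
    simp only [val, deg, pow_one]; omega
  | r x, _, _ => by simpa [val, deg] using (hs.2.1 x).2
  | ld a i j, hw, hok => by
    simp only [ok] at hok
    simpa [val, deg] using (hs.2.2 a _ _ hok.2.2.1 hok.2.2.2).2
  | add e f, hw, hok => by
    simp only [small, Bool.and_eq_true] at hw
    have h1 := val_lt hS hs e hw.1.2 hok.1
    have h2 := val_lt hS hs f hw.2 hok.2
    have h3 : S ^ e.deg ≤ S ^ max e.deg f.deg := Nat.pow_le_pow_right (by omega) (le_max_left _ _)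
    have h4 : S ^ f.deg ≤ S ^ max e.deg f.deg := Nat.pow_le_pow_right (by omega) (le_max_right _ _)
    have h5 : 2 * S ^ max e.deg f.deg ≤ S ^ (max e.deg f.deg + 1) := by
      rw [pow_succ, mul_comm]; exact Nat.mul_le_mul_left _ (by omega)
    simp only [val, deg]; omega
  | sub e f, hw, hok => by
    simp only [small, Bool.and_eq_true] at hw
    have h1 := val_lt hS hs e hw.1 hok.1
    simp only [val, deg]; omega
  | mul e f, hw, hok => by
    simp only [small, Bool.and_eq_true] at hw
    have h1 := val_lt hS hs e hw.1.2 hok.1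
    have h2 := val_lt hS hs f hw.2 hok.2
    simp only [val, deg, pow_add]
    exact Nat.mul_lt_mul'' h1 h2
  | lt e f, _, _ => by simp only [val, deg, pow_one]; split <;> omega
  | eq e f, _, _ => by simp only [val, deg, pow_one]; split <;> omega

theorem HExpr.deg_le : ∀ e : HExpr, e.small = true → e.deg ≤ 6
  | c k, _ => by simp [deg]
  | r x, _ => by simp [deg]
  | ld a i j, _ => by simp [deg]
  | add e f, hw => by
    simp only [small, Bool.and_eq_true, decide_eq_true_eq] at hw
    exact hw.1.1
  | sub e f, hw => by
    simp only [small, Bool.and_eq_true] at hw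
    exact deg_le e hw.1
  | mul e f, hw => by
    simp only [small, Bool.and_eq_true, decide_eq_true_eq] at hw
    exact hw.1.1
  | lt e f, _ => by simp [deg]
  | eq e f, _ => by simp [deg]

/-- As a ≤ 200 < S, the address is a three-digit number in base S, and the partial results stay
below S² and S³, so no overflow occurs. -/
theorem eval_address {S W a : ℕ} {σ : State} (hS : 256 ≤ S) (hW : S ^ 6 ≤ W) (h1 : σ.reg 1 = S)
    (ha : a ≤ 200) {ei ej : Expr} {i j : ℕ} (hi : ei.eval W σ = some i) (hj : ej.eval W σ = some j)
    (hiS : i < S) (hjS : j < S) :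
    (Expr.add (.mul (.add (.mul (.const a) (.reg 1)) ei) (.reg 1)) ej).eval W σ =
      some ((a * S + i) * S + j) := by
  have b1 : a < S := by omega
  have e1 : a * S < S ^ 2 := by rw [pow_two]; exact Nat.mul_lt_mul_of_pos_right b1 (by omega)
  have e2 : a * S + i < S ^ 2 := by
    rw [pow_two]
    calc a * S + i < a * S + S := by omega
      _ = (a + 1) * S := by ring
      _ ≤ S * S := Nat.mul_le_mul_right _ b1
  have e3 : (a * S + i) * S < S ^ 3 := by
    rw [pow_succ]; exact Nat.mul_lt_mul_of_pos_right e2 (by omega)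
  have e4 : (a * S + i) * S + j < S ^ 3 := by
    calc (a * S + i) * S + j < (a * S + i) * S + S := by omega
      _ = (a * S + i + 1) * S := by ring
      _ ≤ S ^ 2 * S := Nat.mul_le_mul_right _ e2
      _ = S ^ 3 := by ring
  have w0 : S < W := pow_bound (p := 2) hS hW (by norm_num) (by nlinarith)
  simp only [Expr.eval, h1, hi, hj, word_of_lt (b1.trans w0), word_of_lt w0, Option.bind_some,
    word_of_lt (pow_bound hS hW (by norm_num) e1), word_of_lt (pow_bound hS hW (by norm_num) e2),
    word_of_lt (pow_bound hS hW (by norm_num) e3), word_of_lt (pow_bound hS hW (by norm_num) e4)]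

theorem HExpr.eval_compile {S W : ℕ} {h : HState} {σ : State} (hS : 256 ≤ S) (hW : S ^ 6 ≤ W)
    (hs : Sim S h σ) :
    ∀ e : HExpr, e.small = true → e.ok S h → e.compile.eval W σ = some (e.val h)
  | c k, hw, hok => word_of_lt
      (pow_bound hS hW (deg_le (c k) hw) (val_lt hS hs (c k) hw hok))
  | r x, hw, hok => by
    have h1 := word_of_lt (pow_bound hS hW (deg_le (r x) hw) (val_lt hS hs (r x) hw hok))
    simpa only [compile, Expr.eval, (hs.2.1 x).1, val] using h1
  | ld a i j, hw, hok => by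
    have h1 := word_of_lt (pow_bound hS hW (deg_le (ld a i j) hw) (val_lt hS hs (ld a i j) hw hok))
    simp only [small, Bool.and_eq_true, decide_eq_true_eq] at hw
    obtain ⟨o1, o2, o3, o4⟩ := hok
    have h2 := eval_address hS hW hs.1 hw.1.1 (eval_compile hS hW hs i hw.1.2 o1)
      (eval_compile hS hW hs j hw.2 o2) o3 o4
    rw [compile, Expr.eval, h2, Option.bind_some, (hs.2.2 a _ _ o3 o4).1]
    exact h1
  | add e f, hw, hok => by
    have h1 := word_of_lt (pow_bound hS hW (deg_le (add e f) hw) (val_lt hS hs (add e f) hw hok))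
    simp only [small, Bool.and_eq_true] at hw
    simp only [compile, Expr.eval, eval_compile hS hW hs e hw.1.2 hok.1,
      eval_compile hS hW hs f hw.2 hok.2, Option.bind_some]; exact h1
  | sub e f, hw, hok => by
    have h1 := word_of_lt (pow_bound hS hW (deg_le (sub e f) hw) (val_lt hS hs (sub e f) hw hok))
    simp only [small, Bool.and_eq_true] at hw
    simp only [compile, Expr.eval, eval_compile hS hW hs e hw.1 hok.1,
      eval_compile hS hW hs f hw.2 hok.2, Option.bind_some]; exact h1
  | mul e f, hw, hok => by
    have h1 := word_of_lt (pow_bound hS hW (deg_le (mul e f) hw) (val_lt hS hs (mul e f) hw hok))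
    simp only [small, Bool.and_eq_true] at hw
    simp only [compile, Expr.eval, eval_compile hS hW hs e hw.1.2 hok.1,
      eval_compile hS hW hs f hw.2 hok.2, Option.bind_some]; exact h1
  | lt e f, hw, hok => by
    have h1 := word_of_lt (pow_bound hS hW (deg_le (lt e f) hw) (val_lt hS hs (lt e f) hw hok))
    simp only [small, Bool.and_eq_true] at hw
    simp only [compile, Expr.eval, eval_compile hS hW hs e hw.1 hok.1,
      eval_compile hS hW hs f hw.2 hok.2, Option.bind_some]; exact h1
  | eq e f, hw, hok => by
    have h1 := word_of_lt (pow_bound hS hW (deg_le (eq e f) hw) (val_lt hS hs (eq e f) hw hok))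
    simp only [small, Bool.and_eq_true] at hw
    simp only [compile, Expr.eval, eval_compile hS hW hs e hw.1 hok.1,
      eval_compile hS hW hs f hw.2 hok.2, Option.bind_some]; exact h1

/-! ### Program constructors and their proof rules -/

/-- Assignment to a register. -/
def setP (x : ℕ) (e : HExpr) : Prog := .set (x + 2) e.compile

/-- Assignment to an array entry. -/
def storeP (a : ℕ) (i j e : HExpr) : Prog :=
  .store (.add (.mul (.add (.mul (.const a) (.reg 1)) i.compile) (.reg 1)) j.compile) e.compile

/-- Conditional. -/
def iteP (e : HExpr) (p q : Prog) : Prog := .ite e.compile p q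

/-- Conditional without alternative. -/
def whenP (e : HExpr) (p : Prog) : Prog := iteP e p .skip

/-- While loop. -/
def loopP (e : HExpr) (p : Prog) : Prog := .loop e.compile p

/-- Counting loop: the register `x` runs through the numbers below `N`. -/
def forP (x : ℕ) (N : HExpr) (p : Prog) : Prog :=
  .seq (setP x (.c 0)) (loopP (.lt (.r x) N) (.seq p (setP x (.add (.r x) (.c 1)))))

/-- `Run S p h Q`: on a machine with sufficiently long words, `p` started in `h` halts within
`200 * T` steps in a state `h'` with `Q h' T`. -/
def Run (S : ℕ) (p : Prog) (h : HState) (Q : HState → ℕ → Prop) : Prop :=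
  ∀ (W : ℕ) (σ : State), 256 ≤ S → S ^ 6 ≤ W → Sim S h σ →
    ∃ (h' : HState) (σ' : State) (t T : ℕ),
      Exec W p σ σ' t ∧ t ≤ 200 * T ∧ Sim S h' σ' ∧ Q h' T

section Rules

variable {S : ℕ} {p q : Prog} {h : HState} {Q Q' : HState → ℕ → Prop}

theorem Run.mono (hr : Run S p h Q) (hQ : ∀ h' T, Q h' T → Q' h' T) : Run S p h Q' := by
  intro W σ hS hW hs
  obtain ⟨h', σ', t, T, h1, h2, h3, h4⟩ := hr W σ hS hW hs
  exact ⟨h', σ', t, T, h1, h2, h3, hQ _ _ h4⟩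

theorem run_skip (hQ : Q h 1) : Run S .skip h Q :=
  fun _ σ _ _ hs => ⟨h, σ, 1, 1, .skip σ, by norm_num, hs, hQ⟩

/-- The postcondition of the first program is a run of the second one. Nesting runs in this way adds
the times without naming the intermediate assertion. -/
theorem run_seq (hp : Run S p h fun h' T => Run S q h' fun h'' T' => Q h'' (T + T')) :
    Run S (.seq p q) h Q := by
  intro W σ hS hW hs
  obtain ⟨h1, σ1, t1, T1, e1, b1, s1, r1⟩ := hp W σ hS hW hs
  obtain ⟨h2, σ2, t2, T2, e2, b2, s2, r2⟩ := r1 W σ1 hS hW s1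
  exact ⟨h2, σ2, t1 + t2, T1 + T2, .seq e1 e2, by omega, s2, r2⟩

theorem HExpr.wf_iff {e : HExpr} : e.wf = true ↔ e.small = true ∧ e.compile.cost ≤ 60 := by
  simp [wf]

theorem run_set {x : ℕ} {e : HExpr} (hok : e.ok S h) (hv : e.val h < S)
    (hQ : Q (h.setR x (e.val h)) 1) (hw : e.wf = true := by rfl) : Run S (setP x e) h Q := by
  intro W σ hS hW hs
  rw [HExpr.wf_iff] at hw
  refine ⟨_, _, _, 1, .set (e.eval_compile hS hW hs hw.1 hok), by omega, ?_, hQ⟩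
  refine ⟨?_, fun y => ?_, hs.2.2⟩
  · simpa using hs.1
  · by_cases hy : y = x
    · subst hy; simpa using hv
    · simpa [hy, Function.update] using hs.2.1 y

theorem run_store {a : ℕ} {i j e : HExpr} (hi : i.ok S h) (hj : j.ok S h) (hok : e.ok S h)
    (hiS : i.val h < S) (hjS : j.val h < S) (hv : e.val h < S)
    (hQ : Q (h.setA a (i.val h) (j.val h) (e.val h)) 1)
    (hw : (decide (a ≤ 200) && i.wf && j.wf && e.wf) = true := by rfl) :
    Run S (storeP a i j e) h Q := by
  intro W σ hS hW hs
  simp only [Bool.and_eq_true, decide_eq_true_eq, HExpr.wf_iff] at hw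
  obtain ⟨⟨⟨ha, w1⟩, w2⟩, w3⟩ := hw
  refine ⟨_, _, _, 1, .store (eval_address hS hW hs.1 ha (i.eval_compile hS hW hs w1.1 hi)
    (j.eval_compile hS hW hs w2.1 hj) hiS hjS) (e.eval_compile hS hW hs w3.1 hok), ?_, ?_, hQ⟩
  -- Three expressions of cost at most 60, seven steps of address arithmetic and one for the write
  -- make 188. This is why one unit of time stands for 200 steps.
  · simp only [Expr.cost]; omega
  · refine ⟨hs.1, hs.2.1, fun a' i' j' hi' hj' => ?_⟩
    by_cases hc : a' = a ∧ i' = i.val h ∧ j' = j.val h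
    · obtain ⟨rfl, rfl, rfl⟩ := hc
      simpa using hv
    · have : (a' * S + i') * S + j' ≠ (a * S + i.val h) * S + j.val h :=
        fun hh => hc (address_inj hi' hj' hiS hjS hh)
      simpa [Function.update, this, hc] using hs.2.2 a' i' j' hi' hj'

theorem run_ite {e : HExpr} (hok : e.ok S h)
    (hp : e.val h ≠ 0 → Run S p h fun h' T => Q h' (T + 1))
    (hq : e.val h = 0 → Run S q h fun h' T => Q h' (T + 1)) (hw : e.wf = true := by rfl) :
    Run S (iteP e p q) h Q := by
  intro W σ hS hW hs
  rw [HExpr.wf_iff] at hw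
  have he := e.eval_compile hS hW hs hw.1 hok
  by_cases h0 : e.val h = 0
  · obtain ⟨h1, σ1, t1, T1, e1, b1, s1, r1⟩ := hq h0 W σ hS hW hs
    rw [h0] at he
    exact ⟨h1, σ1, _, _, .ite_false he e1, by omega, s1, r1⟩
  · obtain ⟨h1, σ1, t1, T1, e1, b1, s1, r1⟩ := hp h0 W σ hS hW hs
    exact ⟨h1, σ1, _, _, .ite_true he h0 e1, by omega, s1, r1⟩

theorem run_when {e : HExpr} (hok : e.ok S h)
    (hp : e.val h ≠ 0 → Run S p h fun h' T => Q h' (T + 1))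
    (hq : e.val h = 0 → Q h 2) (hw : e.wf = true := by rfl) : Run S (whenP e p) h Q :=
  run_ite hok hp (fun h0 => run_skip (hq h0)) hw

/-- While loops: `I k h T` is the invariant after time `T`, with termination measure `k`. -/
theorem run_loop {e : HExpr} (I : ℕ → HState → ℕ → Prop) {k : ℕ} (hI : I k h 0)
    (hok : ∀ k h T, I k h T → e.ok S h)
    (hstep : ∀ k h T, I k h T → e.val h ≠ 0 →
      Run S p h fun h' T' => ∃ k' < k, I k' h' (T + T' + 1))
    (hQ : ∀ k h T, I k h T → e.val h = 0 → Q h (T + 1))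
    (hw : e.wf = true := by rfl) : Run S (loopP e p) h Q := by
  intro W σ hS hW hs
  have hw' := HExpr.wf_iff.1 hw
  -- The accumulated time T is generalized in the induction, because the invariant refers to the
  -- time since the loop was entered.
  have main : ∀ k h T σ, I k h T → Sim S h σ → ∃ (h' : HState) (σ' : State) (t T' : ℕ),
      Exec W (loopP e p) σ σ' t ∧ t ≤ 200 * T' ∧ Sim S h' σ' ∧ Q h' (T + T') := by
    intro k
    induction k using Nat.strong_induction_on with
    | _ k ih =>
      intro h T σ hI hs
      have he := e.eval_compile hS hW hs hw'.1 (hok _ _ _ hI)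
      by_cases h0 : e.val h = 0
      · have hq := hQ _ _ _ hI h0
        rw [h0] at he
        exact ⟨h, σ, _, 1, .loop_done he, by omega, hs, hq⟩
      · obtain ⟨h1, σ1, t1, T1, e1, b1, s1, k', hk', r1⟩ := hstep _ _ _ hI h0 W σ hS hW hs
        obtain ⟨h2, σ2, t2, T2, e2, b2, s2, r2⟩ := ih k' hk' h1 _ σ1 r1 s1
        refine ⟨h2, σ2, _, T1 + 1 + T2, .loop_step he h0 e1 e2, by omega, s2, ?_⟩
        rwa [show T + (T1 + 1 + T2) = T + T1 + 1 + T2 by ring]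
  obtain ⟨h', σ', t, T', h1, h2, h3, h4⟩ := main k h 0 σ hI hs
  exact ⟨h', σ', t, T', h1, h2, h3, by rwa [zero_add] at h4⟩

/-- Counting loops: `I i h T` is the invariant before round `i`, after time `T`. -/
theorem run_for {x Nv : ℕ} {N : HExpr} (I : ℕ → HState → ℕ → Prop) (hI : I 0 (h.setR x 0) 0)
    (hNS : Nv < S)
    (hN : ∀ i h T, i ≤ Nv → I i h T → h.reg x = i ∧ N.val h = Nv ∧ N.ok S h)
    (hstep : ∀ i h T, i < Nv → I i h T → h.reg x = i →
      Run S p h fun h' T' => h'.reg x = i ∧ I (i + 1) (h'.setR x (i + 1)) (T + (T' + 2)))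
    (hQ : ∀ h T, I Nv h T → h.reg x = Nv → Q h (T + 2))
    (hw : (HExpr.lt (.r x) N).wf = true := by rfl) :
    Run S (forP x N p) h Q := by
  refine run_seq (run_set (by simp) (by simp; omega) ?_)
  refine run_loop (fun k h T => ∃ i, i ≤ Nv ∧ k = Nv - i ∧ I i h T) (k := Nv)
    ⟨0, by omega, by omega, hI⟩ ?_ ?_ ?_ (hw := hw)
  · rintro k h T ⟨i, hi, -, hI⟩
    exact ⟨trivial, (hN i h T hi hI).2.2⟩
  · rintro k h T ⟨i, hi, rfl, hI⟩ hv
    obtain ⟨h1, h2, h3⟩ := hN i h T hi hI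
    have hlt : i < Nv := by
      by_contra hcon
      apply hv
      simp [h1, h2]
      omega
    refine run_seq ((hstep i h T hlt hI h1).mono fun h' T' hh => ?_)
    refine run_set (by simp) (by simp only [HExpr.val, hh.1]; omega) ?_
    refine ⟨Nv - (i + 1), by omega, i + 1, by omega, rfl, ?_⟩
    simp only [HExpr.val, hh.1]
    convert hh.2 using 1
    omega
  · rintro k h T ⟨i, hi, rfl, hI⟩ hv
    obtain ⟨h1, h2, h3⟩ := hN i h T hi hI
    have : i = Nv := by
      by_contra hcon
      have : i < Nv := by omega
      simp [h1, h2, this] at hv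
    subst this
    have := hQ h T hI h1
    convert this using 1
    omega

/-- Counting loops whose rounds take time at most `B`. -/
theorem run_for_uniform {x Nv B : ℕ} {N : HExpr} (I : ℕ → HState → Prop) (hI : I 0 (h.setR x 0))
    (hNS : Nv < S)
    (hN : ∀ i h, i ≤ Nv → I i h → h.reg x = i ∧ N.val h = Nv ∧ N.ok S h)
    (hstep : ∀ i h, i < Nv → I i h → h.reg x = i →
      Run S p h fun h' T' => h'.reg x = i ∧ T' ≤ B ∧ I (i + 1) (h'.setR x (i + 1)))
    (hQ : ∀ h T, I Nv h → h.reg x = Nv → T ≤ Nv * (B + 2) + 2 → Q h T)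
    (hw : (HExpr.lt (.r x) N).wf = true := by rfl) :
    Run S (forP x N p) h Q := by
  -- Besides its body, each round pays for the loop test and the increment; the final 2 pays for the
  -- initialization and the failing test.
  refine run_for (fun i h T => I i h ∧ T ≤ i * (B + 2)) ⟨hI, by omega⟩ hNS
    (fun i h T hi hh => hN i h hi hh.1) ?_ ?_ hw
  · rintro i h T hi ⟨hh, hT⟩ hx
    refine (hstep i h hi hh hx).mono fun h' T' hh' => ⟨hh'.1, hh'.2.2, ?_⟩
    rw [add_mul]
    omega
  · rintro h T ⟨hh, hT⟩ hx
    exact hQ h _ hh hx (by omega)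

end Rules

end ArrayRAM

/-! ## The expander mixing lemma -/

namespace OrderedRegularGraph

open Finset Matrix

variable {n d : ℕ} (G : OrderedRegularGraph n d)

theorem card_adj_left (u : Fin n) [DecidablePred (G.Adj u)] : #{v | G.Adj u v} = d := by
  classical
  rw [← Fintype.card_subtype, ← Fintype.card_congr (G.nbrL u), Fintype.card_fin]

theorem card_adj_right (v : Fin n) [DecidablePred fun u => G.Adj u v] :
    #{u | G.Adj u v} = d := by
  classical
  rw [← Fintype.card_subtype, ← Fintype.card_congr (G.nbrR v), Fintype.card_fin]

theorem adjMat_mulVec_one : G.adjMat *ᵥ 1 = fun _ => (d : ℝ) := by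
  classical
  funext u
  have := G.card_adj_left u
  simp only [mulVec, dotProduct, adjMat, of_apply, Pi.one_apply, mul_one, sum_boole]
  exact_mod_cast this

open Classical in
/-- The indicator vector of a set of vertices. -/
noncomputable def indicatorVec (A : Finset (Fin n)) : Fin n → ℝ := fun u => if u ∈ A then 1 else 0

open Classical in
theorem indicator_adj_indicator (A B : Finset (Fin n)) :
    indicatorVec A ⬝ᵥ (G.adjMat *ᵥ indicatorVec B) = #{p ∈ A ×ˢ B | G.Adj p.1 p.2} := by
  rw [card_filter, sum_product]
  simp only [dotProduct, indicatorVec, mulVec, adjMat, of_apply, mul_ite, mul_one, mul_zero,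
    ite_mul, one_mul, zero_mul, sum_ite_mem, univ_inter]
  push_cast
  rfl

theorem indicator_dot_self (A : Finset (Fin n)) : indicatorVec A ⬝ᵥ indicatorVec A = #A := by
  simp [dotProduct, indicatorVec]

theorem one_dot_indicator (A : Finset (Fin n)) : (1 : Fin n → ℝ) ⬝ᵥ indicatorVec A = #A := by
  simp [dotProduct, indicatorVec]

/-- The `i`-th vector of an orthonormal eigenbasis. -/
noncomputable def eigenVec (i : Fin n) : Fin n → ℝ := G.adjMat_isHermitian.eigenvectorBasis i

theorem mulVec_eigenVec (i : Fin n) :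
    G.adjMat *ᵥ G.eigenVec i = G.adjMat_isHermitian.eigenvalues i • G.eigenVec i :=
  G.adjMat_isHermitian.mulVec_eigenvectorBasis i

theorem sum_dot_mul_dot (f g : Fin n → ℝ) :
    ∑ i, (f ⬝ᵥ G.eigenVec i) * (G.eigenVec i ⬝ᵥ g) = f ⬝ᵥ g := by
  have h := G.adjMat_isHermitian.eigenvectorBasis.sum_inner_mul_inner
    (WithLp.toLp 2 f) (WithLp.toLp 2 g)
  simp only [EuclideanSpace.inner_eq_star_dotProduct, star_trivial] at h
  rw [dotProduct_comm f g, ← h]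
  refine sum_congr rfl fun i _ => ?_
  rw [dotProduct_comm f, dotProduct_comm _ g]
  rfl

theorem eigenVec_dot_mulVec (i : Fin n) (g : Fin n → ℝ) :
    G.eigenVec i ⬝ᵥ (G.adjMat *ᵥ g) =
      G.adjMat_isHermitian.eigenvalues i * (G.eigenVec i ⬝ᵥ g) := by
  have ht : G.adjMatᵀ = G.adjMat := by
    simpa [conjTranspose_eq_transpose_of_trivial] using G.adjMat_isHermitian.eq
  rw [dotProduct_mulVec, ← mulVec_transpose, ht, mulVec_eigenVec, smul_dotProduct, smul_eq_mul]

/-- The eigenvalues are sorted with multiplicity, so all but the first lie between the last and the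
second. The exceptional index is the image of 0 under the reindexing that turns `eigenvalues₀` into
`eigenvalues`. -/
theorem exists_index_abs_eigenvalues_le (hn : 2 ≤ n) :
    ∃ i₀ : Fin n, ∀ i, i ≠ i₀ → |G.adjMat_isHermitian.eigenvalues i| ≤ G.expansion hn := by
  set E : Fin (Fintype.card (Fin n)) ≃ Fin n := Fintype.equivOfCardEq (Fintype.card_fin _) with hE
  have hc : Fintype.card (Fin n) = n := Fintype.card_fin n
  refine ⟨E ⟨0, by omega⟩, fun i hi => ?_⟩
  obtain ⟨j, rfl⟩ := E.surjective i
  have hj : j.1 ≠ 0 := fun h => hi (by congr 1; exact Fin.ext h)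
  have he : G.adjMat_isHermitian.eigenvalues (E j) = G.adjMat_isHermitian.eigenvalues₀ j := by
    simp only [IsHermitian.eigenvalues]
    congr 1
    exact E.symm_apply_apply j
  rw [he, expansion, abs_le']
  have hanti := G.adjMat_isHermitian.eigenvalues₀_antitone
  constructor
  · exact le_max_of_le_left (hanti (Fin.mk_le_of_le_val (by omega)))
  · refine le_max_of_le_right ?_
    have : G.adjMat_isHermitian.eigenvalues₀ ⟨n - 1, by omega⟩ ≤
        G.adjMat_isHermitian.eigenvalues₀ j := hanti (Fin.le_def.2 (by simp only; omega))
    exact (neg_le_neg this).trans (neg_le_abs _)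

open Classical in
theorem card_adj_le_left (A B : Finset (Fin n)) : #{p ∈ A ×ˢ B | G.Adj p.1 p.2} ≤ #A * d := by
  rw [card_filter, sum_product]
  refine (sum_le_card_nsmul _ _ d fun u _ => ?_).trans (by simp)
  rw [← card_filter]
  exact (card_le_card (filter_subset_filter _ (subset_univ _))).trans (G.card_adj_left u).le

open Classical in
theorem card_adj_le_right (A B : Finset (Fin n)) : #{p ∈ A ×ˢ B | G.Adj p.1 p.2} ≤ #B * d := by
  rw [card_filter, sum_product_right]
  refine (sum_le_card_nsmul _ _ d fun u _ => ?_).trans (by simp)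
  rw [← card_filter]
  exact (card_le_card (filter_subset_filter _ (subset_univ _))).trans (G.card_adj_right u).le

open Classical in
-- Both indicator vectors are expanded in the eigenbasis. The constant direction contributes the
-- main term, and the other eigenvalues are at most λ in absolute value, so the Cauchy–Schwarz
-- inequality bounds the rest. The constant vector is a multiple of a basis vector only if no second
-- index has eigenvalue d; the remaining case is treated separately.
theorem mixing (hn : 2 ≤ n) (A B : Finset (Fin n)) :
    (#{p ∈ A ×ˢ B | G.Adj p.1 p.2} : ℝ) ≤
      d * #A * #B / n + G.expansion hn * √(#A * #B) := by
  obtain ⟨i₀, hi₀⟩ := G.exists_index_abs_eigenvalues_le hn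
  set μ := G.adjMat_isHermitian.eigenvalues with hμ
  set lam := G.expansion hn with hlam
  have hn0 : (0 : ℝ) < n := by exact_mod_cast (by omega : 0 < n)
  by_cases hd : ∃ i, i ≠ i₀ ∧ μ i = d
  -- A second index with eigenvalue d forces λ ≥ d. The trivial bounds d·#A and d·#B then suffice,
  -- since the minimum is at most the geometric mean.
  · obtain ⟨i, hi, hid⟩ := hd
    have h1 : (d : ℝ) ≤ lam := by
      have := hi₀ i hi
      rw [hid] at this
      exact (le_abs_self _).trans this
    have h2 : (#{p ∈ A ×ˢ B | G.Adj p.1 p.2} : ℝ) ≤ #A * d := by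
      exact_mod_cast G.card_adj_le_left A B
    have h3 : (#{p ∈ A ×ˢ B | G.Adj p.1 p.2} : ℝ) ≤ #B * d := by
      exact_mod_cast G.card_adj_le_right A B
    have h4 : min (#A : ℝ) #B ≤ √(#A * #B) := by
      apply Real.le_sqrt_of_sq_le
      rw [pow_two]
      exact mul_le_mul (min_le_left _ _) (min_le_right _ _) (by positivity) (by positivity)
    have h5 : (#{p ∈ A ×ˢ B | G.Adj p.1 p.2} : ℝ) ≤ min (#A : ℝ) #B * d := by
      rcases min_choice (#A : ℝ) #B with h | h <;> rw [h] <;> assumption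
    have h6 : min (#A : ℝ) #B * d ≤ √(#A * #B) * lam :=
      mul_le_mul h4 h1 (by positivity) (by positivity)
    have h7 : (0 : ℝ) ≤ d * #A * #B / n := by positivity
    linarith
  · push Not at hd
    -- The constant vector is an eigenvector for d, hence orthogonal to eigenvectors of all other
    -- eigenvalues.
    have horth : ∀ i, i ≠ i₀ → G.eigenVec i ⬝ᵥ 1 = 0 := by
      intro i hi
      have h1 := G.eigenVec_dot_mulVec i 1
      rw [adjMat_mulVec_one] at h1
      have h2 : (fun _ : Fin n => (d : ℝ)) = (d : ℝ) • (1 : Fin n → ℝ) := by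
        funext; simp
      rw [h2, dotProduct_smul, smul_eq_mul] at h1
      have h3 : ((d : ℝ) - μ i) * (G.eigenVec i ⬝ᵥ 1) = 0 := by rw [sub_mul, h1, sub_self]
      rcases mul_eq_zero.1 h3 with h4 | h4
      · exact absurd (by linarith) (hd i hi)
      · exact h4
    set c := (1 : Fin n → ℝ) ⬝ᵥ G.eigenVec i₀ with hc
    have hone : ∀ g : Fin n → ℝ, c * (G.eigenVec i₀ ⬝ᵥ g) = 1 ⬝ᵥ g := by
      intro g
      rw [← G.sum_dot_mul_dot 1 g, sum_eq_single i₀]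
      · intro i _ hi
        rw [dotProduct_comm 1, horth i hi, zero_mul]
      · simp
    -- Only the direction of i₀ contributes to the constant vector, so c² is its squared norm.
    have hcc : c * c = n := by
      have := hone 1
      rw [dotProduct_comm _ 1, ← hc] at this
      rw [this]
      simp [dotProduct]
    have hc0 : c ≠ 0 := by
      rintro h
      rw [h] at hcc
      linarith
    have hμ0 : μ i₀ = d := by
      have h1 := G.eigenVec_dot_mulVec i₀ 1
      rw [adjMat_mulVec_one] at h1
      have h2 : (fun _ : Fin n => (d : ℝ)) = (d : ℝ) • (1 : Fin n → ℝ) := by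
        funext; simp
      rw [h2, dotProduct_smul, smul_eq_mul, dotProduct_comm _ 1, ← hc] at h1
      exact (mul_right_cancel₀ hc0 h1).symm
    set a : Fin n → ℝ := fun i => indicatorVec A ⬝ᵥ G.eigenVec i with ha
    set b : Fin n → ℝ := fun i => G.eigenVec i ⬝ᵥ indicatorVec B with hb
    have hsum : (#{p ∈ A ×ˢ B | G.Adj p.1 p.2} : ℝ) = ∑ i, a i * (μ i * b i) := by
      rw [← indicator_adj_indicator, ← G.sum_dot_mul_dot]
      simp only [eigenVec_dot_mulVec, ha, hb, hμ]
    have hA2 : ∑ i, a i ^ 2 = #A := by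
      rw [← indicator_dot_self, ← G.sum_dot_mul_dot]
      refine sum_congr rfl fun i _ => ?_
      rw [dotProduct_comm (G.eigenVec i), pow_two]
    have hB2 : ∑ i, b i ^ 2 = #B := by
      rw [← indicator_dot_self, ← G.sum_dot_mul_dot]
      refine sum_congr rfl fun i _ => ?_
      rw [dotProduct_comm _ (G.eigenVec i), pow_two]
    have hmain : a i₀ * (μ i₀ * b i₀) = d * #A * #B / n := by
      have h1 : c * a i₀ = #A := by
        simp only [ha]
        rw [dotProduct_comm, hone, one_dot_indicator]
      have h2 : c * b i₀ = #B := by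
        simp only [hb]
        rw [hone, one_dot_indicator]
      rw [hμ0, ← h1, ← h2, ← hcc]
      field_simp
    have hrest : ∑ i ∈ univ.erase i₀, a i * (μ i * b i) ≤ lam * √(#A * #B) := by
      calc ∑ i ∈ univ.erase i₀, a i * (μ i * b i)
          ≤ ∑ i ∈ univ.erase i₀, lam * (|a i| * |b i|) := by
            refine sum_le_sum fun i hi => ?_
            refine (le_abs_self _).trans ?_
            rw [abs_mul, abs_mul]
            have := mul_le_mul_of_nonneg_right (hi₀ i (ne_of_mem_erase hi))
              (mul_nonneg (abs_nonneg (a i)) (abs_nonneg (b i)))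
            linarith
        _ = lam * ∑ i ∈ univ.erase i₀, |a i| * |b i| := by rw [mul_sum]
        _ ≤ lam * √(#A * #B) := by
            have hlam0 : 0 ≤ lam := le_max_of_le_right (abs_nonneg _)
            refine mul_le_mul_of_nonneg_left ?_ hlam0
            refine (Real.sum_mul_le_sqrt_mul_sqrt _ _ _).trans ?_
            rw [← Real.sqrt_mul (sum_nonneg fun i _ => by positivity)]
            refine Real.sqrt_le_sqrt ?_
            simp only [sq_abs]
            rw [← hA2, ← hB2]
            exact mul_le_mul
              (sum_le_sum_of_subset_of_nonneg (subset_univ _) fun _ _ _ => by positivity)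
              (sum_le_sum_of_subset_of_nonneg (subset_univ _) fun _ _ _ => by positivity)
              (sum_nonneg fun _ _ => by positivity) (sum_nonneg fun _ _ => by positivity)
    rw [hsum, ← add_sum_erase _ _ (mem_univ i₀), hmain]
    linarith

end OrderedRegularGraph

/-! ## Local codes on erased coordinates -/

section LocalCode

open Finset

/-- The generalized distance minimizes over subspaces of dimension exactly r, whereas local codes of
dimension at least r occur. -/
theorem Submodule.exists_le_finrank_eq {K V : Type*} [Field K] [AddCommGroup V] [Module K V]
    (W : Submodule K V) {r : ℕ} (hr : r ≤ Module.finrank K W) :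
    ∃ W' ≤ W, Module.finrank K W' = r := by
  obtain ⟨f, hf⟩ := exists_linearIndependent_of_le_finrank hr
  refine ⟨Submodule.span K (Set.range fun i => (f i : V)), ?_, ?_⟩
  · rw [Submodule.span_le]
    rintro _ ⟨i, rfl⟩
    exact (f i).2
  · have h2 : LinearIndependent K fun i => (f i : V) := hf.map' W.subtype W.ker_subtype
    rw [finrank_span_eq_card h2, Fintype.card_fin]

variable {d : ℕ} (C₀ : Submodule (ZMod 2) (Fin d → ZMod 2))

/-- The words of `C₀` that vanish off `I`. -/
def localCode (I : Finset (Fin d)) : Submodule (ZMod 2) (Fin d → ZMod 2) where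
  carrier := {x | x ∈ C₀ ∧ ∀ i, i ∉ I → x i = 0}
  zero_mem' := ⟨C₀.zero_mem, fun _ _ => rfl⟩
  add_mem' hx hy := ⟨C₀.add_mem hx.1 hy.1, fun i hi => by
    simp [hx.2 i hi, hy.2 i hi]⟩
  smul_mem' c x hx := ⟨C₀.smul_mem c hx.1, fun i hi => by simp [hx.2 i hi]⟩

theorem mem_localCode {I : Finset (Fin d)} {x : Fin d → ZMod 2} :
    x ∈ localCode C₀ I ↔ x ∈ C₀ ∧ ∀ i, i ∉ I → x i = 0 := Iff.rfl

variable {C₀}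

theorem relDist_mul_le_of_mem {x : Fin d → ZMod 2} (hx : x ∈ C₀) (hx0 : x ≠ 0) :
    relDist C₀ * d ≤ #{i | x i ≠ 0} := by
  have hd : (d : ℝ) ≠ 0 := by
    rintro h
    have : d = 0 := by exact_mod_cast h
    subst this
    exact hx0 (Subsingleton.elim _ _)
  rw [relDist, Fintype.card_fin, div_mul_cancel₀ _ hd]
  have : hammingDist x 0 = #{i | x i ≠ 0} := by simp [hammingDist]
  rw [← this]
  have h1 := Nat.sInf_le (s := {k : ℕ | ∃ x ∈ C₀, ∃ y ∈ C₀, x ≠ y ∧ k = hammingDist x y})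
    ⟨x, hx, 0, C₀.zero_mem, hx0, rfl⟩
  exact_mod_cast h1

theorem genDist_mul_le_of_le {r : ℕ} (hd : d ≠ 0) {V : Submodule (ZMod 2) (Fin d → ZMod 2)}
    (hV : V ≤ C₀) (hr : r ≤ Module.finrank (ZMod 2) V) {I : Finset (Fin d)}
    (hI : ∀ x ∈ V, ∀ i, i ∉ I → x i = 0) : genDist r C₀ * d ≤ #I := by
  obtain ⟨W, hWV, hW⟩ := Submodule.exists_le_finrank_eq V hr
  have hd' : (d : ℝ) ≠ 0 := by exact_mod_cast hd
  rw [genDist, Fintype.card_fin, div_mul_cancel₀ _ hd']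
  have h1 := Nat.sInf_le (s := {k : ℕ | ∃ V : Submodule (ZMod 2) (Fin d → ZMod 2), V ≤ C₀ ∧
    Module.finrank (ZMod 2) V = r ∧ k = {i | ∃ v ∈ V, v i ≠ 0}.ncard}) ⟨W, hWV.trans hV, hW, rfl⟩
  have h2 : {i | ∃ v ∈ W, v i ≠ 0}.ncard ≤ #I := by
    rw [← Set.ncard_coe_finset]
    refine Set.ncard_le_ncard ?_ (Finset.finite_toSet I)
    rintro i ⟨v, hv, hvi⟩
    by_contra hi
    exact hvi (hI v (hWV hv) i hi)
  exact_mod_cast h1.trans h2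

theorem genDist_le_one (r : ℕ) (hr : r ≤ Module.finrank (ZMod 2) C₀) : genDist r C₀ ≤ 1 := by
  rcases Nat.eq_zero_or_pos d with rfl | hd
  · simp [genDist]
  · have := genDist_mul_le_of_le hd.ne' le_rfl hr (I := univ) (by simp)
    have hd' : (0 : ℝ) < d := by exact_mod_cast hd
    rw [card_univ, Fintype.card_fin] at this
    nlinarith

/-- As r ≥ 1, a minimizing subspace contains a nonzero word, whose support is part of the support of
the subspace. -/
theorem relDist_le_genDist {r : ℕ} (hr1 : 1 ≤ r) (hr : r ≤ Module.finrank (ZMod 2) C₀) :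
    relDist C₀ ≤ genDist r C₀ := by
  obtain ⟨W, hWV, hW⟩ := Submodule.exists_le_finrank_eq C₀ hr
  have hne : {k : ℕ | ∃ V : Submodule (ZMod 2) (Fin d → ZMod 2), V ≤ C₀ ∧
    Module.finrank (ZMod 2) V = r ∧ k = {i | ∃ v ∈ V, v i ≠ 0}.ncard}.Nonempty :=
    ⟨_, W, hWV, hW, rfl⟩
  obtain ⟨V, hV, hVr, hk⟩ := Nat.sInf_mem hne
  have hd : 0 < (d : ℝ) := by
    rcases Nat.eq_zero_or_pos d with rfl | h
    · have : Module.finrank (ZMod 2) V = 0 := Module.finrank_zero_of_subsingleton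
      omega
    · exact_mod_cast h
  have : ∃ x ∈ V, x ≠ 0 := by
    by_contra! h
    have : V = ⊥ := (Submodule.eq_bot_iff V).2 h
    subst this
    simp at hVr
    omega
  obtain ⟨x, hx, hx0⟩ := this
  have h1 := relDist_mul_le_of_mem (hV hx) hx0
  have h2 : (#{i | x i ≠ 0} : ℝ) ≤ genDist r C₀ * d := by
    rw [genDist, Fintype.card_fin, div_mul_cancel₀ _ hd.ne', hk]
    have : #{i | x i ≠ 0} ≤ {i | ∃ v ∈ V, v i ≠ 0}.ncard := by
      rw [← Set.ncard_coe_finset]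
      refine Set.ncard_le_ncard ?_ (Set.toFinite _)
      intro i hi
      exact ⟨x, hx, by simpa using hi⟩
    exact_mod_cast this
  exact le_of_mul_le_mul_right (h1.trans h2) hd

/-- A nonzero word makes the set of distances nonempty, so the infimum is a distance of distinct
words; for the empty set it would be 0 by convention. -/
theorem relDist_pos (hr : 1 ≤ Module.finrank (ZMod 2) C₀) : 0 < relDist C₀ := by
  have hd : 0 < d := by
    rcases Nat.eq_zero_or_pos d with rfl | h
    · have : Module.finrank (ZMod 2) C₀ = 0 := Module.finrank_zero_of_subsingleton
      omega
    · exact h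
  have : ∃ x ∈ C₀, x ≠ 0 := by
    by_contra! h
    have : C₀ = ⊥ := (Submodule.eq_bot_iff C₀).2 h
    subst this
    simp at hr
  obtain ⟨x, hx, hx0⟩ := this
  rw [relDist, Fintype.card_fin]
  refine div_pos ?_ (by exact_mod_cast hd)
  have hne : {k : ℕ | ∃ x ∈ C₀, ∃ y ∈ C₀, x ≠ y ∧ k = hammingDist x y}.Nonempty :=
    ⟨_, x, hx, 0, C₀.zero_mem, hx0, rfl⟩
  obtain ⟨y, -, y', -, hne', hk⟩ := Nat.sInf_mem hne
  rw [hk]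
  exact_mod_cast hammingDist_pos.2 hne'

theorem relDist_le_card {I : Finset (Fin d)} (hI : ∀ i ∈ I, ∃ x ∈ localCode C₀ I, x i ≠ 0)
    (hne : I.Nonempty) : relDist C₀ * d ≤ #I := by
  obtain ⟨i, hi⟩ := hne
  obtain ⟨x, hx, hxi⟩ := hI i hi
  refine (relDist_mul_le_of_mem hx.1 (fun h => hxi (by rw [h]; rfl))).trans ?_
  have : ({i | x i ≠ 0} : Finset (Fin d)) ⊆ I := by
    intro j hj
    by_contra hjI
    simp [hx.2 j hjI] at hj
  exact_mod_cast card_le_card this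

open Classical in
/-- Few coordinates are in small classes of coordinates that agree on the local code. -/
theorem card_small_classes {r : ℕ} (hr1 : 1 ≤ r) {I : Finset (Fin d)}
    (hr : Module.finrank (ZMod 2) (localCode C₀ I) < r)
    (hI : ∀ i ∈ I, ∃ x ∈ localCode C₀ I, x i ≠ 0) :
    (#{i ∈ I | (#{j ∈ I | ∀ x ∈ localCode C₀ I, x j = x i} : ℝ) <
      relDist C₀ / 2 ^ (r + 2) * d} : ℝ) ≤ #I / 8 := by
  rcases I.eq_empty_or_nonempty with rfl | hne
  · simp
  have h1 := relDist_le_card hI hne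
  set τ := relDist C₀ / 2 ^ (r + 2) with hτ
  set s : Finset (Fin d) := {i ∈ I | (#{j ∈ I | ∀ x ∈ localCode C₀ I, x j = x i} : ℝ) < τ * d}
    with hs
  -- Coordinates become functionals on the local code, and classes become fibres. The dual space has
  -- as many elements as the local code, at most 2^(r-1), which bounds the number of classes.
  let f : Fin d → Module.Dual (ZMod 2) (localCode C₀ I) := fun i =>
    (LinearMap.proj i).comp (localCode C₀ I).subtype
  have hf : ∀ i j, f j = f i ↔ ∀ x ∈ localCode C₀ I, x j = x i := by
    intro i j
    constructor
    · intro h x hx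
      exact LinearMap.congr_fun h ⟨x, hx⟩
    · intro h
      ext x
      exact h x.1 x.2
  have : Finite (Module.Dual (ZMod 2) (localCode C₀ I)) := Module.finite_of_finite (ZMod 2)
  have : Fintype (Module.Dual (ZMod 2) (localCode C₀ I)) :=
    Fintype.ofFinite _
  have h2 : (#(s.image f) : ℝ) ≤ 2 ^ (r - 1) := by
    have h3 : #(s.image f) ≤ Fintype.card (Module.Dual (ZMod 2) (localCode C₀ I)) :=
      card_le_univ _
    rw [Module.card_eq_pow_finrank (K := ZMod 2), ZMod.card, Subspace.dual_finrank_eq] at h3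
    have h4 : #(s.image f) ≤ 2 ^ (r - 1) := h3.trans (Nat.pow_le_pow_right (by norm_num) (by omega))
    exact_mod_cast h4
  -- Each fibre of f on s is contained in the small class of any of its members.
  have h5 : (#s : ℝ) ≤ #(s.image f) * (τ * d) := by
    rw [card_eq_sum_card_image f s]
    push_cast
    rw [← nsmul_eq_mul]
    refine sum_le_card_nsmul _ _ _ fun φ hφ => ?_
    obtain ⟨i, hi, rfl⟩ := mem_image.1 hφ
    refine le_trans ?_ (mem_filter.1 hi).2.le
    have : #{a ∈ s | f a = f i} ≤ #{j ∈ I | ∀ x ∈ localCode C₀ I, x j = x i} := by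
      refine card_le_card fun a ha => ?_
      rw [mem_filter] at ha ⊢
      exact ⟨(mem_filter.1 ha.1).1, (hf i a).1 ha.2⟩
    exact_mod_cast this
  have hδ : 0 ≤ relDist C₀ := by unfold relDist; positivity
  have hτ0 : 0 ≤ τ * d := by positivity
  -- The exponent r+2 in τ is chosen to make this an eighth of δd, the least size of a nonempty I.
  have h6 : (2 : ℝ) ^ (r - 1) * (τ * d) = relDist C₀ * d / 8 := by
    obtain ⟨k, rfl⟩ : ∃ k, r = k + 1 := ⟨r - 1, by omega⟩
    rw [hτ, Nat.add_sub_cancel]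
    field_simp
    ring
  have h7 := mul_le_mul_of_nonneg_right h2 hτ0
  linarith

end LocalCode

/-! ## Large classes of unknown edges -/

open Finset

/-- One side of a bipartite `d`-regular graph with edge set `E`: the vertex of every edge, and the
ordered edges at every vertex. -/
structure EdgeSide (E : Type*) (n d : ℕ) where
  vert : E → Fin n
  edge : Fin n → Fin d → E
  vert_edge : ∀ u i, vert (edge u i) = u
  exists_edge : ∀ e, ∃ i, edge (vert e) i = e
  edge_injective : ∀ u, Function.Injective (edge u)

namespace EdgeSide

variable {E : Type*} {n d : ℕ} (s t : EdgeSide E n d) (U : Finset E)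
  (C₀ : Submodule (ZMod 2) (Fin d → ZMod 2))

open Classical in
/-- The positions of the edges of `U` at the vertex `u`. -/
noncomputable def positions (u : Fin n) : Finset (Fin d) := {i | s.edge u i ∈ U}

@[simp] theorem mem_positions {u : Fin n} {i : Fin d} :
    i ∈ s.positions U u ↔ s.edge u i ∈ U := by simp [positions]

open Classical in
theorem card_filter_vert (p : E → Prop) (u : Fin n) :
    #{e ∈ U | p e ∧ s.vert e = u} = #{i ∈ s.positions U u | p (s.edge u i)} := by
  rw [← card_image_of_injective _ (s.edge_injective u)]
  congr 1
  ext e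
  simp only [mem_filter, mem_image, mem_positions]
  constructor
  · rintro ⟨he, hp, rfl⟩
    obtain ⟨i, hi⟩ := s.exists_edge e
    exact ⟨i, by rw [hi]; exact ⟨he, hp⟩, hi⟩
  · rintro ⟨i, ⟨h1, h2⟩, rfl⟩
    exact ⟨h1, h2, s.vert_edge u i⟩

open Classical in
theorem card_filter_eq_sum (p : E → Prop) :
    #{e ∈ U | p e} = ∑ u, #{i ∈ s.positions U u | p (s.edge u i)} := by
  rw [card_eq_sum_card_fiberwise (f := s.vert) (t := univ) fun _ _ => mem_univ _]
  refine sum_congr rfl fun u _ => ?_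
  rw [filter_filter, card_filter_vert]

theorem card_eq_sum : #U = ∑ u, #(s.positions U u) := by
  classical
  simpa using s.card_filter_eq_sum U fun _ => True

/-- No coordinate of an unknown edge vanishes on the local code of the unknown edges. -/
def Closed : Prop :=
  ∀ u, ∀ i ∈ s.positions U u, ∃ x ∈ localCode C₀ (s.positions U u), x i ≠ 0

/-- Two unknown edges at a vertex carry the same symbol in all words of the local code. -/
def LocEq (e e' : E) : Prop :=
  ∃ u, ∃ i ∈ s.positions U u, ∃ j ∈ s.positions U u, s.edge u i = e ∧ s.edge u j = e' ∧
    ∀ x ∈ localCode C₀ (s.positions U u), x j = x i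

open Classical in
theorem card_locEq {u : Fin n} {i : Fin d} (hi : i ∈ s.positions U u) :
    #{e' ∈ U | s.LocEq U C₀ (s.edge u i) e'} =
      #{j ∈ s.positions U u | ∀ x ∈ localCode C₀ (s.positions U u), x j = x i} := by
  rw [← card_image_of_injective _ (s.edge_injective u)]
  congr 1
  ext e
  simp only [mem_filter, mem_image]
  constructor
  · rintro ⟨he, u', i', hi', j, hj, h1, rfl, h3⟩
    have hu : u' = u := by rw [← s.vert_edge u' i', h1, s.vert_edge]
    subst hu
    have := s.edge_injective _ h1
    subst this
    exact ⟨j, ⟨hj, h3⟩, rfl⟩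
  · rintro ⟨j, ⟨h1, h2⟩, rfl⟩
    exact ⟨(s.mem_positions U).1 h1, u, i, hi, j, h1, rfl, rfl, h2⟩

/-- The upper bound of the expander mixing lemma. -/
def Mixing [Fintype E] (lam : ℝ) : Prop := by
  classical
  exact ∀ A B : Finset (Fin n), (#{e | s.vert e ∈ A ∧ t.vert e ∈ B} : ℝ) ≤
    d * #A * #B / n + lam * √(#A * #B)

/-- The vertices that are incident with `U`. -/
noncomputable def touched : Finset (Fin n) := by
  classical
  exact U.image s.vert

theorem mem_touched {u : Fin n} : u ∈ s.touched U ↔ (s.positions U u).Nonempty := by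
  classical
  simp only [touched, mem_image, Finset.Nonempty, mem_positions]
  constructor
  · rintro ⟨e, he, rfl⟩
    obtain ⟨i, hi⟩ := s.exists_edge e
    exact ⟨i, by rwa [hi]⟩
  · rintro ⟨i, hi⟩
    exact ⟨_, hi, s.vert_edge u i⟩

variable {s t U C₀}

/-- Closedness gives each touched vertex a nonzero local word, hence at least δd edges of U. -/
theorem card_touched_mul_le (hs : s.Closed U C₀) :
    #(s.touched U) * (relDist C₀ * d) ≤ #U := by
  rw [s.card_eq_sum U, ← nsmul_eq_mul]
  push_cast
  refine le_trans ?_ (sum_le_sum_of_subset_of_nonneg (subset_univ (s.touched U))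
    fun _ _ _ => by positivity)
  refine card_nsmul_le_sum _ _ _ fun u hu => ?_
  exact relDist_le_card (hs u) ((s.mem_touched U).1 hu)

open Classical in
/-- Few unknown edges are in small local classes. -/
theorem card_small_le [Fintype E] {r : ℕ} {ε lam : ℝ} (hn : 0 < n) (hd : 0 < d) (hr1 : 1 ≤ r)
    (hr : r ≤ Module.finrank (ZMod 2) C₀) (hε : 0 < ε) (hε1 : ε ≤ 1)
    (hlam : lam / d ≤ ε ^ 2 * relDist C₀ ^ 2 / 2 ^ (r + 4)) (hmix : s.Mixing t lam)
    (hs : s.Closed U C₀) (ht : t.Closed U C₀)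
    (hU : (#U : ℝ) ≤ (1 - ε) * relDist C₀ * genDist r C₀ * d * n) :
    (#{e ∈ U | (#{e' ∈ U | s.LocEq U C₀ e e'} : ℝ) < relDist C₀ / 2 ^ (r + 2) * d} : ℝ) ≤
      (1 / 8 + 1 / 1024) * #U := by
  set δ := relDist C₀ with hδ
  set δr := genDist r C₀ with hδr
  have hδ0 : 0 < δ := relDist_pos (hr1.trans hr)
  have hδ1 : δ ≤ δr := relDist_le_genDist hr1 hr
  have hδ2 : δr ≤ 1 := genDist_le_one r hr
  have hn' : (0 : ℝ) < n := by exact_mod_cast hn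
  have hd' : (0 : ℝ) < d := by exact_mod_cast hd
  set B : Finset (Fin n) :=
    {u | r ≤ Module.finrank (ZMod 2) (localCode C₀ (s.positions U u))} with hB
  have hT := card_touched_mul_le ht
  set b : ℝ := ((#B : ℕ) : ℝ) with hb
  set T : ℝ := ((#(t.touched U) : ℕ) : ℝ) with hTdef
  have hb0 : 0 ≤ b := by positivity
  have hT0 : 0 ≤ T := by positivity
  -- Each of the T touched vertices opposite uses up δd of the at most (1-ε)δδ_r dn edges of U.
  have hT1 : T ≤ (1 - ε) * δr * n := by
    have h1 : T * (δ * d) ≤ (1 - ε) * δr * n * (δ * d) := by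
      refine hT.trans (hU.trans (le_of_eq ?_)); ring
    exact le_of_mul_le_mul_right h1 (by positivity)
  -- the number of vertices whose local code has dimension at least `r`
  have hbad : b ≤ δ ^ 2 / 1024 * T := by
    -- The edges between B and the touched vertices opposite are counted twice: from below by the
    -- generalized distance, as each local code at B has dimension at least r, and from above by
    -- mixing.
    have h1 : b * (δr * d) ≤ d * b * T / n + lam * √(b * T) := by
      refine le_trans ?_ (hmix B (t.touched U))
      have h2 : (∑ u ∈ B, #(s.positions U u)) ≤ #{e | s.vert e ∈ B ∧ t.vert e ∈ t.touched U} := by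
        rw [card_eq_sum_card_fiberwise (f := s.vert) (t := B)
          (s := {e | s.vert e ∈ B ∧ t.vert e ∈ t.touched U})]
        · refine sum_le_sum fun u hu => ?_
          have h3 := s.card_filter_vert U (fun _ => True) u
          simp only [true_and, filter_true] at h3
          rw [← h3]
          refine card_le_card fun e he => ?_
          simp only [mem_filter, mem_univ, true_and] at he ⊢
          refine ⟨⟨by rw [he.2]; exact hu, ?_⟩, he.2⟩
          simp only [touched, mem_image]
          exact ⟨e, he.1, rfl⟩
        · intro e he
          simp only [coe_filter, mem_univ, true_and, Set.mem_ofPred_eq] at he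
          exact he.1
      have h4 : b * (δr * d) ≤ ∑ u ∈ B, (#(s.positions U u) : ℝ) := by
        rw [hb, ← nsmul_eq_mul]
        refine card_nsmul_le_sum _ _ _ fun u hu => ?_
        rw [hB, mem_filter] at hu
        exact genDist_mul_le_of_le hd.ne' (V := localCode C₀ (s.positions U u))
          (fun x hx => hx.1) hu.2 fun x hx => hx.2
      refine h4.trans ?_
      exact_mod_cast h2
    -- The main term reaches only the fraction 1-ε of the lower bound, so the error term must
    -- account for εδ_r db.
    have h2 : d * b * T / n ≤ d * b * ((1 - ε) * δr) := by
      rw [div_le_iff₀ hn']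
      have := mul_le_mul_of_nonneg_left hT1 (by positivity : 0 ≤ d * b)
      linarith
    have h3 : b * (ε * δr * d) ≤ lam * √(b * T) := by nlinarith
    -- This uses 2^(r+4) ≥ 32, ε² ≤ ε and δ² ≤ δ_r δ.
    have h4 : lam ≤ ε * δr * d * (δ / 32) := by
      rw [div_le_iff₀ hd'] at hlam
      refine hlam.trans ?_
      have h5 : (32 : ℝ) ≤ 2 ^ (r + 4) := by
        calc (32 : ℝ) = 2 ^ 5 := by norm_num
          _ ≤ 2 ^ (r + 4) := pow_le_pow_right₀ (by norm_num) (by omega)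
      have h6 : ε ^ 2 * δ ^ 2 / 2 ^ (r + 4) ≤ ε ^ 2 * δ ^ 2 / 32 :=
        div_le_div_of_nonneg_left (by positivity) (by norm_num) h5
      have h7 : ε ^ 2 * δ ^ 2 ≤ ε * δr * δ := by
        have : ε ^ 2 ≤ ε := by nlinarith
        have h8 : δ ^ 2 ≤ δr * δ := by nlinarith
        calc ε ^ 2 * δ ^ 2 ≤ ε * (δr * δ) := mul_le_mul this h8 (by positivity) hε.le
          _ = _ := by ring
      calc _ ≤ ε ^ 2 * δ ^ 2 / 32 * d := mul_le_mul_of_nonneg_right h6 hd'.le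
        _ ≤ ε * δr * δ / 32 * d := by gcongr
        _ = _ := by ring
    have hx : 0 < ε * δr * d := by have : 0 < δr := hδ0.trans_le hδ1; positivity
    have h5 : b ≤ δ / 32 * √(b * T) := by
      have h6 : b * (ε * δr * d) ≤ δ / 32 * √(b * T) * (ε * δr * d) := by
        refine h3.trans ((mul_le_mul_of_nonneg_right h4 (Real.sqrt_nonneg _)).trans (le_of_eq ?_))
        ring
      exact le_of_mul_le_mul_right h6 hx
    have h6 : b ^ 2 ≤ (δ / 32) ^ 2 * (b * T) := by
      have := pow_le_pow_left₀ hb0 h5 2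
      rwa [mul_pow, Real.sq_sqrt (by positivity)] at this
    rcases hb0.eq_or_lt with h | h
    · rw [← h]; positivity
    · have h7 : b * b ≤ δ ^ 2 / 1024 * T * b := by nlinarith
      exact le_of_mul_le_mul_right h7 h
  rw [s.card_filter_eq_sum U]
  push_cast
  -- A vertex of B may contribute all its d edges; at any other vertex `card_small_classes` leaves
  -- at most an eighth.
  have hvert : ∀ u, (#{i ∈ s.positions U u | (#{e' ∈ U | s.LocEq U C₀ (s.edge u i) e'} : ℝ) <
      δ / 2 ^ (r + 2) * d} : ℝ) ≤ #(s.positions U u) / 8 + if u ∈ B then (d : ℝ) else 0 := by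
    intro u
    by_cases hu : u ∈ B
    · rw [if_pos hu]
      have h1 : (#{i ∈ s.positions U u | (#{e' ∈ U | s.LocEq U C₀ (s.edge u i) e'} : ℝ) <
          δ / 2 ^ (r + 2) * d} : ℝ) ≤ d := by
        have := card_le_univ ({i ∈ s.positions U u |
          (#{e' ∈ U | s.LocEq U C₀ (s.edge u i) e'} : ℝ) < δ / 2 ^ (r + 2) * d})
        rw [Fintype.card_fin] at this
        exact_mod_cast this
      have : (0 : ℝ) ≤ #(s.positions U u) / 8 := by positivity
      linarith
    · rw [if_neg hu, add_zero]
      have hlt : Module.finrank (ZMod 2) (localCode C₀ (s.positions U u)) < r := by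
        simpa [hB] using hu
      refine le_trans (le_of_eq ?_) (card_small_classes hr1 hlt (hs u))
      congr 2
      refine filter_congr fun i hi => ?_
      rw [s.card_locEq U C₀ hi]
  refine (sum_le_sum fun u _ => hvert u).trans ?_
  rw [sum_add_distrib, ← sum_div, sum_ite_mem, univ_inter, sum_const, nsmul_eq_mul]
  have h8 : (#U : ℝ) = ∑ u, (#(s.positions U u) : ℝ) := by
    rw [s.card_eq_sum U]; push_cast; rfl
  rw [← h8]
  -- The factor T in the bound for b is paid by the δd unknown edges at each touched vertex.
  have h9 : b * d ≤ 1 / 1024 * #U := by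
    calc b * d ≤ δ ^ 2 / 1024 * T * d := mul_le_mul_of_nonneg_right hbad hd'.le
      _ = δ / 1024 * (T * (δ * d)) := by ring
      _ ≤ δ / 1024 * #U := by gcongr
      _ ≤ 1 / 1024 * #U := by gcongr; linarith
  linarith

open Classical in
-- Local classes never leave the class k, and those at distinct vertices are disjoint. So each
-- vertex of an edge of U' in the class k accounts for at least τ edges of that class.
theorem card_image_vert_mul_le {κ : Type*} {cl : E → κ}
    (hcl : ∀ e e', s.LocEq U C₀ e e' → cl e = cl e') {U' : Finset E} {τ : ℝ}
    (hτ : ∀ e ∈ U', τ ≤ #{e' ∈ U | s.LocEq U C₀ e e'}) (k : κ) :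
    #({e ∈ U' | cl e = k}.image s.vert) * τ ≤ #{e ∈ U | cl e = k} := by
  have h1 : #{e ∈ U | cl e = k ∧ s.vert e ∈ {e ∈ U' | cl e = k}.image s.vert} ≤
      #{e ∈ U | cl e = k} := card_le_card fun e he => by
    rw [mem_filter] at he ⊢
    exact ⟨he.1, he.2.1⟩
  have h2 : (#{e ∈ U | cl e = k ∧ s.vert e ∈ {e ∈ U' | cl e = k}.image s.vert} : ℝ) ≤
      #{e ∈ U | cl e = k} := by exact_mod_cast h1
  refine le_trans ?_ h2
  rw [card_eq_sum_card_fiberwise (f := s.vert) (t := {e ∈ U' | cl e = k}.image s.vert)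
    (s := {e ∈ U | cl e = k ∧ s.vert e ∈ {e ∈ U' | cl e = k}.image s.vert})
    fun e he => by
      simp only [coe_filter, Set.mem_ofPred_eq] at he
      exact he.2.2]
  push_cast
  rw [← nsmul_eq_mul]
  refine card_nsmul_le_sum _ _ _ fun u hu => ?_
  obtain ⟨e, he, rfl⟩ := mem_image.1 hu
  rw [mem_filter] at he
  refine (hτ e he.1).trans ?_
  have : #{e' ∈ U | s.LocEq U C₀ e e'} ≤ #{e' ∈ {e ∈ U | cl e = k ∧
      s.vert e ∈ {e ∈ U' | cl e = k}.image s.vert} | s.vert e' = s.vert e} := by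
    refine card_le_card fun e' he' => ?_
    rw [mem_filter] at he'
    have hv : s.vert e' = s.vert e := by
      obtain ⟨u, i, -, j, -, rfl, rfl, -⟩ := he'.2
      rw [s.vert_edge, s.vert_edge]
    simp only [mem_filter]
    refine ⟨⟨he'.1, (hcl e e' he'.2).symm.trans he.2, ?_⟩, hv⟩
    rw [hv]
    exact hu
  exact_mod_cast this

/-- Put w = x/(τd), which bounds a and b. The assumption on x gives w ≤ (2/5)τn, so the main term is
at most dw²/n ≤ (2/5)x, and the error term is at most (τd/4)w = x/4. The sum is (13/20)x. -/
theorem mixing_bound_of_lt {d n τ x a b lam : ℝ} (hn : 0 < n) (hd : 0 < d) (hτ : 0 < τ)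
    (hlam : lam ≤ τ * d / 4) (ha0 : 0 ≤ a) (hb0 : 0 ≤ b) (ha : a * (τ * d) ≤ x)
    (hb : b * (τ * d) ≤ x) (hx : x < 2 / 5 * τ ^ 2 * d * n) :
    d * a * b / n + lam * √(a * b) ≤ 13 / 20 * x := by
  set w := x / (τ * d) with hw
  have hτd : 0 < τ * d := by positivity
  have haw : a ≤ w := (le_div_iff₀ hτd).2 ha
  have hbw : b ≤ w := (le_div_iff₀ hτd).2 hb
  have hw0 : 0 ≤ w := ha0.trans haw
  have hwx : w * (τ * d) = x := div_mul_cancel₀ _ hτd.ne'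
  have hab : a * b ≤ w * w := mul_le_mul haw hbw hb0 hw0
  have h3 : d * a * b / n ≤ 2 / 5 * x := by
    rw [div_le_iff₀ hn]
    have h5 : w ≤ 2 / 5 * τ * n := by
      have : w * (τ * d) ≤ 2 / 5 * τ * n * (τ * d) := by
        rw [hwx]
        refine hx.le.trans (le_of_eq ?_)
        ring
      exact le_of_mul_le_mul_right this hτd
    calc d * a * b = d * (a * b) := by ring
      _ ≤ d * (w * w) := by gcongr
      _ ≤ d * (w * (2 / 5 * τ * n)) := by gcongr
      _ = 2 / 5 * (w * (τ * d)) * n := by ring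
      _ = 2 / 5 * x * n := by rw [hwx]
  have h4 : lam * √(a * b) ≤ 1 / 4 * x := by
    have : √(a * b) ≤ w := by
      rw [← Real.sqrt_mul_self hw0]
      exact Real.sqrt_le_sqrt hab
    calc lam * √(a * b) ≤ τ * d / 4 * w :=
          mul_le_mul hlam this (Real.sqrt_nonneg _) (by positivity)
      _ = 1 / 4 * (w * (τ * d)) := by ring
      _ = 1 / 4 * x := by rw [hwx]
  linarith

open Classical in
/-- If local equivalence refines the partition into the classes of `cl`, then some class is
large. -/
theorem exists_large_class [Fintype E] {r : ℕ} {ε lam : ℝ} (hn : 0 < n) (hd : 0 < d) (hr1 : 1 ≤ r)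
    (hr : r ≤ Module.finrank (ZMod 2) C₀) (hε : 0 < ε) (hε1 : ε ≤ 1)
    (hlam : lam / d ≤ ε ^ 2 * relDist C₀ ^ 2 / 2 ^ (r + 4)) (hmix : s.Mixing t lam)
    (hmix' : t.Mixing s lam) (hs : s.Closed U C₀) (ht : t.Closed U C₀)
    (hU : (#U : ℝ) ≤ (1 - ε) * relDist C₀ * genDist r C₀ * d * n) (hne : U.Nonempty)
    {κ : Type*} {cl : E → κ} (hcs : ∀ e e', s.LocEq U C₀ e e' → cl e = cl e')
    (hct : ∀ e e', t.LocEq U C₀ e e' → cl e = cl e') :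
    ∃ e ∈ U, 2 / 5 * (relDist C₀ / 2 ^ (r + 2)) ^ 2 * d * n ≤ #{e' ∈ U | cl e' = cl e} := by
  have hn' : (0 : ℝ) < n := by exact_mod_cast hn
  have hd' : (0 : ℝ) < d := by exact_mod_cast hd
  have hδ0 : 0 < relDist C₀ := relDist_pos (hr1.trans hr)
  have hδ1 : relDist C₀ ≤ 1 := (relDist_le_genDist hr1 hr).trans (genDist_le_one r hr)
  have h1 := card_small_le hn hd hr1 hr hε hε1 hlam hmix hs ht hU
  have h2 := card_small_le hn hd hr1 hr hε hε1 hlam hmix' ht hs hU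
  set τ := relDist C₀ / 2 ^ (r + 2) with hτ
  have hτ0 : 0 < τ := by positivity
  -- As ε²δ² ≤ δ, the hypothesis on λ/d leaves δ/2^(r+4), which is τ/4.
  have hlam' : lam ≤ τ * d / 4 := by
    rw [div_le_iff₀ hd'] at hlam
    refine hlam.trans ?_
    have h3 : ε ^ 2 * relDist C₀ ^ 2 ≤ relDist C₀ := by
      have : ε ^ 2 ≤ 1 := by nlinarith
      nlinarith [sq_nonneg ε]
    have h4 : ε ^ 2 * relDist C₀ ^ 2 / 2 ^ (r + 4) ≤ relDist C₀ / 2 ^ (r + 4) := by gcongr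
    have h5 : relDist C₀ / 2 ^ (r + 4) = τ / 4 := by
      rw [hτ]; field_simp; ring
    nlinarith
  set As : Finset E := {e ∈ U | (#{e' ∈ U | s.LocEq U C₀ e e'} : ℝ) < τ * d} with hAs
  set At : Finset E := {e ∈ U | (#{e' ∈ U | t.LocEq U C₀ e e'} : ℝ) < τ * d} with hAt
  set U' := U \ (As ∪ At) with hU'
  have hsub : U' ⊆ U := sdiff_subset
  -- Discarding the fraction 1/8 + 1/1024 for each of the two sides leaves more than 7/10.
  have hbig : (#U : ℝ) * (7 / 10) ≤ #U' := by
    have h3 : #U ≤ #U' + #(As ∪ At) := by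
      have := card_le_card_sdiff_add_card (s := U) (t := As ∪ At)
      omega
    have h4 := card_union_le As At
    have h5 : (#U : ℝ) ≤ #U' + (#As + #At) := by exact_mod_cast h3.trans (by omega)
    have : (0 : ℝ) ≤ #U := by positivity
    linarith
  have hbs : ∀ e ∈ U', τ * d ≤ #{e' ∈ U | s.LocEq U C₀ e e'} := by
    intro e he
    by_contra hcon
    rw [hU', mem_sdiff, mem_union] at he
    exact he.2 (Or.inl (mem_filter.2 ⟨he.1, not_le.1 hcon⟩))
  have hbt : ∀ e ∈ U', τ * d ≤ #{e' ∈ U | t.LocEq U C₀ e e'} := by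
    intro e he
    by_contra hcon
    rw [hU', mem_sdiff, mem_union] at he
    exact he.2 (Or.inr (mem_filter.2 ⟨he.1, not_le.1 hcon⟩))
  by_contra! hcon
  have hclass : ∀ k ∈ U.image cl,
      (#{e ∈ U' | cl e = k} : ℝ) ≤ 13 / 20 * #{e ∈ U | cl e = k} := by
    intro k hk
    obtain ⟨e, he, rfl⟩ := mem_image.1 hk
    have hx := hcon e he
    have hS := card_image_vert_mul_le hcs hbs (cl e)
    have hT := card_image_vert_mul_le hct hbt (cl e)
    have hm := hmix ({e' ∈ U' | cl e' = cl e}.image s.vert) ({e' ∈ U' | cl e' = cl e}.image t.vert)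
    set x : ℝ := ((#{e' ∈ U | cl e' = cl e} : ℕ) : ℝ) with hxdef
    set a : ℝ := ((#({e' ∈ U' | cl e' = cl e}.image s.vert) : ℕ) : ℝ) with ha
    set b : ℝ := ((#({e' ∈ U' | cl e' = cl e}.image t.vert) : ℕ) : ℝ) with hb
    have ha0 : 0 ≤ a := by positivity
    have hb0 : 0 ≤ b := by positivity
    have hle : (#{e' ∈ U' | cl e' = cl e} : ℝ) ≤ d * a * b / n + lam * √(a * b) := by
      refine le_trans ?_ hm
      norm_cast
      refine card_le_card fun e' he' => ?_
      simp only [mem_filter, mem_univ, true_and]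
      exact ⟨mem_image_of_mem _ he', mem_image_of_mem _ he'⟩
    exact hle.trans (mixing_bound_of_lt hn' hd' hτ0 hlam' ha0 hb0 hS hT hx)
  have hsumU : (#U : ℝ) = ∑ k ∈ U.image cl, (#{e ∈ U | cl e = k} : ℝ) := by
    rw [card_eq_sum_card_image cl U]; push_cast; rfl
  have hsumU' : (#U' : ℝ) = ∑ k ∈ U.image cl, (#{e ∈ U' | cl e = k} : ℝ) := by
    rw [card_eq_sum_card_fiberwise (f := cl) (t := U.image cl) (s := U')
      fun e he => by simpa using ⟨e, hsub he, rfl⟩]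
    push_cast; rfl
  -- Summing over all classes gives #U' ≤ (13/20)·#U, which is less than 7/10 of the nonempty set U.
  have hfin := sum_le_sum hclass
  rw [← mul_sum, ← hsumU, ← hsumU'] at hfin
  have hpos : (0 : ℝ) < #U := by exact_mod_cast hne.card_pos
  linarith

end EdgeSide

/-! ### The two sides of a double cover and their mixing bounds -/

namespace OrderedRegularGraph

variable {n d : ℕ} (G : OrderedRegularGraph n d)

/-- The left side of the double cover. -/
def sideL : EdgeSide G.Edge n d where
  vert e := e.1.1
  edge := G.edgeL
  vert_edge _ _ := rfl
  exists_edge e := by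
    obtain ⟨i, hi⟩ := (G.nbrL e.1.1).surjective ⟨e.1.2, e.2⟩
    exact ⟨i, Subtype.ext (Prod.ext rfl (by simp [edgeL, hi]))⟩
  edge_injective u i j h := by
    apply (G.nbrL u).injective
    apply Subtype.ext
    have := congrArg (fun e : G.Edge => e.1.2) h
    simpa [edgeL] using this

/-- The right side of the double cover. -/
def sideR : EdgeSide G.Edge n d where
  vert e := e.1.2
  edge := G.edgeR
  vert_edge _ _ := rfl
  exists_edge e := by
    obtain ⟨i, hi⟩ := (G.nbrR e.1.2).surjective ⟨e.1.1, e.2⟩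
    exact ⟨i, Subtype.ext (Prod.ext (by simp [edgeR, hi]) rfl)⟩
  edge_injective u i j h := by
    apply (G.nbrR u).injective
    apply Subtype.ext
    have := congrArg (fun e : G.Edge => e.1.1) h
    simpa [edgeR] using this

open Classical in
theorem card_edges_between [Fintype G.Edge] (A B : Finset (Fin n)) :
    #{e : G.Edge | e.1.1 ∈ A ∧ e.1.2 ∈ B} = #{p ∈ A ×ˢ B | G.Adj p.1 p.2} := by
  rw [← card_image_of_injective _ Subtype.val_injective]
  congr 1
  ext p
  simp only [mem_image, mem_filter, mem_univ, true_and, mem_product, Subtype.exists]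
  constructor
  · rintro ⟨p', h1, h2, rfl⟩
    exact ⟨h2, h1⟩
  · rintro ⟨h1, h2⟩
    exact ⟨p, h2, h1, rfl⟩

theorem mixing_sideL (hn : 2 ≤ n) [Fintype G.Edge] :
    G.sideL.Mixing G.sideR (G.expansion hn) := by
  classical
  intro A B
  have h := G.mixing hn A B
  rw [← card_edges_between] at h
  exact h

theorem mixing_sideR (hn : 2 ≤ n) [Fintype G.Edge] :
    G.sideR.Mixing G.sideL (G.expansion hn) := by
  classical
  intro A B
  have h := G.mixing hn B A
  rw [← card_edges_between, mul_comm (#B : ℝ), mul_right_comm] at h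
  simp only [and_comm (a := _ ∈ B)] at h
  exact h

end OrderedRegularGraph

/-! ## Edge tables and their representation in memory -/

open Finset

/-- A double cover with numbered edges and vertices, and a parity-check matrix, in terms of natural
numbers: `eid v i` is the `i`-th edge at the vertex `v < 2 * n` (vertices below `n` are left
vertices), `ev e s` is the left (`s = 0`) or right (`s = 1`) vertex of the edge `e < n * d`. -/
structure EdgeTable where
  n : ℕ
  d : ℕ
  m : ℕ
  eid : ℕ → ℕ → ℕ
  ev : ℕ → ℕ → ℕ
  H : ℕ → ℕ → ℕ
  two_le_n : 2 ≤ n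
  d_pos : 0 < d
  m_le : m ≤ d
  eid_lt : ∀ {v i}, v < 2 * n → i < d → eid v i < n * d
  ev_lt : ∀ {e s}, e < n * d → s < 2 → ev e s < 2 * n
  ev_eid : ∀ {v i}, v < 2 * n → i < d → ev (eid v i) (if v < n then 0 else 1) = v
  side_ev : ∀ {e s}, e < n * d → s < 2 → (if ev e s < n then 0 else 1) = s
  exists_eid : ∀ {e s}, e < n * d → s < 2 → ∃ i < d, eid (ev e s) i = e
  eid_inj : ∀ {v i j}, v < 2 * n → i < d → j < d → eid v i = eid v j → i = j
  H_lt : ∀ {k i}, k < m → i < d → H k i < 2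

namespace EdgeTable

variable (T : EdgeTable)

/-- The side of a vertex. -/
def side (v : ℕ) : ℕ := if v < T.n then 0 else 1

theorem side_lt (v : ℕ) : T.side v < 2 := by unfold side; split <;> omega

/-- The value of the `k`-th parity check at the vertex `v`. -/
def check (c : ℕ → ZMod 2) (v k : ℕ) : ZMod 2 := ∑ i ∈ range T.d, (T.H k i : ZMod 2) * c (T.eid v i)

/-- The words of the expander code. -/
def IsWord (c : ℕ → ZMod 2) : Prop := ∀ v < 2 * T.n, ∀ k < T.m, T.check c v k = 0

/-- The words that satisfy the first `k` parity checks of the inner code and vanish on the edges at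
`v` outside of `U`. -/
def Loc (U : ℕ → Prop) (v k : ℕ) (x : ℕ → ZMod 2) : Prop :=
  (∀ i < T.d, ¬ U (T.eid v i) → x i = 0) ∧
    ∀ k' < k, ∑ i ∈ range T.d, (T.H k' i : ZMod 2) * x i = 0

/-- The edge `e` is among the first `p` edges at the vertex `v`. -/
def IsFirst (v p e : ℕ) : Prop := ∃ i < p, T.eid v i = e

theorem isFirst_zero (v e : ℕ) : ¬ T.IsFirst v 0 e := by
  rintro ⟨i, hi, -⟩
  omega

theorem isFirst_succ (v p e : ℕ) : T.IsFirst v (p + 1) e ↔ T.IsFirst v p e ∨ e = T.eid v p := by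
  constructor
  · rintro ⟨i, hi, rfl⟩
    rcases Nat.lt_succ_iff_lt_or_eq.1 hi with h | rfl
    · exact Or.inl ⟨i, h, rfl⟩
    · exact Or.inr rfl
  · rintro (⟨i, hi, rfl⟩ | rfl)
    · exact ⟨i, by omega, rfl⟩
    · exact ⟨p, by omega, rfl⟩

theorem not_isFirst_eid {v p : ℕ} (hv : v < 2 * T.n) (hp : p < T.d) :
    ¬ T.IsFirst v p (T.eid v p) := by
  rintro ⟨i, hi, h⟩
  have := T.eid_inj hv (by omega) hp h
  omega

theorem n_le_mul : T.n ≤ T.n * T.d := Nat.le_mul_of_pos_right _ T.d_pos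

theorem d_le_mul : 2 * T.d ≤ T.n * T.d := Nat.mul_le_mul_right _ T.two_le_n

/-- The size of the arrays is large enough. -/
def Fits (S : ℕ) : Prop := (T.n * T.d + 2) ^ 4 ≤ S

variable {T}

theorem Fits.le {S : ℕ} (hS : T.Fits S) : 64 * (T.n * T.d + 2) ≤ S := by
  refine le_trans ?_ hS
  have h1 := T.d_le_mul
  have h2 := T.d_pos
  have h3 : 4 ^ 3 ≤ (T.n * T.d + 2) ^ 3 := Nat.pow_le_pow_left (by omega) 3
  calc 64 * (T.n * T.d + 2) ≤ (T.n * T.d + 2) ^ 3 * (T.n * T.d + 2) :=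
        Nat.mul_le_mul_right _ (by omega)
    _ = (T.n * T.d + 2) ^ 4 := by ring

end EdgeTable

namespace ArrayRAM

open RAM

-- Registers are numbered roughly by depth of nesting, outer loops having the smaller numbers. This
-- lets a single threshold in `Frame` say which registers a subprogram leaves alone. Labels are rows
-- of `aLab`: the columns below d are scratch variables for the vertex at hand, column d is the
-- constant term, and the columns from d+1 on are guessed variables.
notation "rN" => 0
notation "rD" => 1
notation "rM" => 2
notation "rK" => 3
notation "rNN" => 4
notation "rE" => 5
notation "rGo" => 6
notation "rCur" => 10
notation "rPtr" => 11
notation "rV" => 15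
notation "rSP" => 16
notation "rRow" => 17
notation "rI" => 18
notation "rEd" => 19
notation "rSide" => 20
notation "rI2" => 21
notation "rEd2" => 22
notation "rF" => 25
notation "rJ" => 26
notation "rP" => 27
notation "rX" => 28
notation "rBest" => 30
notation "rBestE" => 31
notation "rCnt" => 32
notation "rTop" => 33

notation "aIn" => 0
notation "aEid" => 1
notation "aEv" => 2
notation "aLab" => 3
notation "aKn" => 4
notation "aG" => 5
notation "aCl" => 6
notation "aStk" => 7
notation "aVis" => 8
notation "aOut" => 9
notation "aH" => 10
notation "aDead" => 11
notation "aAlive" => 12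

/-- Registers below `k` and the arrays outside of `A` are the same in `h` and `h'`. -/
def Frame (k : ℕ) (A : List ℕ) (h h' : HState) : Prop :=
  (∀ x < k, h'.reg x = h.reg x) ∧ ∀ a, a ∉ A → h'.arr a = h.arr a

namespace Frame

variable {k k' a i j x v : ℕ} {A A' : List ℕ} {h h' h'' : HState}

theorem refl : Frame k A h h := ⟨fun _ _ => rfl, fun _ _ => rfl⟩

theorem trans (h1 : Frame k A h h') (h2 : Frame k A h' h'') : Frame k A h h'' :=
  ⟨fun x hx => (h2.1 x hx).trans (h1.1 x hx), fun a ha => (h2.2 a ha).trans (h1.2 a ha)⟩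

theorem mono (hf : Frame k A h h') (hk : k' ≤ k) (hA : ∀ a ∈ A, a ∈ A') : Frame k' A' h h' :=
  ⟨fun x hx => hf.1 x (by omega), fun a ha => hf.2 a fun h => ha (hA a h)⟩

theorem setR (hf : Frame k A h h') (hx : k ≤ x) : Frame k A h (h'.setR x v) :=
  ⟨fun y hy => by rw [HState.setR_reg, if_neg (by omega), hf.1 y hy], hf.2⟩

theorem setA (hf : Frame k A h h') (ha : a ∈ A) : Frame k A h (h'.setA a i j v) :=
  ⟨hf.1, fun b hb => by
    rw [HState.setA_arr_of_ne, hf.2 b hb]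
    rintro rfl
    exact hb ha⟩

end Frame

variable (T : EdgeTable)

/-- The part of the state that is not changed after the initialization. -/
structure Stat (h : HState) : Prop where
  n : h.reg rN = T.n
  d : h.reg rD = T.d
  m : h.reg rM = T.m
  nn : h.reg rNN = 2 * T.n
  e : h.reg rE = T.n * T.d
  eid : ∀ v < 2 * T.n, ∀ i < T.d, h.arr aEid v i = T.eid v i
  ev : ∀ e < T.n * T.d, ∀ s < 2, h.arr aEv e s = T.ev e s
  H : ∀ k < T.m, ∀ i < T.d, h.arr aH k i = T.H k i

variable {T}

theorem Stat.frame {h h' : HState} (hs : Stat T h) {k : ℕ} {A : List ℕ} (hf : Frame k A h h')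
    (hk : 6 ≤ k := by decide) (hA : aEid ∉ A ∧ aEv ∉ A ∧ aH ∉ A := by decide) : Stat T h' where
  n := by rw [hf.1 _ (by omega), hs.n]
  d := by rw [hf.1 _ (by omega), hs.d]
  m := by rw [hf.1 _ (by omega), hs.m]
  nn := by rw [hf.1 _ (by omega), hs.nn]
  e := by rw [hf.1 _ (by omega), hs.e]
  eid := by rw [hf.2 _ hA.1]; exact hs.eid
  ev := by rw [hf.2 _ hA.2.1]; exact hs.ev
  H := by rw [hf.2 _ hA.2.2]; exact hs.H

/-- The label of the edge `e` at the column `j`. -/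
def lab (h : HState) (e j : ℕ) : ZMod 2 := h.arr aLab e j

theorem lab_frame {h h' : HState} {k : ℕ} {A : List ℕ} (hf : Frame k A h h')
    (hA : aLab ∉ A := by decide) : lab h' = lab h := by
  funext e j
  rw [lab, lab, hf.2 _ hA]

/-- All labels are bits. -/
def LabBits (h : HState) : Prop := ∀ e j, h.arr aLab e j < 2

theorem LabBits.frame {h h' : HState} (hl : LabBits h) {k : ℕ} {A : List ℕ} (hf : Frame k A h h')
    (hA : aLab ∉ A := by decide) : LabBits h' := by
  intro e j
  rw [hf.2 _ hA]
  exact hl e j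

theorem cast_xor {a b : ℕ} (ha : a < 2) (hb : b < 2) :
    ((1 - (if a = b then 1 else 0) : ℕ) : ZMod 2) = a + b := by
  interval_cases a <;> interval_cases b <;> decide

theorem xor_lt (a b : ℕ) : 1 - (if a = b then 1 else 0) < 2 := by omega

/-- The sum of two bits. -/
def HExpr.xor (e f : HExpr) : HExpr := .sub (.c 1) (.eq e f)

@[simp] theorem HExpr.val_xor (h : HState) (e f : HExpr) :
    (e.xor f).val h = 1 - (if e.val h = f.val h then 1 else 0) := rfl

@[simp] theorem HExpr.ok_xor (S : ℕ) (h : HState) (e f : HExpr) :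
    (e.xor f).ok S h ↔ e.ok S h ∧ f.ok S h := by
  simp [HExpr.xor]

/-- Computes the linear form that is the check `rRow` at the vertex `rV` in terms of the labels. -/
def checkForm : Prog :=
  forP rJ (.r rK) (.seq (setP rX (.c 0)) (.seq
    (forP rP (.r rD) (setP rX (.xor (.r rX) (.mul (.ld aH (.r rRow) (.r rP))
      (.ld aLab (.ld aEid (.r rV) (.r rP)) (.r rJ))))))
    (storeP aG (.c 0) (.r rJ) (.r rX))))

theorem run_checkForm {S v k K : ℕ} {h : HState} (hS : T.Fits S) (hs : Stat T h) (hl : LabBits h)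
    (hv : v < 2 * T.n) (hk : k < T.m) (hK : K < S) (hrV : h.reg rV = v) (hrRow : h.reg rRow = k)
    (hrK : h.reg rK = K) :
    Run S checkForm h fun h' t => Frame 25 [aG] h h' ∧ t ≤ K * (3 * T.d + 6) + 2 ∧
      ∀ j < K, h'.arr aG 0 j < 2 ∧ (h'.arr aG 0 j : ZMod 2) = T.check (fun e => lab h e j) v k := by
  have hle := hS.le
  have h1 := T.n_le_mul
  have h2 := T.d_le_mul
  have h3 := T.m_le
  refine run_for_uniform (B := 3 * T.d + 4) (Nv := K)
    (fun j h' => Frame 25 [aG] h h' ∧ h'.reg rJ = j ∧ ∀ j' < j, h'.arr aG 0 j' < 2 ∧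
      (h'.arr aG 0 j' : ZMod 2) = T.check (fun e => lab h e j') v k) ?_ hK ?_ ?_ ?_
  · exact ⟨Frame.refl.setR (by norm_num), by simp, by simp⟩
  · rintro j h' - ⟨hf, hj, -⟩
    exact ⟨hj, by simp [hf.1, hrK], by simp⟩
  · rintro j h' hjK ⟨hf, hj, hG⟩ -
    have hs' := hs.frame hf
    have hlab := lab_frame hf
    have hl' := hl.frame hf
    refine run_seq (run_set (by simp) (by simp; omega) ?_)
    refine run_seq ?_
    refine run_for_uniform (B := 1) (Nv := T.d)
      (fun p h'' => Frame 27 [] h' h'' ∧ h''.reg rP = p ∧ h''.reg rX < 2 ∧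
        (h''.reg rX : ZMod 2) =
          ∑ i ∈ range p, (T.H k i : ZMod 2) * lab h (T.eid v i) j) ?_ (by omega) ?_ ?_ ?_
    · exact ⟨(Frame.refl.setR (by norm_num)).setR (by norm_num), by simp, by simp, by simp⟩
    · rintro p h'' - ⟨hf', hp, -⟩
      exact ⟨hp, by simp [hf'.1, hs'.d], by simp⟩
    · rintro p h'' hpd ⟨hf', hp, hx, hsum⟩ -
      have hs'' := hs'.frame hf'
      have hlab' := lab_frame hf'
      have hl'' := hl'.frame hf'
      have e1 : h''.reg rV = v := by rw [hf'.1 _ (by norm_num), hf.1 _ (by norm_num), hrV]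
      have e2 : h''.reg rRow = k := by rw [hf'.1 _ (by norm_num), hf.1 _ (by norm_num), hrRow]
      have e3 : h''.reg rJ = j := by rw [hf'.1 _ (by norm_num), hj]
      have e4 := T.eid_lt hv hpd
      have e5 := hs''.eid v hv p hpd
      have e6 := hs''.H k hk p hpd
      refine run_set ?_ ?_ ?_
      · simp [e1, e2, e3, hp, e5]; omega
      · have := xor_lt ((HExpr.r rX).val h'') (((HExpr.ld aH (.r rRow) (.r rP)).mul
          (.ld aLab (.ld aEid (.r rV) (.r rP)) (.r rJ))).val h'')
        rw [HExpr.val_xor]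
        omega
      · refine ⟨by simpa using hp, le_rfl, (hf'.setR (by norm_num)).setR (by norm_num), by simp, ?_,
          ?_⟩
        · simp
        · simp only [HState.setR_reg, HExpr.val_xor, HExpr.val, e1, e2, e3, hp, e5, e6]
          norm_num
          rw [cast_xor hx, sum_range_succ, hsum]
          · push_cast
            congr 2
            rw [← hlab, ← hlab']
            rfl
          · have := T.H_lt hk hpd
            have := hl'' (T.eid v p) j
            interval_cases T.H k p <;> omega
    · rintro h'' t ⟨hf', hp, hx, hsum⟩ - ht
      have e3 : h''.reg rJ = j := by rw [hf'.1 _ (by norm_num), hj]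
      refine run_store (by simp) (by simp) (by simp) (by simp; omega) (by simp [e3]; omega)
        (by simp; omega) ?_
      refine ⟨by simp [e3], by omega, ?_, by simp, ?_⟩
      · refine Frame.setR (Frame.setA ?_ (by simp)) (by norm_num)
        exact hf.trans (hf'.mono (by norm_num) (by simp))
      · intro j' hj'
        simp only [HState.setR_arr, HState.setA_arr, HExpr.val, e3]
        by_cases hjj : j' = j
        · subst hjj
          simp [hx, hsum, EdgeTable.check]
        · have hg : h''.arr aG = h'.arr aG := hf'.2 _ (by simp)
          simpa [hjj, hg] using hG j' (by omega)
  · rintro h' t ⟨hf, hj, hG⟩ - ht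
    exact ⟨hf, by linarith, hG⟩

end ArrayRAM

/-! ### Pivot search, substitution and comparison of rows -/

namespace ArrayRAM

open RAM Finset

variable {T : EdgeTable}

/-- Searches a column with a nonzero coefficient of the current linear form among the columns that
pass the test; the register `rF` contains `d` if there is none. -/
def findPivot (test : HExpr) : Prog :=
  .seq (setP rF (.r rD)) (forP rJ (.r rK)
    (whenP (.mul (.ld aG (.c 0) (.r rJ)) test) (setP rF (.r rJ))))

/-- The value d can signal failure because d is the index of the constant column, which passes
neither of the two tests in use, j < d and d < j. -/
theorem run_findPivot {S K : ℕ} {h : HState} {test : HExpr} {p : ℕ → Prop} [DecidablePred p]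
    (hS : T.Fits S) (hs : Stat T h) (hK : K < S) (hrK : h.reg rK = K)
    (htest : ∀ h' : HState, h'.reg rD = T.d → test.ok S h' ∧
      test.val h' = if p (h'.reg rJ) then 1 else 0)
    (hw : (HExpr.mul (.ld aG (.c 0) (.r rJ)) test).wf = true := by rfl) :
    Run S (findPivot test) h fun h' t => Frame 25 [] h h' ∧ t ≤ K * 4 + 3 ∧
      ((h'.reg rF = T.d ∧ ∀ j < K, p j → h.arr aG 0 j = 0) ∨
        (h'.reg rF < K ∧ p (h'.reg rF) ∧ h.arr aG 0 (h'.reg rF) ≠ 0)) := by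
  have hle := hS.le
  have h2 := T.d_le_mul
  refine run_seq (run_set (by simp) (by simp [hs.d]; omega) ?_)
  refine run_for_uniform (B := 2) (Nv := K)
    (fun j h' => Frame 25 [] h h' ∧ h'.reg rJ = j ∧ h'.reg rF < S ∧
      ((h'.reg rF = T.d ∧ ∀ j' < j, p j' → h.arr aG 0 j' = 0) ∨
        (h'.reg rF < K ∧ p (h'.reg rF) ∧ h.arr aG 0 (h'.reg rF) ≠ 0))) ?_ hK ?_ ?_ ?_
  · refine ⟨(Frame.refl.setR (by norm_num)).setR (by norm_num), by simp, ?_, Or.inl ?_⟩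
    · simp [hs.d]; omega
    · simp [hs.d]
  · rintro j h' - ⟨hf, hj, -⟩
    exact ⟨hj, by simp [hf.1, hrK], by simp⟩
  · rintro j h' hjK ⟨hf, hj, hFS, hF⟩ -
    have hs' := hs.frame hf
    obtain ⟨ht1, ht2⟩ := htest h' hs'.d
    have hg : h'.arr aG = h.arr aG := hf.2 _ (by simp)
    refine run_when ⟨?_, ht1⟩ ?_ ?_ hw
    · simp [hj]; omega
    · intro hv
      refine run_set (by simp) (by simp [hj]; omega) ?_
      refine ⟨by simp [hj], by norm_num, (hf.setR (by norm_num)).setR (by norm_num), by simp, ?_,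
        Or.inr ?_⟩
      · simp [hj]; omega
      · simp only [HExpr.val, ht2, hj, hg] at hv
        have hp : p j := by
          by_contra hcon
          simp [hcon] at hv
        simp only [hp, if_true, mul_one] at hv
        simp [hj, hjK, hp, hv]
    · intro hv
      refine ⟨hj, le_rfl, hf.setR (by norm_num), by simp, by simpa using hFS, ?_⟩
      rcases hF with ⟨h3, h4⟩ | h3
      · refine Or.inl ⟨by simpa using h3, fun j' hj' hp => ?_⟩
        by_cases hjj : j' = j
        · subst hjj
          simpa [ht2, hj, hp, hg] using hv
        · exact h4 j' (by omega) hp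
      · exact Or.inr (by simpa using h3)
  · rintro h' t ⟨hf, -, -, hF⟩ - ht
    exact ⟨hf, by omega, hF⟩

/-- Adds the current linear form to the label of all edges at `rV` in which the column `rF`
occurs. -/
def addForm : Prog :=
  forP rP (.r rD) (.seq (setP rX (.ld aEid (.r rV) (.r rP)))
    (whenP (.ld aLab (.r rX) (.r rF)) (forP rJ (.r rK)
      (storeP aLab (.r rX) (.r rJ) (.xor (.ld aLab (.r rX) (.r rJ)) (.ld aG (.c 0) (.r rJ)))))))

open Classical in
-- Where the coefficient at F is 1, adding the form g substitutes y_F + g(y) for y_F; if g_F = 1,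
-- this eliminates y_F. The coefficient at F is tested once per edge, before the row is changed.
theorem run_addForm {S v K F : ℕ} {h : HState} (hS : T.Fits S) (hs : Stat T h) (hl : LabBits h)
    (hv : v < 2 * T.n) (hK : K < S) (hrV : h.reg rV = v) (hrK : h.reg rK = K)
    (hrF : h.reg rF = F) (hF : F < K) (hG : ∀ j < K, h.arr aG 0 j < 2) :
    Run S addForm h fun h' t => Frame 26 [aLab] h h' ∧ LabBits h' ∧
      t ≤ T.d * (3 * K + 6) + 2 ∧
      ∀ e j, lab h' e j = if T.IsFirst v T.d e ∧ j < K then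
        lab h e j + lab h e F * h.arr aG 0 j else lab h e j := by
  have hle := hS.le
  have h2 := T.d_le_mul
  have h3 := T.n_le_mul
  refine run_for_uniform (B := 3 * K + 4) (Nv := T.d)
    (fun p h' => Frame 26 [aLab] h h' ∧ LabBits h' ∧ h'.reg rP = p ∧
      ∀ e j, lab h' e j = if T.IsFirst v p e ∧ j < K then
        lab h e j + lab h e F * h.arr aG 0 j else lab h e j) ?_ (by omega) ?_ ?_ ?_
  · exact ⟨Frame.refl.setR (by norm_num), hl, by simp, fun e j => by
      simp [lab, T.isFirst_zero]⟩
  · rintro p h' - ⟨hf, -, hp, -⟩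
    exact ⟨hp, by simp [hf.1, hs.d], by simp⟩
  · rintro p h' hpd ⟨hf, hl', hp, hlab⟩ -
    have hs' := hs.frame hf
    have e1 : h'.reg rV = v := by rw [hf.1 _ (by norm_num), hrV]
    have e2 := hs'.eid v hv p hpd
    have e3 := T.eid_lt hv hpd
    have e4 : h'.reg rF = F := by rw [hf.1 _ (by norm_num), hrF]
    have hnew := T.not_isFirst_eid hv hpd
    have hold : ∀ j, lab h' (T.eid v p) j = lab h (T.eid v p) j := by
      intro j
      rw [hlab, if_neg (fun hc => hnew hc.1)]
    refine run_seq (run_set (by simp [e1, hp]; omega) (by simp [e1, hp, e2]; omega) ?_)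
    refine run_when (by simp [e4, e1, hp, e2]; omega) ?_ ?_
    · intro hv1
      have hF1 : lab h (T.eid v p) F = 1 := by
        rw [← hold]
        have h3 := hl' (T.eid v p) F
        simp only [HExpr.val, HState.setR_reg, HState.setR_arr, e1, hp, e2, e4] at hv1
        norm_num at hv1
        have : h'.arr aLab (T.eid v p) F = 1 := by omega
        simp [lab, this]
      refine run_for_uniform (B := 1) (Nv := K)
        (fun j h'' => Frame 26 [aLab] h h'' ∧ LabBits h'' ∧ h''.reg rP = p ∧ h''.reg rJ = j ∧
          h''.reg rX = T.eid v p ∧ ∀ e j', lab h'' e j' = if e = T.eid v p ∧ j' < j then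
            lab h' e j' + h.arr aG 0 j' else lab h' e j') ?_ hK ?_ ?_ ?_
      · refine ⟨(hf.setR (by norm_num)).setR (by norm_num), hl', by simp [hp], by simp,
          by simp [e1, hp, e2], fun e j => by simp [lab]⟩
      · rintro j h'' - ⟨hf', -, -, hj, -⟩
        exact ⟨hj, by simp [hf'.1, hrK], by simp⟩
      · rintro j h'' hjK ⟨hf', hl'', hp', hj, hX, hlab'⟩ -
        have hg : h''.arr aG = h.arr aG := hf'.2 _ (by simp)
        refine run_store (by simp) (by simp) (by simp [hX, hj]; omega) (by simp [hX]; omega)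
          (by simp [hj]; omega) ?_ ?_
        · have := xor_lt ((HExpr.ld aLab (.r rX) (.r rJ)).val h'')
            ((HExpr.ld aG (.c 0) (.r rJ)).val h'')
          rw [HExpr.val_xor]
          omega
        · refine ⟨by simp [hj], le_rfl, (hf'.setA (by simp)).setR (by norm_num), ?_, by simp [hp'],
            by simp, by simp [hX], ?_⟩
          · intro e j'
            simp only [HState.setR_arr, HState.setA_arr]
            split
            · exact xor_lt _ _
            · exact hl'' e j'
          · intro e j'
            by_cases hc : e = T.eid v p ∧ j' = j
            · obtain ⟨rfl, rfl⟩ := hc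
              simp only [lab, HState.setR_arr, HState.setA_arr, HExpr.val_xor, HExpr.val, hX, hj]
              norm_num
              rw [cast_xor (hl'' _ _) (by rw [hg]; exact hG _ hjK), hg]
              have := hlab' (T.eid v p) j'
              simp only [lab, lt_irrefl, and_false, if_false] at this
              rw [this]
            · have h3 : lab (((h''.setA aLab ((HExpr.r rX).val h'') ((HExpr.r rJ).val h'')
                  (((HExpr.ld aLab (.r rX) (.r rJ)).xor (.ld aG (.c 0) (.r rJ))).val h'')).setR
                    rJ (j + 1))) e j' = lab h'' e j' := by
                simp [lab, hX, hj, hc]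
              rw [h3, hlab']
              by_cases he : e = T.eid v p
              · have : j' ≠ j := fun hj' => hc ⟨he, hj'⟩
                simp only [he, true_and]
                by_cases h4 : j' < j
                · rw [if_pos h4, if_pos (by omega)]
                · rw [if_neg h4, if_neg (by omega)]
              · simp [he]
      · rintro h'' t ⟨hf', hl'', hp', hj, hX, hlab'⟩ - ht
        refine ⟨by simp [hp'], by omega, hf'.setR (by norm_num), hl'', by simp, ?_⟩
        intro e j
        have h3 : lab (h''.setR rP (p + 1)) e j = lab h'' e j := rfl
        rw [h3, hlab']
        by_cases he : e = T.eid v p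
        · subst he
          rw [hold, hF1, one_mul]
          simp [T.isFirst_succ]
        · rw [if_neg (fun hc => he hc.1), hlab]
          simp [T.isFirst_succ, he]
    · intro hv0
      have hF0 : lab h (T.eid v p) F = 0 := by
        rw [← hold]
        simp only [HExpr.val, HState.setR_reg, HState.setR_arr, e1, hp, e2, e4] at hv0
        norm_num at hv0
        simp [lab, hv0]
      refine ⟨by simp [hp], by omega, (hf.setR (by norm_num)).setR (by norm_num), hl', by simp, ?_⟩
      intro e j
      have h3 : ∀ v', lab ((h'.setR rX v').setR rP (p + 1)) e j = lab h' e j := fun _ => rfl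
      rw [h3, hlab]
      by_cases he : e = T.eid v p
      · subst he
        simp [hF0]
      · simp [T.isFirst_succ, he]
  · rintro h' t ⟨hf, hl', -, hlab⟩ - ht
    exact ⟨hf, hl', by linarith, hlab⟩

/-- Compares the scratch columns of the labels of the edges in `rEd` and `rEd2`. -/
def eqScratch : Prog :=
  .seq (setP rX (.c 1)) (forP rJ (.r rD) (setP rX (.mul (.r rX)
    (.eq (.ld aLab (.r rEd) (.r rJ)) (.ld aLab (.r rEd2) (.r rJ))))))

open Classical in
theorem run_eqScratch {S e e' : ℕ} {h : HState} (hS : T.Fits S) (hs : Stat T h)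
    (he : e < S) (he' : e' < S) (hrEd : h.reg rEd = e) (hrEd2 : h.reg rEd2 = e') :
    Run S eqScratch h fun h' t => Frame 25 [] h h' ∧ t ≤ T.d * 3 + 3 ∧
      h'.reg rX = if ∀ j < T.d, h.arr aLab e j = h.arr aLab e' j then 1 else 0 := by
  have hle := hS.le
  have h2 := T.d_le_mul
  refine run_seq (run_set (by simp) (by simp; omega) ?_)
  refine run_for_uniform (B := 1) (Nv := T.d)
    (fun j h' => Frame 25 [] h h' ∧ h'.reg rJ = j ∧
      h'.reg rX = if ∀ j' < j, h.arr aLab e j' = h.arr aLab e' j' then 1 else 0)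
    ?_ (by omega) ?_ ?_ ?_
  · exact ⟨(Frame.refl.setR (by norm_num)).setR (by norm_num), by simp, by simp⟩
  · rintro j h' - ⟨hf, hj, -⟩
    exact ⟨hj, by simp [hf.1, hs.d], by simp⟩
  · rintro j h' hjd ⟨hf, hj, hX⟩ -
    have hg : h'.arr aLab = h.arr aLab := hf.2 _ (by simp)
    have e1 : h'.reg rEd = e := by rw [hf.1 _ (by norm_num), hrEd]
    have e2 : h'.reg rEd2 = e' := by rw [hf.1 _ (by norm_num), hrEd2]
    have hval : (HExpr.mul (.r rX) (.eq (.ld aLab (.r rEd) (.r rJ))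
        (.ld aLab (.r rEd2) (.r rJ)))).val h' =
        if ∀ j' < j + 1, h.arr aLab e j' = h.arr aLab e' j' then 1 else 0 := by
      simp only [HExpr.val, hX, e1, e2, hj, hg]
      have : (∀ j' < j + 1, h.arr aLab e j' = h.arr aLab e' j') ↔
          (∀ j' < j, h.arr aLab e j' = h.arr aLab e' j') ∧ h.arr aLab e j = h.arr aLab e' j := by
        constructor
        · exact fun hh => ⟨fun j' hj' => hh j' (by omega), hh j (by omega)⟩
        · rintro ⟨h3, h4⟩ j' hj'
          rcases Nat.lt_succ_iff_lt_or_eq.1 hj' with h5 | rfl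
          · exact h3 j' h5
          · exact h4
      simp only [this]
      split_ifs <;> simp_all
    refine run_set (by simp [e1, e2, hj]; omega) (by rw [hval]; split_ifs <;> omega) ?_
    refine ⟨by simp [hj], le_rfl, (hf.setR (by norm_num)).setR (by norm_num), by simp, ?_⟩
    rw [hval]
    simp
  · rintro h' t ⟨hf, -, hX⟩ - ht
    exact ⟨hf, by omega, hX⟩

end ArrayRAM

/-! ## Elimination at a vertex -/

namespace EdgeTable

open Finset

variable {T : EdgeTable} {Sol : (ℕ → ZMod 2) → Prop} {U : ℕ → Prop} {v K k : ℕ}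
  {L₀ L L' : ℕ → ℕ → ZMod 2}

theorem check_sum (s : Finset ℕ) (y : ℕ → ZMod 2) :
    T.check (fun e => ∑ j ∈ s, L e j * y j) v k = ∑ j ∈ s, T.check (fun e => L e j) v k * y j := by
  simp only [check, mul_sum, sum_mul]
  rw [sum_comm]
  simp only [mul_assoc]

variable (T Sol U v K k L₀ L) in
/-- The labels `L` during the elimination at `v`, with unknown edges `U`, after `k` parity checks,
starting from labels `L₀`. The scratch columns parametrize the local code of `v`. -/
structure Elim : Prop where
  other : ∀ e j, (¬ T.IsFirst v T.d e ∨ ¬ U e ∨ K ≤ j) → L e j = L₀ e j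
  img : ∀ y : ℕ → ZMod 2, T.Loc U v k fun i => ∑ j ∈ range T.d, L (T.eid v i) j * y j
  fix : ∀ x, T.Loc U v k x → ∀ i < T.d, x i = ∑ j ∈ range T.d, L (T.eid v i) j * x j
  sound : ∀ c, Sol c → ∃ y : ℕ → ZMod 2, y T.d = 1 ∧ ∀ e < T.n * T.d, (¬ U e ∨ T.IsFirst v T.d e) →
    c e = ∑ j ∈ range K, L e j * y j

/-- At first the scratch block at v is the identity on the unknown positions and zero on the known
ones, that is, the projection onto the words that vanish on the known edges. -/
theorem elim_init (hv : v < 2 * T.n) (hK : T.d < K)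
    (hzero : ∀ e < T.n * T.d, ∀ j, (U e ∨ j < T.d ∨ K ≤ j) → L₀ e j = 0)
    (hsound : ∀ c, Sol c → ∃ y : ℕ → ZMod 2, y T.d = 1 ∧ ∀ e < T.n * T.d, ¬ U e →
      c e = ∑ j ∈ range K, L₀ e j * y j)
    (h1 : ∀ e j, (j < T.d ∧ e = T.eid v j ∧ U e) → L e j = 1)
    (h0 : ∀ e j, ¬ (j < T.d ∧ e = T.eid v j ∧ U e) → L e j = L₀ e j) :
    T.Elim Sol U v K 0 L₀ L := by
  have hrow : ∀ i < T.d, ∀ j < T.d, U (T.eid v i) → L (T.eid v i) j = if j = i then 1 else 0 := by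
    intro i hi j hj hU
    by_cases hji : j = i
    · subst hji
      rw [if_pos rfl, h1 _ _ ⟨hi, rfl, hU⟩]
    · rw [if_neg hji, h0, hzero _ (T.eid_lt hv hi) _ (Or.inl hU)]
      rintro ⟨-, he, -⟩
      exact hji (T.eid_inj hv hi hj he).symm
  have hkn : ∀ i < T.d, ∀ j < T.d, ¬ U (T.eid v i) → L (T.eid v i) j = 0 := by
    intro i hi j hj hU
    rw [h0 _ _ (fun hc => hU hc.2.2), hzero _ (T.eid_lt hv hi) _ (Or.inr (Or.inl hj))]
  refine ⟨?_, ?_, ?_, ?_⟩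
  · intro e j h
    apply h0
    rintro ⟨hj, he, hU⟩
    rcases h with h | h | h
    · exact h ⟨j, hj, he.symm⟩
    · exact h hU
    · omega
  · intro y
    refine ⟨fun i hi hU => sum_eq_zero fun j hj => ?_, by simp⟩
    rw [hkn i hi j (mem_range.1 hj) hU, zero_mul]
  · intro x hx i hi
    by_cases hU : U (T.eid v i)
    · rw [sum_congr rfl fun j hj => by rw [hrow i hi j (mem_range.1 hj) hU]]
      simp [hi]
    · rw [hx.1 i hi hU]
      refine (sum_eq_zero fun j hj => ?_).symm
      rw [hkn i hi j (mem_range.1 hj) hU, zero_mul]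
  · intro c hc
    obtain ⟨y, hy, hsum⟩ := hsound c hc
    -- The scratch parameters of c are its own symbols at v. Known edges do not notice the change,
    -- since their scratch columns are empty.
    refine ⟨fun j => if j < T.d then c (T.eid v j) else y j, by simp [hy], fun e he hor => ?_⟩
    by_cases hU : U e
    · obtain ⟨i, hi, rfl⟩ := hor.resolve_left (fun h => h hU)
      rw [sum_eq_single i]
      · rw [hrow i hi i hi hU]; simp [hi]
      · intro j _ hj
        by_cases hjd : j < T.d
        · rw [hrow i hi j hjd hU, if_neg hj, zero_mul]
        · rw [h0 _ _ (fun hc => hjd hc.1), hzero _ he _ (Or.inl hU), zero_mul]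
      · intro h
        exact absurd (mem_range.2 (hi.trans hK)) h
    · rw [hsum e he hU]
      refine sum_congr rfl fun j hj => ?_
      rw [h0 _ _ (fun hc => hU hc.2.2)]
      by_cases hjd : j < T.d
      · rw [hzero _ he _ (Or.inr (Or.inl hjd)), zero_mul, zero_mul]
      · simp only [if_neg hjd]

theorem Loc.of_succ {x : ℕ → ZMod 2} (hx : T.Loc U v (k + 1) x) :
    T.Loc U v k x ∧ ∑ i ∈ range T.d, (T.H k i : ZMod 2) * x i = 0 :=
  ⟨⟨hx.1, fun k' hk' => hx.2 k' (by omega)⟩, hx.2 k (by omega)⟩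

theorem Loc.succ {x : ℕ → ZMod 2} (hx : T.Loc U v k x)
    (h : ∑ i ∈ range T.d, (T.H k i : ZMod 2) * x i = 0) : T.Loc U v (k + 1) x := by
  refine ⟨hx.1, fun k' hk' => ?_⟩
  rcases Nat.lt_succ_iff_lt_or_eq.1 hk' with h1 | rfl
  · exact hx.2 k' h1
  · exact h

/-- If no scratch variable occurs in the check, then every word parametrized by the scratch block
satisfies it already. The condition that the check may impose on the guessed variables is left to
the final reduction. -/
theorem Elim.skip (h : T.Elim Sol U v K k L₀ L)
    (hg : ∀ j < T.d, T.check (fun e => L e j) v k = 0) : T.Elim Sol U v K (k + 1) L₀ L := by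
  refine ⟨h.other, fun y => (h.img y).succ ?_, fun x hx => h.fix x hx.of_succ.1, h.sound⟩
  have := T.check_sum (L := L) (v := v) (k := k) (range T.d) y
  rw [check] at this
  rw [this]
  exact sum_eq_zero fun j hj => by rw [hg j (mem_range.1 hj), zero_mul]

theorem sum_add_mul_form {s : Finset ℕ} {a g y : ℕ → ZMod 2} {b : ZMod 2} :
    ∑ j ∈ s, (a j + b * g j) * y j = ∑ j ∈ s, a j * y j + b * ∑ j ∈ s, g j * y j := by
  simp only [add_mul, sum_add_distrib, mul_sum, mul_assoc]

/-- As g_F = 1 in characteristic 2, the form g vanishes after the substitution of y_F + g(y) for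
y_F, so the new check holds on the image. Parameters with g(y) = 0 are not moved, so the local words
that satisfy the check stay fixed and all solutions stay described. -/
theorem Elim.pivot (h : T.Elim Sol U v K k L₀ L) (hSol : ∀ c, Sol c → T.IsWord c)
    (hv : v < 2 * T.n) (hk : k < T.m) (hK : T.d < K)
    (hzero : ∀ e < T.n * T.d, ∀ j, (U e ∨ j < T.d ∨ K ≤ j) → L₀ e j = 0) {F : ℕ} (hF : F < T.d)
    {g : ℕ → ZMod 2} (hg : ∀ j < K, g j = T.check (fun e => L e j) v k) (hgF : g F = 1)
    (h1 : ∀ e j, T.IsFirst v T.d e → j < K → L' e j = L e j + L e F * g j)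
    (h0 : ∀ e j, ¬ (T.IsFirst v T.d e ∧ j < K) → L' e j = L e j) :
    T.Elim Sol U v K (k + 1) L₀ L' := by
  have hrow : ∀ i < T.d, ∀ y : ℕ → ZMod 2, ∑ j ∈ range T.d, L' (T.eid v i) j * y j =
      ∑ j ∈ range T.d, L (T.eid v i) j * y j +
        L (T.eid v i) F * ∑ j ∈ range T.d, g j * y j := by
    intro i hi y
    rw [← sum_add_mul_form]
    refine sum_congr rfl fun j hj => ?_
    rw [h1 _ _ ⟨i, hi, rfl⟩ ((mem_range.1 hj).trans hK)]
  have hcheck : ∀ y : ℕ → ZMod 2, ∑ i ∈ range T.d, (T.H k i : ZMod 2) *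
      ∑ j ∈ range T.d, L (T.eid v i) j * y j = ∑ j ∈ range T.d, g j * y j := by
    intro y
    have := T.check_sum (L := L) (v := v) (k := k) (range T.d) y
    rw [check] at this
    rw [this]
    exact sum_congr rfl fun j hj => by rw [hg j ((mem_range.1 hj).trans hK)]
  refine ⟨?_, ?_, ?_, ?_⟩
  · intro e j hor
    by_cases hc : T.IsFirst v T.d e ∧ j < K
    · rw [h1 e j hc.1 hc.2]
      have hU : ¬ U e := by
        rcases hor with h | h | h
        · exact absurd hc.1 h
        · exact h
        · omega
      obtain ⟨i, hi, rfl⟩ := hc.1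
      -- A known edge at v has empty scratch columns, so F does not occur in its label and the label
      -- does not change.
      rw [h.other _ F (Or.inr (Or.inl hU)), hzero _ (T.eid_lt hv hi) _ (Or.inr (Or.inl hF)),
        zero_mul, add_zero, h.other _ _ hor]
    · rw [h0 e j hc, h.other e j hor]
  · intro y
    set a := ∑ j ∈ range T.d, g j * y j with ha
    set y' : ℕ → ZMod 2 := fun j => y j + if j = F then a else 0 with hy'
    have hsplit : ∀ b : ℕ → ZMod 2, ∑ j ∈ range T.d, b j * y' j =
        ∑ j ∈ range T.d, b j * y j + b F * a := by
      intro b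
      simp only [hy', mul_add, sum_add_distrib, mul_ite, mul_zero, sum_ite_eq', mem_range, hF,
        if_true]
    have heq : ∀ i < T.d, ∑ j ∈ range T.d, L' (T.eid v i) j * y j =
        ∑ j ∈ range T.d, L (T.eid v i) j * y' j := by
      intro i hi
      rw [hrow i hi, hsplit]
    have himg := h.img y'
    refine Loc.succ ⟨fun i hi hU => ?_, fun k' hk' => ?_⟩ ?_
    · exact (heq i hi).trans (himg.1 i hi hU)
    · rw [← himg.2 k' hk']
      exact sum_congr rfl fun i hi => congrArg _ (heq i (mem_range.1 hi))
    · have h2 : ∑ i ∈ range T.d, (T.H k i : ZMod 2) * ∑ j ∈ range T.d, L' (T.eid v i) j * y j =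
          ∑ i ∈ range T.d, (T.H k i : ZMod 2) * ∑ j ∈ range T.d, L (T.eid v i) j * y' j :=
        sum_congr rfl fun i hi => by rw [heq i (mem_range.1 hi)]
      rw [h2, hcheck, hsplit, hgF, one_mul, ← ha, CharTwo.add_self_eq_zero]
  · intro x hx i hi
    obtain ⟨hx1, hx2⟩ := hx.of_succ
    have hfix := h.fix x hx1
    have h3 : ∑ j ∈ range T.d, g j * x j = 0 := by
      rw [← hcheck, ← hx2]
      exact sum_congr rfl fun i hi => by rw [← hfix i (mem_range.1 hi)]
    rw [hrow i hi, h3, mul_zero, add_zero]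
    exact hfix i hi
  · intro c hc
    obtain ⟨y, hy, hsum⟩ := h.sound c hc
    refine ⟨y, hy, fun e he hor => ?_⟩
    -- Here all columns enter: evaluated at the parameters of c, the full form is the value of the
    -- check on the word c, which is zero.
    have h3 : ∑ j ∈ range K, g j * y j = 0 := by
      have h4 := T.check_sum (L := L) (v := v) (k := k) (range K) y
      rw [sum_congr rfl fun j hj => by rw [hg j (mem_range.1 hj)], ← h4, ← hSol c hc v hv k hk]
      refine sum_congr rfl fun i hi => ?_
      rw [hsum _ (T.eid_lt hv (mem_range.1 hi)) (Or.inr ⟨i, mem_range.1 hi, rfl⟩)]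
    rw [hsum e he hor]
    by_cases hfirst : T.IsFirst v T.d e
    · have h4 : ∑ j ∈ range K, L' e j * y j = ∑ j ∈ range K, (L e j + L e F * g j) * y j :=
        sum_congr rfl fun j hj => by rw [h1 e j hfirst (mem_range.1 hj)]
      rw [h4, sum_add_mul_form, h3, mul_zero, add_zero]
    · exact sum_congr rfl fun j _ => by rw [h0 e j (fun hc => hfirst hc.1)]

/-- After all parity checks, equality of scratch rows is equality on the local code. -/
theorem Elim.rows_eq_iff (h : T.Elim Sol U v K k L₀ L) {i i' : ℕ} (hi : i < T.d) (hi' : i' < T.d) :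
    (∀ j < T.d, L (T.eid v i) j = L (T.eid v i') j) ↔ ∀ x, T.Loc U v k x → x i = x i' := by
  constructor
  · intro heq x hx
    rw [h.fix x hx i hi, h.fix x hx i' hi']
    exact sum_congr rfl fun j hj => by rw [heq j (mem_range.1 hj)]
  · intro hall j hj
    have := hall _ (h.img fun j' => if j' = j then 1 else 0)
    simpa [hj] using this

/-- The scratch block reproduces local words from themselves, and unit vectors as parameters yield
local words whose symbols are the single entries. -/
theorem Elim.row_eq_zero_iff (h : T.Elim Sol U v K k L₀ L) {i : ℕ} (hi : i < T.d) :
    (∀ j < T.d, L (T.eid v i) j = 0) ↔ ∀ x, T.Loc U v k x → x i = 0 := by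
  constructor
  · intro heq x hx
    rw [h.fix x hx i hi]
    exact sum_eq_zero fun j hj => by rw [heq j (mem_range.1 hj), zero_mul]
  · intro hall j hj
    have := hall _ (h.img fun j' => if j' = j then 1 else 0)
    simpa [hj] using this

end EdgeTable

/-! ### Programs for the elimination of scratch variables -/

namespace ArrayRAM

open RAM Finset

variable {T : EdgeTable}

/-- The edge `e` has no label yet. -/
def Unk (h : HState) (e : ℕ) : Prop := h.arr aKn e 0 = 0

theorem Unk.frame {h h' : HState} {k : ℕ} {A : List ℕ} (hf : Frame k A h h')
    (hA : aKn ∉ A := by decide) : Unk h' = Unk h := by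
  funext e
  rw [Unk, Unk, hf.2 _ hA]

theorem lab_eq_zero_iff {h : HState} (hl : LabBits h) {e j : ℕ} :
    lab h e j = 0 ↔ h.arr aLab e j = 0 := by
  have := hl e j
  unfold lab
  interval_cases h.arr aLab e j <;> simp

theorem lab_eq_iff {h : HState} (hl : LabBits h) {e e' j : ℕ} :
    lab h e j = lab h e' j ↔ h.arr aLab e j = h.arr aLab e' j := by
  have h1 := hl e j
  have h2 := hl e' j
  unfold lab
  interval_cases h.arr aLab e j <;> interval_cases h.arr aLab e' j <;> simp

variable (T) in
/-- The invariant of the labels: `K` columns are in use, the labels of the unknown edges are zero,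
the scratch columns are empty, and every word `c` with `Sol c` is described by the labels. -/
structure LabelInv (Sol : (ℕ → ZMod 2) → Prop) (K : ℕ) (h : HState) : Prop where
  bits : LabBits h
  kn_lt : ∀ e, h.arr aKn e 0 < 2
  d_lt : T.d < K
  zeroRow : ∀ j, h.arr aLab (T.n * T.d) j = 0
  zero : ∀ e < T.n * T.d, ∀ j, (Unk h e ∨ j < T.d ∨ K ≤ j) → h.arr aLab e j = 0
  sound : ∀ c, Sol c → ∃ y : ℕ → ZMod 2, y T.d = 1 ∧ ∀ e < T.n * T.d, ¬ Unk h e →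
    c e = ∑ j ∈ range K, lab h e j * y j

/-- Gives a scratch variable to every unknown edge at `rV`. -/
def scratchInit : Prog :=
  forP rI (.r rD) (.seq (setP rEd (.ld aEid (.r rV) (.r rI)))
    (whenP (.eq (.ld aKn (.r rEd) (.c 0)) (.c 0)) (storeP aLab (.r rEd) (.r rI) (.c 1))))

open Classical in
theorem run_scratchInit {S v : ℕ} {h : HState} (hS : T.Fits S) (hs : Stat T h) (hl : LabBits h)
    (hv : v < 2 * T.n) (hrV : h.reg rV = v) :
    Run S scratchInit h fun h' t => Frame 17 [aLab] h h' ∧ LabBits h' ∧ t ≤ T.d * 5 + 2 ∧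
      ∀ e j, h'.arr aLab e j =
        if j < T.d ∧ e = T.eid v j ∧ Unk h e then 1 else h.arr aLab e j := by
  have hle := hS.le
  have h1 := T.n_le_mul
  have h2 := T.d_le_mul
  refine run_for_uniform (B := 3) (Nv := T.d)
    (fun i h' => Frame 17 [aLab] h h' ∧ LabBits h' ∧ h'.reg rI = i ∧ ∀ e j, h'.arr aLab e j =
        if j < i ∧ e = T.eid v j ∧ Unk h e then 1 else h.arr aLab e j) ?_ (by omega) ?_ ?_ ?_
  · exact ⟨Frame.refl.setR (by norm_num), hl, by simp, by simp⟩
  · rintro i h' - ⟨hf, -, hi, -⟩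
    exact ⟨hi, by simp [hf.1, hs.d], by simp⟩
  · rintro i h' hid ⟨hf, hl', hi, hlab⟩ -
    have hs' := hs.frame hf
    have e1 : h'.reg rV = v := by rw [hf.1 _ (by norm_num), hrV]
    have e2 := hs'.eid v hv i hid
    have e3 := T.eid_lt hv hid
    have hkn : h'.arr aKn = h.arr aKn := hf.2 _ (by simp)
    refine run_seq (run_set (by simp [e1, hi]; omega) (by simp [e1, hi, e2]; omega) ?_)
    have hU : (HExpr.eq (.ld aKn (.r rEd) (.c 0)) (.c 0)).val (h'.setR rEd
        ((HExpr.ld aEid (.r rV) (.r rI)).val h')) = if h.arr aKn (T.eid v i) 0 = 0 then 1 else 0 := by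
      simp [e1, hi, e2, hkn]
    refine run_when (by simp [e1, hi, e2]; omega) ?_ ?_
    · rw [hU]
      intro hv1
      have hu : Unk h (T.eid v i) := by
        by_contra hcon
        rw [Unk] at hcon
        simp [hcon] at hv1
      refine run_store (by simp) (by simp) (by simp) (by simp [e1, hi, e2]; omega)
        (by simp [hi]; omega) (by simp; omega) ?_
      refine ⟨by simp [hi], by norm_num,
        ((hf.setR (by norm_num)).setA (by simp)).setR (by norm_num), ?_, by simp, ?_⟩
      · intro e j
        simp only [HState.setR_arr, HState.setA_arr]
        split
        · simp
        · exact hl' e j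
      · intro e j
        simp only [HState.setR_arr, HState.setA_arr, HExpr.val, HState.setR_reg, e1, hi, e2, hlab]
        norm_num
        by_cases hj : j = i
        · subst hj
          by_cases he : e = T.eid v j
          · subst he; simp [hu]
          · simp [he]
        · have : j ≤ i ↔ j < i := by omega
          simp [hj, this]
    · rw [hU]
      intro hv0
      have hu : ¬ Unk h (T.eid v i) := by
        intro hcon
        rw [Unk] at hcon
        simp [hcon] at hv0
      refine ⟨by simp [hi], by norm_num, (hf.setR (by norm_num)).setR (by norm_num), hl', by simp,
        ?_⟩
      intro e j
      simp only [HState.setR_arr, hlab]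
      by_cases hj : j = i
      · subst hj
        by_cases he : e = T.eid v j
        · subst he; simp [hu]
        · simp [he]
      · have : (j < i + 1) ↔ j < i := by omega
        simp [this]
  · rintro h' t ⟨hf, hl', -, hlab⟩ - ht
    exact ⟨hf, hl', by omega, hlab⟩

/-- Eliminates scratch variables with all parity checks at `rV`. -/
def eliminate : Prog :=
  forP rRow (.r rM) (.seq checkForm (.seq (findPivot (.lt (.r rJ) (.r rD)))
    (whenP (.lt (.r rF) (.r rD)) addForm)))

theorem run_eliminate {S v K : ℕ} {Sol : (ℕ → ZMod 2) → Prop} {U : ℕ → Prop}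
    {L₀ : ℕ → ℕ → ZMod 2} {h : HState} (hS : T.Fits S) (hs : Stat T h) (hl : LabBits h)
    (hv : v < 2 * T.n) (hdK : T.d < K) (hK : K < S) (hrV : h.reg rV = v) (hrK : h.reg rK = K)
    (hSol : ∀ c, Sol c → T.IsWord c)
    (hzero : ∀ e < T.n * T.d, ∀ j, (U e ∨ j < T.d ∨ K ≤ j) → L₀ e j = 0)
    (hE : T.Elim Sol U v K 0 L₀ (lab h)) :
    Run S eliminate h fun h' t => Frame 17 [aLab, aG] h h' ∧ LabBits h' ∧
      t ≤ T.m * (K * (3 * T.d + 6) + K * 4 + T.d * (3 * K + 6) + 12) + 2 ∧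
      T.Elim Sol U v K T.m L₀ (lab h') := by
  classical
  have hle := hS.le
  have h1 := T.n_le_mul
  have h2 := T.d_le_mul
  have h3 := T.m_le
  refine run_for_uniform (B := K * (3 * T.d + 6) + K * 4 + T.d * (3 * K + 6) + 10) (Nv := T.m)
    (fun k h' => Frame 17 [aLab, aG] h h' ∧ LabBits h' ∧ h'.reg rRow = k ∧
      T.Elim Sol U v K k L₀ (lab h')) ?_ (by omega) ?_ ?_ ?_
  · exact ⟨Frame.refl.setR (by norm_num), hl, by simp, hE⟩
  · rintro i h' - ⟨hf, -, hi, -⟩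
    exact ⟨hi, by simp [hf.1, hs.m], by simp⟩
  · rintro k h₁ hk ⟨hf, hl₁, hrow, hE₁⟩ -
    have hs₁ := hs.frame hf
    have e1 : h₁.reg rV = v := by rw [hf.1 _ (by norm_num), hrV]
    have e2 : h₁.reg rK = K := by rw [hf.1 _ (by norm_num), hrK]
    refine run_seq ((run_checkForm hS hs₁ hl₁ hv hk hK e1 hrow e2).mono ?_)
    rintro h₂ t₂ ⟨hf₂, ht₂, hG⟩
    have hs₂ := hs₁.frame hf₂
    have e3 : h₂.reg rK = K := by rw [hf₂.1 _ (by norm_num), e2]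
    refine run_seq ((run_findPivot (p := fun j => j < T.d) hS hs₂ hK e3 ?_).mono ?_)
    · intro h' hd
      simp [hd]
    rintro h₃ t₃ ⟨hf₃, ht₃, hF⟩
    have hs₃ := hs₂.frame hf₃
    have hl₃ := (hl₁.frame hf₂).frame hf₃
    have hlab : lab h₃ = lab h₁ := by rw [lab_frame hf₃, lab_frame hf₂]
    have hf₃' : Frame 17 [aLab, aG] h h₃ :=
      hf.trans ((hf₂.trans (hf₃.mono le_rfl (by simp))).mono (by norm_num) (by simp))
    have hrow₃ : h₃.reg rRow = k := by
      rw [hf₃.1 _ (by norm_num), hf₂.1 _ (by norm_num), hrow]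
    have e4 : h₃.reg rV = v := by rw [hf₃.1 _ (by norm_num), hf₂.1 _ (by norm_num), e1]
    have e5 : h₃.reg rK = K := by rw [hf₃.1 _ (by norm_num), e3]
    have hg₃ : h₃.arr aG = h₂.arr aG := hf₃.2 _ (by simp)
    refine run_when (by simp) ?_ ?_
    · intro hv1
      have hFd : h₃.reg rF < T.d := by
        by_contra hcon
        simp [hs₃.d, hcon] at hv1
      rcases hF with ⟨hF1, -⟩ | ⟨hF1, -, hF2⟩
      · omega
      refine (run_addForm hS hs₃ hl₃ hv hK e4 e5 rfl hF1
        (fun j hj => by rw [hg₃]; exact (hG j hj).1)).mono ?_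
      rintro h₄ t₄ ⟨hf₄, hl₄, ht₄, hlab₄⟩
      refine ⟨by rw [hf₄.1 _ (by norm_num), hrow₃], by omega, ?_, hl₄, by simp, ?_⟩
      · exact (hf₃'.trans (hf₄.mono (by norm_num) (by simp))).setR (by norm_num)
      · have hlab₅ : lab (h₄.setR rRow (k + 1)) = lab h₄ := rfl
        rw [hlab₅]
        refine hE₁.pivot hSol hv hk hdK hzero hFd (g := fun j => h₂.arr aG 0 j)
          (fun j hj => (hG j hj).2) ?_ ?_ ?_
        · have := (hG _ hF1).1
          have h6 : h₂.arr aG 0 (h₃.reg rF) = 1 := by omega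
          simp [h6]
        · intro e j he hj
          rw [hlab₄, if_pos ⟨he, hj⟩, hlab, hg₃]
        · intro e j hc
          rw [hlab₄, if_neg hc, hlab]
    · intro hv0
      have hFd : ¬ h₃.reg rF < T.d := by
        intro hcon
        simp [hs₃.d, hcon] at hv0
      refine ⟨hrow₃, by omega, hf₃'.setR (by norm_num), hl₃, by simp, ?_⟩
      have hlab₅ : lab (h₃.setR rRow (k + 1)) = lab h₁ := hlab
      rw [hlab₅]
      refine hE₁.skip fun j hj => ?_
      rcases hF with ⟨-, hF1⟩ | ⟨-, hF1, -⟩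
      · rw [← (hG j (by omega)).2, hF1 j (by omega) hj, Nat.cast_zero]
      · exact absurd hF1 hFd
  · rintro h' t ⟨hf, hl', -, hE'⟩ - ht
    exact ⟨hf, hl', by linarith, hE'⟩

/-- Clears the labels of the unknown edges at `rV`. -/
def clearRows : Prog :=
  forP rI (.r rD) (.seq (setP rEd (.ld aEid (.r rV) (.r rI)))
    (whenP (.eq (.ld aKn (.r rEd) (.c 0)) (.c 0))
      (forP rJ (.r rK) (storeP aLab (.r rEd) (.r rJ) (.c 0)))))

open Classical in
-- Only rows of still unknown edges are cleared. The rows of newly learned edges have an empty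
-- scratch part and keep the rest, so the scratch columns are free for the next vertex.
theorem run_clearRows {S v K : ℕ} {h : HState} (hS : T.Fits S) (hs : Stat T h)
    (hv : v < 2 * T.n) (hK : K < S) (hrV : h.reg rV = v) (hrK : h.reg rK = K) :
    Run S clearRows h fun h' t => Frame 17 [aLab] h h' ∧ t ≤ T.d * (3 * K + 7) + 2 ∧
      ∀ e j, h'.arr aLab e j =
        if T.IsFirst v T.d e ∧ Unk h e ∧ j < K then 0 else h.arr aLab e j := by
  have hle := hS.le
  have h1 := T.n_le_mul
  have h2 := T.d_le_mul
  refine run_for_uniform (B := 3 * K + 5) (Nv := T.d)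
    (fun i h' => Frame 17 [aLab] h h' ∧ h'.reg rI = i ∧ ∀ e j, h'.arr aLab e j =
        if T.IsFirst v i e ∧ Unk h e ∧ j < K then 0 else h.arr aLab e j) ?_ (by omega) ?_ ?_ ?_
  · exact ⟨Frame.refl.setR (by norm_num), by simp, by simp [T.isFirst_zero]⟩
  · rintro i h' - ⟨hf, hi, -⟩
    exact ⟨hi, by simp [hf.1, hs.d], by simp⟩
  · rintro i h' hid ⟨hf, hi, hlab⟩ -
    have hs' := hs.frame hf
    have e1 : h'.reg rV = v := by rw [hf.1 _ (by norm_num), hrV]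
    have e2 := hs'.eid v hv i hid
    have e3 := T.eid_lt hv hid
    have hkn : h'.arr aKn = h.arr aKn := hf.2 _ (by simp)
    refine run_seq (run_set (by simp [e1, hi]; omega) (by simp [e1, hi, e2]; omega) ?_)
    have hU : (HExpr.eq (.ld aKn (.r rEd) (.c 0)) (.c 0)).val (h'.setR rEd
        ((HExpr.ld aEid (.r rV) (.r rI)).val h')) = if h.arr aKn (T.eid v i) 0 = 0 then 1 else 0 := by
      simp [e1, hi, e2, hkn]
    refine run_when (by simp [e1, hi, e2]; omega) ?_ ?_
    · rw [hU]
      intro hv1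
      have hu : Unk h (T.eid v i) := by
        by_contra hcon
        rw [Unk] at hcon
        simp [hcon] at hv1
      refine run_for_uniform (B := 1) (Nv := K)
        (fun j h'' => Frame 17 [aLab] h h'' ∧ h''.reg rI = i ∧ h''.reg rEd = T.eid v i ∧
          h''.reg rJ = j ∧ ∀ e j', h''.arr aLab e j' =
            if e = T.eid v i ∧ j' < j then 0 else h'.arr aLab e j') ?_ hK ?_ ?_ ?_
      · exact ⟨(hf.setR (by norm_num)).setR (by norm_num), by simp [hi], by simp [e1, hi, e2],
          by simp, by simp⟩
      · rintro j h'' - ⟨hf', -, -, hj, -⟩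
        exact ⟨hj, by simp [hf'.1, hrK], by simp⟩
      · rintro j h'' hjK ⟨hf', hi', hed, hj, hlab'⟩ -
        refine run_store (by simp) (by simp) (by simp) (by simp [hed]; omega)
          (by simp [hj]; omega) (by simp; omega) ?_
        refine ⟨by simp [hj], le_rfl, (hf'.setA (by simp)).setR (by norm_num), by simp [hi'],
          by simp [hed], by simp, ?_⟩
        intro e j'
        simp only [HState.setR_arr, HState.setA_arr, HExpr.val, hed, hj, hlab']
        norm_num
        by_cases he : e = T.eid v i
        · by_cases hjj : j' = j
          · simp [he, hjj]
          · have : j' ≤ j ↔ j' < j := by omega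
            simp [he, hjj, this]
        · simp [he]
      · rintro h'' t ⟨hf', hi', hed, hj, hlab'⟩ - ht
        refine ⟨by simp [hi'], by omega, hf'.setR (by norm_num), by simp, ?_⟩
        intro e j
        simp only [HState.setR_arr, hlab', hlab, T.isFirst_succ]
        by_cases he : e = T.eid v i
        · subst he
          simp only [true_and, or_true, hu]
          split_ifs <;> simp_all
        · simp [he]
    · rw [hU]
      intro hv0
      have hu : ¬ Unk h (T.eid v i) := by
        intro hcon
        rw [Unk] at hcon
        simp [hcon] at hv0
      refine ⟨by simp [hi], by omega, (hf.setR (by norm_num)).setR (by norm_num), by simp, ?_⟩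
      intro e j
      simp only [HState.setR_arr, hlab, T.isFirst_succ]
      by_cases he : e = T.eid v i
      · subst he
        simp [hu]
      · simp [he]
  · rintro h' t ⟨hf, -, hlab⟩ - ht
    exact ⟨hf, by linarith, hlab⟩

end ArrayRAM

/-! ### Newly determined edges and representatives of local classes -/

namespace ArrayRAM

open RAM Finset

variable {T : EdgeTable}

variable (T) in
/-- The unknown edges. -/
def unkSet (h : HState) : Finset ℕ := (range (T.n * T.d)).filter fun e => h.arr aKn e 0 = 0

theorem mem_unkSet {h : HState} {e : ℕ} : e ∈ unkSet T h ↔ e < T.n * T.d ∧ Unk h e := by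
  simp [unkSet, Unk]

theorem unkSet_congr {h h' : HState} (hk : ∀ e, h'.arr aKn e 0 = h.arr aKn e 0) :
    unkSet T h' = unkSet T h := by
  ext e
  simp only [mem_unkSet, Unk, hk]

theorem unkSet_frame {h h' : HState} {k : ℕ} {A : List ℕ} (hf : Frame k A h h')
    (hA : aKn ∉ A := by decide) : unkSet T h' = unkSet T h :=
  unkSet_congr fun e => by rw [hf.2 _ hA]

/-- Marks the edge `rEd` as known and puts its end points on the stack. -/
def learn : Prog :=
  .seq (storeP aKn (.r rEd) (.c 0) (.c 1))
  (.seq (storeP aStk (.r rSP) (.c 0) (.ld aEv (.r rEd) (.c 0)))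
  (.seq (setP rSP (.add (.r rSP) (.c 1)))
  (.seq (storeP aStk (.r rSP) (.c 0) (.ld aEv (.r rEd) (.c 1)))
    (setP rSP (.add (.r rSP) (.c 1))))))

/-- Two stack entries are exchanged for one unknown edge, so the stack height plus twice the number
of unknown edges does not change. This quantity is the potential of the propagation. -/
theorem run_learn {S e : ℕ} {h : HState} (hS : T.Fits S) (hs : Stat T h) (he : e < T.n * T.d)
    (hed : h.reg rEd = e) (hsp : h.reg rSP + 2 < S) (hu : Unk h e) :
    Run S learn h fun h' t => t ≤ 5 ∧ (∀ x, x ≠ rSP → h'.reg x = h.reg x) ∧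
      (∀ a, a ∉ [aKn, aStk] → h'.arr a = h.arr a) ∧ h'.reg rSP = h.reg rSP + 2 ∧
      (∀ e' j, h'.arr aKn e' j = if e' = e ∧ j = 0 then 1 else h.arr aKn e' j) ∧
      (∀ p < h.reg rSP, h'.arr aStk p 0 = h.arr aStk p 0) ∧
      h'.arr aStk (h.reg rSP) 0 = T.ev e 0 ∧ h'.arr aStk (h.reg rSP + 1) 0 = T.ev e 1 ∧
      #(unkSet T h') + 1 = #(unkSet T h) := by
  have hle := hS.le
  have h1 := T.n_le_mul
  have v0 := hs.ev e he 0 (by norm_num)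
  have v1 := hs.ev e he 1 (by norm_num)
  have l0 := T.ev_lt he (s := 0) (by norm_num)
  have l1 := T.ev_lt he (s := 1) (by norm_num)
  refine run_seq (run_store (by simp) (by simp) (by simp) (by simp [hed]; omega)
    (by simp; omega) (by simp; omega) ?_)
  refine run_seq (run_store (by simp) (by simp) (by simp [hed]; omega) (by simp; omega)
    (by simp; omega) (by simp [hed, v0]; omega) ?_)
  refine run_seq (run_set (by simp) (by simp; omega) ?_)
  refine run_seq (run_store (by simp) (by simp) (by simp [hed]; omega) (by simp; omega)
    (by simp; omega) (by simp [hed, v1]; omega) ?_)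
  refine run_set (by simp) (by simp; omega) ?_
  refine ⟨by norm_num, ?_, ?_, by simp, ?_, ?_, by simp [hed, v0], by simp [hed, v1], ?_⟩
  · intro x hx
    simp [hx]
  · intro a ha
    simp only [List.mem_cons, List.not_mem_nil, or_false, not_or] at ha
    funext i j
    simp [ha.1, ha.2]
  · intro e' j
    simp [hed]
  · intro p hp
    have h2 : p ≠ h.reg rSP := by omega
    have h3 : p ≠ h.reg rSP + 1 := by omega
    simp [h2, h3]
  · rw [← card_erase_add_one (mem_unkSet.2 ⟨he, hu⟩)]
    congr 2
    ext e'
    simp only [mem_erase, mem_unkSet, Unk]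
    by_cases hee : e' = e
    · simp [hed, hee]
    · simp [hed, hee]

/-- Stores a representative of the local class of the edge `rEd`. -/
def pickClass : Prog :=
  forP rI2 (.r rD) (.seq (setP rEd2 (.ld aEid (.r rV) (.r rI2)))
    (.seq eqScratch (whenP (.r rX) (storeP aCl (.r rEd) (.r rSide) (.r rEd2)))))

variable (T) in
/-- The edges at the positions `i` and `i'` of `v` have the same scratch rows. -/
def SameRow (h : HState) (v i i' : ℕ) : Prop :=
  ∀ j < T.d, h.arr aLab (T.eid v i) j = h.arr aLab (T.eid v i') j

/-- Later matches overwrite earlier ones, so the representative is the last edge with the same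
scratch row. It depends on the row only, and comparing representatives amounts to comparing rows. -/
theorem run_pickClass {S v i s : ℕ} {h : HState} (hS : T.Fits S) (hs : Stat T h)
    (hv : v < 2 * T.n) (hi : i < T.d) (hrV : h.reg rV = v) (hed : h.reg rEd = T.eid v i)
    (hside : h.reg rSide = s) (hs2 : s < 2) :
    Run S pickClass h fun h' t => Frame 21 [aCl] h h' ∧ t ≤ T.d * (3 * T.d + 8) + 2 ∧
      (∀ e s', ¬ (e = T.eid v i ∧ s' = s) → h'.arr aCl e s' = h.arr aCl e s') ∧
      ∃ k < T.d, h'.arr aCl (T.eid v i) s = T.eid v k ∧ SameRow T h v i k ∧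
        ∀ k', k < k' → k' < T.d → ¬ SameRow T h v i k' := by
  classical
  have hle := hS.le
  have h1 := T.n_le_mul
  have h2 := T.d_le_mul
  have e3 := T.eid_lt hv hi
  refine run_for_uniform (B := 3 * T.d + 6) (Nv := T.d)
    (fun p h' => Frame 21 [aCl] h h' ∧ h'.reg rI2 = p ∧
      (∀ e s', ¬ (e = T.eid v i ∧ s' = s) → h'.arr aCl e s' = h.arr aCl e s') ∧
      ((∀ k < p, ¬ SameRow T h v i k) ∨
      ∃ k < p, h'.arr aCl (T.eid v i) s = T.eid v k ∧ SameRow T h v i k ∧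
        ∀ k', k < k' → k' < p → ¬ SameRow T h v i k')) ?_ (by omega) ?_ ?_ ?_
  · exact ⟨Frame.refl.setR (by norm_num), by simp, by simp, by simp⟩
  · rintro p h' - ⟨hf, hp, -⟩
    exact ⟨hp, by simp [hf.1, hs.d], by simp⟩
  · rintro p h' hpd ⟨hf, hp, hoth, hcl⟩ -
    have hs' := hs.frame hf
    have e1 : h'.reg rV = v := by rw [hf.1 _ (by norm_num), hrV]
    have e2 := hs'.eid v hv p hpd
    have e4 := T.eid_lt hv hpd
    have e5 : h'.reg rEd = T.eid v i := by rw [hf.1 _ (by norm_num), hed]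
    have e6 : h'.reg rSide = s := by rw [hf.1 _ (by norm_num), hside]
    have hl : h'.arr aLab = h.arr aLab := hf.2 _ (by simp)
    refine run_seq (run_set (by simp [e1, hp]; omega) (by simp [e1, hp, e2]; omega) ?_)
    set h₁ := h'.setR rEd2 ((HExpr.ld aEid (.r rV) (.r rI2)).val h') with hh₁
    have hf₁ : Frame 21 [] h' h₁ := Frame.refl.setR (by norm_num)
    refine run_seq ((run_eqScratch (e := T.eid v i) (e' := T.eid v p) hS (hs'.frame hf₁)
      (by omega) (by omega) (by simp [hh₁, e5]) (by simp [hh₁, e1, hp, e2])).mono ?_)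
    rintro h₂ t₂ ⟨hf₂, ht₂, hX⟩
    have hf₃ : Frame 21 [] h' h₂ := hf₁.trans (hf₂.mono (by norm_num) (by simp))
    have hX' : h₂.reg rX = if SameRow T h v i p then 1 else 0 := by
      rw [hX]
      refine if_congr ?_ rfl rfl
      simp only [SameRow, hh₁, HState.setR_arr, hl]
    have e7 : h₂.reg rEd = T.eid v i := by rw [hf₃.1 _ (by norm_num), e5]
    have e8 : h₂.reg rSide = s := by rw [hf₃.1 _ (by norm_num), e6]
    have e9 : h₂.reg rEd2 = T.eid v p := by
      rw [hf₂.1 _ (by norm_num)]; simp [hh₁, e1, hp, e2]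
    have e10 : h₂.reg rI2 = p := by rw [hf₂.1 _ (by norm_num)]; simp [hh₁, hp]
    have hc₂ : h₂.arr aCl = h'.arr aCl := hf₃.2 _ (by simp)
    have hf₄ : Frame 21 [aCl] h h₂ := hf.trans (hf₃.mono le_rfl (by simp))
    refine run_when (by simp) ?_ ?_
    · intro hv1
      have hsame : SameRow T h v i p := by
        by_contra hcon
        simp [hX', hcon] at hv1
      refine run_store (by simp) (by simp) (by simp) (by simp [e7]; omega) (by simp [e8]; omega)
        (by simp [e9]; omega) ?_
      refine ⟨by simpa using e10, by omega, (hf₄.setA (by simp)).setR (by norm_num), by simp, ?_,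
        Or.inr ⟨p, by omega, by simp [e7, e8, e9], hsame, fun k' hk' hk'' => by omega⟩⟩
      intro e s' hne
      have := hoth e s' hne
      simp only [HState.setR_arr, HState.setA_arr, HExpr.val, e7, e8, hc₂]
      norm_num
      rw [if_neg hne, this]
    · intro hv0
      have hsame : ¬ SameRow T h v i p := by
        intro hcon
        simp [hX', hcon] at hv0
      refine ⟨e10, by omega, hf₄.setR (by norm_num), by simp, ?_, ?_⟩
      · intro e s' hne
        rw [HState.setR_arr, hc₂, hoth e s' hne]
      · rcases hcl with h3 | ⟨k, hk, h4, h5, h6⟩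
        · left
          intro k hk
          rcases Nat.lt_succ_iff_lt_or_eq.1 hk with h7 | rfl
          · exact h3 k h7
          · exact hsame
        · refine Or.inr ⟨k, by omega, by rw [HState.setR_arr, hc₂, h4], h5, fun k' hk' hk'' => ?_⟩
          rcases Nat.lt_succ_iff_lt_or_eq.1 hk'' with h7 | rfl
          · exact h6 k' hk' h7
          · exact hsame
  · rintro h' t ⟨hf, -, hoth, hcl⟩ - ht
    refine ⟨hf, by linarith, hoth, ?_⟩
    rcases hcl with h3 | h3
    · exact absurd (fun j _ => rfl) (h3 i hi)
    · exact h3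

/-- Learns the edges at `rV` with empty scratch rows and stores the local classes of the others. -/
def classify : Prog :=
  .seq (setP rSide (.sub (.c 1) (.lt (.r rV) (.r rN))))
  (forP rI (.r rD) (.seq (setP rEd (.ld aEid (.r rV) (.r rI)))
    (whenP (.eq (.ld aKn (.r rEd) (.c 0)) (.c 0))
      (.seq (setP rEd2 (.r rE)) (.seq eqScratch (iteP (.r rX) learn pickClass))))))

variable (T) in
/-- The effect of classifying the first `i` edges at `v`. -/
structure Classified (v i : ℕ) (h h' : HState) : Prop where
  frame : Frame 16 [aKn, aCl, aStk] h h'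
  kn_lt : ∀ e, h'.arr aKn e 0 < 2
  kn_eq : ∀ e, (¬ T.IsFirst v i e ∨ ¬ Unk h e) → h'.arr aKn e 0 = h.arr aKn e 0
  kn_new : ∀ k < i, Unk h (T.eid v k) →
    (Unk h' (T.eid v k) ↔ ¬ ∀ j < T.d, h.arr aLab (T.eid v k) j = 0)
  cl : ∀ i' < i, Unk h' (T.eid v i') → ∃ k < T.d,
    h'.arr aCl (T.eid v i') (T.side v) = T.eid v k ∧ SameRow T h v i' k ∧
      ∀ k', k < k' → k' < T.d → ¬ SameRow T h v i' k'
  cl_other : ∀ e s, ¬ (T.IsFirst v i e ∧ s = T.side v) → h'.arr aCl e s = h.arr aCl e s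
  sp : h'.reg rSP + 2 * #(unkSet T h') = h.reg rSP + 2 * #(unkSet T h)
  sp_le : h.reg rSP ≤ h'.reg rSP
  stk_old : ∀ p < h.reg rSP, h'.arr aStk p 0 = h.arr aStk p 0
  stk_new : ∀ e < T.n * T.d, Unk h e → ¬ Unk h' e → ∀ s < 2, ∃ p < h'.reg rSP,
    h.reg rSP ≤ p ∧ h'.arr aStk p 0 = T.ev e s
  stk_lt : ∀ p < h'.reg rSP, h.reg rSP ≤ p → h'.arr aStk p 0 < 2 * T.n

theorem run_classify {S v : ℕ} {h : HState} (hS : T.Fits S) (hs : Stat T h)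
    (hv : v < 2 * T.n) (hrV : h.reg rV = v) (hkn : ∀ e, h.arr aKn e 0 < 2)
    (hzero : ∀ j, h.arr aLab (T.n * T.d) j = 0) (hsp : h.reg rSP + 2 * #(unkSet T h) < S) :
    Run S classify h fun h' t => Classified T v T.d h h' ∧
      t ≤ T.d * (T.d * (3 * T.d + 8) + 3 * T.d + 20) + 4 := by
  classical
  have hle := hS.le
  have h1 := T.n_le_mul
  have h2 := T.d_le_mul
  have hsideval : (HExpr.sub (.c 1) (.lt (.r rV) (.r rN))).val h = T.side v := by
    simp only [HExpr.val, hrV, hs.n, EdgeTable.side]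
    split_ifs <;> rfl
  have hside2 := T.side_lt v
  refine run_seq (run_set (by simp) (by rw [hsideval]; omega) ?_)
  rw [hsideval]
  refine run_for_uniform (B := T.d * (3 * T.d + 8) + 3 * T.d + 18) (Nv := T.d)
    (fun i h' => Classified T v i h h' ∧ h'.reg rI = i ∧ h'.reg rSide = T.side v)
    ?_ (by omega) ?_ ?_ ?_
  · refine ⟨⟨(Frame.refl.setR (by norm_num)).setR (by norm_num), hkn, by simp, by simp, by simp,
      by simp, ?_, by simp, by simp, ?_, ?_⟩, by simp, by simp⟩
    · have hu : unkSet T ((h.setR rSide (T.side v)).setR rI 0) = unkSet T h :=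
        unkSet_congr fun e => rfl
      rw [hu]
      simp
    · exact fun e _ hu hu' => absurd hu hu'
    · intro p hp hp'
      simp only [HState.setR_reg] at hp
      norm_num at hp
      omega
  · rintro i h' - ⟨hC, hi, -⟩
    exact ⟨hi, by simp [hC.frame.1, hs.d], by simp⟩
  · rintro i h' hid ⟨hC, hi, hside⟩ -
    have hf := hC.frame
    have hs' := hs.frame hf
    have e1 : h'.reg rV = v := by rw [hf.1 _ (by norm_num), hrV]
    have e2 := hs'.eid v hv i hid
    have e3 := T.eid_lt hv hid
    have hl : h'.arr aLab = h.arr aLab := hf.2 _ (by simp)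
    have hnew := T.not_isFirst_eid hv hid
    have hkn' := hC.kn_eq _ (Or.inl hnew)
    refine run_seq (run_set (by simp [e1, hi]; omega) (by simp [e1, hi, e2]; omega) ?_)
    set h₁ := h'.setR rEd ((HExpr.ld aEid (.r rV) (.r rI)).val h') with hh₁
    have hf₁ : Frame 19 [] h' h₁ := Frame.refl.setR (by norm_num)
    have e4 : h₁.reg rEd = T.eid v i := by simp [hh₁, e1, hi, e2]
    have e5 : h₁.reg rE = T.n * T.d := (hs'.frame hf₁).e
    have e6 : h₁.reg rSide = T.side v := by simp [hh₁, hside]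
    have e7 : h₁.reg rI = i := by simp [hh₁, hi]
    have hsp₁ : h₁.reg rSP = h'.reg rSP := by simp [hh₁]
    have hU : (HExpr.eq (.ld aKn (.r rEd) (.c 0)) (.c 0)).val h₁ =
        if h.arr aKn (T.eid v i) 0 = 0 then 1 else 0 := by
      simp only [HExpr.val, e4]
      rw [hh₁, HState.setR_arr, hkn']
    refine run_when (by simp [e4]; omega) ?_ ?_
    · rw [hU]
      intro hv1
      have hu : Unk h (T.eid v i) := by
        by_contra hcon
        rw [Unk] at hcon
        simp [hcon] at hv1
      have hu' : Unk h' (T.eid v i) := by rw [Unk, hkn']; exact hu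
      -- The number nd belongs to no edge, and its row is always zero; comparison with it tests
      -- whether the scratch row is empty.
      refine run_seq (run_set (by simp) (by simp [e5]; omega) ?_)
      set h₂ := h₁.setR rEd2 ((HExpr.r rE).val h₁) with hh₂
      have hf₂ : Frame 19 [] h' h₂ := hf₁.setR (by norm_num)
      refine run_seq ((run_eqScratch (e := T.eid v i) (e' := T.n * T.d) hS (hs'.frame hf₂)
        (by omega) (by omega) (by simp [hh₂, e4]) (by simp [hh₂, e5])).mono ?_)
      rintro h₃ t₃ ⟨hf₃, ht₃, hX⟩
      have hf₄ : Frame 19 [] h' h₃ := hf₂.trans (hf₃.mono (by norm_num) (by simp))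
      have hs₃ := hs'.frame hf₄
      have hX' : h₃.reg rX = if ∀ j < T.d, h.arr aLab (T.eid v i) j = 0 then 1 else 0 := by
        rw [hX]
        simp only [hh₂, hh₁, HState.setR_arr, hl, hzero]
      have e8 : h₃.reg rEd = T.eid v i := by
        rw [hf₃.1 _ (by norm_num)]; simp [hh₂, e4]
      have e9 : h₃.reg rSide = T.side v := by
        rw [hf₃.1 _ (by norm_num)]; simp [hh₂, e6]
      have e10 : h₃.reg rI = i := by
        rw [hf₃.1 _ (by norm_num)]; simp [hh₂, e7]
      have e11 : h₃.reg rV = v := by rw [hf₄.1 _ (by norm_num), e1]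
      have e12 : h₃.reg rSP = h'.reg rSP := hf₄.1 _ (by norm_num)
      have hK₃ : ∀ e, h₃.arr aKn e 0 = h'.arr aKn e 0 := fun e => by rw [hf₄.2 _ (by simp)]
      have hu₃ : Unk h₃ (T.eid v i) := by rw [Unk, hK₃]; exact hu'
      have hset₃ : unkSet T h₃ = unkSet T h' := unkSet_congr hK₃
      -- An unknown edge is still left, so the preserved potential provides room for two more stack
      -- entries.
      have hpos : 0 < #(unkSet T h') := card_pos.2 ⟨_, mem_unkSet.2 ⟨e3, hu'⟩⟩
      have hspC := hC.sp
      refine run_ite (by simp) ?_ ?_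
      · intro hv2
        have hz : ∀ j < T.d, h.arr aLab (T.eid v i) j = 0 := by
          by_contra hcon
          simp [hX', hcon] at hv2
        refine (run_learn hS hs₃ e3 e8 (by omega) hu₃).mono ?_
        rintro h₄ t₄ ⟨ht₄, hreg, harr, hsp₄, hkn₄, hstk, hst0, hst1, hcard⟩
        rw [e12] at hsp₄ hstk hst0 hst1
        have hkn₄' : ∀ e, h₄.arr aKn e 0 = if e = T.eid v i then 1 else h'.arr aKn e 0 := by
          intro e
          rw [hkn₄, hK₃]
          simp
        have hset : unkSet T (h₄.setR rI (i + 1)) = unkSet T h₄ := unkSet_congr fun e => rfl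
        refine ⟨by rw [hreg _ (by norm_num), e10], ?_, ⟨?_, ?_, ?_, ?_, ?_, ?_, ?_, ?_, ?_, ?_, ?_⟩,
          by simp, ?_⟩
        · ring_nf at *
          omega
        · refine Frame.setR ⟨fun x hx => ?_, fun a ha => ?_⟩ (by norm_num)
          · rw [hreg _ (by omega), hf₄.1 _ (by omega), hf.1 _ hx]
          · have ha' : a ∉ [aKn, aStk] := by
              simp only [List.mem_cons, List.not_mem_nil, or_false, not_or] at ha ⊢
              tauto
            rw [harr a ha', hf₄.2 _ (by simp), hf.2 _ ha]
        · intro e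
          rw [HState.setR_arr, hkn₄']
          split
          · norm_num
          · exact hC.kn_lt e
        · intro e he
          rw [HState.setR_arr, hkn₄', T.isFirst_succ] at *
          have hne : e ≠ T.eid v i := by
            rintro rfl
            tauto
          rw [if_neg hne]
          apply hC.kn_eq
          tauto
        · intro k hk hk'
          rw [Unk, HState.setR_arr, hkn₄']
          rcases Nat.lt_succ_iff_lt_or_eq.1 hk with h3 | rfl
          · have hne : T.eid v k ≠ T.eid v i := by
              intro heq
              exact hnew ⟨k, h3, heq⟩
            rw [if_neg hne]
            exact hC.kn_new k h3 hk'
          · simp only [if_true, one_ne_zero, false_iff, not_not]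
            exact hz
        · intro k hk hk'
          rw [Unk, HState.setR_arr, hkn₄'] at hk'
          have hne : T.eid v k ≠ T.eid v i := by
            intro heq
            simp [heq] at hk'
          rw [if_neg hne] at hk'
          have hki : k ≠ i := by
            rintro rfl
            exact hne rfl
          have hcl : h₄.arr aCl = h'.arr aCl := by
            rw [harr _ (by simp), hf₄.2 _ (by simp)]
          rw [HState.setR_arr, hcl]
          exact hC.cl k (by omega) hk'
        · intro e s hes
          have hcl : h₄.arr aCl = h'.arr aCl := by
            rw [harr _ (by simp), hf₄.2 _ (by simp)]
          rw [HState.setR_arr, hcl]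
          apply hC.cl_other
          rw [T.isFirst_succ] at hes
          tauto
        · rw [hset]
          simp only [HState.setR_reg]
          norm_num
          rw [hset₃] at hcard
          omega
        · have := hC.sp_le
          simp only [HState.setR_reg]
          norm_num
          omega
        · intro p hp
          have := hC.sp_le
          rw [HState.setR_arr, hstk p (by omega), hf₄.2 _ (by simp)]
          exact hC.stk_old p hp
        · intro e he hue hue' s hs2
          rw [Unk, HState.setR_arr, hkn₄'] at hue'
          have hle' := hC.sp_le
          by_cases hee : e = T.eid v i
          · subst hee
            have : s = 0 ∨ s = 1 := by omega
            rcases this with rfl | rfl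
            · refine ⟨h'.reg rSP, ?_, hle', hst0⟩
              simp [hsp₄]
            · refine ⟨h'.reg rSP + 1, ?_, by omega, hst1⟩
              simp [hsp₄]
          · rw [if_neg hee] at hue'
            obtain ⟨p, hp1, hp2, hp3⟩ := hC.stk_new e he hue hue' s hs2
            refine ⟨p, ?_, hp2, ?_⟩
            · simp only [HState.setR_reg]
              norm_num
              omega
            · rw [HState.setR_arr, hstk p hp1, hf₄.2 _ (by simp), hp3]
        · intro p hp hp'
          simp only [HState.setR_reg] at hp
          norm_num at hp
          rw [HState.setR_arr]
          by_cases hp1 : p < h'.reg rSP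
          · rw [hstk p hp1, hf₄.2 _ (by simp)]
            exact hC.stk_lt p hp1 hp'
          · have : p = h'.reg rSP ∨ p = h'.reg rSP + 1 := by omega
            rcases this with rfl | rfl
            · rw [hst0]; exact T.ev_lt e3 (by norm_num)
            · rw [hst1]; exact T.ev_lt e3 (by norm_num)
        · simp only [HState.setR_reg]
          norm_num
          rw [hreg _ (by norm_num), e9]
      · intro hv2
        have hz : ¬ ∀ j < T.d, h.arr aLab (T.eid v i) j = 0 := by
          intro hcon
          rw [HExpr.val, hX', if_pos hcon] at hv2
          omega
        refine (run_pickClass hS hs₃ hv hid e11 e8 e9 hside2).mono ?_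
        rintro h₄ t₄ ⟨hf₅, ht₄, hoth, hcl⟩
        have hf₆ : Frame 16 [aKn, aCl, aStk] h h₄ :=
          hf.trans ((hf₄.mono (by norm_num) (by simp)).trans (hf₅.mono (by norm_num) (by simp)))
        have hK₄ : ∀ e, h₄.arr aKn e 0 = h'.arr aKn e 0 := fun e => by
          rw [hf₅.2 _ (by simp), hK₃]
        have hset : unkSet T (h₄.setR rI (i + 1)) = unkSet T h' := unkSet_congr hK₄
        have hsp₄ : h₄.reg rSP = h'.reg rSP := by rw [hf₅.1 _ (by norm_num), e12]
        have hstk₄ : h₄.arr aStk = h'.arr aStk := by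
          rw [hf₅.2 _ (by simp), hf₄.2 _ (by simp)]
        have hsp₅ : (h₄.setR rI (i + 1)).reg rSP = h'.reg rSP := by simp [hsp₄]
        have hcl₃ : h₃.arr aCl = h'.arr aCl := hf₄.2 _ (by simp)
        have hsame : ∀ k k', SameRow T h₃ v k k' ↔ SameRow T h v k k' := by
          intro k k'
          simp only [SameRow, hf₄.2 aLab (by simp), hl]
        refine ⟨by rw [hf₅.1 _ (by norm_num), e10], ?_, ⟨hf₆.setR (by norm_num), ?_, ?_, ?_, ?_, ?_,
          ?_, ?_, ?_, ?_, ?_⟩, by simp, ?_⟩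
        · omega
        · intro e
          rw [HState.setR_arr, hK₄]
          exact hC.kn_lt e
        · intro e he
          rw [HState.setR_arr, hK₄]
          rw [T.isFirst_succ] at he
          by_cases hee : e = T.eid v i
          · rw [hee, hkn']
          · apply hC.kn_eq
            tauto
        · intro k hk hk'
          rw [Unk, HState.setR_arr, hK₄]
          rcases Nat.lt_succ_iff_lt_or_eq.1 hk with h3 | rfl
          · exact hC.kn_new k h3 hk'
          · exact ⟨fun _ => hz, fun _ => hu'⟩
        · intro k hk hk'
          rw [Unk, HState.setR_arr, hK₄] at hk'
          rw [HState.setR_arr]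
          rcases Nat.lt_succ_iff_lt_or_eq.1 hk with h3 | rfl
          · have hne : T.eid v k ≠ T.eid v i := by
              intro heq
              exact hnew ⟨k, h3, heq⟩
            rw [hoth _ _ (fun hc => hne hc.1), hcl₃]
            exact hC.cl k h3 hk'
          · obtain ⟨k', hk1, hk2, hk3, hk4⟩ := hcl
            exact ⟨k', hk1, hk2, (hsame _ _).1 hk3, fun k'' ha hb hc =>
              hk4 k'' ha hb ((hsame _ _).2 hc)⟩
        · intro e s hes
          rw [T.isFirst_succ] at hes
          rw [HState.setR_arr, hoth e s (by tauto), hcl₃]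
          exact hC.cl_other e s (by tauto)
        · rw [hset, hsp₅]
          exact hC.sp
        · rw [hsp₅]
          exact hC.sp_le
        · intro p hp
          rw [HState.setR_arr, hstk₄]
          exact hC.stk_old p hp
        · intro e he hue hue' s hs2
          rw [Unk, HState.setR_arr, hK₄] at hue'
          rw [hsp₅, HState.setR_arr, hstk₄]
          exact hC.stk_new e he hue hue' s hs2
        · rw [hsp₅, HState.setR_arr, hstk₄]
          exact hC.stk_lt
        · simp only [HState.setR_reg]
          norm_num
          rw [hf₅.1 _ (by norm_num), e9]
    · rw [hU]
      intro hv0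
      have hu : ¬ Unk h (T.eid v i) := by
        intro hcon
        rw [Unk] at hcon
        simp [hcon] at hv0
      have hset : unkSet T (h₁.setR rI (i + 1)) = unkSet T h' := unkSet_congr fun e => rfl
      have hsp₅ : (h₁.setR rI (i + 1)).reg rSP = h'.reg rSP := by simp [hsp₁]
      refine ⟨e7, by omega, ⟨(hf.setR (by norm_num)).setR (by norm_num), hC.kn_lt, ?_, ?_, ?_, ?_,
        ?_, ?_, hC.stk_old, ?_, ?_⟩, by simp, by simp [e6]⟩
      · intro e he
        apply hC.kn_eq
        rw [T.isFirst_succ] at he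
        by_cases hee : e = T.eid v i
        · exact Or.inr (by rw [hee]; exact hu)
        · tauto
      · intro k hk hk'
        rcases Nat.lt_succ_iff_lt_or_eq.1 hk with h3 | rfl
        · exact hC.kn_new k h3 hk'
        · exact absurd hk' hu
      · intro k hk hk'
        rcases Nat.lt_succ_iff_lt_or_eq.1 hk with h3 | rfl
        · exact hC.cl k h3 hk'
        · exact absurd (show Unk h (T.eid v k) by rw [Unk, ← hkn']; exact hk') hu
      · intro e s hes
        rw [T.isFirst_succ] at hes
        exact hC.cl_other e s (by tauto)
      · rw [hset, hsp₅]
        exact hC.sp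
      · rw [hsp₅]
        exact hC.sp_le
      · rw [hsp₅]
        exact hC.stk_new
      · rw [hsp₅]
        exact hC.stk_lt
  · rintro h' t ⟨hC, -⟩ - ht
    exact ⟨hC, by linarith⟩

end ArrayRAM

/-! ### Processing one vertex -/

namespace ArrayRAM

open RAM Finset

variable {T : EdgeTable}

/-- Processes the vertex `rV`. -/
def processVertex : Prog := .seq scratchInit (.seq eliminate (.seq classify clearRows))

variable (T) in
/-- The effect of processing the vertex `v`. -/
structure Processed (Sol : (ℕ → ZMod 2) → Prop) (K v : ℕ) (h h' : HState) : Prop where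
  frame : Frame 16 [aLab, aKn, aG, aCl, aStk] h h'
  inv : LabelInv T Sol K h'
  lab_known : ∀ e, ¬ Unk h e → ∀ j, h'.arr aLab e j = h.arr aLab e j
  kn_eq : ∀ e, (¬ T.IsFirst v T.d e ∨ ¬ Unk h e) → h'.arr aKn e 0 = h.arr aKn e 0
  kn_new : ∀ i < T.d, Unk h (T.eid v i) →
    (¬ Unk h' (T.eid v i) ↔ ∀ x, T.Loc (Unk h) v T.m x → x i = 0)
  cl : ∀ i < T.d, ∀ i' < T.d, Unk h' (T.eid v i) → Unk h' (T.eid v i') →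
    (h'.arr aCl (T.eid v i) (T.side v) = h'.arr aCl (T.eid v i') (T.side v) ↔
      ∀ x, T.Loc (Unk h) v T.m x → x i = x i')
  cl_other : ∀ e s, ¬ (T.IsFirst v T.d e ∧ s = T.side v) → h'.arr aCl e s = h.arr aCl e s
  sp : h'.reg rSP + 2 * #(unkSet T h') = h.reg rSP + 2 * #(unkSet T h)
  sp_le : h.reg rSP ≤ h'.reg rSP
  stk_old : ∀ p < h.reg rSP, h'.arr aStk p 0 = h.arr aStk p 0
  stk_new : ∀ e < T.n * T.d, Unk h e → ¬ Unk h' e → ∀ s < 2, ∃ p < h'.reg rSP,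
    h.reg rSP ≤ p ∧ h'.arr aStk p 0 = T.ev e s
  stk_lt : ∀ p < h'.reg rSP, h.reg rSP ≤ p → h'.arr aStk p 0 < 2 * T.n

/-- The substitutions d = l+1 and K = d+1+k absorb the lower bounds, so that the claim follows by
comparing coefficients of polynomials with natural coefficients. The other time estimates use the
same device. -/
theorem vertex_time {d K m a b c e : ℕ} (hd : 0 < d) (hK : d < K) (hm : m ≤ d)
    (ha : a ≤ d * 5 + 2) (hb : b ≤ m * (K * (3 * d + 6) + K * 4 + d * (3 * K + 6) + 12) + 2)
    (hc : c ≤ d * (d * (3 * d + 8) + 3 * d + 20) + 4) (he : e ≤ d * (3 * K + 7) + 2) :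
    a + (b + (c + e)) ≤ 200 * d ^ 2 * K := by
  have hb' := hb.trans (Nat.add_le_add_right (Nat.mul_le_mul_right _ hm) 2)
  obtain ⟨k, rfl⟩ : ∃ k, K = d + 1 + k := ⟨K - (d + 1), by omega⟩
  obtain ⟨l, rfl⟩ : ∃ l, d = l + 1 := ⟨d - 1, by omega⟩
  ring_nf at *
  omega

theorem run_processVertex {S K v : ℕ} {Sol : (ℕ → ZMod 2) → Prop} {h : HState} (hS : T.Fits S)
    (hs : Stat T h) (hI : LabelInv T Sol K h) (hSol : ∀ c, Sol c → T.IsWord c)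
    (hv : v < 2 * T.n) (hK : K < S) (hrV : h.reg rV = v) (hrK : h.reg rK = K)
    (hsp : h.reg rSP + 2 * #(unkSet T h) < S) :
    Run S processVertex h fun h' t => Processed T Sol K v h h' ∧ t ≤ 200 * T.d ^ 2 * K := by
  classical
  have hzero : ∀ e < T.n * T.d, ∀ j, (Unk h e ∨ j < T.d ∨ K ≤ j) → lab h e j = 0 :=
    fun e he j hj => (lab_eq_zero_iff hI.bits).2 (hI.zero e he j hj)
  refine run_seq ((run_scratchInit hS hs hI.bits hv hrV).mono ?_)
  rintro h₁ t₁ ⟨hf₁, hl₁, ht₁, hlab₁⟩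
  have hs₁ := hs.frame hf₁
  have hE₀ : T.Elim Sol (Unk h) v K 0 (lab h) (lab h₁) := by
    refine EdgeTable.elim_init hv hI.d_lt hzero hI.sound ?_ ?_
    · intro e j hc
      rw [lab, hlab₁, if_pos hc, Nat.cast_one]
    · intro e j hc
      rw [lab, hlab₁, if_neg hc, lab]
  refine run_seq ((run_eliminate hS hs₁ hl₁ hv hI.d_lt hK (by rw [hf₁.1 _ (by norm_num), hrV])
    (by rw [hf₁.1 _ (by norm_num), hrK]) hSol hzero hE₀).mono ?_)
  rintro h₂ t₂ ⟨hf₂, hl₂, ht₂, hE⟩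
  have hf₂' : Frame 17 [aLab, aG] h h₂ := (hf₁.mono le_rfl (by simp)).trans hf₂
  have hs₂ := hs.frame hf₂'
  have hU₂ : Unk h₂ = Unk h := Unk.frame hf₂'
  have hset₂ : unkSet T h₂ = unkSet T h := unkSet_frame hf₂'
  -- The zero row at nd belongs to no edge at v, so the elimination does not touch it.
  have hzr : ∀ j, h₂.arr aLab (T.n * T.d) j = 0 := by
    intro j
    have hnf : ¬ T.IsFirst v T.d (T.n * T.d) := by
      rintro ⟨i, hi, hie⟩
      have := T.eid_lt hv hi
      omega
    rw [← lab_eq_zero_iff hl₂, hE.other _ _ (Or.inl hnf), lab_eq_zero_iff hI.bits]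
    exact hI.zeroRow j
  refine run_seq ((run_classify hS hs₂ hv (by rw [hf₂'.1 _ (by norm_num), hrV])
    (fun e => by rw [hf₂'.2 _ (by simp)]; exact hI.kn_lt e) hzr
    (by rw [hset₂, hf₂'.1 _ (by norm_num)]; exact hsp)).mono ?_)
  rintro h₃ t₃ ⟨hC, ht₃⟩
  have hs₃ := hs₂.frame hC.frame
  have hl₃ : h₃.arr aLab = h₂.arr aLab := hC.frame.2 _ (by simp)
  refine (run_clearRows hS hs₃ hv hK
    (by rw [hC.frame.1 _ (by norm_num), hf₂'.1 _ (by norm_num), hrV])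
    (by rw [hC.frame.1 _ (by norm_num), hf₂'.1 _ (by norm_num), hrK])).mono ?_
  rintro h₄ t₄ ⟨hf₄, ht₄, hlab₄⟩
  have hkn₂ : h₂.arr aKn = h.arr aKn := hf₂'.2 _ (by simp)
  have hkn₄ : h₄.arr aKn = h₃.arr aKn := hf₄.2 _ (by simp)
  have hU₄ : Unk h₄ = Unk h₃ := Unk.frame hf₄
  have hset₄ : unkSet T h₄ = unkSet T h₃ := unkSet_frame hf₄
  have hmono : ∀ e, Unk h₃ e → Unk h e := by
    intro e he
    by_contra hcon
    have := hC.kn_eq e (Or.inr (by rw [hU₂]; exact hcon))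
    rw [hkn₂] at this
    exact hcon (by rw [Unk, ← this]; exact he)
  have hfirst : ∀ e, Unk h e → ¬ Unk h₃ e → T.IsFirst v T.d e := by
    intro e he he'
    by_contra hcon
    have := hC.kn_eq e (Or.inl hcon)
    rw [hkn₂] at this
    exact he' (by rw [Unk, this]; exact he)
  have hrow₄ : ∀ e, ¬ Unk h₃ e → ∀ j, h₄.arr aLab e j = h₂.arr aLab e j := by
    intro e he j
    rw [hlab₄, if_neg (fun hc => he hc.2.1), hl₃]
  have hbits₄ : LabBits h₄ := by
    intro e j
    rw [hlab₄]
    split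
    · norm_num
    · rw [hl₃]; exact hl₂ e j
  have heq₂ : ∀ e j, (¬ T.IsFirst v T.d e ∨ ¬ Unk h e ∨ K ≤ j) →
      h₂.arr aLab e j = h.arr aLab e j := by
    intro e j hor
    have h5 := hE.other e j hor
    have h6 := hl₂ e j
    have h7 := hI.bits e j
    rw [lab, lab] at h5
    interval_cases h₂.arr aLab e j <;> interval_cases h.arr aLab e j <;> simp_all
  have hknown : ∀ e, ¬ Unk h e → ∀ j, h₄.arr aLab e j = h.arr aLab e j := by
    intro e he j
    rw [hrow₄ e (fun hc => he (hmono e hc)), heq₂ e j (Or.inr (Or.inl he))]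
  have hnewrow : ∀ i < T.d, Unk h (T.eid v i) →
      (¬ Unk h₃ (T.eid v i) ↔ ∀ j < T.d, h₂.arr aLab (T.eid v i) j = 0) := by
    intro i hi hu
    rw [hC.kn_new i hi (by rw [hU₂]; exact hu), not_not]
  refine ⟨⟨?_, ⟨hbits₄, ?_, hI.d_lt, ?_, ?_, ?_⟩, hknown, ?_, ?_, ?_, ?_, ?_, ?_, ?_, ?_, ?_⟩, ?_⟩
  · exact (hf₂'.mono (by norm_num) (by simp)).trans
      ((hC.frame.mono le_rfl (by simp)).trans (hf₄.mono (by norm_num) (by simp)))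
  · intro e
    rw [hkn₄]
    exact hC.kn_lt e
  · intro j
    rw [hlab₄, hl₃, hzr]
    simp
  · intro e he j hor
    rw [hU₄] at hor
    by_cases hu : Unk h₃ e
    · by_cases hfi : T.IsFirst v T.d e
      · by_cases hj : j < K
        · rw [hlab₄, if_pos ⟨hfi, hu, hj⟩]
        · rw [hlab₄, if_neg (fun hc => hj hc.2.2), hl₃, heq₂ e j (Or.inr (Or.inr (by omega)))]
          exact hI.zero e he j (Or.inr (Or.inr (by omega)))
      · rw [hlab₄, if_neg (fun hc => hfi hc.1), hl₃, heq₂ e j (Or.inl hfi)]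
        exact hI.zero e he j (Or.inl (hmono e hu))
    · have hor' := hor.resolve_left hu
      by_cases hu' : Unk h e
      · rw [hrow₄ e hu]
        obtain ⟨i, hi, rfl⟩ := hfirst e hu' hu
        rcases hor' with hj | hj
        · exact (hnewrow i hi hu').1 hu j hj
        · rw [heq₂ _ j (Or.inr (Or.inr hj))]
          exact hI.zero _ he j (Or.inr (Or.inr hj))
      · rw [hknown e hu']
        exact hI.zero e he j (Or.inr hor')
  · intro c hc
    obtain ⟨y, hy, hsum⟩ := hE.sound c hc
    refine ⟨y, hy, fun e he hu => ?_⟩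
    rw [hU₄] at hu
    rw [hsum e he]
    · refine sum_congr rfl fun j _ => ?_
      rw [lab, lab, hrow₄ e hu]
    · by_cases hu' : Unk h e
      · exact Or.inr (hfirst e hu' hu)
      · exact Or.inl hu'
  · intro e he
    rw [hkn₄, ← hkn₂]
    apply hC.kn_eq
    rwa [hU₂]
  · intro i hi hu
    rw [hU₄, hnewrow i hi hu, ← hE.row_eq_zero_iff hi]
    simp only [lab_eq_zero_iff hl₂]
  · intro i hi i' hi' hu hu'
    rw [hU₄] at hu hu'
    have hcl₄ : h₄.arr aCl = h₃.arr aCl := hf₄.2 _ (by simp)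
    rw [hcl₄, ← hE.rows_eq_iff hi hi']
    simp only [lab_eq_iff hl₂]
    obtain ⟨k, hk1, hk2, hk3, hk4⟩ := hC.cl i hi hu
    obtain ⟨k', hk1', hk2', hk3', hk4'⟩ := hC.cl i' hi' hu'
    rw [hk2, hk2']
    constructor
    · intro heq j hj
      have := T.eid_inj hv hk1 hk1' heq
      subst this
      rw [hk3 j hj, hk3' j hj]
    · intro heq
      -- Both representatives are last positions of their rows, so for equal rows neither position
      -- can exceed the other.
      rcases lt_trichotomy k k' with hlt | hkk | hlt
      · exact absurd (fun j hj => (heq j hj).trans (hk3' j hj)) (hk4 k' hlt hk1')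
      · rw [hkk]
      · exact absurd (fun j hj => (heq j hj).symm.trans (hk3 j hj)) (hk4' k hlt hk1)
  · intro e s hes
    rw [hf₄.2 _ (by simp), hC.cl_other e s hes, hf₂'.2 _ (by simp)]
  · rw [hset₄, hf₄.1 _ (by norm_num), hC.sp, hset₂, hf₂'.1 _ (by norm_num)]
  · rw [hf₄.1 _ (by norm_num), ← hf₂'.1 _ (by norm_num : (rSP : ℕ) < 17)]
    exact hC.sp_le
  · intro p hp
    rw [hf₄.2 _ (by simp), hC.stk_old p (by rw [hf₂'.1 _ (by norm_num)]; exact hp),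
      hf₂'.2 _ (by simp)]
  · intro e he hu hu' s hs2
    obtain ⟨p, hp1, hp2, hp3⟩ := hC.stk_new e he (by rw [hU₂]; exact hu) (by rw [← hU₄]; exact hu')
      s hs2
    refine ⟨p, by rw [hf₄.1 _ (by norm_num)]; exact hp1, ?_, by rw [hf₄.2 _ (by simp)]; exact hp3⟩
    rw [← hf₂'.1 _ (by norm_num : (rSP : ℕ) < 17)]
    exact hp2
  · intro p hp hp'
    rw [hf₄.2 _ (by simp)]
    apply hC.stk_lt p
    · rw [← hf₄.1 _ (by norm_num : (rSP : ℕ) < 17)]; exact hp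
    · rw [hf₂'.1 _ (by norm_num)]; exact hp'
  · exact vertex_time T.d_pos hI.d_lt T.m_le ht₁ ht₂ ht₃ ht₄

/-! ### Propagation -/

variable (T) in
/-- No unknown edge at `v` is determined by the known ones, and the local classes are stored. -/
def Clean (h : HState) (v : ℕ) : Prop :=
  ∀ i < T.d, Unk h (T.eid v i) → (∃ x, T.Loc (Unk h) v T.m x ∧ x i ≠ 0) ∧
    ∀ i' < T.d, Unk h (T.eid v i') →
      (h.arr aCl (T.eid v i) (T.side v) = h.arr aCl (T.eid v i') (T.side v) ↔
        ∀ x, T.Loc (Unk h) v T.m x → x i = x i')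

theorem Processed.unk_mono {Sol : (ℕ → ZMod 2) → Prop} {K v : ℕ} {h h' : HState}
    (hP : Processed T Sol K v h h') {e : ℕ} (hu : Unk h' e) : Unk h e := by
  by_contra hcon
  exact hcon (by rw [Unk, ← hP.kn_eq e (Or.inr hcon)]; exact hu)

/-- The edges that have just become known vanish on the local code, so the local code is the same
for the smaller set of unknown edges. Hence one pass is enough at v itself. -/
theorem Processed.clean {Sol : (ℕ → ZMod 2) → Prop} {K v : ℕ} {h h' : HState}
    (hP : Processed T Sol K v h h') : Clean T h' v := by
  have hloc : ∀ x, T.Loc (Unk h) v T.m x ↔ T.Loc (Unk h') v T.m x := by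
    intro x
    constructor
    · intro hx
      refine ⟨fun i hi hu => ?_, hx.2⟩
      by_cases hu' : Unk h (T.eid v i)
      · exact (hP.kn_new i hi hu').1 hu x hx
      · exact hx.1 i hi hu'
    · intro hx
      exact ⟨fun i hi hu => hx.1 i hi fun hu' => hu (hP.unk_mono hu'), hx.2⟩
  intro i hi hu
  refine ⟨?_, fun i' hi' hu' => ?_⟩
  · have := mt (hP.kn_new i hi (hP.unk_mono hu)).2 (not_not.2 hu)
    push Not at this
    obtain ⟨x, hx, hxi⟩ := this
    exact ⟨x, (hloc x).1 hx, hxi⟩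
  · rw [hP.cl i hi i' hi' hu hu']
    simp only [hloc]

/-- Cleanness of w depends on the unknown edges at w and on the representatives stored for the side
of w. Processing v changes only entries for the side of v, and two distinct vertices on one side
have no common edge. -/
theorem Processed.clean_of_clean {Sol : (ℕ → ZMod 2) → Prop} {K v w : ℕ} {h h' : HState}
    (hP : Processed T Sol K v h h') (hv : v < 2 * T.n) (hw : w < 2 * T.n) (hwv : w ≠ v)
    (hc : Clean T h w) (hnew : ∀ i < T.d, Unk h (T.eid w i) → Unk h' (T.eid w i)) :
    Clean T h' w := by
  have hiff : ∀ i < T.d, (Unk h' (T.eid w i) ↔ Unk h (T.eid w i)) := fun i hi =>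
    ⟨hP.unk_mono, hnew i hi⟩
  have hloc : ∀ x, T.Loc (Unk h') w T.m x ↔ T.Loc (Unk h) w T.m x := by
    intro x
    constructor
    · exact fun hx => ⟨fun i hi hu => hx.1 i hi (by rwa [hiff i hi]), hx.2⟩
    · exact fun hx => ⟨fun i hi hu => hx.1 i hi (by rwa [← hiff i hi]), hx.2⟩
  have hcl : ∀ i < T.d, h'.arr aCl (T.eid w i) (T.side w) = h.arr aCl (T.eid w i) (T.side w) := by
    intro i hi
    apply hP.cl_other
    rintro ⟨⟨j, hj, hje⟩, hside⟩
    apply hwv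
    have h1 := T.ev_eid hw hi
    have h2 := T.ev_eid hv hj
    rw [hje] at h2
    unfold EdgeTable.side at hside
    rw [← h1, ← h2, hside]
  intro i hi hu
  rw [hiff i hi] at hu
  obtain ⟨h1, h2⟩ := hc i hi hu
  refine ⟨?_, fun i' hi' hu' => ?_⟩
  · obtain ⟨x, hx, hxi⟩ := h1
    exact ⟨x, (hloc x).2 hx, hxi⟩
  · rw [hiff i' hi'] at hu'
    rw [hcl i hi, hcl i' hi', h2 i' hi' hu']
    simp only [hloc]

/-- Processes vertices from the stack until it is empty. -/
def propagate : Prog :=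
  loopP (.lt (.c 0) (.r rSP)) (.seq (setP rSP (.sub (.r rSP) (.c 1)))
    (.seq (setP rV (.ld aStk (.r rSP) (.c 0))) processVertex))

variable (T) in
/-- The effect of processing vertices. -/
structure Propagated (Sol : (ℕ → ZMod 2) → Prop) (K : ℕ) (h h' : HState) : Prop where
  frame : Frame 15 [aLab, aKn, aG, aCl, aStk] h h'
  inv : LabelInv T Sol K h'
  lab_known : ∀ e, ¬ Unk h e → ∀ j, h'.arr aLab e j = h.arr aLab e j
  unk_mono : ∀ e, Unk h' e → Unk h e

/-- The potential is the stack height plus twice the number of unknown edges: removing a vertex from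
the stack lowers it by one, and processing preserves it. Every vertex is clean or on the stack
throughout, because both ends of a newly known edge are stacked. -/
theorem run_propagate {S K : ℕ} {Sol : (ℕ → ZMod 2) → Prop} {h : HState} (hS : T.Fits S)
    (hs : Stat T h) (hI : LabelInv T Sol K h) (hSol : ∀ c, Sol c → T.IsWord c)
    (hK : K < S) (hrK : h.reg rK = K) (hsp : h.reg rSP + 2 * #(unkSet T h) < S)
    (hstk : ∀ p < h.reg rSP, h.arr aStk p 0 < 2 * T.n)
    (hall : ∀ w < 2 * T.n, ∃ p < h.reg rSP, h.arr aStk p 0 = w) :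
    Run S propagate h fun h' t => Propagated T Sol K h h' ∧ h'.reg rSP = 0 ∧
      (∀ w < 2 * T.n, Clean T h' w) ∧
      t ≤ (h.reg rSP + 2 * #(unkSet T h)) * (200 * T.d ^ 2 * K + 3) + 1 := by
  have hle := hS.le
  have hn := T.n_le_mul
  set k₀ := h.reg rSP + 2 * #(unkSet T h) with hk₀
  set B := 200 * T.d ^ 2 * K + 3 with hB
  refine run_loop (fun k h' t => k = h'.reg rSP + 2 * #(unkSet T h') ∧ k ≤ k₀ ∧
    t + k * B ≤ k₀ * B ∧ Propagated T Sol K h h' ∧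
    (∀ p < h'.reg rSP, h'.arr aStk p 0 < 2 * T.n) ∧
    ∀ w < 2 * T.n, Clean T h' w ∨ ∃ p < h'.reg rSP, h'.arr aStk p 0 = w) (k := k₀) ?_ ?_ ?_ ?_
  · exact ⟨hk₀, le_rfl, by omega, ⟨Frame.refl, hI, fun _ _ _ => rfl, fun _ => id⟩, hstk,
      fun w hw => Or.inr (hall w hw)⟩
  · simp
  · rintro k h₁ t ⟨hk, hkk, ht, hP, hlt, hcl⟩ hval
    have hpos : 0 < h₁.reg rSP := by
      by_contra hcon
      simp [hcon] at hval
    have hs₁ := hs.frame hP.frame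
    have hl := hlt (h₁.reg rSP - 1) (by omega)
    refine run_seq (run_set (by simp) (by simp; omega) ?_)
    refine run_seq (run_set (by simp; omega) (by simp; omega) ?_)
    set h₂ := h₁.setR rSP ((HExpr.sub (.r rSP) (.c 1)).val h₁) with hh₂
    set h₃ := h₂.setR rV ((HExpr.ld aStk (.r rSP) (.c 0)).val h₂) with hh₃
    set v := h₁.arr aStk (h₁.reg rSP - 1) 0 with hv
    have e1 : h₃.reg rV = v := by simp [hh₃, hh₂, hv]
    have e2 : h₃.reg rSP = h₁.reg rSP - 1 := by simp [hh₃, hh₂]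
    have hf₃ : Frame 15 [] h₁ h₃ := (Frame.refl.setR (by norm_num)).setR (by norm_num)
    have hset : unkSet T h₃ = unkSet T h₁ := unkSet_frame hf₃
    have hU : Unk h₃ = Unk h₁ := Unk.frame hf₃
    have hI₃ : LabelInv T Sol K h₃ := ⟨hP.inv.bits, hP.inv.kn_lt, hP.inv.d_lt, hP.inv.zeroRow,
      hP.inv.zero, hP.inv.sound⟩
    have hclean : ∀ w, Clean T h₃ w ↔ Clean T h₁ w := fun w => Iff.rfl
    refine (run_processVertex hS (hs₁.frame hf₃) hI₃ hSol hl hK e1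
      (by rw [hf₃.1 _ (by norm_num), hP.frame.1 _ (by norm_num), hrK])
      (by rw [e2, hset]; omega)).mono ?_
    rintro h₄ t₄ ⟨hQ, ht₄⟩
    have hsp₄ := hQ.sp
    have hsple := hQ.sp_le
    rw [e2, hset] at hsp₄
    rw [e2] at hsple
    refine ⟨k - 1, by omega, by omega, by omega, ?_, ⟨?_, hQ.inv, ?_, ?_⟩, ?_, ?_⟩
    · obtain ⟨k', rfl⟩ : ∃ k', k = k' + 1 := ⟨k - 1, by omega⟩
      rw [add_mul] at ht
      simp only [Nat.add_sub_cancel]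
      omega
    · exact hP.frame.trans ((hf₃.mono le_rfl (by simp)).trans (hQ.frame.mono (by norm_num)
        (by simp)))
    · intro e he j
      rw [hQ.lab_known e (by rw [hU]; exact fun hc => he (hP.unk_mono e hc))]
      exact hP.lab_known e he j
    · intro e he
      have := hQ.unk_mono he
      rw [hU] at this
      exact hP.unk_mono e this
    · intro p hp
      by_cases hp' : p < h₃.reg rSP
      · rw [hQ.stk_old p hp']
        exact hlt p (by omega)
      · exact hQ.stk_lt p hp (by omega)
    · intro w hw
      by_cases hwv : w = v
      · left
        rw [hwv]
        exact hQ.clean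
      · by_cases hnew : ∀ i < T.d, Unk h₃ (T.eid w i) → Unk h₄ (T.eid w i)
        · rcases hcl w hw with hc | ⟨p, hp, hpw⟩
          · left
            exact hQ.clean_of_clean hl hw hwv ((hclean w).2 hc) hnew
          · right
            have hp' : p < h₁.reg rSP - 1 := by
              by_contra hcon
              have : p = h₁.reg rSP - 1 := by omega
              subst this
              exact hwv hpw.symm
            exact ⟨p, by omega, by rw [hQ.stk_old p (by omega)]; exact hpw⟩
        · right
          push Not at hnew
          obtain ⟨i, hi, hu, hu'⟩ := hnew
          obtain ⟨p, hp1, -, hp3⟩ := hQ.stk_new _ (T.eid_lt hw hi) hu hu' _ (T.side_lt w)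
          exact ⟨p, hp1, hp3.trans (T.ev_eid hw hi)⟩
  · rintro k h₁ t ⟨hk, hkk, ht, hP, hlt, hcl⟩ hval
    have hz : h₁.reg rSP = 0 := by
      by_contra hcon
      have : 0 < h₁.reg rSP := by omega
      simp [this] at hval
    refine ⟨hP, hz, fun w hw => ?_, by omega⟩
    rcases hcl w hw with hc | ⟨p, hp, -⟩
    · exact hc
    · omega

end ArrayRAM

namespace ArrayRAM

open RAM Finset

variable {T : EdgeTable}

/-- Values may be assumed to fit into words. -/
theorem Run.of_bounded {S : ℕ} {p : Prog} {h : HState} {Q : HState → ℕ → Prop}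
    (hr : (∀ x, h.reg x < S) → (∀ a i j, i < S → j < S → h.arr a i j < S) → Run S p h Q) :
    Run S p h Q := fun W σ hS hW hs =>
  hr (fun x => (hs.2.1 x).2) (fun a i j hi hj => (hs.2.2 a i j hi hj).2) W σ hS hW hs

/-! ### Classes of unknown edges -/

variable (T) in
/-- Unknown edges that belong to the same local class at a common vertex. -/
def EdgeAdj (h : HState) (e e' : ℕ) : Prop :=
  e ∈ unkSet T h ∧ e' ∈ unkSet T h ∧ ∃ s < 2, T.ev e s = T.ev e' s ∧ h.arr aCl e s = h.arr aCl e' s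

variable (T) in
/-- The class of an edge under the equivalence that is generated by the local classes. -/
def edgeClass (h : HState) (e : ℕ) : Quot (EdgeAdj T h) := Quot.mk _ e

theorem EdgeAdj.symm {h : HState} {e e' : ℕ} (ha : EdgeAdj T h e e') : EdgeAdj T h e' e := by
  obtain ⟨h1, h2, s, hs, h3, h4⟩ := ha
  exact ⟨h2, h1, s, hs, h3.symm, h4.symm⟩

/-- As the relation is symmetric, a set that is closed under it is a union of classes of the
generated equivalence. -/
theorem mem_of_edgeClass_eq {h : HState} {V : Finset ℕ} {e e' : ℕ}
    (hV : ∀ e ∈ V, ∀ e', EdgeAdj T h e e' → e' ∈ V) (he : e ∈ V)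
    (hc : edgeClass T h e = edgeClass T h e') : e' ∈ V := by
  have key : e ∈ V ↔ e' ∈ V := by
    have hgen := Quot.eqvGen_exact hc
    clear hc he
    induction hgen with
    | rel x y hxy => exact ⟨fun hx => hV x hx y hxy, fun hy => hV y hy x hxy.symm⟩
    | refl x => rfl
    | symm x y _ ih => exact ih.symm
    | trans x y z _ _ ih1 ih2 => exact ih1.trans ih2
  exact key.1 he

open Classical in
variable (T) in
/-- The number of edges in `V` that are equivalent to `e`. -/
noncomputable def classCard (h : HState) (V : Finset ℕ) (e : ℕ) : ℕ :=
  #(V.filter fun e' => edgeClass T h e' = edgeClass T h e)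

theorem classCard_insert_of_eq {h : HState} {V : Finset ℕ} {e x : ℕ} (hx : x ∉ V)
    (hc : edgeClass T h x = edgeClass T h e) :
    classCard T h (insert x V) e = classCard T h V e + 1 := by
  classical
  rw [classCard, filter_insert, if_pos hc, card_insert_of_notMem (by simp [hx])]
  rfl

theorem classCard_insert_of_ne {h : HState} {V : Finset ℕ} {e x : ℕ}
    (hc : edgeClass T h x ≠ edgeClass T h e) :
    classCard T h (insert x V) e = classCard T h V e := by
  classical
  rw [classCard, filter_insert, if_neg hc]
  rfl

theorem classCard_mono {h : HState} {V V' : Finset ℕ} {e : ℕ} (hV : V ⊆ V') :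
    classCard T h V e ≤ classCard T h V' e := by
  classical
  exact card_le_card (filter_subset_filter _ hV)

theorem classCard_congr {h : HState} {V : Finset ℕ} {e e' : ℕ}
    (hc : edgeClass T h e = edgeClass T h e') : classCard T h V e = classCard T h V e' := by
  rw [classCard, classCard, hc]

theorem classCard_le {h : HState} {V : Finset ℕ} {e : ℕ} : classCard T h V e ≤ #V := by
  classical
  exact card_filter_le _ _

theorem classCard_pos {h : HState} {V : Finset ℕ} {e : ℕ} (he : e ∈ V) :
    0 < classCard T h V e := by
  classical
  exact card_pos.2 ⟨e, by simp [he]⟩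

/-- Puts the edge `rEd2` on the stack of the search. -/
def visit : Prog :=
  .seq (storeP aVis (.r rEd2) (.c 0) (.c 1))
  (.seq (storeP aStk (.r rTop) (.c 0) (.r rEd2))
  (.seq (setP rTop (.add (.r rTop) (.c 1)))
  (.seq (setP rCnt (.add (.r rCnt) (.c 1)))
  (whenP (.lt (.r rBest) (.r rCnt)) (.seq (setP rBest (.r rCnt)) (setP rBestE (.r rCur)))))))

/-- Puts the unvisited edges at both ends of `rEd` that are in the same local class as `rEd` on the
stack. -/
def scan : Prog :=
  forP rSide (.c 2) (.seq (setP rV (.ld aEv (.r rEd) (.r rSide)))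
    (forP rI (.r rD) (.seq (setP rEd2 (.ld aEid (.r rV) (.r rI)))
      (whenP (.eq (.ld aVis (.r rEd2) (.c 0)) (.c 0))
        (whenP (.eq (.ld aCl (.r rEd2) (.r rSide)) (.ld aCl (.r rEd) (.r rSide))) visit)))))

/-- Finds the size `rBest` of a largest class of unknown edges, and an edge `rBestE` in it. -/
def largestClass : Prog :=
  .seq (forP rI (.r rE) (storeP aVis (.r rI) (.c 0) (.ld aKn (.r rI) (.c 0))))
  (.seq (setP rBest (.c 0)) (.seq (setP rCnt (.c 0)) (.seq (setP rPtr (.c 0))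
  (.seq (setP rTop (.c 0))
  (loopP (.lt (.c 0) (.add (.r rTop) (.sub (.r rE) (.r rPtr))))
    (iteP (.lt (.c 0) (.r rTop))
      (.seq (setP rTop (.sub (.r rTop) (.c 1)))
        (.seq (setP rEd (.ld aStk (.r rTop) (.c 0))) scan))
      (.seq (setP rEd2 (.r rPtr)) (.seq
        (whenP (.eq (.ld aVis (.r rEd2) (.c 0)) (.c 0))
          (.seq (setP rCur (.r rEd2)) (.seq (setP rCnt (.c 0)) visit)))
        (setP rPtr (.add (.r rPtr) (.c 1)))))))))))

variable (T) in
/-- The invariant of the search: `V` is the set of the visited unknown edges, the edges with `off`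
are being scanned. -/
structure Search (h₀ : HState) (off : ℕ → Prop) (V : Finset ℕ) (h : HState) : Prop where
  frame : Frame 7 [aVis, aStk] h₀ h
  sub : V ⊆ unkSet T h₀
  vis : ∀ e < T.n * T.d, h.arr aVis e 0 = 0 ↔ Unk h₀ e ∧ e ∉ V
  ptr : ∀ e < h.reg rPtr, e ∈ unkSet T h₀ → e ∈ V
  stk : ∀ p < h.reg rTop, h.arr aStk p 0 ∈ V ∧
    edgeClass T h₀ (h.arr aStk p 0) = edgeClass T h₀ (h.reg rCur) ∧ h.reg rCur ∈ unkSet T h₀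
  closed : ∀ e ∈ V, (∃ p < h.reg rTop, h.arr aStk p 0 = e) ∨ off e ∨
    ∀ e', EdgeAdj T h₀ e e' → e' ∈ V
  cnt : h.reg rCnt = classCard T h₀ V (h.reg rCur)
  best : ∀ e ∈ V, classCard T h₀ V e ≤ h.reg rBest
  bestE : h.reg rBest = 0 ∨ (h.reg rBestE ∈ unkSet T h₀ ∧
    h.reg rBest ≤ classCard T h₀ V (h.reg rBestE))

theorem card_unkSet_le (h : HState) : #(unkSet T h) ≤ T.n * T.d :=
  (card_le_card (filter_subset _ _)).trans (by simp)

/-- The counter is the size of the visited part of the current class. The record is updated at every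
visit, so no action is needed when a class is exhausted. -/
theorem run_visit {S x : ℕ} {h₀ h : HState} {off : ℕ → Prop} {V : Finset ℕ} (hS : T.Fits S)
    (hV : Search T h₀ off V h) (hx : x ∈ unkSet T h₀) (hxV : x ∉ V) (hed : h.reg rEd2 = x)
    (hcur : edgeClass T h₀ x = edgeClass T h₀ (h.reg rCur)) (hcurU : h.reg rCur ∈ unkSet T h₀)
    (htop : h.reg rTop + 1 < S) :
    Run S visit h fun h' t => t ≤ 7 ∧ Search T h₀ off (insert x V) h' ∧
      h'.reg rTop = h.reg rTop + 1 ∧ ∀ y, y ∉ [rTop, rCnt, rBest, rBestE] → h'.reg y = h.reg y := by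
  have hle := hS.le
  have hcardV := (classCard_le (T := T) (h := h₀) (e := h.reg rCur)).trans
    ((card_le_card hV.sub).trans (card_unkSet_le h₀))
  rw [← hV.cnt] at hcardV
  have hxlt := (mem_unkSet.1 hx).1
  refine run_seq (run_store (by simp) (by simp) (by simp) (by simp [hed]; omega)
    (by simp; omega) (by simp; omega) ?_)
  refine run_seq (run_store (by simp) (by simp) (by simp) (by simp; omega)
    (by simp; omega) (by simp [hed]; omega) ?_)
  refine run_seq (run_set (by simp) (by simp; omega) ?_)
  refine run_seq (run_set (by simp) (by simp; omega) ?_)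
  set h₁ := (((h.setA aVis _ _ _).setA aStk _ _ _).setR rTop _).setR rCnt _ with hh₁
  have r1 : ∀ y, y ∉ [rTop, rCnt] → h₁.reg y = h.reg y := by
    intro y hy
    simp only [List.mem_cons, List.not_mem_nil, or_false, not_or] at hy
    simp [hh₁, hy.1, hy.2]
  have rtop : h₁.reg rTop = h.reg rTop + 1 := by simp [hh₁]
  have rcnt : h₁.reg rCnt = h.reg rCnt + 1 := by simp [hh₁]
  have avis : ∀ e, h₁.arr aVis e 0 = if e = x then 1 else h.arr aVis e 0 := by
    intro e; simp [hh₁, hed]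
  have astk : ∀ p, h₁.arr aStk p 0 = if p = h.reg rTop then x else h.arr aStk p 0 := by
    intro p; simp [hh₁, hed]
  have hf₁ : Frame 7 [aVis, aStk] h₀ h₁ := by
    rw [hh₁]
    exact (((hV.frame.setA (by simp)).setA (by simp)).setR (by norm_num)).setR (by norm_num)
  clear_value h₁
  have hcnt' : h.reg rCnt + 1 = classCard T h₀ (insert x V) (h.reg rCur) := by
    rw [classCard_insert_of_eq hxV hcur, hV.cnt]
  -- Both outcomes of the comparison with the record are treated together; they differ only in the
  -- two registers of the record.
  have main : ∀ h₂ : HState, h₂.arr = h₁.arr → (∀ y, y ∉ [rBest, rBestE] → h₂.reg y = h₁.reg y) →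
      ((h₂.reg rBest = h.reg rBest ∧ h₂.reg rBestE = h.reg rBestE ∧ h.reg rCnt + 1 ≤ h.reg rBest) ∨
        (h₂.reg rBest = h.reg rCnt + 1 ∧ h₂.reg rBestE = h.reg rCur ∧
          h.reg rBest < h.reg rCnt + 1)) →
      Search T h₀ off (insert x V) h₂ := by
    intro h₂ ha hr hb
    have q1 : h₂.reg rTop = h.reg rTop + 1 := by rw [hr _ (by simp), rtop]
    have q2 : h₂.reg rCnt = h.reg rCnt + 1 := by rw [hr _ (by simp), rcnt]
    have q3 : h₂.reg rCur = h.reg rCur := by rw [hr _ (by simp), r1 _ (by simp)]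
    have q4 : h₂.reg rPtr = h.reg rPtr := by rw [hr _ (by simp), r1 _ (by simp)]
    have q5 : ∀ p, h₂.arr aStk p 0 = if p = h.reg rTop then x else h.arr aStk p 0 := by
      intro p; rw [ha, astk]
    refine ⟨⟨fun y hy => ?_, fun a haa => by rw [ha, hf₁.2 a haa]⟩, ?_, ?_, ?_, ?_, ?_, ?_, ?_, ?_⟩
    · rw [hr y (by simp; omega), hf₁.1 y hy]
    · exact insert_subset hx hV.sub
    · intro e he
      rw [ha, avis, mem_insert, not_or]
      split_ifs with hex
      · simp [hex]
      · rw [hV.vis e he]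
        tauto
    · intro e he hu
      rw [q4] at he
      exact mem_insert_of_mem (hV.ptr e he hu)
    · intro p hp
      rw [q5, q3]
      split_ifs with hpt
      · exact ⟨mem_insert_self _ _, hcur, hcurU⟩
      · obtain ⟨a1, a2, a3⟩ := hV.stk p (by omega)
        exact ⟨mem_insert_of_mem a1, a2, a3⟩
    · intro e he
      rcases mem_insert.1 he with rfl | he
      · exact Or.inl ⟨h.reg rTop, by omega, by rw [q5, if_pos rfl]⟩
      · rcases hV.closed e he with ⟨p, hp, hpe⟩ | ho | hc
        · exact Or.inl ⟨p, by omega, by rw [q5, if_neg (by omega), hpe]⟩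
        · exact Or.inr (Or.inl ho)
        · exact Or.inr (Or.inr fun e' hee => mem_insert_of_mem (hc e' hee))
    · rw [q2, q3, hcnt']
    · intro e he
      by_cases hec : edgeClass T h₀ x = edgeClass T h₀ e
      · rw [classCard_congr (hec.symm.trans hcur), ← hcnt']
        omega
      · rw [classCard_insert_of_ne hec]
        rcases mem_insert.1 he with rfl | he
        · exact absurd rfl hec
        · have := hV.best e he
          omega
    · rcases hb with ⟨b1, b2, b3⟩ | ⟨b1, b2, b3⟩
      · rw [b1, b2]
        rcases hV.bestE with b4 | ⟨b4, b5⟩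
        · omega
        · exact Or.inr ⟨b4, b5.trans (classCard_mono (subset_insert _ _))⟩
      · rw [b1, b2]
        exact Or.inr ⟨hcurU, hcnt'.le⟩
  have e1 : h₁.reg rBest = h.reg rBest := r1 _ (by simp)
  have e2 : h₁.reg rBestE = h.reg rBestE := r1 _ (by simp)
  have e3 : h₁.reg rCur = h.reg rCur := r1 _ (by simp)
  have hcurlt := (mem_unkSet.1 hcurU).1
  refine run_when (by simp) ?_ ?_
  · intro hv
    have hlt : h.reg rBest < h.reg rCnt + 1 := by
      by_contra hcon
      simp [e1, rcnt, hcon] at hv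
    refine run_seq (run_set (by simp) (by simp [rcnt]; omega) ?_)
    refine run_set (by simp) (by simp [e3]; omega) ?_
    refine ⟨by norm_num, main _ rfl ?_ (Or.inr ⟨by simp [rcnt], by simp [e3], hlt⟩), by simp [rtop],
      ?_⟩
    · intro y hy
      simp only [List.mem_cons, List.not_mem_nil, or_false, not_or] at hy
      simp [hy.1, hy.2]
    · intro y hy
      simp only [List.mem_cons, List.not_mem_nil, or_false, not_or] at hy
      rw [← r1 y (by simp [hy.1, hy.2.1])]
      simp [hy]
  · intro hv
    have hlt : ¬ h.reg rBest < h.reg rCnt + 1 := by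
      intro hcon
      simp [e1, rcnt, hcon] at hv
    refine ⟨by norm_num, main _ rfl (fun _ _ => rfl) (Or.inl ⟨e1, e2, by omega⟩), rtop, ?_⟩
    intro y hy
    simp only [List.mem_cons, List.not_mem_nil, or_false, not_or] at hy
    rw [← r1 y (by simp [hy.1, hy.2.1])]

/-- A visit adds one stack entry and one visited edge. Counting visited edges twice turns this into
a decrease of the termination measure of the search. -/
theorem run_scan {S e : ℕ} {h₀ h : HState} {V : Finset ℕ} (hS : T.Fits S) (hs : Stat T h₀)
    (hV : Search T h₀ (· = e) V h) (he : e ∈ V) (hed : h.reg rEd = e)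
    (hcur : edgeClass T h₀ e = edgeClass T h₀ (h.reg rCur)) (hcurU : h.reg rCur ∈ unkSet T h₀)
    (htop : h.reg rTop + 2 * (T.n * T.d) < S + 2 * #V) :
    Run S scan h fun h' t => t ≤ 26 * T.d + 14 ∧ h'.reg rPtr = h.reg rPtr ∧
      ∃ V', Search T h₀ (fun _ => False) V' h' ∧ h'.reg rTop + 2 * #V ≤ h.reg rTop + 2 * #V' := by
  have hle := hS.le
  have h1 := T.n_le_mul
  have h2 := T.d_le_mul
  have heU := hV.sub he
  have helt := (mem_unkSet.1 heU).1
  refine run_for_uniform (B := 13 * T.d + 4) (Nv := 2)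
    (fun s h' => h'.reg rSide = s ∧ h'.reg rEd = e ∧ h'.reg rCur = h.reg rCur ∧
      h'.reg rPtr = h.reg rPtr ∧ ∃ V', V ⊆ V' ∧ Search T h₀ (· = e) V' h' ∧
        h'.reg rTop + 2 * #V ≤ h.reg rTop + 2 * #V' ∧
        ∀ s' < s, ∀ e' ∈ unkSet T h₀, T.ev e s' = T.ev e' s' →
          h₀.arr aCl e s' = h₀.arr aCl e' s' → e' ∈ V') ?_ (by omega) ?_ ?_ ?_
  · refine ⟨by simp, by simp [hed], by simp, by simp, V, subset_rfl, ?_, by simp, by simp⟩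
    exact ⟨hV.frame.setR (by norm_num), hV.sub, hV.vis, hV.ptr, hV.stk, hV.closed, hV.cnt, hV.best,
      hV.bestE⟩
  · rintro s h' - ⟨hs', -⟩
    exact ⟨hs', by simp, by simp⟩
  · rintro s h' hs2 ⟨hs', hed', hcur', hptr', V', hVV, hV', htop', hdone⟩ -
    have hst := hs.frame hV'.frame
    have hev := hst.ev e helt s hs2
    have hvlt := T.ev_lt helt hs2
    set v := T.ev e s with hv
    refine run_seq (run_set (by simp [hed', hs']; omega) (by simp [hed', hs', hev]; omega) ?_)
    refine run_for_uniform (B := 11) (Nv := T.d)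
      (fun i h'' => h''.reg rI = i ∧ h''.reg rV = v ∧ h''.reg rSide = s ∧ h''.reg rEd = e ∧
        h''.reg rCur = h.reg rCur ∧ h''.reg rPtr = h.reg rPtr ∧
        ∃ V'', V' ⊆ V'' ∧ Search T h₀ (· = e) V'' h'' ∧
          h''.reg rTop + 2 * #V ≤ h.reg rTop + 2 * #V'' ∧
          ∀ i' < i, T.eid v i' ∈ unkSet T h₀ →
            h₀.arr aCl e s = h₀.arr aCl (T.eid v i') s → T.eid v i' ∈ V'') ?_ (by omega) ?_ ?_ ?_
    · refine ⟨by simp, by simp [hed', hs', hev], by simp [hs'], by simp [hed'], by simp [hcur'],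
        by simp [hptr'], V', subset_rfl, ?_, by simpa using htop', by simp⟩
      exact ⟨(hV'.frame.setR (by norm_num)).setR (by norm_num), hV'.sub, hV'.vis, hV'.ptr, hV'.stk,
        hV'.closed, hV'.cnt, hV'.best, hV'.bestE⟩
    · rintro i h'' - ⟨hi, -, -, -, -, -, V'', -, hV'', -⟩
      exact ⟨hi, by simp [(hs.frame hV''.frame).d], by simp⟩
    · rintro i h'' hid ⟨hi, hv'', hs'', hed'', hcur'', hptr'', V'', hVV', hV'', htop'', hdone'⟩ -
      have hst' := hs.frame hV''.frame
      have e2 := hst'.eid v hvlt i hid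
      have e3 := T.eid_lt hvlt hid
      have hcl : h''.arr aCl = h₀.arr aCl := hV''.frame.2 _ (by simp)
      refine run_seq (run_set (by simp [hv'', hi]; omega) (by simp [hv'', hi, e2]; omega) ?_)
      set h₁ := h''.setR rEd2 ((HExpr.ld aEid (.r rV) (.r rI)).val h'') with hh₁
      have q1 : h₁.reg rEd2 = T.eid v i := by simp [hh₁, hv'', hi, e2]
      have hS₁ : Search T h₀ (· = e) V'' h₁ := ⟨hV''.frame.setR (by norm_num), hV''.sub, hV''.vis,
        hV''.ptr, hV''.stk, hV''.closed, hV''.cnt, hV''.best, hV''.bestE⟩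
      have q2 : h₁.reg rTop = h''.reg rTop := by simp [hh₁]
      have q3 : ∀ y, y ≠ rEd2 → h₁.reg y = h''.reg y := by
        intro y hy; simp [hh₁, hy]
      have q4 : h₁.arr = h''.arr := rfl
      clear_value h₁
      have hvis := hV''.vis _ e3
      have hskip : (T.eid v i ∈ unkSet T h₀ → h₀.arr aCl e s = h₀.arr aCl (T.eid v i) s →
          T.eid v i ∈ V'') → ∀ i' < i + 1, T.eid v i' ∈ unkSet T h₀ →
            h₀.arr aCl e s = h₀.arr aCl (T.eid v i') s → T.eid v i' ∈ V'' := by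
        intro hh i' hi' 
        rcases Nat.lt_succ_iff_lt_or_eq.1 hi' with h3 | rfl
        · exact hdone' i' h3
        · exact hh
      have hsame : ∀ V₃, Search T h₀ (· = e) V₃ h₁ → Search T h₀ (· = e) V₃ (h₁.setR rI (i + 1)) :=
        fun V₃ hh => ⟨hh.frame.setR (by norm_num), hh.sub, hh.vis,
        hh.ptr, hh.stk, hh.closed, hh.cnt, hh.best, hh.bestE⟩
      refine run_when (by simp [q1]; omega) ?_ ?_
      · intro hval
        have hun : Unk h₀ (T.eid v i) ∧ T.eid v i ∉ V'' := by
          rw [← hvis]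
          by_contra hcon
          simp [q1, q4, hcon] at hval
        have hmem : T.eid v i ∈ unkSet T h₀ := mem_unkSet.2 ⟨e3, hun.1⟩
        refine run_when (by simp [q1, q3, hs'', hed'']; omega) ?_ ?_
        · intro hval2
          have hcle : h₀.arr aCl (T.eid v i) s = h₀.arr aCl e s := by
            by_contra hcon
            simp [q1, q3, q4, hs'', hed'', hcl, hcon] at hval2
          have hadj : EdgeAdj T h₀ e (T.eid v i) := by
            refine ⟨heU, hmem, s, hs2, ?_, hcle.symm⟩
            have h4 := T.ev_eid hvlt hid
            have h5 := T.side_ev helt hs2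
            rw [← hv] at h5
            rw [h5] at h4
            rw [h4]
          have hcl' : edgeClass T h₀ (T.eid v i) = edgeClass T h₀ (h₁.reg rCur) := by
            rw [q3 _ (by norm_num), hcur'', ← hcur]
            exact (Quot.sound hadj).symm
          have hcardlt : #V'' < #(unkSet T h₀) :=
            card_lt_card ⟨hV''.sub, fun hcon => hun.2 (hcon hmem)⟩
          have hcardU := card_unkSet_le (T := T) h₀
          refine (run_visit hS hS₁ hmem hun.2 q1 hcl'
            (by rw [q3 _ (by norm_num), hcur'']; exact hcurU) (by rw [q2]; omega)).mono ?_
          rintro h₂ t₂ ⟨ht₂, hV₂, htop₂, hreg₂⟩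
          refine ⟨?_, by omega, by simp, ?_, ?_, ?_, ?_, ?_, insert (T.eid v i) V'',
            hVV'.trans (subset_insert _ _), ?_, ?_, ?_⟩
          · rw [hreg₂ _ (by simp), q3 _ (by norm_num), hi]
          · rw [HState.setR_reg, if_neg (by norm_num), hreg₂ _ (by simp), q3 _ (by norm_num), hv'']
          · rw [HState.setR_reg, if_neg (by norm_num), hreg₂ _ (by simp), q3 _ (by norm_num), hs'']
          · rw [HState.setR_reg, if_neg (by norm_num), hreg₂ _ (by simp), q3 _ (by norm_num), hed'']
          · rw [HState.setR_reg, if_neg (by norm_num), hreg₂ _ (by simp), q3 _ (by norm_num),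
              hcur'']
          · rw [HState.setR_reg, if_neg (by norm_num), hreg₂ _ (by simp), q3 _ (by norm_num),
              hptr'']
          · exact ⟨hV₂.frame.setR (by norm_num), hV₂.sub, hV₂.vis,
              hV₂.ptr, hV₂.stk, hV₂.closed, hV₂.cnt, hV₂.best, hV₂.bestE⟩
          · rw [HState.setR_reg, if_neg (by norm_num), htop₂, card_insert_of_notMem hun.2]
            omega
          · intro i' hi' hm hc
            rcases Nat.lt_succ_iff_lt_or_eq.1 hi' with h3 | rfl
            · exact mem_insert_of_mem (hdone' i' h3 hm hc)
            · exact mem_insert_self _ _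
        · intro hval2
          have hcle : ¬ h₀.arr aCl (T.eid v i) s = h₀.arr aCl e s := by
            intro hcon
            simp [q1, q3, q4, hs'', hed'', hcl, hcon] at hval2
          refine ⟨by simp [q3, hi], by omega, by simp, by simp [q3, hv''], by simp [q3, hs''],
            by simp [q3, hed''], by simp [q3, hcur''], by simp [q3, hptr''], V'', hVV', hsame _ hS₁,
            by simpa [q2] using htop'', hskip fun _ hc => absurd hc.symm hcle⟩
      · intro hval
        have hun : ¬ (Unk h₀ (T.eid v i) ∧ T.eid v i ∉ V'') := by
          rw [← hvis]
          intro hcon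
          simp [q1, q4, hcon] at hval
        refine ⟨by simp [q3, hi], by omega, by simp, by simp [q3, hv''], by simp [q3, hs''],
            by simp [q3, hed''], by simp [q3, hcur''], by simp [q3, hptr''], V'', hVV', hsame _ hS₁,
            by simpa [q2] using htop'', hskip fun hm _ => ?_⟩
        by_contra hcon
        exact hun ⟨(mem_unkSet.1 hm).2, hcon⟩
    · rintro h'' t ⟨hi, hv'', hs'', hed'', hcur'', hptr'', V'', hVV', hV'', htop'', hdone'⟩ - ht
      refine ⟨hs'', by omega, by simp, by simp [hed''], by simp [hcur''], by simp [hptr''], V'',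
        hVV.trans hVV', ⟨hV''.frame.setR (by norm_num), hV''.sub, hV''.vis, hV''.ptr, hV''.stk,
        hV''.closed, hV''.cnt, hV''.best, hV''.bestE⟩, by simpa using htop'', ?_⟩
      intro s' hs1 e' he' hee hcc
      rcases Nat.lt_succ_iff_lt_or_eq.1 hs1 with h3 | rfl
      · exact hVV' (hdone s' h3 e' he' hee hcc)
      -- A neighbour of e through side s is one of the d edges at the common vertex, so the inner
      -- loop has met it.
      · obtain ⟨i, hi, hie⟩ := T.exists_eid (mem_unkSet.1 he').1 hs2
        rw [← hee] at hie
        rw [← hie] at he' hcc ⊢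
        exact hdone' i hi he' hcc
  · rintro h' t ⟨-, -, -, hptr, V', hVV, hV', htop', hdone⟩ - ht
    refine ⟨by omega, hptr, V', ⟨hV'.frame, hV'.sub, hV'.vis, hV'.ptr, hV'.stk, ?_, hV'.cnt,
      hV'.best, hV'.bestE⟩, htop'⟩
    intro x hx
    rcases hV'.closed x hx with h3 | rfl | h3
    · exact Or.inl h3
    · right; right
      rintro e' ⟨-, he', s, hs2, hee, hcc⟩
      exact hdone s hs2 e' he' hee hcc
    · exact Or.inr (Or.inr h3)

/-- This is a depth-first search in which known edges count as visited from the start. The measure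
is the stack height, plus twice the number of unvisited unknown edges, plus the number of edges that
the pointer has not passed. When the stack is empty, the visited edges form a union of classes, so
an unvisited edge starts a fresh class with counter 0. -/
theorem run_largestClass {S : ℕ} {h : HState} (hS : T.Fits S) (hs : Stat T h) :
    Run S largestClass h fun h' t => Frame 7 [aVis, aStk] h h' ∧
      t ≤ 3 * (T.n * T.d) * (26 * T.d + 20) + 3 * (T.n * T.d) + 7 ∧
      (h'.reg rBest = 0 → unkSet T h = ∅) ∧
      (h'.reg rBest ≠ 0 → h'.reg rBestE ∈ unkSet T h ∧ ∀ e ∈ unkSet T h,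
        classCard T h (unkSet T h) e ≤ classCard T h (unkSet T h) (h'.reg rBestE)) := by
  have hle := hS.le
  have h1 := T.n_le_mul
  have h2 := T.d_le_mul
  have hcardU := card_unkSet_le (T := T) h
  refine run_seq (run_for_uniform (B := 1) (Nv := T.n * T.d)
    (fun i h' => Frame 7 [aVis, aStk] h h' ∧ h'.reg rI = i ∧
      ∀ e < i, h'.arr aVis e 0 = h.arr aKn e 0) ?_ (by omega) ?_ ?_ ?_)
  · exact ⟨Frame.refl.setR (by norm_num), by simp, by simp⟩
  · rintro i h' - ⟨hf, hi, -⟩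
    exact ⟨hi, by simp [(hs.frame hf).e], by simp⟩
  · rintro i h' hid ⟨hf, hi, hvis⟩ -
    refine Run.of_bounded fun _ hbd => ?_
    refine run_store (by simp) (by simp) (by simp [hi]; omega) (by simp [hi]; omega)
      (by simp; omega) (by simpa [hi] using hbd aKn i 0 (by omega) (by omega)) ?_
    refine ⟨by simp [hi], le_rfl, (hf.setA (by simp)).setR (by norm_num), by simp, ?_⟩
    intro e he
    have hk : h'.arr aKn = h.arr aKn := hf.2 _ (by simp)
    simp only [HState.setR_arr, HState.setA_arr, HExpr.val, hi, hk]
    norm_num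
    split_ifs with hei
    · rw [hei]
    · exact hvis e (by omega)
  rintro h₁ t₁ ⟨hf₁, -, hvis₁⟩ - ht₁
  refine run_seq (run_set (by simp) (by simp; omega) ?_)
  refine run_seq (run_set (by simp) (by simp; omega) ?_)
  refine run_seq (run_set (by simp) (by simp; omega) ?_)
  refine run_seq (run_set (by simp) (by simp; omega) ?_)
  set h₂ := (((h₁.setR rBest _).setR rCnt _).setR rPtr _).setR rTop _ with hh₂
  have hS₂ : Search T h (fun _ => False) ∅ h₂ := by
    refine ⟨?_, by simp, ?_, by simp [hh₂], by simp [hh₂], by simp, by simp [hh₂, classCard],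
      by simp, by simp [hh₂]⟩
    · rw [hh₂]
      exact (((hf₁.setR (by norm_num)).setR (by norm_num)).setR (by norm_num)).setR (by norm_num)
    · intro e he
      have : h₂.arr aVis e 0 = h.arr aKn e 0 := hvis₁ e he
      simp [this, Unk]
  have htop₂ : h₂.reg rTop = 0 := by simp [hh₂]
  have hptr₂ : h₂.reg rPtr = 0 := by simp [hh₂]
  clear_value h₂
  set B := 26 * T.d + 20 with hB
  refine run_loop (fun k h' t => ∃ V, Search T h (fun _ => False) V h' ∧
      k + 2 * #V + h'.reg rPtr = h'.reg rTop + 2 * #(unkSet T h) + T.n * T.d ∧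
      h'.reg rPtr ≤ T.n * T.d ∧ k ≤ 3 * (T.n * T.d) ∧ h'.reg rTop ≤ 2 * #V ∧
      t + k * B ≤ 3 * (T.n * T.d) * B) (k := 2 * #(unkSet T h) + T.n * T.d) ?_ ?_ ?_ ?_
  · refine ⟨∅, hS₂, by simp [htop₂, hptr₂], by omega, by omega, by omega, ?_⟩
    rw [zero_add]
    exact Nat.mul_le_mul_right _ (by omega)
  · simp
  · rintro k h₃ t ⟨V, hV, hk, hptr, hk3, htop, ht⟩ hval
    have hs₃ := hs.frame hV.frame
    have hVU := card_le_card hV.sub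
    refine run_ite (by simp) ?_ ?_
    · intro hval2
      have hpos : 0 < h₃.reg rTop := by
        by_contra hcon
        simp [hcon] at hval2
      obtain ⟨s1, s2, s3⟩ := hV.stk (h₃.reg rTop - 1) (by omega)
      set e := h₃.arr aStk (h₃.reg rTop - 1) 0 with he
      have helt := (mem_unkSet.1 (hV.sub s1)).1
      refine run_seq (run_set (by simp) (by simp; omega) ?_)
      refine run_seq (run_set (by simp; omega) (by simp; omega) ?_)
      set h₄ := (h₃.setR rTop _).setR rEd _ with hh₄
      have r1 : h₄.reg rEd = e := by simp [hh₄, he]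
      have r2 : h₄.reg rTop = h₃.reg rTop - 1 := by simp [hh₄]
      have r3 : h₄.reg rPtr = h₃.reg rPtr := by simp [hh₄]
      have r4 : h₄.reg rCur = h₃.reg rCur := by simp [hh₄]
      have hV₄ : Search T h (· = e) V h₄ := by
        refine ⟨?_, hV.sub, hV.vis, hV.ptr, ?_, ?_, hV.cnt, hV.best, hV.bestE⟩
        · rw [hh₄]
          exact (hV.frame.setR (by norm_num)).setR (by norm_num)
        · intro p hp
          rw [r2] at hp
          exact hV.stk p (by omega)
        · intro x hx
          rcases hV.closed x hx with ⟨p, hp, hpx⟩ | h5 | h5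
          · by_cases hpt : p = h₃.reg rTop - 1
            · right; left
              rw [← hpx, hpt]
            · exact Or.inl ⟨p, by omega, hpx⟩
          · exact h5.elim
          · exact Or.inr (Or.inr h5)
      clear_value h₄
      refine (run_scan hS hs hV₄ s1 r1 (by rw [r4]; exact s2) (by rw [r4]; exact s3)
        (by rw [r2]; omega)).mono ?_
      rintro h₅ t₅ ⟨ht₅, hptr₅, V', hV', htop'⟩
      have hVU' := card_le_card hV'.sub
      rw [r2] at htop'
      rw [r3] at hptr₅
      refine ⟨h₅.reg rTop + 2 * #(unkSet T h) + T.n * T.d - 2 * #V' - h₅.reg rPtr, by omega, V', hV',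
        by omega, by omega, by omega, by omega, ?_⟩
      set k' := h₅.reg rTop + 2 * #(unkSet T h) + T.n * T.d - 2 * #V' - h₅.reg rPtr with hk'
      have hkk : k' + 1 ≤ k := by omega
      have := Nat.mul_le_mul_right B hkk
      rw [add_mul] at this
      omega
    · intro hval2
      have hz : h₃.reg rTop = 0 := by
        by_contra hcon
        have : 0 < h₃.reg rTop := by omega
        simp [this] at hval2
      have hlt : h₃.reg rPtr < T.n * T.d := by
        by_contra hcon
        have : T.n * T.d - h₃.reg rPtr = 0 := by omega
        simp [hz, hs₃.e, this] at hval
      have hclosed : ∀ e ∈ V, ∀ e', EdgeAdj T h e e' → e' ∈ V := by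
        intro e he
        rcases hV.closed e he with ⟨p, hp, -⟩ | h5 | h5
        · omega
        · exact h5.elim
        · exact h5
      refine run_seq (run_set (by simp) (by simp; omega) ?_)
      set x := h₃.reg rPtr with hx
      set h₄ := h₃.setR rEd2 _ with hh₄
      have r1 : h₄.reg rEd2 = x := by simp [hh₄, hx]
      have r6 : ∀ y, y ≠ rEd2 → h₄.reg y = h₃.reg y := by
        intro y hy; simp [hh₄, hy]
      have r5 : h₄.arr = h₃.arr := rfl
      have hV₄ : Search T h (fun _ => False) V h₄ := by
        refine ⟨?_, hV.sub, hV.vis, hV.ptr, hV.stk, hV.closed, hV.cnt, hV.best, hV.bestE⟩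
        rw [hh₄]
        exact hV.frame.setR (by norm_num)
      clear_value h₄
      have hvis := hV.vis x hlt
      have hfin : ∀ V' h₅, Search T h (fun _ => False) V' h₅ → (x ∈ unkSet T h → x ∈ V') →
          h₅.reg rPtr = x → Search T h (fun _ => False) V' (h₅.setR rPtr (x + 1)) := by
        intro V' h₅ hh hx' hp
        refine ⟨hh.frame.setR (by norm_num), hh.sub, hh.vis, ?_, hh.stk, hh.closed, hh.cnt,
          hh.best, hh.bestE⟩
        intro e he hu
        simp only [HState.setR_reg, if_true] at he
        rcases Nat.lt_succ_iff_lt_or_eq.1 he with h3 | rfl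
        · exact hh.ptr e (by rw [hp]; exact h3) hu
        · exact hx' hu
      refine run_seq (run_when (by simp [r1]; omega) ?_ ?_)
      · intro hval3
        have hun : Unk h x ∧ x ∉ V := by
          rw [← hvis]
          by_contra hcon
          simp [r1, r5, hcon] at hval3
        have hxU : x ∈ unkSet T h := mem_unkSet.2 ⟨hlt, hun.1⟩
        refine run_seq (run_set (by simp) (by simp [r1]; omega) ?_)
        refine run_seq (run_set (by simp) (by simp; omega) ?_)
        set h₅ := (h₄.setR rCur _).setR rCnt _ with hh₅
        have u1 : h₅.reg rEd2 = x := by simp [hh₅, r1]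
        have u4 : h₅.reg rCur = x := by simp [hh₅, r1]
        have u5 : h₅.reg rCnt = 0 := by simp [hh₅]
        have u6 : ∀ y, y ≠ rCur → y ≠ rCnt → h₅.reg y = h₄.reg y := by
          intro y hy hy'; simp [hh₅, hy, hy']
        have hV₅ : Search T h (fun _ => False) V h₅ := by
          refine ⟨?_, hV₄.sub, hV₄.vis, ?_, ?_, fun e he => Or.inr (Or.inr (hclosed e he)), ?_, ?_,
            ?_⟩
          · rw [hh₅]
            exact (hV₄.frame.setR (by norm_num)).setR (by norm_num)
          · rw [u6 _ (by norm_num) (by norm_num)]; exact hV₄.ptr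
          · intro p hp
            rw [u6 _ (by norm_num) (by norm_num), r6 _ (by norm_num)] at hp
            omega
          · classical
            rw [u4, u5, classCard]
            symm
            rw [card_eq_zero, filter_eq_empty_iff]
            intro e he hee
            exact hun.2 (mem_of_edgeClass_eq hclosed he hee)
          · rw [u6 _ (by norm_num) (by norm_num)]; exact hV₄.best
          · rw [u6 _ (by norm_num) (by norm_num), u6 _ (by norm_num) (by norm_num)]
            exact hV₄.bestE
        have hcardlt : #V < #(unkSet T h) := card_lt_card ⟨hV.sub, fun hcon => hun.2 (hcon hxU)⟩
        clear_value h₅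
        refine (run_visit hS hV₅ hxU hun.2 u1 (by rw [u4]) (by rw [u4]; exact hxU)
          (by rw [u6 _ (by norm_num) (by norm_num), r6 _ (by norm_num)]; omega)).mono ?_
        rintro h₆ t₆ ⟨ht₆, hV₆, htop₆, hreg₆⟩
        rw [u6 _ (by norm_num) (by norm_num), r6 _ (by norm_num)] at htop₆
        have hptr₆ : h₆.reg rPtr = x := by
          rw [hreg₆ _ (by simp), u6 _ (by norm_num) (by norm_num), r6 _ (by norm_num)]
        refine run_set (by simp) (by simp [hptr₆]; omega) ?_
        have hval₆ : (HExpr.add (.r rPtr) (.c 1)).val h₆ = x + 1 := by simp [hptr₆]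
        rw [hval₆]
        have hcard := card_insert_of_notMem hun.2
        -- The stack grows by one, one unvisited edge less counts for two, and the pointer advances
        -- by one: 1 - 2 - 1 = -2.
        refine ⟨k - 2, by omega, insert x V, hfin _ _ hV₆ (fun _ => mem_insert_self _ _) hptr₆, ?_,
          ?_, by omega, ?_, ?_⟩
        · simp [htop₆, hcard, hz]
          omega
        · simp; omega
        · simp [htop₆, hcard, hz]; omega
        · have hkk : k - 2 + 1 ≤ k := by omega
          have := Nat.mul_le_mul_right B hkk
          rw [add_mul] at this
          omega
      · intro hval3
        have hun : x ∈ unkSet T h → x ∈ V := by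
          intro hx'
          by_contra hcon
          have := hvis.2 ⟨(mem_unkSet.1 hx').2, hcon⟩
          simp [r1, r5, this] at hval3
        have hptr₄ : h₄.reg rPtr = x := r6 _ (by norm_num)
        have htop₄ : h₄.reg rTop = 0 := by rw [r6 _ (by norm_num), hz]
        refine run_set (by simp) (by simp [hptr₄]; omega) ?_
        have hval₆ : (HExpr.add (.r rPtr) (.c 1)).val h₄ = x + 1 := by simp [hptr₄]
        rw [hval₆]
        refine ⟨k - 1, by omega, V, hfin _ _ hV₄ hun hptr₄, ?_, ?_, by omega, ?_, ?_⟩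
        · simp [htop₄]
          omega
        · simp; omega
        · simp [htop₄]
        · have hkk : k - 1 + 1 ≤ k := by omega
          have := Nat.mul_le_mul_right B hkk
          rw [add_mul] at this
          omega
  · rintro k h₃ t ⟨V, hV, hk, hptr, hk3, htop, ht⟩ hval
    have hs₃ := hs.frame hV.frame
    have hfin : h₃.reg rTop = 0 ∧ T.n * T.d ≤ h₃.reg rPtr := by
      by_contra hcon
      have : 0 < h₃.reg rTop + (T.n * T.d - h₃.reg rPtr) := by omega
      simp [hs₃.e, this] at hval
    have hVU : V = unkSet T h := by
      refine subset_antisymm hV.sub fun e he => hV.ptr e ?_ he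
      have := (mem_unkSet.1 he).1
      omega
    subst hVU
    refine ⟨hV.frame, by omega, ?_, ?_⟩
    · intro hb
      by_contra hne
      obtain ⟨e, he⟩ := nonempty_iff_ne_empty.2 hne
      have h3 := hV.best e he
      have h4 := classCard_pos (T := T) (h := h) he
      omega
    · intro hb
      obtain ⟨h3, h4⟩ := hV.bestE.resolve_left hb
      exact ⟨h3, fun e he => (hV.best e he).trans h4⟩

end ArrayRAM

/-! ### Rounds of guessing and deduction -/

namespace ArrayRAM

open RAM Finset

variable {T : EdgeTable}

theorem LabelInv.frame {Sol : (ℕ → ZMod 2) → Prop} {K : ℕ} {h h' : HState}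
    (hI : LabelInv T Sol K h) {k : ℕ} {A : List ℕ} (hf : Frame k A h h')
    (hA : aLab ∉ A ∧ aKn ∉ A := by decide) : LabelInv T Sol K h' := by
  have h1 := hf.2 _ hA.1
  have h2 := hf.2 _ hA.2
  have h3 := lab_frame hf hA.1
  have h4 := Unk.frame hf hA.2
  refine ⟨fun e j => ?_, fun e => ?_, hI.d_lt, fun j => ?_, fun e he j hor => ?_, ?_⟩
  · rw [h1]; exact hI.bits e j
  · rw [h2]; exact hI.kn_lt e
  · rw [h1]; exact hI.zeroRow j
  · rw [h1]; rw [h4] at hor; exact hI.zero e he j hor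
  · rw [h3, h4]; exact hI.sound

theorem Clean.frame {h h' : HState} {v : ℕ} (hc : Clean T h v) {k : ℕ} {A : List ℕ}
    (hf : Frame k A h h') (hA : aKn ∉ A ∧ aCl ∉ A := by decide) : Clean T h' v := by
  have h2 := hf.2 _ hA.2
  have h4 := Unk.frame hf hA.1
  unfold Clean
  rw [h2, h4]
  exact hc

end ArrayRAM

namespace EdgeTable

open Finset

/-- Every nonempty set of edges in `U₀` in which no edge is determined by the edges outside has a
class with at least `Q` edges, for every equivalence that is coarser than the local ones. -/
def Expanding (T : EdgeTable) (Q : ℕ) (U₀ : Finset ℕ) : Prop :=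
  ∀ U ⊆ U₀, U.Nonempty →
    (∀ v < 2 * T.n, ∀ i < T.d, T.eid v i ∈ U → ∃ x, T.Loc (· ∈ U) v T.m x ∧ x i ≠ 0) →
    ∀ {α : Type} (cl : ℕ → α), (∀ v < 2 * T.n, ∀ i < T.d, ∀ i' < T.d, T.eid v i ∈ U →
      T.eid v i' ∈ U → (∀ x, T.Loc (· ∈ U) v T.m x → x i = x i') →
        cl (T.eid v i) = cl (T.eid v i')) →
    ∃ e ∈ U, ∃ D ⊆ U, Q ≤ #D ∧ ∀ e' ∈ D, cl e' = cl e

end EdgeTable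

namespace ArrayRAM

open RAM Finset

variable {T : EdgeTable}

/-- At a clean vertex, equality of stored representatives can be read back as agreement on the local
code. -/
theorem EdgeAdj.eq_of_clean {h : HState} {e e' : ℕ} (hc : ∀ w < 2 * T.n, Clean T h w)
    (ha : EdgeAdj T h e e') : ∃ v < 2 * T.n, ∃ i < T.d, ∃ i' < T.d, T.eid v i = e ∧
      T.eid v i' = e' ∧ ∀ x, T.Loc (Unk h) v T.m x → x i = x i' := by
  obtain ⟨he, he', s, hs, hv, hcl⟩ := ha
  rw [mem_unkSet] at he he'
  obtain ⟨i, hi, hie⟩ := T.exists_eid he.1 hs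
  obtain ⟨i', hi', hie'⟩ := T.exists_eid he'.1 hs
  rw [← hv] at hie'
  have hvlt := T.ev_lt he.1 hs
  refine ⟨T.ev e s, hvlt, i, hi, i', hi', hie, hie', ?_⟩
  refine ((hc _ hvlt i hi (by rw [hie]; exact he.2)).2 i' hi' (by rw [hie']; exact he'.2)).1 ?_
  have hside : T.side (T.ev e s) = s := T.side_ev he.1 hs
  rw [hie, hie', hside, hcl]

/-- The array of known flags extends beyond nd, so the predicate and the finite set agree only on
numbers of edges. The local code looks at no others. -/
theorem loc_unk_iff {h : HState} {v k : ℕ} (hv : v < 2 * T.n) (x : ℕ → ZMod 2) :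
    T.Loc (· ∈ unkSet T h) v k x ↔ T.Loc (Unk h) v k x := by
  have key : ∀ i < T.d, (T.eid v i ∈ unkSet T h ↔ Unk h (T.eid v i)) := fun i hi => by
    rw [mem_unkSet, and_iff_right (T.eid_lt hv hi)]
  constructor
  · exact fun hx => ⟨fun i hi hu => hx.1 i hi (mt (key i hi).1 hu), hx.2⟩
  · exact fun hx => ⟨fun i hi hu => hx.1 i hi (mt (key i hi).2 hu), hx.2⟩

/-- If one edge of a largest class becomes known, then the whole class does. -/
theorem card_unkSet_of_guess {Q e : ℕ} {U₀ : Finset ℕ} {h h' : HState} (hQ : T.Expanding Q U₀)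
    (hU : unkSet T h ⊆ U₀) (hc : ∀ w < 2 * T.n, Clean T h w) (he : e ∈ unkSet T h)
    (hmax : ∀ e' ∈ unkSet T h, classCard T h (unkSet T h) e' ≤ classCard T h (unkSet T h) e)
    (hc' : ∀ w < 2 * T.n, Clean T h' w) (hmono : ∀ e, Unk h' e → Unk h e) (he' : ¬ Unk h' e) :
    #(unkSet T h') + Q ≤ #(unkSet T h) := by
  classical
  have hsub : unkSet T h' ⊆ unkSet T h := fun x hx => by
    rw [mem_unkSet] at hx ⊢
    exact ⟨hx.1, hmono x hx.2⟩
  obtain ⟨e₁, he₁, D, hD, hQD, hDc⟩ := hQ (unkSet T h) hU ⟨e, he⟩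
    (fun v hv i hi hi' => by
      obtain ⟨x, hx, hxi⟩ := (hc v hv i hi (mem_unkSet.1 hi').2).1
      exact ⟨x, (loc_unk_iff hv x).2 hx, hxi⟩)
    (edgeClass T h) (fun v hv i hi i' hi' hu hu' hx => by
      refine Quot.sound ⟨hu, hu', T.side v, T.side_lt v, ?_, ?_⟩
      · exact (T.ev_eid hv hi).trans (T.ev_eid hv hi').symm
      · exact ((hc v hv i hi (mem_unkSet.1 hu).2).2 i' hi' (mem_unkSet.1 hu').2).2
          fun x hx' => hx x ((loc_unk_iff hv x).2 hx'))
  have hcard : Q ≤ classCard T h (unkSet T h) e := by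
    refine hQD.trans (le_trans ?_ (hmax e₁ he₁))
    exact card_le_card fun x hx => by
      rw [mem_filter]
      exact ⟨hD hx, hDc x hx⟩
  -- Suppose x has become known, y is in its local class, and y is still unknown. By cleanness, some
  -- word w of the new local code is nonzero at y. It is a word of the old local code as well, so it
  -- has the same symbol at x; but w vanishes at the known edge x.
  have hclosed : ∀ x ∈ unkSet T h \ unkSet T h', ∀ y, EdgeAdj T h x y →
      y ∈ unkSet T h \ unkSet T h' := by
    intro x hx y hxy
    rw [mem_sdiff] at hx ⊢
    refine ⟨hxy.2.1, fun hy => ?_⟩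
    obtain ⟨v, hv, i, hi, i', hi', rfl, rfl, hloc⟩ := hxy.eq_of_clean hc
    obtain ⟨w, hw, hwi⟩ := (hc' v hv i' hi' (mem_unkSet.1 hy).2).1
    have hw' : T.Loc (Unk h) v T.m w := ⟨fun k hk hu => hw.1 k hk fun hcon => hu (hmono _ hcon),
      hw.2⟩
    apply hwi
    rw [← hloc w hw']
    exact hw.1 i hi fun hcon => hx.2 (mem_unkSet.2 ⟨(mem_unkSet.1 hx.1).1, hcon⟩)
  have hdisj : (unkSet T h).filter (fun x => edgeClass T h x = edgeClass T h e) ⊆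
      unkSet T h \ unkSet T h' := by
    intro x hx
    rw [mem_filter] at hx
    refine mem_of_edgeClass_eq hclosed ?_ hx.2.symm
    rw [mem_sdiff]
    exact ⟨he, fun hcon => he' (mem_unkSet.1 hcon).2⟩
  have h1 := card_le_card hdisj
  rw [card_sdiff_of_subset hsub] at h1
  have h2 := card_le_card hsub
  unfold classCard at hcard
  omega

/-- Labels all edges that are determined by the labeled ones, and finds a largest class of the
others. -/
def deduce : Prog :=
  .seq (forP rI (.r rNN) (storeP aStk (.r rI) (.c 0) (.r rI)))
    (.seq (setP rSP (.r rNN)) (.seq propagate largestClass))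

/-- Introduces a variable for the label of the edge `rBestE`. -/
def guess : Prog :=
  .seq (storeP aKn (.r rBestE) (.c 0) (.c 1)) (.seq (storeP aLab (.r rBestE) (.r rK) (.c 1))
    (setP rK (.add (.r rK) (.c 1))))

/-- Labels all edges. -/
def labelEdges : Prog := .seq deduce (loopP (.r rBest) (.seq guess deduce))

/-- The four spare units pay for the guess before the deduction and for the test of the surrounding
loop. -/
theorem deduce_time {n d K a b c : ℕ} (hn : 2 ≤ n) (hd : 0 < d) (hK : d < K)
    (ha : a ≤ 2 * n * (1 + 2) + 2) (hb : b ≤ (2 * n + 2 * (n * d)) * (200 * d ^ 2 * K + 3) + 1)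
    (hc : c ≤ 3 * (n * d) * (26 * d + 20) + 3 * (n * d) + 7) :
    a + (1 + (b + c)) + 4 ≤ 1000 * n * d ^ 3 * K := by
  obtain ⟨k, rfl⟩ : ∃ k, K = d + 1 + k := ⟨K - (d + 1), by omega⟩
  obtain ⟨l, rfl⟩ : ∃ l, d = l + 1 := ⟨d - 1, by omega⟩
  obtain ⟨j, rfl⟩ : ∃ j, n = j + 2 := ⟨n - 2, by omega⟩
  ring_nf at *
  omega

/-- The stack is filled with all vertices, so no cleanness has to survive a guess. The gain of Q
edges is stated for an arbitrary later clean state, because the guess and the next deduction are yet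
to come. -/
theorem run_deduce {S K : ℕ} {Sol : (ℕ → ZMod 2) → Prop} {h : HState} (hS : T.Fits S)
    (hs : Stat T h) (hI : LabelInv T Sol K h) (hSol : ∀ c, Sol c → T.IsWord c)
    (hK : K < S) (hrK : h.reg rK = K) {Q : ℕ} {U₀ : Finset ℕ} (hQ : T.Expanding Q U₀)
    (hU : unkSet T h ⊆ U₀) :
    Run S deduce h fun h' t => Frame 7 [aLab, aKn, aG, aCl, aStk, aVis] h h' ∧
      LabelInv T Sol K h' ∧ (∀ e, ¬ Unk h e → ∀ j, h'.arr aLab e j = h.arr aLab e j) ∧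
      (∀ e, Unk h' e → Unk h e) ∧ (∀ w < 2 * T.n, Clean T h' w) ∧
      t + 4 ≤ 1000 * T.n * T.d ^ 3 * K ∧ (h'.reg rBest = 0 → unkSet T h' = ∅) ∧
      (h'.reg rBest ≠ 0 → h'.reg rBestE ∈ unkSet T h' ∧ ∀ h'' : HState,
        (∀ w < 2 * T.n, Clean T h'' w) → (∀ e, Unk h'' e → Unk h' e) →
          ¬ Unk h'' (h'.reg rBestE) → #(unkSet T h'') + Q ≤ #(unkSet T h')) := by
  have hle := hS.le
  have h1 := T.n_le_mul
  have h2 := T.d_le_mul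
  have hcardU := card_unkSet_le (T := T) h
  refine run_seq (run_for_uniform (B := 1) (Nv := 2 * T.n)
    (fun i h' => Frame 15 [aStk] h h' ∧ h'.reg rI = i ∧ ∀ p < i, h'.arr aStk p 0 = p)
    ?_ (by omega) ?_ ?_ ?_)
  · exact ⟨Frame.refl.setR (by norm_num), by simp, by simp⟩
  · rintro i h' - ⟨hf, hi, -⟩
    exact ⟨hi, by simp [(hs.frame hf).nn], by simp⟩
  · rintro i h' hid ⟨hf, hi, hstk⟩ -
    refine run_store (by simp) (by simp) (by simp) (by simp [hi]; omega)
      (by simp; omega) (by simp [hi]; omega) ?_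
    refine ⟨by simp [hi], le_rfl, (hf.setA (by simp)).setR (by norm_num), by simp, ?_⟩
    intro p hp
    simp only [HState.setR_arr, HState.setA_arr, HExpr.val, hi]
    norm_num
    split_ifs with hpi
    · exact hpi.symm
    · exact hstk p (by omega)
  rintro h₁ t₁ ⟨hf₁, -, hstk₁⟩ - ht₁
  have hs₁ := hs.frame hf₁
  refine run_seq (run_set (by simp) (by simp [hs₁.nn]; omega) ?_)
  set h₂ := h₁.setR rSP ((HExpr.r rNN).val h₁) with hh₂
  have hf₂ : Frame 15 [aStk] h h₂ := hf₁.setR (by norm_num)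
  have hsp₂ : h₂.reg rSP = 2 * T.n := by simp [hh₂, hs₁.nn]
  have hset₂ : unkSet T h₂ = unkSet T h := unkSet_frame hf₂
  have hU₂ : Unk h₂ = Unk h := Unk.frame hf₂
  have hl₂ : h₂.arr aLab = h.arr aLab := hf₂.2 _ (by simp)
  refine run_seq ((run_propagate hS (hs.frame hf₂) (hI.frame hf₂) hSol hK
    (by rw [hf₂.1 _ (by norm_num), hrK]) (by rw [hsp₂, hset₂]; omega) ?_ ?_).mono ?_)
  · intro p hp
    rw [hsp₂] at hp
    exact (hstk₁ p hp).trans_lt hp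
  · intro w hw
    exact ⟨w, by rw [hsp₂]; exact hw, hstk₁ w hw⟩
  rintro h₃ t₃ ⟨hP, -, hclean, ht₃⟩
  rw [hsp₂, hset₂] at ht₃
  have hf₃ : Frame 15 [aLab, aKn, aG, aCl, aStk] h h₃ :=
    (hf₂.mono le_rfl (by simp)).trans hP.frame
  refine (run_largestClass hS (hs.frame hf₃)).mono ?_
  rintro h₄ t₄ ⟨hf₄, ht₄, hb0, hb1⟩
  have hset₄ : unkSet T h₄ = unkSet T h₃ := unkSet_frame hf₄
  have hU₄ : Unk h₄ = Unk h₃ := Unk.frame hf₄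
  have hmono : ∀ e, Unk h₄ e → Unk h e := by
    intro e he
    rw [hU₄] at he
    rw [← hU₂]
    exact hP.unk_mono e he
  have hsub : unkSet T h₃ ⊆ U₀ := by
    rw [← hset₄]
    exact fun x hx => hU (mem_unkSet.2 ⟨(mem_unkSet.1 hx).1, hmono x (mem_unkSet.1 hx).2⟩)
  refine ⟨?_, hP.inv.frame hf₄, ?_, hmono, fun w hw => (hclean w hw).frame hf₄, ?_, ?_, ?_⟩
  · exact (hf₃.mono (by norm_num) (by simp)).trans (hf₄.mono le_rfl (by simp))
  · intro e he j
    rw [hf₄.2 _ (by simp), hP.lab_known e (by rw [hU₂]; exact he), hl₂]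
  · refine deduce_time T.two_le_n T.d_pos hI.d_lt ht₁ (ht₃.trans ?_) ht₄
    gcongr
  · rw [hset₄]
    exact hb0
  · intro hb
    obtain ⟨hb2, hb3⟩ := hb1 hb
    rw [hset₄]
    refine ⟨hb2, fun h'' hc'' hm'' he'' => card_unkSet_of_guess hQ hsub hclean hb2 hb3 hc'' ?_ he''⟩
    rwa [hU₄] at hm''

/-- The row of an unknown edge is zero and column K is unused, so a single entry 1 makes the new
variable the label of e. -/
theorem run_guess {S K e : ℕ} {Sol : (ℕ → ZMod 2) → Prop} {h : HState}
    (hI : LabelInv T Sol K h) (hK : K + 1 < S) (hrK : h.reg rK = K) (he : e ∈ unkSet T h)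
    (heS : e < S) (hbe : h.reg rBestE = e) :
    Run S guess h fun h' t => t ≤ 3 ∧ (∀ x, x ≠ rK → h'.reg x = h.reg x) ∧
      h'.reg rK = K + 1 ∧ (∀ a, a ∉ [aLab, aKn] → h'.arr a = h.arr a) ∧
      LabelInv T Sol (K + 1) h' ∧ (∀ e' j, h'.arr aLab e' j =
        if e' = e ∧ j = K then 1 else h.arr aLab e' j) ∧
      (∀ e', Unk h' e' ↔ Unk h e' ∧ e' ≠ e) := by
  rw [mem_unkSet] at he
  refine run_seq (run_store (by simp) (by simp) (by simp) (by simp [hbe]; omega)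
    (by simp; omega) (by simp; omega) ?_)
  refine run_seq (run_store (by simp) (by simp) (by simp) (by simp [hbe]; omega)
    (by simp [hrK]; omega) (by simp; omega) ?_)
  refine run_set (by simp) (by simp [hrK]; omega) ?_
  set h₁ := ((h.setA aKn _ _ _).setA aLab _ _ _).setR rK _ with hh₁
  have hlab : ∀ e' j, h₁.arr aLab e' j = if e' = e ∧ j = K then 1 else h.arr aLab e' j := by
    intro e' j
    simp [hh₁, hbe, hrK]
  have hkn : ∀ e', h₁.arr aKn e' 0 = if e' = e then 1 else h.arr aKn e' 0 := by
    intro e'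
    simp [hh₁, hbe]
  have hunk : ∀ e', Unk h₁ e' ↔ Unk h e' ∧ e' ≠ e := by
    intro e'
    rw [Unk, hkn, Unk]
    split_ifs with h3 <;> simp [h3]
  refine ⟨by norm_num, ?_, by simp [hh₁, hrK], ?_, ⟨?_, ?_, by have := hI.d_lt; omega, ?_, ?_, ?_⟩,
    hlab, hunk⟩
  · intro x hx
    simp [hh₁, hx]
  · intro a ha
    simp only [List.mem_cons, List.not_mem_nil, or_false, not_or] at ha
    funext i j
    simp [hh₁, ha.1, ha.2]
  · intro e' j
    rw [hlab]
    split_ifs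
    · norm_num
    · exact hI.bits e' j
  · intro e'
    rw [hkn]
    split_ifs
    · norm_num
    · exact hI.kn_lt e'
  · intro j
    rw [hlab, if_neg (by omega)]
    exact hI.zeroRow j
  · intro e' he' j hor
    have hdK := hI.d_lt
    rw [hunk] at hor
    rw [hlab, if_neg (by
      rintro ⟨rfl, rfl⟩
      rcases hor with h3 | h3 | h3
      exacts [h3.2 rfl, by omega, by omega])]
    by_cases hee : e' = e
    · subst hee
      exact hI.zero e' he' j (Or.inl he.2)
    · refine hI.zero e' he' j ?_
      rcases hor with h3 | h3 | h3
      · exact Or.inl h3.1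
      · exact Or.inr (Or.inl h3)
      · exact Or.inr (Or.inr (by omega))
  · intro c hc
    obtain ⟨y, hy, hsum⟩ := hI.sound c hc
    have hdK := hI.d_lt
    -- The new variable takes the symbol of c at the guessed edge; older labels do not involve
    -- column K.
    refine ⟨Function.update y K (c e), ?_, fun e' he' hu => ?_⟩
    · rw [Function.update_of_ne (by omega), hy]
    · have hlab' : ∀ j, lab h₁ e' j = if e' = e ∧ j = K then 1 else lab h e' j := by
        intro j
        rw [lab, hlab]
        split_ifs <;> simp [lab]
      by_cases hee : e' = e
      · subst hee
        rw [sum_range_succ, sum_eq_zero, zero_add, hlab', if_pos ⟨rfl, rfl⟩]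
        · simp
        · intro j hj
          rw [mem_range] at hj
          rw [hlab', if_neg (by omega), lab, hI.zero _ he' j (Or.inl he.2)]
          simp
      · rw [hsum e' he' (fun hcon => hu ((hunk e').2 ⟨hcon, hee⟩)), sum_range_succ]
        rw [hlab' K, if_neg (by tauto)]
        have hzK : lab h e' K = 0 := by
          rw [lab, hI.zero _ he' K (Or.inr (Or.inr le_rfl)), Nat.cast_zero]
        rw [hzK, zero_mul, add_zero]
        refine sum_congr rfl fun j hj => ?_
        rw [mem_range] at hj
        rw [hlab', if_neg (by tauto), Function.update_of_ne (by omega)]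

variable (T) in
/-- The state of the labels after the introduction of `s` variables. -/
structure Labeled (Sol : (ℕ → ZMod 2) → Prop) (s : ℕ) (h h' : HState) : Prop where
  frame : Frame 3 [aLab, aKn, aG, aCl, aStk, aVis] h h'
  stat : Stat T h'
  inv : LabelInv T Sol (T.d + 1 + s) h'
  width : h'.reg rK = T.d + 1 + s
  lab_known : ∀ e, ¬ Unk h e → ∀ j, h'.arr aLab e j = h.arr aLab e j
  unk_mono : ∀ e, Unk h' e → Unk h e
  unit : ∀ j, T.d < j → j < T.d + 1 + s → ∃ e < T.n * T.d, ¬ Unk h' e ∧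
    ∀ j', h'.arr aLab e j' = if j' = j then 1 else 0

/-- The invariant sQ + #unknown ≤ nd bounds the number s of guesses. The row of a guessed edge is a
unit vector and stays so, since labels of known edges never change in this phase; the unit rows
later show that the output has independent columns. -/
theorem run_labelEdges {S Q : ℕ} {Sol : (ℕ → ZMod 2) → Prop} {h : HState} (hS : T.Fits S)
    (hs : Stat T h) (hI : LabelInv T Sol (T.d + 1) h) (hSol : ∀ c, Sol c → T.IsWord c)
    (hrK : h.reg rK = T.d + 1) (hQ1 : 1 ≤ Q) (hQ : T.Expanding Q (unkSet T h)) :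
    Run S labelEdges h fun h' t => ∃ s, Labeled T Sol s h h' ∧ unkSet T h' = ∅ ∧
      s * Q ≤ T.n * T.d ∧ t ≤ 1000 * T.n * T.d ^ 3 * (T.d + 1 + s) ^ 2 := by
  have hle := hS.le
  have h1 := T.n_le_mul
  have h2 := T.d_le_mul
  have hcardU := card_unkSet_le (T := T) h
  refine run_seq ((run_deduce hS hs hI hSol (by omega) hrK hQ subset_rfl).mono ?_)
  rintro h₁ t₁ ⟨hf₁, hI₁, hlab₁, hmono₁, hclean₁, ht₁, hb0₁, hb1₁⟩
  refine run_loop (fun k h' t => ∃ s, k = #(unkSet T h') ∧ Labeled T Sol s h h' ∧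
    (∀ w < 2 * T.n, Clean T h' w) ∧ s * Q + #(unkSet T h') ≤ T.n * T.d ∧
    t₁ + t + 1 ≤ 1000 * T.n * T.d ^ 3 * (T.d + 1 + s) * (s + 1) ∧
    (h'.reg rBest = 0 → unkSet T h' = ∅) ∧
      (h'.reg rBest ≠ 0 → h'.reg rBestE ∈ unkSet T h' ∧ ∀ h'' : HState,
        (∀ w < 2 * T.n, Clean T h'' w) → (∀ e, Unk h'' e → Unk h' e) →
          ¬ Unk h'' (h'.reg rBestE) → #(unkSet T h'') + Q ≤ #(unkSet T h')))
    (k := #(unkSet T h₁)) ?_ ?_ ?_ ?_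
  · refine ⟨0, rfl, ⟨hf₁.mono (by norm_num) (by simp), hs.frame hf₁, hI₁, ?_, hlab₁, hmono₁, ?_⟩,
      hclean₁, ?_, by simp; omega, hb0₁, hb1₁⟩
    · rw [hf₁.1 _ (by norm_num), hrK]
    · intro j hj hj'
      omega
    · have := card_unkSet_le (T := T) h₁
      omega
  · simp
  · rintro k h₂ t ⟨s, rfl, hL, hclean, hsQ, ht, -, hb1⟩ hval
    obtain ⟨hbe, hcard⟩ := hb1 (by simpa using hval)
    have hbelt := (mem_unkSet.1 hbe).1
    have hsle : s ≤ s * Q := Nat.le_mul_of_pos_right _ hQ1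
    refine run_seq ((run_guess hL.inv (by omega) hL.width hbe (by omega) rfl).mono ?_)
    rintro h₃ t₃ ⟨ht₃, hreg₃, hrK₃, harr₃, hI₃, hlab₃, hunk₃⟩
    have hst := hL.stat
    have hs₃ : Stat T h₃ := by
      refine ⟨?_, ?_, ?_, ?_, ?_, ?_, ?_, ?_⟩
      · rw [hreg₃ _ (by norm_num), hst.n]
      · rw [hreg₃ _ (by norm_num), hst.d]
      · rw [hreg₃ _ (by norm_num), hst.m]
      · rw [hreg₃ _ (by norm_num), hst.nn]
      · rw [hreg₃ _ (by norm_num), hst.e]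
      · rw [harr₃ _ (by simp)]; exact hst.eid
      · rw [harr₃ _ (by simp)]; exact hst.ev
      · rw [harr₃ _ (by simp)]; exact hst.H
    have hmono₃ : ∀ e, Unk h₃ e → Unk h e := fun e he => hL.unk_mono e ((hunk₃ e).1 he).1
    refine (run_deduce hS hs₃ hI₃ hSol (by omega) hrK₃ hQ (fun x hx => mem_unkSet.2
      ⟨(mem_unkSet.1 hx).1, hmono₃ x (mem_unkSet.1 hx).2⟩)).mono ?_
    rintro h₄ t₄ ⟨hf₄, hI₄, hlab₄, hmono₄, hclean₄, ht₄, hb0₄, hb1₄⟩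
    have hne₄ : ∀ e, Unk h₄ e → Unk h₂ e := fun e he => ((hunk₃ e).1 (hmono₄ e he)).1
    have hcard₄ := hcard h₄ hclean₄ hne₄ fun hcon => ((hunk₃ _).1 (hmono₄ _ hcon)).2 rfl
    refine ⟨#(unkSet T h₄), by omega, s + 1, rfl, ⟨?_, hs₃.frame hf₄, hI₄, ?_, ?_, ?_, ?_⟩, hclean₄,
      ?_, ?_, hb0₄, hb1₄⟩
    · refine (hL.frame.trans ?_).trans (hf₄.mono (by norm_num) (by simp))
      refine ⟨fun x hx => hreg₃ x (by omega), fun a ha => harr₃ a ?_⟩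
      simp only [List.mem_cons, List.not_mem_nil, or_false, not_or] at ha ⊢
      tauto
    · rw [hf₄.1 _ (by norm_num), hrK₃]
      ring
    · intro e he j
      rw [hlab₄ e (fun hcon => he (hmono₃ e hcon)), hlab₃, if_neg, hL.lab_known e he]
      rintro ⟨rfl, -⟩
      exact he (hL.unk_mono _ (mem_unkSet.1 hbe).2)
    · exact fun e he => hmono₃ e (hmono₄ e he)
    · intro j hj hj'
      have hbz := hL.inv.zero _ hbelt
      by_cases hjs : j = T.d + 1 + s
      · refine ⟨h₂.reg rBestE, hbelt, fun hcon => ((hunk₃ _).1 (hmono₄ _ hcon)).2 rfl, fun j' => ?_⟩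
        rw [hlab₄ _ (fun hcon => ((hunk₃ _).1 hcon).2 rfl), hlab₃, hjs]
        simp [hbz j' (Or.inl (mem_unkSet.1 hbe).2)]
      · obtain ⟨e, he, hu, hrow⟩ := hL.unit j hj (by omega)
        refine ⟨e, he, fun hcon => hu (hne₄ e hcon), fun j' => ?_⟩
        rw [hlab₄ _ (fun hcon => hu ((hunk₃ _).1 hcon).1), hlab₃, if_neg, hrow]
        rintro ⟨rfl, -⟩
        exact hu (mem_unkSet.1 hbe).2
    · rw [add_mul]
      omega
    · have hstep : 1000 * T.n * T.d ^ 3 * (T.d + 1 + s) * (s + 1) ≤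
          1000 * T.n * T.d ^ 3 * (T.d + 1 + (s + 1)) * (s + 1) := by gcongr; omega
      have heq : 1000 * T.n * T.d ^ 3 * (T.d + 1 + (s + 1)) * (s + 1 + 1) =
        1000 * T.n * T.d ^ 3 * (T.d + 1 + (s + 1)) * (s + 1) +
          1000 * T.n * T.d ^ 3 * (T.d + 1 + s + 1) := by ring
      rw [heq]
      omega
  · rintro k h₂ t ⟨s, rfl, hL, -, hsQ, ht, hb0, -⟩ hval
    refine ⟨s, hL, hb0 (by simpa using hval), by omega, ?_⟩
    rw [← add_assoc]
    refine ht.trans ?_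
    rw [pow_two, ← mul_assoc]
    -- The number s+1 of deductions is at most the number d+1+s of columns.
    exact Nat.mul_le_mul_left _ (by omega)

end ArrayRAM

/-! ### Reduction of the labels by the parity checks -/

namespace EdgeTable

open Finset

variable {T : EdgeTable} {Sol Agr : (ℕ → ZMod 2) → Prop} {K : ℕ} {D : Finset ℕ} {bad : Prop}
  {done : ℕ → ℕ → Prop} {L L' : ℕ → ℕ → ZMod 2} {v k : ℕ}

theorem check_congr {c c' : ℕ → ZMod 2} (hv : v < 2 * T.n) (hc : ∀ e < T.n * T.d, c e = c' e) :
    T.check c v k = T.check c' v k :=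
  sum_congr rfl fun i hi => by rw [hc _ (T.eid_lt hv (mem_range.1 hi))]

/-- The word with the parameters `y`. -/
def labelWord (L : ℕ → ℕ → ZMod 2) (K : ℕ) (y : ℕ → ZMod 2) (e : ℕ) : ZMod 2 :=
  ∑ j ∈ range K, L e j * y j

variable (T Sol Agr K D bad done L) in
/-- The words in `Sol` are described by the labels `L`. The variables in `D` have been eliminated,
and the parity checks in `done` hold for all parameters unless `bad` holds. -/
structure Reduced : Prop where
  low : ∀ e < T.n * T.d, ∀ j < T.d, L e j = 0
  sub : D ⊆ Ioo T.d K
  dead : ∀ e < T.n * T.d, ∀ j ∈ D, L e j = 0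
  unit : ∀ j, T.d < j → j < K → j ∉ D → ∃ e < T.n * T.d, ∀ j' < K, L e j' = if j' = j then 1 else 0
  sound : ∀ c, Sol c → ∃ y : ℕ → ZMod 2, y T.d = 1 ∧ ∀ e < T.n * T.d, c e = labelWord L K y e
  agr : ∀ y : ℕ → ZMod 2, y T.d = 1 → Agr (labelWord L K y)
  checks : ¬ bad → ∀ v < 2 * T.n, ∀ k < T.m, done v k → ∀ y : ℕ → ZMod 2, y T.d = 1 →
    T.check (labelWord L K y) v k = 0
  none : bad → ∀ c, ¬ Sol c

theorem Reduced.mono_done {done' : ℕ → ℕ → Prop} (hR : T.Reduced Sol Agr K D bad done L)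
    (hd : ∀ v < 2 * T.n, ∀ k < T.m, done' v k → done v k) :
    T.Reduced Sol Agr K D bad done' L :=
  ⟨hR.low, hR.sub, hR.dead, hR.unit, hR.sound, hR.agr,
    fun hb v hv k hk hd' => hR.checks hb v hv k hk (hd v hv k hk hd'), hR.none⟩

theorem check_labelWord (y : ℕ → ZMod 2) :
    T.check (labelWord L K y) v k = ∑ j ∈ range K, T.check (fun e => L e j) v k * y j :=
  T.check_sum (range K) y

/-- Scratch columns are empty and the guessed variables do not occur in the form, so the check has a
constant value, its coefficient in column d. If this is 1, then no word satisfies the check. -/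
theorem Reduced.skip (hR : T.Reduced Sol Agr K D bad done L) (hSol : ∀ c, Sol c → T.IsWord c)
    (hv : v < 2 * T.n) (hk : k < T.m) (hK : T.d < K)
    (hg : ∀ j, T.d < j → j < K → T.check (fun e => L e j) v k = 0) :
    T.Reduced Sol Agr K D (bad ∨ T.check (fun e => L e T.d) v k ≠ 0)
      (fun v' k' => done v' k' ∨ v' = v ∧ k' = k) L := by
  have hcheck : ∀ y : ℕ → ZMod 2, y T.d = 1 →
      T.check (labelWord L K y) v k = T.check (fun e => L e T.d) v k := by
    intro y hy
    rw [check_labelWord, sum_eq_single T.d]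
    · rw [hy, mul_one]
    · intro j hj hjd
      rcases lt_or_gt_of_ne hjd with h1 | h1
      · have : T.check (fun e => L e j) v k = T.check (fun _ => 0) v k :=
          check_congr hv fun e he => hR.low e he j h1
        rw [this]
        simp [check]
      · rw [hg j h1 (mem_range.1 hj), zero_mul]
    · intro h1
      exact absurd (mem_range.2 hK) h1
  refine ⟨hR.low, hR.sub, hR.dead, hR.unit, hR.sound, hR.agr, ?_, ?_⟩
  · intro hb v' hv' k' hk' hd y hy
    rw [not_or, not_not] at hb
    rcases hd with hd | ⟨rfl, rfl⟩
    · exact hR.checks hb.1 v' hv' k' hk' hd y hy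
    · rw [hcheck y hy, hb.2]
  · rintro (hb | hb) c hc
    · exact hR.none hb c hc
    · obtain ⟨y, hy, hcy⟩ := hR.sound c hc
      apply hb
      rw [← hcheck y hy, ← check_congr hv hcy]
      exact hSol c hc v hv k hk

/-- This is the substitution of `Elim.pivot` for a guessed variable: every word described afterwards
is described by old parameters at which the check holds, so earlier checks and the received symbols
are respected. An eliminated variable has coefficient 0 in every later form and is never chosen
again. A unit row for j ≠ F has entry 0 at F and survives. -/
theorem Reduced.pivot (hR : T.Reduced Sol Agr K D bad done L) (hSol : ∀ c, Sol c → T.IsWord c)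
    (hAgr : ∀ c c', (∀ e < T.n * T.d, c e = c' e) → Agr c → Agr c')
    (hv : v < 2 * T.n) (hk : k < T.m) {F : ℕ} (hF : T.d < F) (hFK : F < K)
    {g : ℕ → ZMod 2} (hg : ∀ j < K, g j = T.check (fun e => L e j) v k) (hgF : g F = 1)
    (h1 : ∀ e < T.n * T.d, ∀ j < K, L' e j = L e j + L e F * g j) :
    F ∉ D ∧ T.Reduced Sol Agr K (insert F D) bad
      (fun v' k' => done v' k' ∨ v' = v ∧ k' = k) L' := by
  have hzero : ∀ j < K, (∀ e < T.n * T.d, L e j = 0) → g j = 0 := by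
    intro j hj hz
    have : T.check (fun e => L e j) v k = T.check (fun _ => 0) v k := check_congr hv hz
    rw [hg j hj, this]
    simp [check]
  have hword : ∀ y : ℕ → ZMod 2, ∀ e < T.n * T.d,
      labelWord L' K y e = labelWord L K y e + L e F * ∑ j ∈ range K, g j * y j := by
    intro y e he
    rw [labelWord, labelWord, ← sum_add_mul_form]
    exact sum_congr rfl fun j hj => by rw [h1 e he j (mem_range.1 hj)]
  have hform : ∀ y : ℕ → ZMod 2, ∑ j ∈ range K, g j * y j = T.check (labelWord L K y) v k := by
    intro y
    rw [check_labelWord]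
    exact sum_congr rfl fun j hj => by rw [hg j (mem_range.1 hj)]
  have himg : ∀ y : ℕ → ZMod 2, y T.d = 1 → ∃ y' : ℕ → ZMod 2, y' T.d = 1 ∧
      (∀ e < T.n * T.d, labelWord L K y' e = labelWord L' K y e) ∧
      T.check (labelWord L K y') v k = 0 := by
    intro y hy
    set a := ∑ j ∈ range K, g j * y j with ha
    set y' : ℕ → ZMod 2 := fun j => y j + if j = F then a else 0 with hy'
    have hsplit : ∀ b : ℕ → ZMod 2, ∑ j ∈ range K, b j * y' j =
        ∑ j ∈ range K, b j * y j + b F * a := by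
      intro b
      simp only [hy', mul_add, sum_add_distrib, mul_ite, mul_zero, sum_ite_eq', mem_range, hFK,
        if_true]
    refine ⟨y', by simp [hy', hy, hF.ne], fun e he => ?_, ?_⟩
    · rw [hword y e he, labelWord, hsplit]
      rfl
    · rw [← hform, hsplit, hgF, one_mul, ← ha, CharTwo.add_self_eq_zero]
  have hFD : F ∉ D := by
    intro hc
    rw [hzero F hFK fun e he => hR.dead e he F hc] at hgF
    exact zero_ne_one hgF
  refine ⟨hFD, ?_, ?_, ?_, ?_, ?_, ?_, ?_, hR.none⟩
  · intro e he j hj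
    rw [h1 e he j (by omega), hR.low e he j hj, hzero j (by omega) fun e he => hR.low e he j hj,
      mul_zero, add_zero]
  · exact insert_subset (mem_Ioo.2 ⟨hF, hFK⟩) hR.sub
  · intro e he j hj
    rcases mem_insert.1 hj with rfl | hj
    · rw [h1 e he j hFK, hgF, mul_one, CharTwo.add_self_eq_zero]
    · rw [h1 e he j (mem_Ioo.1 (hR.sub hj)).2, hR.dead e he j hj,
        hzero j (mem_Ioo.1 (hR.sub hj)).2 fun e he => hR.dead e he j hj, mul_zero, add_zero]
  · intro j hj hjK hjD
    rw [mem_insert, not_or] at hjD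
    obtain ⟨e, he, hrow⟩ := hR.unit j hj hjK hjD.2
    refine ⟨e, he, fun j' hj' => ?_⟩
    rw [h1 e he j' hj', hrow j' hj', hrow F hFK, if_neg (Ne.symm hjD.1), zero_mul, add_zero]
  · intro c hc
    obtain ⟨y, hy, hcy⟩ := hR.sound c hc
    refine ⟨y, hy, fun e he => ?_⟩
    rw [hword y e he, hform, ← check_congr hv hcy, hSol c hc v hv k hk, mul_zero, add_zero,
      hcy e he]
  · intro y hy
    obtain ⟨y', hy', hw, -⟩ := himg y hy
    exact hAgr _ _ hw (hR.agr y' hy')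
  · intro hb v' hv' k' hk' hd y hy
    obtain ⟨y', hy', hw, hch⟩ := himg y hy
    rw [← check_congr hv' hw]
    rcases hd with hd | ⟨rfl, rfl⟩
    · exact hR.checks hb v' hv' k' hk' hd y' hy'
    · exact hch

end EdgeTable

/-! ### Programs that impose all parity checks on the guessed variables -/

namespace ArrayRAM

open RAM Finset

variable {T : EdgeTable}

/-- Adds the linear form to the labels of all edges that contain the variable `rF`. -/
def addFormAll : Prog := forP rV (.r rN) addForm

/-- Each edge has exactly one left end, so a pass over the left vertices changes each row once. -/
theorem run_addFormAll {S K F : ℕ} {h : HState} (hS : T.Fits S) (hs : Stat T h) (hl : LabBits h)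
    (hK : K < S) (hrK : h.reg rK = K) (hrF : h.reg rF = F) (hF : F < K)
    (hG : ∀ j < K, h.arr aG 0 j < 2) :
    Run S addFormAll h fun h' t => Frame 15 [aLab] h h' ∧ h'.reg rRow = h.reg rRow ∧ LabBits h' ∧
      t ≤ T.n * (T.d * (3 * K + 6) + 4) + 2 ∧
      ∀ e < T.n * T.d, ∀ j < K, lab h' e j = lab h e j + lab h e F * h.arr aG 0 j := by
  have hle := hS.le
  have h1 := T.n_le_mul
  refine run_for_uniform (B := T.d * (3 * K + 6) + 2) (Nv := T.n)
    (fun u h' => Frame 15 [aLab] h h' ∧ h'.reg rRow = h.reg rRow ∧ LabBits h' ∧ h'.reg rV = u ∧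
      h'.reg rF = F ∧ ∀ e < T.n * T.d, ∀ j < K, lab h' e j = if T.ev e 0 < u then
        lab h e j + lab h e F * h.arr aG 0 j else lab h e j) ?_ (by omega) ?_ ?_ ?_
  · refine ⟨Frame.refl.setR (by norm_num), by simp, hl, by simp, by simp [hrF], ?_⟩
    intro e he j hj
    rw [if_neg (by omega)]
    rfl
  · rintro u h' - ⟨hf, -, -, hu, -⟩
    exact ⟨hu, by simp [hf.1, hs.n], by simp⟩
  · rintro u h' hun ⟨hf, hrow, hl', hu, hF', hlab⟩ -
    have hs' := hs.frame hf
    have hg : h'.arr aG = h.arr aG := hf.2 _ (by simp)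
    refine (run_addForm hS hs' hl' (v := u) (by omega) hK hu
      (by rw [hf.1 _ (by norm_num), hrK]) hF' hF (by rw [hg]; exact hG)).mono ?_
    rintro h₂ t₂ ⟨hf₂, hl₂, ht₂, hlab₂⟩
    refine ⟨by rw [hf₂.1 _ (by norm_num), hu], ht₂, ?_, ?_, hl₂, by simp, ?_, ?_⟩
    · exact (hf.trans (hf₂.mono (by norm_num) (by simp))).setR (by norm_num)
    · rw [HState.setR_reg, if_neg (by norm_num), hf₂.1 _ (by norm_num), hrow]
    · rw [HState.setR_reg, if_neg (by norm_num), hf₂.1 _ (by norm_num), hF']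
    · intro e he j hj
      have h3 : lab (h₂.setR rV (u + 1)) e j = lab h₂ e j := rfl
      have hside : T.ev e 0 < T.n := by
        have := T.side_ev he (s := 0) (by norm_num)
        by_contra hcon
        rw [if_neg hcon] at this
        exact one_ne_zero this
      have hiff : T.IsFirst u T.d e ↔ T.ev e 0 = u := by
        constructor
        · rintro ⟨i, hi, rfl⟩
          have := T.ev_eid (v := u) (by omega) hi
          rwa [if_pos hun] at this
        · rintro rfl
          obtain ⟨i, hi, hie⟩ := T.exists_eid he (s := 0) (by norm_num)
          exact ⟨i, hi, hie⟩
      rw [h3, hlab₂, hlab e he j hj, hlab e he F hF, hiff, hg]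
      by_cases heu : T.ev e 0 = u
      · rw [if_pos ⟨heu, hj⟩, if_neg (by omega), if_neg (by omega), if_pos (by omega)]
      · rw [if_neg (by tauto)]
        by_cases hlt : T.ev e 0 < u
        · rw [if_pos hlt, if_pos (by omega)]
        · rw [if_neg hlt, if_neg (by omega)]
  · rintro h' t ⟨hf, hrow, hl', -, -, hlab⟩ - ht
    refine ⟨hf, hrow, hl', ht, fun e he j hj => ?_⟩
    rw [hlab e he j hj, if_pos]
    have := T.side_ev he (s := 0) (by norm_num)
    by_contra hcon
    rw [if_neg hcon] at this
    exact one_ne_zero this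

/-- Eliminates a variable with the parity check `rRow` at the vertex `rCur`. -/
def reduceRow : Prog :=
  .seq (setP rV (.r rCur)) (.seq checkForm (.seq (findPivot (.lt (.r rD) (.r rJ)))
    (iteP (.lt (.r rD) (.r rF)) (.seq (storeP aDead (.r rF) (.c 0) (.c 1)) addFormAll)
      (whenP (.ld aG (.c 0) (.r rD)) (setP rGo (.c 1))))))

/-- Eliminates variables with all parity checks. -/
def reduce : Prog := forP rCur (.r rNN) (forP rRow (.r rM) reduceRow)

variable (T) in
/-- The invariant of the reduction. -/
structure Reducing (Sol Agr : (ℕ → ZMod 2) → Prop) (K : ℕ) (h₀ : HState) (D : Finset ℕ)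
    (done : ℕ → ℕ → Prop) (h : HState) : Prop where
  frame : Frame 6 [aLab, aG, aDead] h₀ h
  bits : LabBits h
  dead : ∀ j < K, h.arr aDead j 0 ≠ 0 ↔ j ∈ D
  red : T.Reduced Sol Agr K D (h.reg rGo ≠ 0) done (lab h)

/-- The time bound is amortized: the pass over all edges is charged to the variable that joins D. -/
theorem run_reduceRow {S K v k : ℕ} {Sol Agr : (ℕ → ZMod 2) → Prop} {h₀ h : HState} {D : Finset ℕ}
    {done : ℕ → ℕ → Prop} (hS : T.Fits S) (hs : Stat T h₀) (hSol : ∀ c, Sol c → T.IsWord c)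
    (hAgr : ∀ c c', (∀ e < T.n * T.d, c e = c' e) → Agr c → Agr c') (hdK : T.d < K) (hK : K < S)
    (hrK : h₀.reg rK = K) (hR : Reducing T Sol Agr K h₀ D done h) (hv : v < 2 * T.n) (hk : k < T.m)
    (hcur : h.reg rCur = v) (hrow : h.reg rRow = k) :
    Run S reduceRow h fun h' t => h'.reg rCur = v ∧ h'.reg rRow = k ∧ ∃ D' : Finset ℕ,
      Reducing T Sol Agr K h₀ D' (fun v' k' => done v' k' ∨ v' = v ∧ k' = k) h' ∧
      t + #D * (T.n * (T.d * (3 * K + 6) + 4) + 3) ≤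
        K * (3 * T.d + 10) + 10 + #D' * (T.n * (T.d * (3 * K + 6) + 4) + 3) := by
  have hle := hS.le
  have h1 := T.n_le_mul
  have h2 := T.d_le_mul
  have hs₀ := hs.frame hR.frame
  refine run_seq (run_set (by simp) (by simp [hcur]; omega) ?_)
  set h₁ := h.setR rV ((HExpr.r rCur).val h) with hh₁
  have e1 : h₁.reg rV = v := by simp [hh₁, hcur]
  have hf₁ : Frame 15 [] h h₁ := Frame.refl.setR (by norm_num)
  have e2 : h₁.reg rRow = k := by simp [hh₁, hrow]
  have hl₁ : LabBits h₁ := hR.bits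
  have e3 : h₁.reg rK = K := by rw [hf₁.1 _ (by norm_num), hR.frame.1 _ (by norm_num), hrK]
  have hlab₁ : lab h₁ = lab h := lab_frame hf₁
  clear_value h₁
  have hs₁ := hs₀.frame hf₁
  refine run_seq ((run_checkForm hS hs₁ hl₁ hv hk hK e1 e2 e3).mono ?_)
  rintro h₂ t₂ ⟨hf₂, ht₂, hG⟩
  have hs₂ := hs₁.frame hf₂
  rw [hlab₁] at hG
  have e4 : h₂.reg rK = K := by rw [hf₂.1 _ (by norm_num), e3]
  refine run_seq ((run_findPivot (p := fun j => T.d < j) hS hs₂ hK e4 ?_).mono ?_)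
  · intro h' hd
    simp [hd]
  rintro h₃ t₃ ⟨hf₃, ht₃, hF⟩
  have hs₃ := hs₂.frame hf₃
  have hlab : lab h₃ = lab h := by rw [lab_frame hf₃, lab_frame hf₂, hlab₁]
  have hl₃ : LabBits h₃ := (hl₁.frame hf₂).frame hf₃
  have hf : Frame 15 [aG] h h₃ := (hf₁.mono le_rfl (by simp)).trans
    ((hf₂.mono (by norm_num) (by simp)).trans (hf₃.mono (by norm_num) (by simp)))
  have e5 : h₃.reg rRow = k := by rw [hf₃.1 _ (by norm_num), hf₂.1 _ (by norm_num), e2]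
  have e6 : h₃.reg rCur = v := by rw [hf.1 _ (by norm_num), hcur]
  have e7 : h₃.reg rK = K := by rw [hf₃.1 _ (by norm_num), e4]
  have e8 : h₃.reg rGo = h.reg rGo := hf.1 _ (by norm_num)
  have hg₃ : h₃.arr aG = h₂.arr aG := hf₃.2 _ (by simp)
  have hdead₃ : h₃.arr aDead = h.arr aDead := hf.2 _ (by simp)
  have hfr : Frame 6 [aLab, aG, aDead] h₀ h₃ := hR.frame.trans (hf.mono (by norm_num) (by simp))
  have hsplit : K * (3 * T.d + 10) = K * (3 * T.d + 6) + K * 4 := by ring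
  refine run_ite (by simp) ?_ ?_
  · intro hval
    have hdF : T.d < h₃.reg rF := by
      by_contra hcon
      simp [hs₃.d, hcon] at hval
    rcases hF with ⟨hF, -⟩ | ⟨hF1, -, hF3⟩
    · omega
    set F := h₃.reg rF with hFdef
    refine run_seq (run_store (by simp) (by simp) (by simp) (by simp; omega) (by simp; omega)
      (by simp; omega) ?_)
    set h₄ := h₃.setA aDead ((HExpr.r rF).val h₃) ((HExpr.c 0).val h₃) ((HExpr.c 1).val h₃) with hh₄
    have hf₄ : Frame 30 [aDead] h₃ h₄ := Frame.refl.setA (by simp)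
    have hg₄ : h₄.arr aG = h₂.arr aG := by rw [hf₄.2 _ (by simp), hg₃]
    have hd₄ : ∀ j, h₄.arr aDead j 0 = if j = F then 1 else h.arr aDead j 0 := by
      intro j
      simp [hh₄, hdead₃, hFdef]
    have hlab₄ : lab h₄ = lab h := by rw [lab_frame hf₄, hlab]
    refine (run_addFormAll hS (hs₃.frame hf₄) (hl₃.frame hf₄) hK
      (by rw [hf₄.1 _ (by norm_num), e7]) (F := F) (hf₄.1 _ (by norm_num)) hF1
      (by rw [hg₄]; exact fun j hj => (hG j hj).1)).mono ?_
    rintro h₅ t₅ ⟨hf₅, hrow₅, hl₅, ht₅, hlab₅⟩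
    rw [hlab₄, hg₄] at hlab₅
    have hgF : (h₂.arr aG 0 F : ZMod 2) = 1 := by
      have := (hG F hF1).1
      have : h₂.arr aG 0 F = 1 := by omega
      rw [this, Nat.cast_one]
    obtain ⟨hFD, hred⟩ := hR.red.pivot hSol hAgr hv hk hdF hF1
      (g := fun j => (h₂.arr aG 0 j : ZMod 2)) (fun j hj => (hG j hj).2) hgF hlab₅
    refine ⟨?_, ?_, insert F D, ⟨?_, hl₅, ?_, ?_⟩, ?_⟩
    · rw [hf₅.1 _ (by norm_num), hf₄.1 _ (by norm_num), e6]
    · rw [hrow₅, hf₄.1 _ (by norm_num), e5]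
    · exact hfr.trans ((hf₄.mono (by norm_num) (by simp)).trans (hf₅.mono (by norm_num) (by simp)))
    · intro j hj
      rw [hf₅.2 _ (by simp), hd₄, mem_insert]
      split_ifs with hjF
      · simp [hjF]
      · rw [hR.dead j hj]
        tauto
    · have : h₅.reg rGo = h.reg rGo := by rw [hf₅.1 _ (by norm_num), hf₄.1 _ (by norm_num), e8]
      rw [this]
      exact hred
    · rw [card_insert_of_notMem hFD, add_mul]
      omega
  · intro hval
    have hdF : ¬ T.d < h₃.reg rF := by
      intro hcon
      simp [hs₃.d, hcon] at hval
    rcases hF with ⟨-, hF⟩ | ⟨-, hF2, -⟩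
    swap
    · exact absurd hF2 hdF
    have hred := hR.red.skip hSol hv hk hdK (fun j hj hjK => by
      rw [← (hG j hjK).2, hF j hjK hj, Nat.cast_zero])
    have hgd := hG T.d hdK
    rw [← hgd.2] at hred
    refine run_when (by simp [hs₃.d]; omega) ?_ ?_
    · intro hval2
      have hne : (h₂.arr aG 0 T.d : ZMod 2) ≠ 0 := by
        have h3 : h₂.arr aG 0 T.d ≠ 0 := by simpa [hs₃.d, hg₃] using hval2
        have : h₂.arr aG 0 T.d = 1 := by omega
        rw [this]
        simp
      refine run_set (by simp) (by simp; omega) ?_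
      refine ⟨by simp [e6], by simp [e5], D, ⟨hfr.setR (by norm_num), hl₃, ?_, ?_⟩, by omega⟩
      · rw [HState.setR_arr, hdead₃]
        exact hR.dead
      · have h4 : lab (h₃.setR rGo ((HExpr.c 1).val h₃)) = lab h := hlab
        have h5 : ((h₃.setR rGo ((HExpr.c 1).val h₃)).reg rGo ≠ 0) =
            (h.reg rGo ≠ 0 ∨ (h₂.arr aG 0 T.d : ZMod 2) ≠ 0) := by simp [hne]
        rw [h4, h5]
        exact hred
    · intro hval2
      have hz : h₂.arr aG 0 T.d = 0 := by simpa [hs₃.d, hg₃] using hval2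
      refine ⟨e6, e5, D, ⟨hfr, hl₃, ?_, ?_⟩, by omega⟩
      · rw [hdead₃]
        exact hR.dead
      · have h5 : (h₃.reg rGo ≠ 0) =
            (h.reg rGo ≠ 0 ∨ (h₂.arr aG 0 T.d : ZMod 2) ≠ 0) := by simp [hz, e8]
        rw [hlab, h5]
        exact hred

theorem run_reduce {S K : ℕ} {Sol Agr : (ℕ → ZMod 2) → Prop} {h : HState}
    (hS : T.Fits S) (hs : Stat T h) (hSol : ∀ c, Sol c → T.IsWord c)
    (hAgr : ∀ c c', (∀ e < T.n * T.d, c e = c' e) → Agr c → Agr c') (hdK : T.d < K) (hK : K < S)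
    (hrK : h.reg rK = K) (hR : Reducing T Sol Agr K h ∅ (fun _ _ => False) h) :
    Run S reduce h fun h' t => ∃ D : Finset ℕ,
      Reducing T Sol Agr K h D (fun _ _ => True) h' ∧ t ≤ 200 * T.n * T.d ^ 2 * K ^ 2 := by
  have hle := hS.le
  have h1 := T.n_le_mul
  have h2 := T.d_le_mul
  have h3 := T.m_le
  set B₁ := K * (3 * T.d + 10) + 12 with hB₁
  set B₂ := T.n * (T.d * (3 * K + 6) + 4) + 3 with hB₂
  refine run_for (fun v h' t => h'.reg rCur = v ∧ ∃ D : Finset ℕ,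
    Reducing T Sol Agr K h D (fun v' _ => v' < v) h' ∧
      t ≤ v * (T.m * B₁ + 4) + #D * B₂) (Nv := 2 * T.n) ?_ (by omega) ?_ ?_ ?_
  · refine ⟨by simp, ∅, ⟨Frame.refl.setR (by norm_num), hR.bits, hR.dead, ?_⟩, by simp⟩
    exact hR.red.mono_done (by simp)
  · rintro v h' t - ⟨hv, D, hD, -⟩
    exact ⟨hv, by simp [(hs.frame hD.frame).nn], by simp⟩
  · rintro v h₁ t hv ⟨hcur, D, hD, ht⟩ -
    refine run_for (fun k h' t' => h'.reg rCur = v ∧ h'.reg rRow = k ∧ ∃ D' : Finset ℕ,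
      Reducing T Sol Agr K h D' (fun v' k' => v' < v ∨ v' = v ∧ k' < k) h' ∧
        t' + #D * B₂ ≤ k * B₁ + #D' * B₂) (Nv := T.m) ?_ (by omega) ?_ ?_ ?_
    · refine ⟨by simp [hcur], by simp, D, ⟨hD.frame.setR (by norm_num), hD.bits, hD.dead, ?_⟩,
        by simp⟩
      exact hD.red.mono_done (by simp)
    · rintro k h' t' - ⟨-, hk, D', hD', -⟩
      exact ⟨hk, by simp [(hs.frame hD'.frame).m], by simp⟩
    · rintro k h₂ t' hk ⟨hcur₂, hrow₂, D', hD', ht'⟩ -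
      refine (run_reduceRow hS hs hSol hAgr hdK hK hrK hD' hv hk hcur₂ hrow₂).mono ?_
      rintro h₃ t₃ ⟨hcur₃, hrow₃, D₃, hD₃, ht₃⟩
      refine ⟨hrow₃, by simp [hcur₃], by simp, D₃, ⟨hD₃.frame.setR (by norm_num), hD₃.bits,
        hD₃.dead, ?_⟩, ?_⟩
      · refine hD₃.red.mono_done fun v' _ k' _ hh => ?_
        omega
      · rw [← hB₂] at ht₃
        rw [add_mul]
        omega
    · rintro h₂ t' ⟨hcur₂, -, D', hD', ht'⟩ -
      refine ⟨hcur₂, by simp, D', ⟨hD'.frame.setR (by norm_num), hD'.bits, hD'.dead, ?_⟩, ?_⟩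
      · refine hD'.red.mono_done fun v' _ k' hk' hh => ?_
        omega
      · rw [add_mul]
        omega
  · rintro h' t ⟨-, D, hD, ht⟩ -
    refine ⟨D, ⟨hD.frame, hD.bits, hD.dead, hD.red.mono_done fun v hv _ _ _ => hv⟩, ?_⟩
    -- The eliminated variables are distinct columns between d and K, so there are at most K
    -- expensive passes.
    have hcard : #D ≤ K := by
      have := card_le_card hD.red.sub
      rw [Nat.card_Ioo] at this
      omega
    have hn := T.two_le_n
    have hd := T.d_pos
    have e1 : t + 2 ≤ 2 * T.n * (T.d * B₁ + 4) + K * B₂ + 2 := by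
      have a1 := Nat.mul_le_mul_right B₁ h3
      have a2 := Nat.mul_le_mul_right B₂ hcard
      have a3 := Nat.mul_le_mul_left (2 * T.n) (Nat.add_le_add_right a1 4)
      omega
    refine e1.trans ?_
    rw [hB₁, hB₂]
    clear_value B₁ B₂
    clear * - hn hd hdK
    generalize T.n = n at *
    generalize T.d = d at *
    obtain ⟨k, rfl⟩ : ∃ k, K = d + 1 + k := ⟨K - (d + 1), by omega⟩
    obtain ⟨l, rfl⟩ : ∃ l, d = l + 1 := ⟨d - 1, by omega⟩
    obtain ⟨j, rfl⟩ : ∃ j, n = j + 2 := ⟨n - 2, by omega⟩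
    ring_nf
    omega

end ArrayRAM

/-! ### Output -/

namespace ArrayRAM

open RAM Finset

variable {T : EdgeTable}

/-- Lists the variables that have not been eliminated. -/
def listAlive : Prog :=
  .seq (setP rCnt (.c 0)) (forP rJ (.r rK)
    (whenP (.mul (.lt (.r rD) (.r rJ)) (.eq (.ld aDead (.r rJ) (.c 0)) (.c 0)))
      (.seq (storeP aAlive (.r rCnt) (.c 0) (.r rJ)) (setP rCnt (.add (.r rCnt) (.c 1))))))

theorem run_listAlive {S K : ℕ} {h : HState} (hS : T.Fits S) (hs : Stat T h) (hK : K < S)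
    (hrK : h.reg rK = K) :
    Run S listAlive h fun h' t => Frame 15 [aAlive] h h' ∧ t ≤ K * 6 + 3 ∧ h'.reg rCnt ≤ K ∧
      (∀ p < h'.reg rCnt, T.d < h'.arr aAlive p 0 ∧ h'.arr aAlive p 0 < K ∧
        h.arr aDead (h'.arr aAlive p 0) 0 = 0) ∧
      (∀ p < h'.reg rCnt, ∀ q < p, h'.arr aAlive q 0 < h'.arr aAlive p 0) ∧
      ∀ j, T.d < j → j < K → h.arr aDead j 0 = 0 → ∃ p < h'.reg rCnt, h'.arr aAlive p 0 = j := by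
  have hle := hS.le
  refine run_seq (run_set (by simp) (by simp; omega) ?_)
  refine run_for_uniform (B := 4) (Nv := K)
    (fun i h' => Frame 15 [aAlive] h h' ∧ h'.reg rJ = i ∧ h'.reg rCnt ≤ i ∧
      (∀ p < h'.reg rCnt, T.d < h'.arr aAlive p 0 ∧ h'.arr aAlive p 0 < i ∧
        h.arr aDead (h'.arr aAlive p 0) 0 = 0) ∧
      (∀ p < h'.reg rCnt, ∀ q < p, h'.arr aAlive q 0 < h'.arr aAlive p 0) ∧
      ∀ j, T.d < j → j < i → h.arr aDead j 0 = 0 → ∃ p < h'.reg rCnt, h'.arr aAlive p 0 = j)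
    ?_ hK ?_ ?_ ?_
  · exact ⟨(Frame.refl.setR (by norm_num)).setR (by norm_num), by simp, by simp, by simp, by simp,
      fun j _ hj => by omega⟩
  · rintro i h' - ⟨hf, hi, -⟩
    exact ⟨hi, by simp [hf.1, hrK], by simp⟩
  · rintro i h' hiK ⟨hf, hi, hcnt, h1, h2, h3⟩ -
    have hd : h'.arr aDead = h.arr aDead := hf.2 _ (by simp)
    have hD : h'.reg rD = T.d := by rw [hf.1 _ (by norm_num), hs.d]
    have hval : (HExpr.mul (.lt (.r rD) (.r rJ)) (.eq (.ld aDead (.r rJ) (.c 0)) (.c 0))).val h' =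
        if T.d < i ∧ h.arr aDead i 0 = 0 then 1 else 0 := by
      simp only [HExpr.val, hi, hd, hD]
      split_ifs <;> simp_all
    refine run_when (by simp [hi]; omega) ?_ ?_
    · rw [hval]
      intro hv
      have hc : T.d < i ∧ h.arr aDead i 0 = 0 := by
        by_contra hcon
        rw [if_neg hcon] at hv
        exact hv rfl
      refine run_seq (run_store (by simp) (by simp) (by simp) (by simp; omega) (by simp; omega)
        (by simp [hi]; omega) ?_)
      refine run_set (by simp) (by simp; omega) ?_
      set h₁ := ((h'.setA aAlive _ _ _).setR rCnt _).setR rJ (i + 1) with hh₁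
      have r1 : h₁.reg rCnt = h'.reg rCnt + 1 := by simp [hh₁]
      have r2 : ∀ p, h₁.arr aAlive p 0 = if p = h'.reg rCnt then i else h'.arr aAlive p 0 := by
        intro p; simp [hh₁, hi]
      have hf₁ : Frame 15 [aAlive] h h₁ := by
        rw [hh₁]
        exact ((hf.setA (by simp)).setR (by norm_num)).setR (by norm_num)
      have r3 : h₁.reg rJ = i + 1 := by simp [hh₁]
      clear_value h₁
      refine ⟨by simp [hi], by norm_num, hf₁, r3, by omega, ?_, ?_, ?_⟩
      · intro p hp
        rw [r2]
        split_ifs with hpc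
        · exact ⟨hc.1, by omega, hc.2⟩
        · have := h1 p (by omega)
          exact ⟨this.1, by omega, this.2.2⟩
      · intro p hp q hq
        rw [r2, r2, if_neg (by omega)]
        split_ifs with hpc
        · exact (h1 q (by omega)).2.1
        · exact h2 p (by omega) q hq
      · intro j hj hji hjd
        rcases Nat.lt_succ_iff_lt_or_eq.1 hji with h4 | rfl
        · obtain ⟨p, hp, hpj⟩ := h3 j hj h4 hjd
          exact ⟨p, by omega, by rw [r2, if_neg (by omega), hpj]⟩
        · exact ⟨h'.reg rCnt, by omega, by rw [r2, if_pos rfl]⟩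
    · rw [hval]
      intro hv
      have hc : ¬ (T.d < i ∧ h.arr aDead i 0 = 0) := by
        intro hcon
        rw [if_pos hcon] at hv
        exact one_ne_zero hv
      refine ⟨hi, by norm_num, hf.setR (by norm_num), by simp, by simp; omega, ?_, ?_, ?_⟩
      · intro p hp
        have := h1 p hp
        exact ⟨this.1, by simp; omega, this.2.2⟩
      · exact h2
      · intro j hj hji hjd
        rcases Nat.lt_succ_iff_lt_or_eq.1 hji with h4 | rfl
        · exact h3 j hj h4 hjd
        · exact absurd ⟨hj, hjd⟩ hc
  · rintro h' t ⟨hf, -, h0, h1, h2, h3⟩ - ht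
    exact ⟨hf, by omega, h0, h1, h2, h3⟩

/-- Writes the columns of the constants and of the remaining variables. -/
def writeColumns : Prog :=
  .seq (storeP aOut (.c 0) (.c 0) (.c 1)) (.seq (storeP aOut (.c 0) (.c 1) (.r rCnt))
    (forP rI (.r rE) (.seq (storeP aOut (.c 0) (.add (.c 2) (.r rI)) (.ld aLab (.r rI) (.r rD)))
      (forP rP (.r rCnt) (storeP aOut (.c 0)
        (.add (.add (.c 2) (.r rE)) (.add (.mul (.r rI) (.r rCnt)) (.r rP)))
        (.ld aLab (.r rI) (.ld aAlive (.r rP) (.c 0))))))))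

variable (T) in
/-- The entries of the output. -/
def outEntry (h : HState) (a x : ℕ) : ℕ :=
  if x = 0 then 1 else if x = 1 then a else if x < 2 + T.n * T.d then h.arr aLab (x - 2) T.d
  else h.arr aLab ((x - 2 - T.n * T.d) / a) (h.arr aAlive ((x - 2 - T.n * T.d) % a) 0)

theorem outEntry_add {h : HState} {a e p : ℕ} (hp : p < a) :
    outEntry T h a (2 + T.n * T.d + (e * a + p)) = h.arr aLab e (h.arr aAlive p 0) := by
  have h1 : 2 + T.n * T.d + (e * a + p) - 2 - T.n * T.d = p + a * e := by
    rw [mul_comm a e]; omega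
  rw [outEntry, if_neg (by omega), if_neg (by omega), if_neg (by omega), h1,
    Nat.add_mul_div_left _ _ (by omega), Nat.div_eq_of_lt hp, zero_add, Nat.add_mul_mod_self_left,
    Nat.mod_eq_of_lt hp]

theorem run_writeColumns {S a : ℕ} {h : HState} (hS : T.Fits S) (hs : Stat T h) (hl : LabBits h)
    (hcnt : h.reg rCnt = a) (ha : 2 + T.n * T.d + T.n * T.d * a < S)
    (hal : ∀ p < a, h.arr aAlive p 0 < S) :
    Run S writeColumns h fun h' t => t ≤ T.n * T.d * (3 * a + 7) + 4 ∧ h'.arr aOut 0 0 = 1 ∧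
      h'.arr aOut 0 1 = a ∧ (∀ e < T.n * T.d, h'.arr aOut 0 (2 + e) = h.arr aLab e T.d) ∧
      ∀ e < T.n * T.d, ∀ p < a, h'.arr aOut 0 (2 + T.n * T.d + (e * a + p)) =
        h.arr aLab e (h.arr aAlive p 0) := by
  have hle := hS.le
  have h1 := T.n_le_mul
  have h2 := T.d_le_mul
  have hn := T.two_le_n
  have haS : 2 * a ≤ T.n * T.d * a := Nat.mul_le_mul_right a (by omega)
  refine run_seq (run_store (by simp) (by simp) (by simp) (by simp; omega) (by simp; omega)
    (by simp; omega) ?_)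
  refine run_seq (run_store (by simp) (by simp) (by simp) (by simp; omega) (by simp; omega)
    (by simp [hcnt]; omega) ?_)
  set h₁ := (h.setA aOut _ _ _).setA aOut _ _ _ with hh₁
  have hf₁ : Frame 40 [aOut] h h₁ := by
    rw [hh₁]
    exact (Frame.refl.setA (by simp)).setA (by simp)
  have o₁ : ∀ x < 2, h₁.arr aOut 0 x = outEntry T h a x := by
    intro x hx
    interval_cases x <;> simp [hh₁, outEntry, hcnt]
  clear_value h₁
  -- The desired content of every cell is fixed in advance by `outEntry`. Storing a correct value
  -- cannot spoil a correct cell, so it is not necessary to show that the addresses are distinct.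
  have hset : ∀ (h' : HState) (X : ℕ → Prop) (x v : ℕ), (∀ y, X y → h'.arr aOut 0 y =
      outEntry T h a y) → v = outEntry T h a x → ∀ y, (X y ∨ y = x) →
        (h'.setA aOut 0 x v).arr aOut 0 y = outEntry T h a y := by
    intro h' X x v hX hv y hy
    by_cases hyx : y = x
    · simp [hyx, hv]
    · simpa [hyx] using hX y (hy.resolve_right hyx)
  refine run_for_uniform (B := 3 * a + 5) (Nv := T.n * T.d)
    (fun i h' => Frame 18 [aOut] h h' ∧ h'.reg rI = i ∧ h'.reg rCnt = a ∧
      ∀ x, (x < 2 + i ∨ ∃ e < i, ∃ p < a, x = 2 + T.n * T.d + (e * a + p)) →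
        h'.arr aOut 0 x = outEntry T h a x) ?_ (by omega) ?_ ?_ ?_
  · refine ⟨(hf₁.mono (by norm_num) (by simp)).setR (by norm_num), by simp, ?_, ?_⟩
    · simp [hf₁.1, hcnt]
    · rintro x (hx | ⟨e, he, -⟩)
      · exact o₁ x hx
      · omega
  · rintro i h' - ⟨hf, hi, -⟩
    exact ⟨hi, by simp [(hs.frame hf).e], by simp⟩
  · rintro i h' hid ⟨hf, hi, hc, ho⟩ -
    have hs' := hs.frame hf
    have hlab : h'.arr aLab = h.arr aLab := hf.2 _ (by simp)
    have halv : h'.arr aAlive = h.arr aAlive := hf.2 _ (by simp)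
    have hb := hl i T.d
    refine run_seq (run_store (by simp) (by simp) (by simp [hi, hs'.d]; omega) (by simp; omega)
      (by simp [hi]; omega) (by simp [hi, hs'.d, hlab]; omega) ?_)
    set h₂ := h'.setA aOut _ _ _ with hh₂
    have hf₂ : Frame 40 [aOut] h' h₂ := by
      rw [hh₂]
      exact Frame.refl.setA (by simp)
    have o₂ : ∀ x, ((x < 2 + i ∨ ∃ e < i, ∃ p < a, x = 2 + T.n * T.d + (e * a + p)) ∨ x = 2 + i) →
        h₂.arr aOut 0 x = outEntry T h a x := by
      have := hset h' _ (2 + i) (h.arr aLab i T.d) ho ?_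
      · simpa [hh₂, hi, hs'.d, hlab] using this
      · rw [outEntry, if_neg (by omega), if_neg (by omega), if_pos (by omega), Nat.add_sub_cancel_left]
    clear_value h₂
    have hbound : T.n * T.d * a = i * a + (T.n * T.d - i) * a := by
      rw [← add_mul]
      congr 1
      omega
    have hbound2 : 1 * a ≤ (T.n * T.d - i) * a := Nat.mul_le_mul_right a (by omega)
    refine run_for_uniform (B := 1) (Nv := a)
      (fun p h'' => Frame 27 [aOut] h₂ h'' ∧ h''.reg rP = p ∧ h''.reg rCnt = a ∧
        ∀ x, ((x < 2 + i + 1 ∨ ∃ e < i, ∃ p < a, x = 2 + T.n * T.d + (e * a + p)) ∨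
          ∃ p' < p, x = 2 + T.n * T.d + (i * a + p')) → h''.arr aOut 0 x = outEntry T h a x)
      ?_ (by omega) ?_ ?_ ?_
    · refine ⟨Frame.refl.setR (by norm_num), by simp, ?_, ?_⟩
      · simp [hf₂.1, hc]
      · rintro x ((hx | hx) | ⟨p', hp', -⟩)
        · rcases Nat.lt_succ_iff_lt_or_eq.1 hx with h3 | h3
          · exact o₂ x (Or.inl (Or.inl h3))
          · exact o₂ x (Or.inr h3)
        · exact o₂ x (Or.inl (Or.inr hx))
        · omega
    · rintro p h'' - ⟨-, hp, hc'', -⟩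
      exact ⟨hp, by simp [hc''], by simp⟩
    · rintro p h'' hpa ⟨hf'', hp, hc'', ho''⟩ -
      have e1 : h''.reg rI = i := by rw [hf''.1 _ (by norm_num), hf₂.1 _ (by norm_num), hi]
      have e2 : h''.reg rE = T.n * T.d := ((hs'.frame hf₂).frame hf'').e
      have e3 : h''.arr aLab = h.arr aLab := by
        rw [hf''.2 _ (by simp), hf₂.2 _ (by simp), hlab]
      have e4 : h''.arr aAlive = h.arr aAlive := by
        rw [hf''.2 _ (by simp), hf₂.2 _ (by simp), halv]
      have h5 := hal p hpa
      have h6 := hl i (h.arr aAlive p 0)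
      refine run_store (by simp) (by simp) (by simp [e1, hp, e4]; omega) (by simp; omega)
        (by simp [e1, e2, hp, hc'']; omega) (by simp [e1, hp, e3, e4]; omega) ?_
      refine ⟨by simp [hp], le_rfl, (hf''.setA (by simp)).setR (by norm_num), by simp, by simp [hc''],
        ?_⟩
      have := hset h'' _ (2 + T.n * T.d + (i * a + p)) (h.arr aLab i (h.arr aAlive p 0)) ho''
        (outEntry_add hpa).symm
      intro x hx
      have hx' := this x (by
        rcases hx with hx | ⟨p', hp', rfl⟩
        · exact Or.inl (Or.inl hx)
        · rcases Nat.lt_succ_iff_lt_or_eq.1 hp' with h3 | rfl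
          · exact Or.inl (Or.inr ⟨p', h3, rfl⟩)
          · exact Or.inr rfl)
      simpa only [HState.setR_arr, HExpr.val, e1, e2, e3, e4, hp, hc''] using hx'
    · rintro h'' t ⟨hf'', -, hc'', ho''⟩ - ht
      refine ⟨?_, by omega, ?_, by simp, by simp [hc''], ?_⟩
      · rw [hf''.1 _ (by norm_num), hf₂.1 _ (by norm_num), hi]
      · refine Frame.setR ?_ (by norm_num)
        exact hf.trans ((hf₂.mono (by norm_num) (by simp)).trans
          (hf''.mono (by norm_num) (by simp)))
      · rintro x (hx | ⟨e, he, p, hp, rfl⟩)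
        · exact ho'' x (Or.inl (Or.inl (by omega)))
        · rcases Nat.lt_succ_iff_lt_or_eq.1 he with h3 | rfl
          · exact ho'' _ (Or.inl (Or.inr ⟨e, h3, p, hp, rfl⟩))
          · exact ho'' _ (Or.inr ⟨p, hp, rfl⟩)
  · rintro h' t ⟨-, -, -, ho⟩ - ht
    refine ⟨?_, ?_, ?_, ?_, ?_⟩
    · have : T.n * T.d * (3 * a + 5 + 2) = T.n * T.d * (3 * a + 7) := rfl
      omega
    · rw [ho 0 (Or.inl (by omega))]; rfl
    · rw [ho 1 (Or.inl (by omega))]; rfl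
    · intro e he
      rw [ho _ (Or.inl (by omega)), outEntry, if_neg (by omega), if_neg (by omega),
        if_pos (by omega), Nat.add_sub_cancel_left]
    · intro e he p hp
      rw [ho _ (Or.inr ⟨e, he, p, hp, rfl⟩), outEntry_add hp]

/-- Writes the output. -/
def output : Prog :=
  iteP (.r rGo) (storeP aOut (.c 0) (.c 0) (.c 0)) (.seq listAlive writeColumns)

end ArrayRAM

/-! ### From reduced labels to a parametrization of the list -/

namespace EdgeTable

open Finset

variable {T : EdgeTable} {Sol Agr : (ℕ → ZMod 2) → Prop} {K a : ℕ} {D : Finset ℕ} {bad : Prop}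
  {done : ℕ → ℕ → Prop} {L : ℕ → ℕ → ZMod 2} {col : ℕ → ℕ}

/-- Scratch columns and the columns of eliminated variables are zero, so only the constant column
and the listed columns contribute. -/
theorem Reduced.labelWord_eq (hR : T.Reduced Sol Agr K D bad done L) (hdK : T.d < K)
    (hcol : ∀ p < a, T.d < col p ∧ col p < K)
    (hlt : ∀ p < a, ∀ q < p, col q < col p)
    (hsurj : ∀ j, T.d < j → j < K → j ∉ D → ∃ p < a, col p = j) {y : ℕ → ZMod 2} (hy : y T.d = 1)
    {e : ℕ} (he : e < T.n * T.d) :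
    labelWord L K y e = ∑ p ∈ range a, L e (col p) * y (col p) + L e T.d := by
  have hinj : Set.InjOn col (range a : Set ℕ) := by
    intro p hp q hq hpq
    rw [mem_coe, mem_range] at hp hq
    rcases lt_trichotomy p q with h | h | h
    · exact absurd hpq (hlt q hq p h).ne
    · exact h
    · exact absurd hpq (hlt p hp q h).ne'
  have hd : T.d ∉ (range a).image col := by
    simp only [mem_image, mem_range, not_exists, not_and]
    intro p hp
    exact (hcol p hp).1.ne'
  have hsum := sum_insert (f := fun j => L e j * y j) hd
  rw [sum_image hinj, hy, mul_one, add_comm] at hsum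
  rw [← hsum, labelWord]
  symm
  refine sum_subset ?_ ?_
  · intro j hj
    rcases mem_insert.1 hj with rfl | hj
    · exact mem_range.2 hdK
    · obtain ⟨p, hp, rfl⟩ := mem_image.1 hj
      exact mem_range.2 (hcol p (mem_range.1 hp)).2
  · intro j hj hj'
    rw [mem_insert, not_or] at hj'
    have hz : L e j = 0 := by
      rcases lt_or_gt_of_ne hj'.1 with h | h
      · exact hR.low e he j h
      · by_contra hne
        obtain ⟨p, hp, hpj⟩ := hsurj j h (mem_range.1 hj) fun hD => hne (hR.dead e he j hD)
        exact hj'.2 (mem_image.2 ⟨p, mem_range.2 hp, hpj⟩)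
    rw [hz, zero_mul]

end EdgeTable

namespace ArrayRAM

open RAM Finset

variable {T : EdgeTable}

/-- The algorithm after the initialization. -/
def decode : Prog := .seq labelEdges (.seq (setP rGo (.c 0)) (.seq reduce output))

variable (T) in
/-- The word `c` agrees with the labels of the known edges. -/
def Agrees (h : HState) (c : ℕ → ZMod 2) : Prop :=
  ∀ e < T.n * T.d, ¬ Unk h e → c e = lab h e T.d

variable (T) in
/-- The output is a parametrization of the words in `Sol` by `a` parameters. -/
structure Parametrizes (Sol : (ℕ → ZMod 2) → Prop) (a : ℕ) (M : ℕ → ℕ → ZMod 2) (l : ℕ → ZMod 2)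
    (out : ℕ → ℕ) : Prop where
  flag : out 0 = 1
  card : out 1 = a
  const : ∀ e < T.n * T.d, out (2 + e) = (l e).val
  coeff : ∀ e < T.n * T.d, ∀ p < a, out (2 + T.n * T.d + (e * a + p)) = (M e p).val
  exists_of_sol : ∀ c, Sol c → ∃ x : ℕ → ZMod 2, ∀ e < T.n * T.d,
    c e = ∑ p ∈ range a, M e p * x p + l e
  sol : ∀ x : ℕ → ZMod 2, Sol fun e => ∑ p ∈ range a, M e p * x p + l e
  unit : ∀ p < a, ∃ e < T.n * T.d, ∀ p' < a, M e p' = if p' = p then 1 else 0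

theorem decode_time {n d K a t₁ t₂ t₃ t₄ : ℕ} (hn : 2 ≤ n) (hd : 0 < d) (hK : d < K) (ha : a ≤ K)
    (h1 : t₁ ≤ 1000 * n * d ^ 3 * K ^ 2) (h2 : t₂ ≤ 200 * n * d ^ 2 * K ^ 2)
    (h3 : t₃ ≤ K * 6 + 3) (h4 : t₄ ≤ n * d * (3 * a + 7) + 4) :
    t₁ + (1 + (t₂ + (t₃ + t₄ + 1))) ≤ 2000 * n * d ^ 3 * K ^ 2 := by
  have h4' : t₄ ≤ n * d * (3 * K + 7) + 4 := h4.trans (by gcongr)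
  clear h4 ha
  obtain ⟨k, rfl⟩ : ∃ k, K = d + 1 + k := ⟨K - (d + 1), by omega⟩
  obtain ⟨l, rfl⟩ : ∃ l, d = l + 1 := ⟨d - 1, by omega⟩
  obtain ⟨j, rfl⟩ : ∃ j, n = j + 2 := ⟨n - 2, by omega⟩
  ring_nf at *
  omega

theorem run_decode {S Q : ℕ} {h : HState} (hS : T.Fits S)
    (hs : Stat T h) (hrK : h.reg rK = T.d + 1) (hQ1 : 1 ≤ Q) (hQ : T.Expanding Q (unkSet T h))
    (hdead : ∀ j, h.arr aDead j 0 = 0) (hbits : LabBits h) (hkn : ∀ e, h.arr aKn e 0 < 2)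
    (hzr : ∀ j, h.arr aLab (T.n * T.d) j = 0)
    (hzero : ∀ e < T.n * T.d, ∀ j, (Unk h e ∨ j ≠ T.d) → h.arr aLab e j = 0) :
    Run S decode h fun h' t => ∃ s, s * Q ≤ T.n * T.d ∧
      t ≤ 2000 * T.n * T.d ^ 3 * (T.d + 1 + s) ^ 2 ∧
      ((h'.arr aOut 0 0 = 0 ∧ ∀ c, ¬ (T.IsWord c ∧ Agrees T h c)) ∨
        ∃ a ≤ s, ∃ M l, Parametrizes T (fun c => T.IsWord c ∧ Agrees T h c) a M l (h'.arr aOut 0)) := by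
  have hle := hS.le
  have h1 := T.n_le_mul
  have h2 := T.d_le_mul
  set Sol : (ℕ → ZMod 2) → Prop := fun c => T.IsWord c ∧ Agrees T h c with hSolDef
  have hSol : ∀ c, Sol c → T.IsWord c := fun c hc => hc.1
  have hAgr : ∀ c c', (∀ e < T.n * T.d, c e = c' e) → Agrees T h c → Agrees T h c' :=
    fun c c' hcc hc e he hu => by rw [← hcc e he, hc e he hu]
  have hI : LabelInv T Sol (T.d + 1) h := by
    refine ⟨hbits, hkn, by omega, hzr, ?_, ?_⟩
    · intro e he j hor
      refine hzero e he j ?_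
      rcases hor with h3 | h3 | h3
      · exact Or.inl h3
      · exact Or.inr h3.ne
      · exact Or.inr (by omega)
    · intro c hc
      -- At the start only the constant column can be nonzero, so only the parameter y_d = 1
      -- matters.
      refine ⟨fun _ => 1, rfl, fun e he hu => ?_⟩
      rw [hc.2 e he hu, sum_range_succ, sum_eq_zero, zero_add, mul_one]
      intro j hj
      rw [lab, hzero e he j (Or.inr (mem_range.1 hj).ne), Nat.cast_zero, zero_mul]
  refine run_seq ((run_labelEdges hS hs hI hSol hrK hQ1 hQ).mono ?_)
  rintro h₁ t₁ ⟨s, hL, hempty, hsQ, ht₁⟩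
  set K := T.d + 1 + s with hK
  have hsle : s ≤ s * Q := Nat.le_mul_of_pos_right _ hQ1
  -- During the setup `rGo` held the offset of the neighbour lists. From here on it is the flag for
  -- an inconsistent check.
  refine run_seq (run_set (by simp) (by simp; omega) ?_)
  set h₂ := h₁.setR rGo ((HExpr.c 0).val h₁) with hh₂
  have hf₂ : Frame 6 [] h₁ h₂ := Frame.refl.setR (by norm_num)
  have hgo₂ : h₂.reg rGo = 0 := by simp [hh₂]
  have hlab₂ : lab h₂ = lab h₁ := lab_frame hf₂
  have hall : ∀ e < T.n * T.d, ¬ Unk h₁ e := by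
    intro e he hu
    have : e ∈ unkSet T h₁ := mem_unkSet.2 ⟨he, hu⟩
    rw [hempty] at this
    exact absurd this (notMem_empty e)
  have hdK : T.d < K := by omega
  have hKS : K < S := by omega
  have hred₂ : Reducing T Sol (Agrees T h) K h₂ ∅ (fun _ _ => False) h₂ := by
    refine ⟨Frame.refl, hL.inv.bits.frame hf₂, ?_, ?_⟩
    · intro j hj
      rw [hf₂.2 _ (by simp), hL.frame.2 _ (by simp), hdead]
      simp
    · rw [hgo₂, hlab₂]
      refine ⟨?_, by simp, by simp, ?_, ?_, ?_, by simp, by simp⟩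
      · intro e he j hj
        rw [lab, hL.inv.zero e he j (Or.inr (Or.inl hj)), Nat.cast_zero]
      · intro j hj hjK _
        obtain ⟨e, he, -, hrow⟩ := hL.unit j hj hjK
        refine ⟨e, he, fun j' _ => ?_⟩
        rw [lab, hrow]
        split_ifs <;> simp
      · intro c hc
        obtain ⟨y, hy, hcy⟩ := hL.inv.sound c hc
        exact ⟨y, hy, fun e he => hcy e he (hall e he)⟩
      -- Edges with a received symbol keep their constant label, so every choice of parameters
      -- agrees with the received word.
      · intro y hy e he hu
        have hrow : ∀ j, lab h₁ e j = lab h e j := fun j => by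
          rw [lab, lab, hL.lab_known e hu]
        rw [EdgeTable.labelWord, sum_eq_single T.d, hy, mul_one, hrow]
        · intro j _ hjd
          rw [hrow, lab, hzero e he j (Or.inr hjd), Nat.cast_zero, zero_mul]
        · exact fun hc => absurd (mem_range.2 hdK) hc
  have hs₂ := hL.stat.frame hf₂
  have hrK₂ : h₂.reg rK = K := by rw [hf₂.1 _ (by norm_num), hL.width]
  refine run_seq ((run_reduce hS hs₂ hSol hAgr hdK hKS hrK₂ hred₂).mono ?_)
  rintro h₃ t₃ ⟨D, hD, ht₃⟩
  have hs₃ := hs₂.frame hD.frame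
  have hrK₃ : h₃.reg rK = K := by rw [hD.frame.1 _ (by norm_num), hrK₂]
  refine run_ite (by simp) ?_ ?_
  · intro hgo
    refine run_store (by simp) (by simp) (by simp) (by simp; omega) (by simp; omega)
      (by simp; omega) ?_
    refine ⟨s, hsQ, ?_, Or.inl ⟨by simp, hD.red.none (by simpa using hgo)⟩⟩
    have := decode_time (a := 0) T.two_le_n T.d_pos hdK (by omega) ht₁ ht₃
      (Nat.zero_le (K * 6 + 3)) (t₄ := 1) (by omega)
    omega
  · intro hgo
    have hbad : ¬ h₃.reg rGo ≠ 0 := by simpa using hgo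
    refine run_seq ((run_listAlive hS hs₃ hKS hrK₃).mono ?_)
    rintro h₄ t₄ ⟨hf₄, ht₄, haK, hc1, hc2, hc3⟩
    set a := h₄.reg rCnt with ha
    set col : ℕ → ℕ := fun p => h₄.arr aAlive p 0 with hcol
    -- The listed columns increase strictly from d+1 on and stay below d+1+s, so there are at most s
    -- of them.
    have hge : ∀ p < a, T.d + 1 + p ≤ col p := by
      intro p
      induction p with
      | zero => exact fun hp => (hc1 0 hp).1
      | succ p ih =>
        intro hp
        have h5 := ih (by omega)
        have h6 : col p < col (p + 1) := hc2 (p + 1) hp p (by omega)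
        omega
    have has : a ≤ s := by
      rcases Nat.eq_zero_or_pos a with h5 | h5
      · omega
      · have h6 := hge (a - 1) (by omega)
        have h7 : col (a - 1) < K := (hc1 (a - 1) (by omega)).2.1
        omega
    have hl₄ : LabBits h₄ := hD.bits.frame hf₄
    have hlab₄ : lab h₄ = lab h₃ := lab_frame hf₄
    have hbound : 2 + T.n * T.d + T.n * T.d * a < S := by
      have h5 : T.n * T.d * a ≤ T.n * T.d * (T.n * T.d) := Nat.mul_le_mul_left _ (by omega)
      have h6 : (T.n * T.d + 2) ^ 4 ≤ S := hS
      have h7 : (T.n * T.d + 2) ^ 2 ≤ (T.n * T.d + 2) ^ 4 := Nat.pow_le_pow_right (by omega) (by norm_num)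
      have h8 : (T.n * T.d + 2) ^ 2 = T.n * T.d * (T.n * T.d) + 4 * (T.n * T.d) + 4 := by ring
      omega
    refine (run_writeColumns hS (hs₃.frame hf₄) hl₄ rfl hbound
      (fun p hp => (hc1 p hp).2.1.trans hKS)).mono ?_
    rintro h₅ t₅ ⟨ht₅, ho0, ho1, hol, hoM⟩
    refine ⟨s, hsQ, decode_time T.two_le_n T.d_pos hdK haK ht₁ ht₃ ht₄ ht₅, Or.inr ⟨a, has,
      fun e p => lab h₃ e (col p), fun e => lab h₃ e T.d, ho0, ho1, ?_, ?_, ?_, ?_, ?_⟩⟩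
    · intro e he
      rw [hol e he, ← hlab₄, lab, ZMod.val_natCast_of_lt (hl₄ e _)]
    · intro e he p hp
      rw [hoM e he p hp, ← hlab₄, lab, ZMod.val_natCast_of_lt (hl₄ e _)]
    · intro c hc
      obtain ⟨y, hy, hcy⟩ := hD.red.sound c hc
      refine ⟨fun p => y (col p), fun e he => ?_⟩
      rw [hcy e he, hD.red.labelWord_eq hdK (fun p hp => ⟨(hc1 p hp).1, (hc1 p hp).2.1⟩) hc2 ?_ hy he]
      intro j hj hjK hjD
      refine hc3 j hj hjK ?_
      by_contra hne
      exact hjD ((hD.dead j hjK).1 hne)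
    · intro x
      -- This places x_p in column `col p` and 1 in the constant column; as `col` is injective, the
      -- sum has at most one nonzero term.
      set y : ℕ → ZMod 2 := fun j => if j = T.d then 1 else
        ∑ p ∈ range a, if col p = j then x p else 0 with hy
      have hyd : y T.d = 1 := by simp [hy]
      have hyc : ∀ p < a, y (col p) = x p := by
        intro p hp
        have h6 : col p ≠ T.d := (hc1 p hp).1.ne'
        simp only [hy, if_neg h6]
        rw [sum_eq_single p, if_pos rfl]
        · intro q hq hqp
          rw [if_neg]
          rcases lt_or_gt_of_ne hqp with h7 | h7
          · exact (hc2 p hp q h7).ne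
          · exact (hc2 q (mem_range.1 hq) p h7).ne'
        · exact fun hc => absurd (mem_range.2 hp) hc
      have hw : ∀ e < T.n * T.d, EdgeTable.labelWord (lab h₃) K y e =
          ∑ p ∈ range a, lab h₃ e (col p) * x p + lab h₃ e T.d := by
        intro e he
        rw [hD.red.labelWord_eq hdK (fun p hp => ⟨(hc1 p hp).1, (hc1 p hp).2.1⟩) hc2 ?_ hyd he]
        · congr 1
          exact sum_congr rfl fun p hp => by rw [hyc p (mem_range.1 hp)]
        · intro j hj hjK hjD
          refine hc3 j hj hjK ?_
          by_contra hne
          exact hjD ((hD.dead j hjK).1 hne)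
      refine ⟨fun v hv k hk => ?_, hAgr _ _ hw (hD.red.agr y hyd)⟩
      rw [← EdgeTable.check_congr hv hw]
      exact hD.red.checks hbad v hv k hk trivial y hyd
    · intro p hp
      obtain ⟨e, he, hrow⟩ := hD.red.unit (col p) (hc1 p hp).1 (hc1 p hp).2.1
        fun hcon => (hD.dead _ (hc1 p hp).2.1).2 hcon (hc1 p hp).2.2
      refine ⟨e, he, fun p' hp' => ?_⟩
      show lab h₃ e (col p') = _
      rw [hrow _ (hc1 p' hp').2.1]
      refine if_congr ⟨fun hpp => ?_, fun hpp => by rw [hpp]⟩ rfl rfl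
      rcases lt_trichotomy p' p with h7 | h7 | h7
      · exact absurd hpp (hc2 p hp p' h7).ne
      · exact h7
      · exact absurd hpp (hc2 p' hp' p h7).ne'

end ArrayRAM

/-! ### Initialization -/

namespace ArrayRAM

open RAM Finset

variable {T : EdgeTable}

/-- The hypothesis `hins` makes the invariant insensitive to both loop registers. Their values are
handed to the body separately, so the bookkeeping of the nested loop is done once. -/
theorem run_for_for {S x y Nv Mv B : ℕ} {N M : HExpr} {p : Prog} {h : HState}
    {Q : HState → ℕ → Prop} (I : ℕ → ℕ → HState → Prop) (hxy : x ≠ y) (hI : I 0 0 h)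
    (hins : ∀ i j h v, I i j h → I i j (h.setR x v) ∧ I i j (h.setR y v))
    (hNS : Nv < S) (hMS : Mv < S)
    (hN : ∀ i j h, I i j h → (N.val h = Nv ∧ N.ok S h) ∧ M.val h = Mv ∧ M.ok S h)
    (hstep : ∀ i < Nv, ∀ j < Mv, ∀ h, I i j h → h.reg x = i → h.reg y = j →
      Run S p h fun h' T' => h'.reg x = i ∧ h'.reg y = j ∧ T' ≤ B ∧ I i (j + 1) h')
    (hnext : ∀ i h, I i Mv h → I (i + 1) 0 h)
    (hQ : ∀ h T, I Nv 0 h → T ≤ Nv * (Mv * (B + 2) + 4) + 2 → Q h T)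
    (hw : (HExpr.lt (.r x) N).wf = true := by rfl) (hw' : (HExpr.lt (.r y) M).wf = true := by rfl) :
    Run S (forP x N (forP y M p)) h Q := by
  refine run_for_uniform (B := Mv * (B + 2) + 2) (Nv := Nv) (fun i h => I i 0 h ∧ h.reg x = i)
    ⟨(hins _ _ _ _ hI).1, by simp⟩ hNS (fun i h _ hh => ⟨hh.2, (hN _ _ _ hh.1).1⟩) ?_ ?_ hw
  · rintro i h₁ hi ⟨hI₁, hx₁⟩ -
    refine run_for_uniform (B := B) (Nv := Mv) (fun j h => I i j h ∧ h.reg x = i ∧ h.reg y = j)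
      ⟨(hins _ _ _ _ hI₁).2, by simp [hxy, hx₁], by simp⟩ hMS
      (fun j h _ hh => ⟨hh.2.2, (hN _ _ _ hh.1).2⟩) ?_ ?_ hw'
    · rintro j h₂ hj ⟨hI₂, hx₂, hy₂⟩ -
      refine (hstep i hi j hj h₂ hI₂ hx₂ hy₂).mono ?_
      rintro h₃ t₃ ⟨hx₃, hy₃, ht₃, hI₃⟩
      exact ⟨hy₃, ht₃, (hins _ _ _ _ hI₃).2, by simp [hxy, hx₃], by simp⟩
    · rintro h₂ t₂ ⟨hI₂, hx₂, -⟩ - ht₂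
      exact ⟨hx₂, by omega, (hins _ _ _ _ (hnext i h₂ hI₂)).1, by simp⟩
  · rintro h' t ⟨hI', -⟩ - ht
    exact hQ h' t hI' (by omega)

variable (T) in
/-- The input: the `n`, `d`, `m`, the parity-check matrix, the neighbours of the left and the right
vertices, and the received word `w`. -/
structure HoldsInput (w : ℕ → ℕ) (h : HState) : Prop where
  n : h.arr aIn 0 0 = T.n
  d : h.arr aIn 0 1 = T.d
  m : h.arr aIn 0 2 = T.m
  H : ∀ k < T.m, ∀ i < T.d, h.arr aIn 0 (3 + (k * T.d + i)) = T.H k i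
  left : ∀ e < T.n * T.d, T.n + h.arr aIn 0 (3 + T.m * T.d + e) = T.ev e 1
  right : ∀ v < T.n, ∀ i < T.d,
    h.arr aIn 0 (3 + T.m * T.d + T.n * T.d + (v * T.d + i)) = T.ev (T.eid (T.n + v) i) 0
  word : ∀ e < T.n * T.d, h.arr aIn 0 (3 + T.m * T.d + T.n * T.d + T.n * T.d + e) = w e
  zero : ∀ a ≠ aIn, ∀ i j, h.arr a i j = 0

variable (T) in
/-- The state before the first deduction. -/
structure Ready (w : ℕ → ℕ) (h : HState) : Prop where
  stat : Stat T h
  width : h.reg rK = T.d + 1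
  dead : ∀ j, h.arr aDead j 0 = 0
  bits : LabBits h
  kn_lt : ∀ e, h.arr aKn e 0 < 2
  zeroRow : ∀ j, h.arr aLab (T.n * T.d) j = 0
  zero : ∀ e < T.n * T.d, ∀ j, (Unk h e ∨ j ≠ T.d) → h.arr aLab e j = 0
  unk : ∀ e < T.n * T.d, Unk h e ↔ ¬ w e < 2
  lab : ∀ e < T.n * T.d, w e < 2 → h.arr aLab e T.d = w e

/-- Reads the parameters. -/
def initParams : Prog :=
  .seq (setP rN (.ld aIn (.c 0) (.c 0))) (.seq (setP rD (.ld aIn (.c 0) (.c 1)))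
  (.seq (setP rM (.ld aIn (.c 0) (.c 2))) (.seq (setP rK (.add (.r rD) (.c 1)))
  (.seq (setP rNN (.add (.r rN) (.r rN))) (.seq (setP rE (.mul (.r rN) (.r rD)))
  (setP rGo (.add (.c 3) (.mul (.r rM) (.r rD)))))))))

/-- Reads the parity-check matrix. -/
def initChecks : Prog :=
  forP rRow (.r rM) (forP rI (.r rD) (storeP aH (.r rRow) (.r rI)
    (.ld aIn (.c 0) (.add (.c 3) (.add (.mul (.r rRow) (.r rD)) (.r rI))))))

/-- Reads the edges at the left vertices and the received word. -/
def initLeft : Prog :=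
  forP rCur (.r rN) (forP rI (.r rD)
    (.seq (setP rEd (.add (.mul (.r rCur) (.r rD)) (.r rI)))
    (.seq (storeP aEid (.r rCur) (.r rI) (.r rEd))
    (.seq (storeP aEv (.r rEd) (.c 0) (.r rCur))
    (.seq (storeP aEv (.r rEd) (.c 1) (.add (.r rN) (.ld aIn (.c 0) (.add (.r rGo) (.r rEd)))))
    (.seq (setP rX (.ld aIn (.c 0) (.add (.add (.add (.r rGo) (.r rE)) (.r rE)) (.r rEd))))
    (whenP (.lt (.r rX) (.c 2)) (.seq (storeP aKn (.r rEd) (.c 0) (.c 1))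
      (storeP aLab (.r rEd) (.r rD) (.r rX))))))))))

/-- Finds the edges at the right vertices. -/
def initRight : Prog :=
  forP rCur (.r rN) (forP rI (.r rD)
    (.seq (setP rV (.ld aIn (.c 0)
      (.add (.add (.r rGo) (.r rE)) (.add (.mul (.r rCur) (.r rD)) (.r rI)))))
    (forP rJ (.r rD) (whenP
      (.eq (.ld aIn (.c 0) (.add (.r rGo) (.add (.mul (.r rV) (.r rD)) (.r rJ)))) (.r rCur))
      (storeP aEid (.add (.r rN) (.r rCur)) (.r rI) (.add (.mul (.r rV) (.r rD)) (.r rJ)))))))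

/-- Fills registers and arrays from the input. -/
def setup : Prog := .seq initParams (.seq initChecks (.seq initLeft initRight))

variable (T) in
/-- The registers after reading the parameters. -/
structure Params (h : HState) : Prop where
  n : h.reg rN = T.n
  d : h.reg rD = T.d
  m : h.reg rM = T.m
  k : h.reg rK = T.d + 1
  nn : h.reg rNN = 2 * T.n
  e : h.reg rE = T.n * T.d
  off : h.reg rGo = 3 + T.m * T.d

theorem Params.frame {h h' : HState} (hp : Params T h) {A : List ℕ} (hf : Frame 7 A h h') :
    Params T h' where
  n := by rw [hf.1 _ (by norm_num), hp.n]
  d := by rw [hf.1 _ (by norm_num), hp.d]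
  m := by rw [hf.1 _ (by norm_num), hp.m]
  k := by rw [hf.1 _ (by norm_num), hp.k]
  nn := by rw [hf.1 _ (by norm_num), hp.nn]
  e := by rw [hf.1 _ (by norm_num), hp.e]
  off := by rw [hf.1 _ (by norm_num), hp.off]

/-- The whole input fits into the first row of array 0, where memory addresses and column indices
coincide. -/
theorem input_size {S : ℕ} (hS : T.Fits S) :
    3 + T.m * T.d + T.n * T.d + T.n * T.d + T.n * T.d < S := by
  have h1 := T.d_le_mul
  have h2 : T.m * T.d ≤ T.n * T.d * (T.n * T.d) := Nat.mul_le_mul (by have := T.m_le; omega) (by omega)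
  have h3 : (T.n * T.d + 2) ^ 4 ≤ S := hS
  have h4 : (T.n * T.d + 2) ^ 2 * 4 ≤ (T.n * T.d + 2) ^ 4 := by
    have : 2 ^ 2 ≤ (T.n * T.d + 2) ^ 2 := Nat.pow_le_pow_left (by omega) 2
    calc (T.n * T.d + 2) ^ 2 * 4 ≤ (T.n * T.d + 2) ^ 2 * (T.n * T.d + 2) ^ 2 :=
          Nat.mul_le_mul_left _ this
      _ = _ := by ring
  have h5 : (T.n * T.d + 2) ^ 2 = T.n * T.d * (T.n * T.d) + 4 * (T.n * T.d) + 4 := by ring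
  omega

theorem run_initParams {S : ℕ} {w : ℕ → ℕ} {h : HState} (hS : T.Fits S) (hin : HoldsInput T w h) :
    Run S initParams h fun h' t => Params T h' ∧ h'.arr = h.arr ∧ t ≤ 7 := by
  have hle := hS.le
  have h1 := T.n_le_mul
  have h2 := T.d_le_mul
  have h3 := T.m_le
  have h4 := input_size hS
  refine run_seq (run_set (by simp; omega) (by simp [hin.n]; omega) ?_)
  refine run_seq (run_set (by simp; omega) (by simp [hin.d]; omega) ?_)
  refine run_seq (run_set (by simp; omega) (by simp [hin.m]; omega) ?_)
  refine run_seq (run_set (by simp) (by simp [hin.d]; omega) ?_)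
  refine run_seq (run_set (by simp) (by simp [hin.n]; omega) ?_)
  refine run_seq (run_set (by simp) (by simp [hin.n, hin.d]; omega) ?_)
  refine run_set (by simp) (by simp [hin.m, hin.d]; omega) ?_
  refine ⟨⟨?_, ?_, ?_, ?_, ?_, ?_, ?_⟩, rfl, by norm_num⟩
  all_goals simp [hin.n, hin.d, hin.m]
  omega

theorem mul_add_lt {a b i j : ℕ} (hi : i < a) (hj : j < b) : i * b + j < a * b := by
  have : (i + 1) * b ≤ a * b := Nat.mul_le_mul_right b hi
  rw [add_mul] at this
  omega

theorem mul_add_inj {b i j i' j' : ℕ} (hj : j < b) (hj' : j' < b) (h : i * b + j = i' * b + j') :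
    i = i' ∧ j = j' := by
  have h1 : i = i' := by
    rcases lt_trichotomy i i' with h2 | h2 | h2
    · have := mul_add_lt h2 hj
      omega
    · exact h2
    · have := mul_add_lt h2 hj'
      omega
  subst h1
  omega

theorem run_initChecks {S : ℕ} {w : ℕ → ℕ} {h : HState} (hS : T.Fits S) (hin : HoldsInput T w h)
    (hH : ∀ k < T.m, ∀ i < T.d, T.H k i < 2) (hp : Params T h) :
    Run S initChecks h fun h' t => Frame 7 [aH] h h' ∧
      (∀ k < T.m, ∀ i < T.d, h'.arr aH k i = T.H k i) ∧ t ≤ T.m * (T.d * 3 + 4) + 2 := by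
  have hle := hS.le
  have h1 := T.n_le_mul
  have h2 := T.d_le_mul
  have h3 := T.m_le
  have h4 := input_size hS
  refine run_for_for (Nv := T.m) (Mv := T.d) (B := 1) (fun k i h' => Frame 7 [aH] h h' ∧
    ∀ k' < T.m, ∀ i' < T.d, k' * T.d + i' < k * T.d + i → h'.arr aH k' i' = T.H k' i') (by norm_num)
    ⟨Frame.refl, by simp⟩ ?_ (by omega) (by omega) ?_ ?_ ?_ ?_
  · rintro i j h' v ⟨hf, hh⟩
    exact ⟨⟨hf.setR (by norm_num), hh⟩, ⟨hf.setR (by norm_num), hh⟩⟩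
  · rintro i j h' ⟨hf, -⟩
    have hp' := hp.frame hf
    simp [hp'.m, hp'.d]
  · rintro k hk i hi h' ⟨hf, hh⟩ hrow hI
    have hp' := hp.frame hf
    have hinp : h'.arr aIn = h.arr aIn := hf.2 _ (by simp)
    have hlt := mul_add_lt hk hi
    have h5 := hH k hk i hi
    have h6 := hin.H k hk i hi
    refine run_store (by simp) (by simp) (by simp [hrow, hI, hp'.d]; omega) (by simp [hrow]; omega)
      (by simp [hI]; omega) (by simp [hrow, hI, hp'.d, hinp, h6]; omega) ?_
    refine ⟨hrow, hI, le_rfl, hf.setA (by simp), fun k' hk' i' hi' hlt' => ?_⟩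
    simp only [HState.setA_arr, HExpr.val, hrow, hI, hp'.d, hinp, h6]
    norm_num
    split_ifs with heq
    · rw [heq.1, heq.2]
    · refine hh k' hk' i' hi' ?_
      by_contra hcon
      exact heq (mul_add_inj hi' hi (by omega))
  · rintro i h' ⟨hf, hh⟩
    refine ⟨hf, fun k' hk' i' hi' hlt => hh k' hk' i' hi' ?_⟩
    rw [add_mul] at hlt
    omega
  · rintro h' t ⟨hf, hh⟩ ht
    refine ⟨hf, fun k hk i hi => hh k hk i hi ?_, ht⟩
    have := mul_add_lt hk hi
    omega

/-- Edges are numbered u·d + i by their left ends, so no search is needed. A received bit becomes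
the constant term of its label. -/
theorem run_initLeft {S : ℕ} {w : ℕ → ℕ} {h₀ h : HState} (hS : T.Fits S)
    (hin : HoldsInput T w h₀)
    (hinp₀ : h.arr aIn = h₀.arr aIn)
    (hin' : ∀ a ∉ [aIn, aH], ∀ i j, h.arr a i j = 0) (hw : ∀ e < T.n * T.d, w e < 3)
    (heid : ∀ u < T.n, ∀ i < T.d, T.eid u i = u * T.d + i) (hp : Params T h) :
    Run S initLeft h fun h' t => Frame 7 [aEid, aEv, aKn, aLab] h h' ∧
      (∀ u < T.n, ∀ i < T.d, h'.arr aEid u i = T.eid u i) ∧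
      (∀ e < T.n * T.d, ∀ s < 2, h'.arr aEv e s = T.ev e s) ∧
      (∀ e, h'.arr aKn e 0 = if e < T.n * T.d ∧ w e < 2 then 1 else 0) ∧
      (∀ e j, h'.arr aLab e j = if e < T.n * T.d ∧ w e < 2 ∧ j = T.d then w e else 0) ∧
      t ≤ T.n * (T.d * 12 + 4) + 2 := by
  have hle := hS.le
  have h1 := T.n_le_mul
  have h2 := T.d_le_mul
  have h4 := input_size hS
  refine run_for_for (Nv := T.n) (Mv := T.d) (B := 10)
    (fun u i h' => Frame 7 [aEid, aEv, aKn, aLab] h h' ∧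
    (∀ u' < T.n, ∀ i' < T.d, u' * T.d + i' < u * T.d + i → h'.arr aEid u' i' = T.eid u' i') ∧
    (∀ e < u * T.d + i, ∀ s < 2, h'.arr aEv e s = T.ev e s) ∧
    (∀ e, h'.arr aKn e 0 = if e < u * T.d + i ∧ w e < 2 then 1 else 0) ∧
    (∀ e j, h'.arr aLab e j = if e < u * T.d + i ∧ w e < 2 ∧ j = T.d then w e else 0)) (by norm_num)
    ?_ ?_ (by omega) (by omega) ?_ ?_ ?_ ?_
  · refine ⟨Frame.refl, by simp, by simp, fun e => ?_, fun e j => ?_⟩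
    · rw [hin' _ (by simp), if_neg (by omega)]
    · rw [hin' _ (by simp), if_neg (by omega)]
  · rintro i j h' v ⟨hf, hh⟩
    exact ⟨⟨hf.setR (by norm_num), hh⟩, ⟨hf.setR (by norm_num), hh⟩⟩
  · rintro i j h' ⟨hf, -⟩
    have hp' := hp.frame hf
    simp [hp'.n, hp'.d]
  · rintro u hu i hi h' ⟨hf, hid, hev, hkn, hlab⟩ hcur hI
    have hp' := hp.frame hf
    have hinp : h'.arr aIn = h₀.arr aIn := by rw [hf.2 _ (by simp), hinp₀]
    have hlt := mul_add_lt hu hi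
    have h5 := hin.left _ hlt
    have h6 := hin.word _ hlt
    have h7 := hw _ hlt
    have h8 := T.ev_lt hlt (s := 1) (by norm_num)
    have h9 : T.ev (u * T.d + i) 0 = u := by
      have := T.ev_eid (v := u) (i := i) (by omega) hi
      rwa [if_pos hu, heid u hu i hi] at this
    refine run_seq (run_set (by simp) (by simp [hcur, hI, hp'.d]; omega) ?_)
    have hval : (HExpr.add (.mul (.r rCur) (.r rD)) (.r rI)).val h' = u * T.d + i := by
      simp [hcur, hI, hp'.d]
    rw [hval]
    set e := u * T.d + i with he
    set h₁ := h'.setR rEd e with hh₁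
    have q1 : h₁.reg rEd = e := by simp [hh₁]
    have hf₁ : Frame 19 [] h' h₁ := Frame.refl.setR (by norm_num)
    have q2 : h₁.reg rCur = u := by rw [hf₁.1 _ (by norm_num), hcur]
    have q3 : h₁.reg rI = i := by rw [hf₁.1 _ (by norm_num), hI]
    have hp₁ := hp'.frame (hf₁.mono (by norm_num) (A' := []) (by simp))
    have harr₁ : h₁.arr = h'.arr := rfl
    clear_value h₁
    refine run_seq (run_store (by simp) (by simp) (by simp) (by simp [q2]; omega)
      (by simp [q3]; omega) (by simp [q1]; omega) ?_)
    refine run_seq (run_store (by simp) (by simp) (by simp) (by simp [q1]; omega)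
      (by simp; omega) (by simp [q2]; omega) ?_)
    refine run_seq (run_store (by simp) (by simp) (by simp [hp₁.off, q1]; omega)
      (by simp [q1]; omega) (by simp; omega)
      (by simp [q1, hp₁.n, hp₁.off, harr₁, hinp, h5]; omega) ?_)
    refine run_seq (run_set (by simp [hp₁.off, hp₁.e, q1]; omega)
      (by simp [hp₁.off, hp₁.e, q1, harr₁, hinp, h6]; omega) ?_)
    set h₂ := (((h₁.setA aEid _ _ _).setA aEv _ _ _).setA aEv _ _ _).setR rX _ with hh₂
    have hf₂ : Frame 28 [aEid, aEv] h₁ h₂ := by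
      rw [hh₂]
      exact (((Frame.refl.setA (by simp)).setA (by simp)).setA (by simp)).setR (by norm_num)
    have qX : h₂.reg rX = w e := by
      simp [hh₂, hp₁.off, hp₁.e, q1, harr₁, hinp, h6]
    have a1 : ∀ u' i', h₂.arr aEid u' i' = if u' = u ∧ i' = i then e else h'.arr aEid u' i' := by
      intro u' i'
      simp [hh₂, q1, q2, q3, harr₁]
    have a2 : ∀ e' s, s < 2 → h₂.arr aEv e' s = if e' = e then T.ev e s else h'.arr aEv e' s := by
      intro e' s hs
      interval_cases s
      · simp [hh₂, q1, q2, harr₁, h9]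
      · simp [hh₂, q1, hp₁.n, hp₁.off, harr₁, hinp, h5]
    have a3 : h₂.arr aKn = h'.arr aKn := by rw [hf₂.2 _ (by simp), harr₁]
    have a4 : h₂.arr aLab = h'.arr aLab := by rw [hf₂.2 _ (by simp), harr₁]
    clear_value h₂
    have hid' : ∀ u' < T.n, ∀ i' < T.d, u' * T.d + i' < u * T.d + (i + 1) →
        h₂.arr aEid u' i' = T.eid u' i' := by
      intro u' hu' i' hi' hlt'
      rw [a1]
      split_ifs with heq
      · rw [heq.1, heq.2, heid u hu i hi]
      · refine hid u' hu' i' hi' ?_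
        by_contra hcon
        exact heq (mul_add_inj hi' hi (by omega))
    have hev' : ∀ e' < u * T.d + (i + 1), ∀ s < 2, h₂.arr aEv e' s = T.ev e' s := by
      intro e' he' s hs
      rw [a2 e' s hs]
      split_ifs with heq
      · rw [heq]
      · exact hev e' (by omega) s hs
    have hff : Frame 7 [aEid, aEv, aKn, aLab] h h₂ := hf.trans
      ((hf₁.mono (by norm_num) (by simp)).trans (hf₂.mono (by norm_num) (by simp)))
    have qcur : h₂.reg rCur = u := by rw [hf₂.1 _ (by norm_num), q2]
    have qI : h₂.reg rI = i := by rw [hf₂.1 _ (by norm_num), q3]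
    have qE : h₂.reg rEd = e := by rw [hf₂.1 _ (by norm_num), q1]
    have qD : h₂.reg rD = T.d := by rw [hf₂.1 _ (by norm_num), hp₁.d]
    refine run_when (by simp) ?_ ?_
    · intro hv
      have hw2 : w e < 2 := by
        by_contra hcon
        simp [qX, hcon] at hv
      refine run_seq (run_store (by simp) (by simp) (by simp) (by simp [qE]; omega)
        (by simp; omega) (by simp; omega) ?_)
      refine run_store (by simp) (by simp) (by simp) (by simp [qE]; omega)
        (by simp [qD]; omega) (by simp [qX]; omega) ?_
      refine ⟨by simp [qcur], by simp [qI], by norm_num, (hff.setA (by simp)).setA (by simp), hid',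
        hev', ?_, ?_⟩
      · intro e'
        simp only [HState.setA_arr, HExpr.val, qE, a3, hkn]
        norm_num
        by_cases hee : e' = e
        · rw [if_pos hee, hee, if_pos ⟨by omega, by omega⟩]
        · rw [if_neg hee]
          refine if_congr ?_ rfl rfl
          have : e' < u * T.d + (i + 1) ↔ e' < e := by omega
          rw [this]
      · intro e' j
        simp only [HState.setA_arr, HState.setA_reg, HExpr.val, qE, qD, qX, a4, hlab]
        norm_num
        by_cases hee : e' = e
        · subst hee
          by_cases hj : j = T.d
          · rw [if_pos ⟨rfl, hj⟩, if_pos ⟨by omega, by omega, hj⟩]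
          · rw [if_neg (by tauto), if_neg (by tauto), if_neg (by tauto)]
        · rw [if_neg (by tauto)]
          refine if_congr ?_ rfl rfl
          have : e' < u * T.d + (i + 1) ↔ e' < e := by omega
          rw [this]
    · intro hv
      have hw2 : ¬ w e < 2 := by
        intro hcon
        simp [qX, hcon] at hv
      refine ⟨qcur, qI, by norm_num, hff, hid', hev', ?_, ?_⟩
      · intro e'
        rw [a3, hkn]
        refine if_congr ?_ rfl rfl
        by_cases hee : e' = e
        · subst hee; tauto
        · have : e' < u * T.d + (i + 1) ↔ e' < e := by omega
          rw [this]
      · intro e' j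
        rw [a4, hlab]
        refine if_congr ?_ rfl rfl
        by_cases hee : e' = e
        · subst hee; tauto
        · have : e' < u * T.d + (i + 1) ↔ e' < e := by omega
          rw [this]
  · rintro i h' ⟨hf, h5, h6, h7, h8⟩
    have : (i + 1) * T.d + 0 = i * T.d + T.d := by ring
    rw [this]
    exact ⟨hf, h5, h6, h7, h8⟩
  · rintro h' t ⟨hf, h5, h6, h7, h8⟩ ht
    rw [add_zero] at h5 h6 h7 h8
    exact ⟨hf, fun u hu i hi => h5 u hu i hi (mul_add_lt hu hi), h6, h7, h8, ht⟩

/-- The number of the edge from u to v is found by looking for v in the list of u. As there are no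
multiple edges, v occurs there exactly once. -/
theorem run_initRight {S : ℕ} {w : ℕ → ℕ} {h₀ h : HState} (hS : T.Fits S)
    (hin : HoldsInput T w h₀) (hinp : h.arr aIn = h₀.arr aIn)
    (heid : ∀ u < T.n, ∀ i < T.d, T.eid u i = u * T.d + i)
    (hsimple : ∀ e < T.n * T.d, ∀ e' < T.n * T.d, T.ev e 0 = T.ev e' 0 → T.ev e 1 = T.ev e' 1 →
      e = e') (hp : Params T h) :
    Run S initRight h fun h' t => Frame 7 [aEid] h h' ∧
      (∀ u < T.n, ∀ i < T.d, h'.arr aEid u i = h.arr aEid u i) ∧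
      (∀ v < T.n, ∀ i < T.d, h'.arr aEid (T.n + v) i = T.eid (T.n + v) i) ∧
      t ≤ T.n * (T.d * (4 * T.d + 5) + 4) + 2 := by
  have hle := hS.le
  have h1 := T.n_le_mul
  have h2 := T.d_le_mul
  have h4 := input_size hS
  refine run_for_for (Nv := T.n) (Mv := T.d) (B := 4 * T.d + 3)
    (fun v i h' => Frame 7 [aEid] h h' ∧
    (∀ u < T.n, ∀ i < T.d, h'.arr aEid u i = h.arr aEid u i) ∧
    (∀ v' < T.n, ∀ i' < T.d, v' * T.d + i' < v * T.d + i →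
      h'.arr aEid (T.n + v') i' = T.eid (T.n + v') i')) (by norm_num)
    ⟨Frame.refl, by simp, by simp⟩ ?_ (by omega) (by omega) ?_ ?_ ?_ ?_
  · rintro i j h' v ⟨hf, hh⟩
    exact ⟨⟨hf.setR (by norm_num), hh⟩, ⟨hf.setR (by norm_num), hh⟩⟩
  · rintro i j h' ⟨hf, -⟩
    have hp' := hp.frame hf
    simp [hp'.n, hp'.d]
  · rintro v hv i hi h' ⟨hf, hleft, hright⟩ hcur hI
    have hp' := hp.frame hf
    have hinp' : h'.arr aIn = h₀.arr aIn := by rw [hf.2 _ (by simp), hinp]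
    have hlt := mul_add_lt hv hi
    have h5 := hin.right v hv i hi
    have hfl := T.eid_lt (v := T.n + v) (i := i) (by omega) hi
    set f := T.eid (T.n + v) i with hfdef
    have hf1 : T.ev f 1 = T.n + v := by
      have := T.ev_eid (v := T.n + v) (i := i) (by omega) hi
      rwa [if_neg (by omega)] at this
    have hu : T.ev f 0 < T.n := by
      have := T.side_ev hfl (s := 0) (by norm_num)
      by_contra hcon
      rw [if_neg hcon] at this
      exact one_ne_zero this
    obtain ⟨j₀, hj₀, hfj⟩ := T.exists_eid hfl (s := 0) (by norm_num)
    set u := T.ev f 0 with hudef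
    rw [heid u hu j₀ hj₀] at hfj
    have htest : ∀ j < T.d, (h₀.arr aIn 0 (3 + T.m * T.d + (u * T.d + j)) = v ↔ j = j₀) := by
      intro j hj
      have hl := mul_add_lt hu hj
      have h6 := hin.left _ hl
      have h7 : T.ev (u * T.d + j) 0 = u := by
        have := T.ev_eid (v := u) (i := j) (by omega) hj
        rwa [if_pos hu, heid u hu j hj] at this
      constructor
      · intro hv'
        have h8 := hsimple _ hl _ hfl (by rw [h7]) (by rw [hf1]; omega)
        rw [← hfj] at h8
        exact (mul_add_inj hj hj₀ h8).2
      · rintro rfl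
        rw [hfj, hf1] at h6
        rw [hfj]
        omega
    have hval : (HExpr.ld aIn (.c 0)
      (.add (.add (.r rGo) (.r rE)) (.add (.mul (.r rCur) (.r rD)) (.r rI)))).val h' = u := by
      simp [hcur, hI, hp'.d, hp'.off, hp'.e, hinp', h5]
    refine run_seq (run_set (by simp [hcur, hI, hp'.d, hp'.off, hp'.e]; omega)
      (by rw [hval]; omega) ?_)
    rw [hval]
    refine run_for_uniform (B := 2) (Nv := T.d) (fun j h'' => Frame 11 [aEid] h' h'' ∧
      h''.reg rI = i ∧ h''.reg rV = u ∧ h''.reg rJ = j ∧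
      (∀ x y, ¬ (x = T.n + v ∧ y = i) → h''.arr aEid x y = h'.arr aEid x y) ∧
      (j₀ < j → h''.arr aEid (T.n + v) i = f)) ?_ (by omega) ?_ ?_ ?_
    · exact ⟨(Frame.refl.setR (by norm_num)).setR (by norm_num), by simp [hI], by simp, by simp,
        by simp, by simp⟩
    · rintro j h'' - ⟨hf'', -, -, hj, -⟩
      exact ⟨hj, by simp [hf''.1, hp'.d], by simp⟩
    · rintro j h'' hjd ⟨hf'', hI'', hV'', hJ'', hoth, hdone⟩ -
      have hp'' := hp'.frame (hf''.mono (by norm_num) (fun _ => id))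
      have hinp'' : h''.arr aIn = h₀.arr aIn := by rw [hf''.2 _ (by simp), hinp']
      have hcur'' : h''.reg rCur = v := by rw [hf''.1 _ (by norm_num), hcur]
      have hl := mul_add_lt hu hjd
      have hval2 : (HExpr.eq (.ld aIn (.c 0) (.add (.r rGo) (.add (.mul (.r rV) (.r rD)) (.r rJ))))
          (.r rCur)).val h'' = if j = j₀ then 1 else 0 := by
        simp only [HExpr.val, hp''.off, hp''.d, hV'', hJ'', hcur'', hinp'']
        exact if_congr (htest j hjd) rfl rfl
      refine run_when (by simp [hp''.off, hp''.d, hV'', hJ'']; omega) ?_ ?_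
      · rw [hval2]
        intro hne
        have hjj : j = j₀ := by
          by_contra hcon
          rw [if_neg hcon] at hne
          exact hne rfl
        refine run_store (by simp) (by simp) (by simp) (by simp [hp''.n, hcur'']; omega)
          (by simp [hI'']; omega) (by simp [hV'', hJ'', hp''.d]; omega) ?_
        refine ⟨by simp [hJ''], le_rfl, (hf''.setA (by simp)).setR (by norm_num), by simp [hI''],
          by simp [hV''], by simp, ?_, ?_⟩
        · intro x y hxy
          simp only [HState.setR_arr, HState.setA_arr, HExpr.val, hp''.n, hcur'', hI'']
          rw [if_neg (by tauto)]
          exact hoth x y hxy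
        · intro _
          simp [hp''.n, hcur'', hI'', hV'', hJ'', hp''.d, hjj, hfj]
      · rw [hval2]
        intro hz
        have hjj : j ≠ j₀ := by
          intro hcon
          rw [if_pos hcon] at hz
          exact one_ne_zero hz
        refine ⟨hJ'', le_rfl, hf''.setR (by norm_num), by simp [hI''], by simp [hV''], by simp, hoth,
          fun hlt' => hdone (by omega)⟩
    · rintro h'' t ⟨hf'', hI'', -, -, hoth, hdone⟩ - ht
      refine ⟨by rw [hf''.1 _ (by norm_num), hcur], hI'', by omega,
        hf.trans (hf''.mono (by norm_num) (fun _ => id)), ?_, ?_⟩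
      · intro u' hu' i' hi'
        rw [hoth _ _ (by omega), hleft u' hu' i' hi']
      · intro v' hv' i' hi' hlt'
        by_cases heq : v' = v ∧ i' = i
        · rw [heq.1, heq.2]
          exact hdone hj₀
        · rw [hoth _ _ (by omega)]
          refine hright v' hv' i' hi' ?_
          by_contra hcon
          exact heq (mul_add_inj hi' hi (by omega))
  · rintro i h' ⟨hf, h5, h6⟩
    have : (i + 1) * T.d + 0 = i * T.d + T.d := by ring
    rw [this]
    exact ⟨hf, h5, h6⟩
  · rintro h' t ⟨hf, h5, h6⟩ ht
    rw [add_zero] at h6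
    refine ⟨hf, h5, fun v hv i hi => h6 v hv i hi (mul_add_lt hv hi), ?_⟩
    have : 4 * T.d + 3 + 2 = 4 * T.d + 5 := rfl
    rwa [this] at ht

/-- Since m ≤ d ≤ n, reading the parity-check matrix is no more expensive than reading the graph. -/
theorem setup_time {n d m a b c e : ℕ} (hn : 2 ≤ n) (hd : 0 < d) (hm : m ≤ d) (hdn : d ≤ n)
    (ha : a ≤ 7) (hb : b ≤ m * (d * 3 + 4) + 2) (hc : c ≤ n * (d * 12 + 4) + 2)
    (he : e ≤ n * (d * (4 * d + 5) + 4) + 2) : a + (b + (c + e)) ≤ 100 * n * d ^ 2 := by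
  have hb' : b ≤ n * (d * 3 + 4) + 2 := hb.trans (by gcongr; omega)
  clear hb
  obtain ⟨l, rfl⟩ : ∃ l, d = l + 1 := ⟨d - 1, by omega⟩
  obtain ⟨j, rfl⟩ : ∃ j, n = j + 2 := ⟨n - 2, by omega⟩
  ring_nf at *
  omega

theorem run_setup {S : ℕ} {w : ℕ → ℕ} {h : HState} (hS : T.Fits S) (hin : HoldsInput T w h)
    (hw : ∀ e < T.n * T.d, w e < 3) (hdn : T.d ≤ T.n)
    (heid : ∀ u < T.n, ∀ i < T.d, T.eid u i = u * T.d + i)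
    (hsimple : ∀ e < T.n * T.d, ∀ e' < T.n * T.d, T.ev e 0 = T.ev e' 0 → T.ev e 1 = T.ev e' 1 →
      e = e') :
    Run S setup h fun h' t => Ready T w h' ∧ t ≤ 100 * T.n * T.d ^ 2 := by
  refine run_seq ((run_initParams hS hin).mono ?_)
  rintro h₁ t₁ ⟨hp₁, harr₁, ht₁⟩
  have hin₁ : HoldsInput T w h₁ := by
    obtain ⟨a1, a2, a3, a4, a5, a6, a7, a8⟩ := hin
    rw [← harr₁] at a1 a2 a3 a4 a5 a6 a7 a8
    exact ⟨a1, a2, a3, a4, a5, a6, a7, a8⟩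
  refine run_seq ((run_initChecks hS hin₁ (fun k hk i hi => T.H_lt hk hi) hp₁).mono ?_)
  rintro h₂ t₂ ⟨hf₂, hH₂, ht₂⟩
  have hzero₂ : ∀ a ∉ [aIn, aH], ∀ i j, h₂.arr a i j = 0 := by
    intro a ha i j
    simp only [List.mem_cons, List.not_mem_nil, or_false, not_or] at ha
    rw [hf₂.2 a (by simp [ha.2]), hin₁.zero a ha.1]
  have hinp₂ : h₂.arr aIn = h₁.arr aIn := hf₂.2 _ (by simp)
  have hp₂ := hp₁.frame hf₂
  refine run_seq ((run_initLeft hS hin₁ hinp₂ hzero₂ hw heid hp₂).mono ?_)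
  rintro h₃ t₃ ⟨hf₃, hid₃, hev₃, hkn₃, hlab₃, ht₃⟩
  have hp₃ := hp₂.frame hf₃
  refine (run_initRight hS hin₁ (by rw [hf₃.2 _ (by simp), hinp₂]) heid hsimple hp₃).mono ?_
  rintro h₄ t₄ ⟨hf₄, hleft₄, hright₄, ht₄⟩
  have hp₄ := hp₃.frame hf₄
  have hkn₄ : ∀ e, h₄.arr aKn e 0 = if e < T.n * T.d ∧ w e < 2 then 1 else 0 := by
    rw [hf₄.2 _ (by simp)]; exact hkn₃
  have hlab₄ : ∀ e j, h₄.arr aLab e j =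
      if e < T.n * T.d ∧ w e < 2 ∧ j = T.d then w e else 0 := by
    rw [hf₄.2 _ (by simp)]; exact hlab₃
  have hunk₄ : ∀ e < T.n * T.d, Unk h₄ e ↔ ¬ w e < 2 := by
    intro e he
    rw [Unk, hkn₄]
    split_ifs with hc
    · simp [hc.2]
    · simp only [true_iff]
      exact fun hcon => hc ⟨he, hcon⟩
  refine ⟨⟨⟨hp₄.n, hp₄.d, hp₄.m, hp₄.nn, hp₄.e, ?_, ?_, ?_⟩, hp₄.k, ?_, ?_, ?_, ?_, ?_, hunk₄, ?_⟩,
    setup_time T.two_le_n T.d_pos T.m_le hdn ht₁ ht₂ ht₃ ht₄⟩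
  · intro v hv i hi
    by_cases hvn : v < T.n
    · rw [hleft₄ v hvn i hi, hid₃ v hvn i hi]
    · obtain ⟨v', rfl⟩ : ∃ v', v = T.n + v' := ⟨v - T.n, by omega⟩
      exact hright₄ v' (by omega) i hi
  · rw [hf₄.2 _ (by simp)]
    exact hev₃
  · intro k hk i hi
    rw [hf₄.2 _ (by simp), hf₃.2 _ (by simp)]
    exact hH₂ k hk i hi
  · intro j
    rw [hf₄.2 _ (by simp), hf₃.2 _ (by simp), hzero₂ _ (by simp)]
  · intro e j
    rw [hlab₄]
    split_ifs with hc
    · exact hc.2.1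
    · norm_num
  · intro e
    rw [hkn₄]
    split_ifs <;> norm_num
  · intro j
    rw [hlab₄, if_neg (by omega)]
  · intro e he j hor
    rw [hlab₄, if_neg]
    rintro ⟨-, hw2, hj⟩
    rcases hor with hc | hc
    · exact (hunk₄ e he).1 hc hw2
    · exact hc hj
  · intro e he hw2
    rw [hlab₄, if_pos ⟨he, hw2, rfl⟩]

end ArrayRAM

/-! ## The edge table of an ordered regular graph -/

open Finset

namespace OrderedRegularGraph

variable {n d : ℕ} (G : OrderedRegularGraph n d)

theorem edgeL_bijective : Function.Bijective fun p : Fin n × Fin d => G.edgeL p.1 p.2 := by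
  constructor
  · rintro ⟨u, i⟩ ⟨v, j⟩ h
    have huv : u = v := congrArg (fun e : G.Edge => e.1.1) h
    subst huv
    exact Prod.ext rfl (G.sideL.edge_injective u h)
  · intro e
    obtain ⟨i, hi⟩ := G.sideL.exists_edge e
    exact ⟨(e.1.1, i), hi⟩

/-- The numbering of the edges by left vertex, in the order at that vertex. -/
noncomputable def edgeEquiv : Fin (n * d) ≃ G.Edge :=
  finProdFinEquiv.symm.trans (Equiv.ofBijective _ G.edgeL_bijective)

/-- The number of an edge. -/
noncomputable def num (e : G.Edge) : ℕ := G.edgeEquiv.symm e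

theorem num_lt (e : G.Edge) : G.num e < n * d := (G.edgeEquiv.symm e).2

theorem num_injective : Function.Injective G.num :=
  Fin.val_injective.comp G.edgeEquiv.symm.injective

theorem num_edgeEquiv (k : Fin (n * d)) : G.num (G.edgeEquiv k) = k := by
  rw [num, Equiv.symm_apply_apply]

theorem exists_num_eq {k : ℕ} (hk : k < n * d) : ∃ e, G.num e = k :=
  ⟨_, G.num_edgeEquiv ⟨k, hk⟩⟩

theorem num_edgeL (u : Fin n) (i : Fin d) : G.num (G.edgeL u i) = u * d + i := by
  have h : G.edgeL u i = G.edgeEquiv (finProdFinEquiv (u, i)) := by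
    rw [edgeEquiv, Equiv.trans_apply, Equiv.symm_apply_apply]
    rfl
  rw [h, num_edgeEquiv, finProdFinEquiv_apply_val]
  ring

/-- Without multiple edges, the d neighbours of a vertex are distinct. -/
theorem degree_le (G : OrderedRegularGraph n d) (hn : 0 < n) : d ≤ n := by
  simpa using Fintype.card_le_of_injective (fun i => (G.nbrL ⟨0, hn⟩ i).1)
    (Subtype.val_injective.comp (G.nbrL ⟨0, hn⟩).injective)

/-- The number of the `i`-th edge at the vertex `v`, where the left vertices come first. -/
noncomputable def edgeNum (v i : ℕ) : ℕ :=
  if hi : i < d then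
    if hv : v < n then G.num (G.edgeL ⟨v, hv⟩ ⟨i, hi⟩)
    else if hv' : v - n < n then G.num (G.edgeR ⟨v - n, hv'⟩ ⟨i, hi⟩) else 0
  else 0

theorem edgeNum_left (u : Fin n) (i : Fin d) : G.edgeNum u i = G.num (G.edgeL u i) := by
  simp [edgeNum]

theorem edgeNum_right (v : Fin n) (i : Fin d) : G.edgeNum (n + v) i = G.num (G.edgeR v i) := by
  simp [edgeNum]

/-- The left (`s = 0`) or right end of the `e`-th edge. -/
noncomputable def endNum (e s : ℕ) : ℕ :=
  if he : e < n * d then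
    if s = 0 then ((G.edgeEquiv ⟨e, he⟩).1.1 : ℕ) else n + ((G.edgeEquiv ⟨e, he⟩).1.2 : ℕ)
  else 0

theorem edgeEquiv_num (e : G.Edge) (h : G.num e < n * d) : G.edgeEquiv ⟨G.num e, h⟩ = e :=
  G.edgeEquiv.apply_symm_apply e

theorem endNum_left (e : G.Edge) : G.endNum (G.num e) 0 = e.1.1 := by
  simp [endNum, G.num_lt, G.edgeEquiv_num]

theorem endNum_right (e : G.Edge) : G.endNum (G.num e) 1 = n + e.1.2 := by
  simp [endNum, G.num_lt, G.edgeEquiv_num]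

theorem vertex_cases {p : ℕ → Prop} {v : ℕ} (hv : v < 2 * n) (hl : ∀ u : Fin n, p u)
    (hr : ∀ u : Fin n, p (n + u)) : p v := by
  by_cases h : v < n
  · exact hl ⟨v, h⟩
  · have := hr ⟨v - n, by omega⟩
    rwa [show n + ((⟨v - n, by omega⟩ : Fin n) : ℕ) = v from Nat.add_sub_cancel' (by omega)] at this

variable {m : ℕ}

/-- The edge table of the double cover and a parity-check matrix. -/
noncomputable def table (hn : 2 ≤ n) (hd : 0 < d) (hm : m ≤ d)
    (H : Matrix (Fin m) (Fin d) (ZMod 2)) : EdgeTable where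
  n := n
  d := d
  m := m
  eid := G.edgeNum
  ev := G.endNum
  H k i := if h : k < m ∧ i < d then (H ⟨k, h.1⟩ ⟨i, h.2⟩).val else 0
  two_le_n := hn
  d_pos := hd
  m_le := hm
  eid_lt {v i} hv hi := by
    have hlt := G.num_lt
    refine vertex_cases (p := fun v => G.edgeNum v i < n * d) hv (fun u => ?_) fun u => ?_
    · exact (G.edgeNum_left u ⟨i, hi⟩).trans_lt (hlt _)
    · exact (G.edgeNum_right u ⟨i, hi⟩).trans_lt (hlt _)
  ev_lt {e s} he hs := by
    obtain ⟨e, rfl⟩ := G.exists_num_eq he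
    obtain rfl | rfl : s = 0 ∨ s = 1 := by omega
    · have := e.1.1.2
      rw [endNum_left]; omega
    · have := e.1.2.2
      rw [endNum_right]; omega
  ev_eid {v i} hv hi := by
    refine vertex_cases (p := fun v => G.endNum (G.edgeNum v i) (if v < n then 0 else 1) = v) hv
      (fun u => ?_) fun u => ?_
    · rw [G.edgeNum_left u ⟨i, hi⟩, if_pos u.2, endNum_left]
      rfl
    · rw [G.edgeNum_right u ⟨i, hi⟩, if_neg (by omega), endNum_right]
      rfl
  side_ev {e s} he hs := by
    obtain ⟨e, rfl⟩ := G.exists_num_eq he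
    obtain rfl | rfl : s = 0 ∨ s = 1 := by omega
    · rw [endNum_left, if_pos e.1.1.2]
    · rw [endNum_right, if_neg (by omega)]
  exists_eid {e s} he hs := by
    obtain ⟨e, rfl⟩ := G.exists_num_eq he
    obtain rfl | rfl : s = 0 ∨ s = 1 := by omega
    · obtain ⟨i, hi⟩ := G.sideL.exists_edge e
      exact ⟨i, i.2, by rw [endNum_left, edgeNum_left]; exact congrArg _ hi⟩
    · obtain ⟨i, hi⟩ := G.sideR.exists_edge e
      exact ⟨i, i.2, by rw [endNum_right, edgeNum_right]; exact congrArg _ hi⟩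
  eid_inj {v i j} hv hi hj := by
    refine vertex_cases (p := fun v => G.edgeNum v i = G.edgeNum v j → i = j) hv
      (fun u h => ?_) fun u h => ?_
    · rw [G.edgeNum_left u ⟨i, hi⟩, G.edgeNum_left u ⟨j, hj⟩] at h
      exact congrArg Fin.val (G.sideL.edge_injective u (G.num_injective h))
    · rw [G.edgeNum_right u ⟨i, hi⟩, G.edgeNum_right u ⟨j, hj⟩] at h
      exact congrArg Fin.val (G.sideR.edge_injective u (G.num_injective h))
  H_lt {k i} hk hi := by
    rw [dif_pos ⟨hk, hi⟩]
    exact ZMod.val_lt _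

variable {hn : 2 ≤ n} {hd : 0 < d} {hm : m ≤ d} {H : Matrix (Fin m) (Fin d) (ZMod 2)}

theorem table_H (k : Fin m) (i : Fin d) : (G.table hn hd hm H).H k i = (H k i).val := by
  simp [table]

theorem table_eid_left {u i : ℕ} (hu : u < n) (hi : i < d) :
    (G.table hn hd hm H).eid u i = u * d + i :=
  (G.edgeNum_left ⟨u, hu⟩ ⟨i, hi⟩).trans (G.num_edgeL _ _)

theorem table_simple {e e' : ℕ} (he : e < n * d) (he' : e' < n * d)
    (h0 : (G.table hn hd hm H).ev e 0 = (G.table hn hd hm H).ev e' 0)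
    (h1 : (G.table hn hd hm H).ev e 1 = (G.table hn hd hm H).ev e' 1) : e = e' := by
  obtain ⟨e, rfl⟩ := G.exists_num_eq he
  obtain ⟨e', rfl⟩ := G.exists_num_eq he'
  have h0 : G.endNum (G.num e) 0 = G.endNum (G.num e') 0 := h0
  have h1 : G.endNum (G.num e) 1 = G.endNum (G.num e') 1 := h1
  rw [endNum_left, endNum_left] at h0
  rw [endNum_right, endNum_right] at h1
  rw [Subtype.ext (Prod.ext (Fin.ext h0) (Fin.ext (by omega)) : e.1 = e'.1)]

theorem table_check_sum (k : Fin m) (x : ℕ → ZMod 2) :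
    ∑ i ∈ range d, ((G.table hn hd hm H).H k i : ZMod 2) * x i =
      H.mulVec (fun i : Fin d => x i) k := by
  rw [sum_range]
  refine sum_congr rfl fun i _ => ?_
  rw [table_H, ZMod.natCast_zmod_val]

/-! ### Expansion -/

variable {C₀ : Submodule (ZMod 2) (Fin d → ZMod 2)}

open Classical in
/-- The edges with numbers in a given set. -/
noncomputable def edgesOf (U : Finset ℕ) : Finset G.Edge := {e | G.num e ∈ U}

theorem mem_edgesOf {U : Finset ℕ} {e : G.Edge} : e ∈ G.edgesOf U ↔ G.num e ∈ U := by
  simp [edgesOf]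

/-- The offset b is 0 for the left and n for the right side, so that both sides share one proof. -/
theorem mem_localCode_of_loc (hC : ∀ x, x ∈ C₀ ↔ H.mulVec x = 0) {U : Finset ℕ}
    {s : EdgeSide G.Edge n d} {b : ℕ} (hb : ∀ u i, G.edgeNum (b + (u : Fin n)) (i : Fin d) =
      G.num (s.edge u i)) {u : Fin n} {x : ℕ → ZMod 2}
    (hx : (G.table hn hd hm H).Loc (· ∈ U) (b + u) m x) :
    (fun i : Fin d => x i) ∈ localCode C₀ (s.positions (G.edgesOf U) u) := by
  rw [mem_localCode, hC]
  refine ⟨funext fun k => ?_, fun i hi => hx.1 i i.2 fun h => hi ?_⟩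
  · rw [← G.table_check_sum (hn := hn) (hd := hd) (hm := hm)]
    exact hx.2 k k.2
  · rw [s.mem_positions, mem_edgesOf, ← hb]
    exact h

theorem closed_edgesOf (hC : ∀ x, x ∈ C₀ ↔ H.mulVec x = 0) {U : Finset ℕ}
    {s : EdgeSide G.Edge n d} {b : ℕ} (hb : ∀ u i, G.edgeNum (b + (u : Fin n)) (i : Fin d) =
      G.num (s.edge u i)) (hbn : b ≤ n)
    (hU : ∀ v < 2 * n, ∀ i < d, G.edgeNum v i ∈ U →
      ∃ x, (G.table hn hd hm H).Loc (· ∈ U) v m x ∧ x i ≠ 0) : s.Closed (G.edgesOf U) C₀ := by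
  intro u i hi
  rw [s.mem_positions, mem_edgesOf, ← hb] at hi
  obtain ⟨x, hx, hxi⟩ := hU _ (by omega) i i.2 hi
  exact ⟨_, G.mem_localCode_of_loc hC hb hx, hxi⟩

theorem eq_of_locEq_edgesOf (hC : ∀ x, x ∈ C₀ ↔ H.mulVec x = 0) {U : Finset ℕ}
    {s : EdgeSide G.Edge n d} {b : ℕ} (hb : ∀ u i, G.edgeNum (b + (u : Fin n)) (i : Fin d) =
      G.num (s.edge u i)) (hbn : b ≤ n) {α : Type} {cl : ℕ → α}
    (hcl : ∀ v < 2 * n, ∀ i < d, ∀ i' < d, G.edgeNum v i ∈ U → G.edgeNum v i' ∈ U →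
      (∀ x, (G.table hn hd hm H).Loc (· ∈ U) v m x → x i = x i') →
        cl (G.edgeNum v i) = cl (G.edgeNum v i')) {e e' : G.Edge}
    (he : s.LocEq (G.edgesOf U) C₀ e e') : cl (G.num e) = cl (G.num e') := by
  obtain ⟨u, i, hi, j, hj, rfl, rfl, hij⟩ := he
  rw [s.mem_positions, mem_edgesOf, ← hb] at hi hj
  rw [← hb, ← hb]
  exact hcl _ (by omega) i i.2 j j.2 hi hj fun x hx =>
    (hij _ (G.mem_localCode_of_loc hC hb hx)).symm

/-- The spectral hypothesis reaches the algorithm only through this property. It speaks of all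
closed subsets of the erased edges, because the unknown set shrinks from round to round. -/
theorem table_expanding (hC : ∀ x, x ∈ C₀ ↔ H.mulVec x = 0) {r : ℕ} {ε : ℝ} (hr1 : 1 ≤ r)
    (hr : r ≤ Module.finrank (ZMod 2) C₀) (hε : 0 < ε) (hε1 : ε ≤ 1)
    (hlam : G.expansion hn / d ≤ ε ^ 2 * relDist C₀ ^ 2 / 2 ^ (r + 4)) {U₀ : Finset ℕ}
    (hlt : U₀ ⊆ range (n * d))
    (hU₀ : (#U₀ : ℝ) ≤ (1 - ε) * relDist C₀ * genDist r C₀ * d * n) :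
    (G.table hn hd hm H).Expanding ⌈2 / 5 * (relDist C₀ / 2 ^ (r + 2)) ^ 2 * d * n⌉₊ U₀ := by
  classical
  intro U hU hne hclosed α cl hcl
  have hbL : ∀ u i, G.edgeNum (0 + (u : Fin n)) (i : Fin d) = G.num (G.sideL.edge u i) := by
    intro u i
    rw [zero_add, edgeNum_left]
    rfl
  have hbR : ∀ u i, G.edgeNum (n + (u : Fin n)) (i : Fin d) = G.num (G.sideR.edge u i) := by
    intro u i
    rw [edgeNum_right]
    rfl
  have hcard : #(G.edgesOf U) ≤ #U :=
    card_le_card_of_injOn G.num (fun e he => G.mem_edgesOf.1 he) G.num_injective.injOn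
  have hUn : (#(G.edgesOf U) : ℝ) ≤ (1 - ε) * relDist C₀ * genDist r C₀ * d * n :=
    le_trans (by exact_mod_cast hcard.trans (card_le_card hU)) hU₀
  have hne' : (G.edgesOf U).Nonempty := by
    obtain ⟨k, hk⟩ := hne
    obtain ⟨e, rfl⟩ := G.exists_num_eq (mem_range.1 (hlt (hU hk)))
    exact ⟨e, G.mem_edgesOf.2 hk⟩
  obtain ⟨e, he, hle⟩ := EdgeSide.exists_large_class (by omega) hd hr1 hr hε hε1 hlam
    (G.mixing_sideL hn) (G.mixing_sideR hn) (G.closed_edgesOf hC hbL (Nat.zero_le _) hclosed)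
    (G.closed_edgesOf hC hbR le_rfl hclosed) hUn hne' (cl := fun e => cl (G.num e))
    (fun e e' h => G.eq_of_locEq_edgesOf hC hbL (Nat.zero_le _) hcl h)
    (fun e e' h => G.eq_of_locEq_edgesOf hC hbR le_rfl hcl h)
  refine ⟨G.num e, G.mem_edgesOf.1 he,
    ({e' ∈ G.edgesOf U | cl (G.num e') = cl (G.num e)}).image G.num, ?_, ?_, ?_⟩
  · intro k hk
    obtain ⟨e', he', rfl⟩ := mem_image.1 hk
    exact G.mem_edgesOf.1 (mem_filter.1 he').1
  · rw [card_image_of_injective _ G.num_injective]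
    exact Nat.ceil_le.2 hle
  · intro k hk
    obtain ⟨e', he', rfl⟩ := mem_image.1 hk
    exact (mem_filter.1 he').2

end OrderedRegularGraph

/-! ## Words of the expander code in terms of the edge table -/

open Finset

/-- The entry of Mx in the row belonging to p is x_p, so M is injective, and the set is a translate
of its range. -/
theorem Matrix.finrank_vectorSpan_of_unit_rows {K E : Type*} [Field K] {a : ℕ}
    (M : Matrix E (Fin a) K) (l : E → K)
    (hM : ∀ p, ∃ e, ∀ p', M e p' = if p' = p then 1 else 0) :
    Module.finrank K (vectorSpan K {c | ∃ x : Fin a → K, c = M.mulVec x + l}) = a := by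
  have hinj : Function.Injective M.mulVecLin := by
    intro x y hxy
    funext p
    obtain ⟨e, he⟩ := hM p
    have := congrFun hxy e
    simpa [Matrix.mulVec, dotProduct, he] using this
  have hset : {c | ∃ x : Fin a → K, c = M.mulVec x + l} =
      (AffineSubspace.mk' l (LinearMap.range M.mulVecLin) : Set (E → K)) := by
    ext c
    simp only [Set.mem_ofPred_eq, SetLike.mem_coe, AffineSubspace.mem_mk', LinearMap.mem_range,
      vsub_eq_sub, Matrix.mulVecLin_apply, eq_sub_iff_add_eq, eq_comm]
  rw [hset, ← AffineSubspace.direction_eq_vectorSpan, AffineSubspace.direction_mk',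
    LinearMap.finrank_range_of_inj hinj, Module.finrank_fin_fun]

theorem symbolWord_lt (a : Option (ZMod 2)) : symbolWord a < 3 := by
  cases a with
  | none => decide
  | some a => exact (ZMod.val_lt a).trans (by norm_num)

theorem symbolWord_lt_two_iff {a : Option (ZMod 2)} : symbolWord a < 2 ↔ a ≠ none := by
  cases a with
  | none => simp [symbolWord]
  | some a => simpa [symbolWord] using ZMod.val_lt a

namespace OrderedRegularGraph

open ArrayRAM

variable {n d m : ℕ} (G : OrderedRegularGraph n d) {hn : 2 ≤ n} {hd : 0 < d} {hm : m ≤ d}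
  {H : Matrix (Fin m) (Fin d) (ZMod 2)} {C₀ : Submodule (ZMod 2) (Fin d → ZMod 2)}
  (z : G.Edge → Option (ZMod 2))

/-- The received word in the order of the edge numbers. -/
noncomputable def received (e : ℕ) : ℕ :=
  if he : e < n * d then symbolWord (z (G.edgeEquiv ⟨e, he⟩)) else 0

theorem received_num (e : G.Edge) : G.received z (G.num e) = symbolWord (z e) := by
  simp [received, G.num_lt, G.edgeEquiv_num]

theorem received_lt (e : ℕ) : G.received z e < 3 := by
  unfold received
  split
  · exact symbolWord_lt _
  · norm_num

theorem isWord_iff (hC : ∀ x, x ∈ C₀ ↔ H.mulVec x = 0) (c : ℕ → ZMod 2) :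
    (G.table hn hd hm H).IsWord c ↔ (fun e => c (G.num e)) ∈ G.expanderCode C₀ := by
  have key : ∀ (k : Fin m) (v : ℕ) (f : Fin d → G.Edge), (∀ i : Fin d, G.edgeNum v i = G.num (f i)) →
      (G.table hn hd hm H).check c v k = H.mulVec (fun i => c (G.num (f i))) k := by
    intro k v f hf
    rw [← funext fun i : Fin d => congrArg c (hf i)]
    exact G.table_check_sum k fun i => c (G.edgeNum v i)
  rw [mem_expanderCode]
  simp only [hC, funext_iff]
  constructor
  · intro h
    refine ⟨fun u k => ?_, fun u k => ?_⟩
    · rw [← key k u _ (G.edgeNum_left u)]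
      exact h u (by change (u : ℕ) < 2 * n; omega) k k.2
    · rw [← key k (n + u) _ (G.edgeNum_right u)]
      exact h (n + u) (by change n + (u : ℕ) < 2 * n; omega) k k.2
  · rintro ⟨hl, hr⟩ v hv k hk
    refine vertex_cases (p := fun v => (G.table hn hd hm H).check c v k = 0) hv
      (fun u => ?_) fun u => ?_
    · exact (key ⟨k, hk⟩ u _ (G.edgeNum_left u)).trans (hl u ⟨k, hk⟩)
    · exact (key ⟨k, hk⟩ (n + u) _ (G.edgeNum_right u)).trans (hr u ⟨k, hk⟩)

variable {z} {h : HState}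

theorem unk_num_iff (hr : Ready (G.table hn hd hm H) (G.received z) h) (e : G.Edge) :
    Unk h (G.num e) ↔ z e = none := by
  rw [hr.unk _ (G.num_lt e), received_num, symbolWord_lt_two_iff, not_not]

theorem card_unkSet_le_ncard (hr : Ready (G.table hn hd hm H) (G.received z) h) :
    #(unkSet (G.table hn hd hm H) h) ≤ {e | z e = none}.ncard := by
  classical
  rw [← Set.ncard_coe_finset]
  refine (Set.ncard_le_ncard (t := G.num '' {e | z e = none}) ?_ (Set.toFinite _)).trans
    (Set.ncard_image_le (Set.toFinite _))
  intro k hk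
  obtain ⟨hk, hu⟩ := mem_unkSet.1 hk
  obtain ⟨e, rfl⟩ := G.exists_num_eq hk
  exact ⟨e, (G.unk_num_iff hr e).1 hu, rfl⟩

theorem agrees_iff (hr : Ready (G.table hn hd hm H) (G.received z) h) (c : ℕ → ZMod 2) :
    Agrees (G.table hn hd hm H) h c ↔ ∀ e a, z e = some a → c (G.num e) = a := by
  have key : ∀ e a, z e = some a → lab h (G.num e) d = a := by
    intro e a he
    have h1 := hr.lab (G.num e) (G.num_lt e)
    rw [received_num, he] at h1
    have h2 : h.arr aLab (G.num e) d = a.val := h1 (ZMod.val_lt a)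
    rw [ArrayRAM.lab, h2, ZMod.natCast_zmod_val]
  constructor
  · intro hc e a he
    refine (hc _ (G.num_lt e) ?_).trans (key e a he)
    rw [G.unk_num_iff hr, he]
    simp
  · intro hc k hk hu
    obtain ⟨e, rfl⟩ := G.exists_num_eq hk
    rw [G.unk_num_iff hr] at hu
    obtain ⟨a, ha⟩ := Option.ne_none_iff_exists'.1 hu
    exact (hc e a ha).trans (key e a ha).symm

theorem mem_erasureList_iff (hC : ∀ x, x ∈ C₀ ↔ H.mulVec x = 0)
    (hr : Ready (G.table hn hd hm H) (G.received z) h) (c : ℕ → ZMod 2) :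
    (fun e => c (G.num e)) ∈ erasureList (G.expanderCode C₀) z ↔
      (G.table hn hd hm H).IsWord c ∧ Agrees (G.table hn hd hm H) h c := by
  rw [G.isWord_iff hC, G.agrees_iff hr]
  rfl

theorem exists_comp_num (c : G.Edge → ZMod 2) : ∃ c' : ℕ → ZMod 2, c = fun e => c' (G.num e) :=
  ⟨_, (funext fun e => G.num_injective.extend_apply c 0 e).symm⟩

variable {a : ℕ} {M : ℕ → ℕ → ZMod 2} {l : ℕ → ZMod 2} {out : ℕ → ℕ}

theorem erasureList_eq_of_parametrizes (hC : ∀ x, x ∈ C₀ ↔ H.mulVec x = 0)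
    (hr : Ready (G.table hn hd hm H) (G.received z) h)
    (hp : Parametrizes (G.table hn hd hm H) (fun c => (G.table hn hd hm H).IsWord c ∧
      Agrees (G.table hn hd hm H) h c) a M l out) :
    erasureList (G.expanderCode C₀) z = {c | ∃ x : Fin a → ZMod 2,
      c = (Matrix.of fun (e : G.Edge) (p : Fin a) => M (G.num e) p).mulVec x +
        fun e => l (G.num e)} := by
  ext c
  constructor
  · obtain ⟨c, rfl⟩ := G.exists_comp_num c
    rw [G.mem_erasureList_iff hC hr]
    intro hc
    obtain ⟨x, hx⟩ := hp.exists_of_sol c hc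
    refine ⟨fun p => x p, funext fun e => ?_⟩
    rw [hx _ (G.num_lt e), sum_range]
    rfl
  · rintro ⟨x, rfl⟩
    have h1 := (G.mem_erasureList_iff hC hr _).2
      (hp.sol fun p => if hp : p < a then x ⟨p, hp⟩ else 0)
    convert h1 using 1
    funext e
    rw [sum_range]
    simp [Matrix.mulVec, dotProduct]

theorem finrank_of_parametrizes
    {Sol : (ℕ → ZMod 2) → Prop} (hp : Parametrizes (G.table hn hd hm H) Sol a M l out) :
    Module.finrank (ZMod 2) (vectorSpan (ZMod 2) {c | ∃ x : Fin a → ZMod 2,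
      c = (Matrix.of fun (e : G.Edge) (p : Fin a) => M (G.num e) p).mulVec x +
        fun e => l (G.num e)}) = a := by
  refine Matrix.finrank_vectorSpan_of_unit_rows _ _ fun p => ?_
  obtain ⟨e, he, hrow⟩ := hp.unit p p.2
  obtain ⟨e, rfl⟩ := G.exists_num_eq he
  refine ⟨e, fun p' => ?_⟩
  rw [Matrix.of_apply, hrow p' p'.2]
  simp [Fin.ext_iff]

end OrderedRegularGraph

/-! ## The decoder -/

theorem List.getD_append_ofFn_append {α : Type*} {m d : ℕ} (l l' : List α) (f : Fin m → Fin d → α)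
    (x : α) {p : ℕ} (hp : l.length = p) (k : Fin m) (i : Fin d) :
    (l ++ List.ofFn (fun j : Fin (m * d) => f j.divNat j.modNat) ++ l').getD (p + (k * d + i)) x =
      f k i := by
  subst hp
  have hk : (k * d + i : ℕ) = finProdFinEquiv (k, i) := by
    rw [finProdFinEquiv_apply_val]; ring
  have h : ((finProdFinEquiv (k, i)).divNat, (finProdFinEquiv (k, i)).modNat) = (k, i) :=
    finProdFinEquiv.symm_apply_apply (k, i)
  rw [Prod.mk.injEq] at h
  rw [hk]
  generalize finProdFinEquiv (k, i) = q at h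
  rw [List.getD_append _ _ _ _ (by simp), List.getD_append_right _ _ _ _ (by simp)]
  simp [h.1, h.2]

/-! ### The input list as an initial state of the arrays -/

namespace OrderedRegularGraph

open ArrayRAM RAM Finset

variable {n d m : ℕ} (G : OrderedRegularGraph n d) {hn : 2 ≤ n} {hd : 0 < d} {hm : m ≤ d}
  (H : Matrix (Fin m) (Fin d) (ZMod 2)) (z : G.Edge → Option (ZMod 2))

theorem length_decoderInput :
    (decoderInput H G z).length = 3 + m * d + n * d + n * d + n * d := by
  simp [decoderInput]
  ring

theorem lt_of_mem_decoderInput {S x : ℕ} (hn : n < S) (hd : d < S) (hm : m < S) (h3 : 3 ≤ S)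
    (hx : x ∈ decoderInput H G z) : x < S := by
  simp only [decoderInput, List.mem_append, List.mem_cons, List.not_mem_nil, or_false,
    List.mem_ofFn] at hx
  rcases hx with ((((rfl | rfl | rfl) | ⟨k, rfl⟩) | ⟨k, rfl⟩) | ⟨k, rfl⟩) | ⟨k, rfl⟩
  · exact hn
  · exact hd
  · exact hm
  · exact (ZMod.val_lt _).trans_le (by omega)
  · exact (Fin.is_lt _).trans hn
  · exact (Fin.is_lt _).trans hn
  · exact (symbolWord_lt _).trans_le h3

theorem decoderInput_check (k : Fin m) (i : Fin d) :
    (decoderInput H G z).getD (3 + (k * d + i)) 0 = (H k i).val := by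
  rw [decoderInput, List.append_assoc _ (List.ofFn _) (List.ofFn _), List.append_assoc]
  exact List.getD_append_ofFn_append [n, d, m] _ (fun k i => (H k i).val) 0 rfl k i

theorem decoderInput_left (u : Fin n) (i : Fin d) :
    (decoderInput H G z).getD (3 + m * d + (u * d + i)) 0 = (G.nbrL u i).1 := by
  rw [decoderInput, List.append_assoc _ (List.ofFn _) (List.ofFn _)]
  exact List.getD_append_ofFn_append _ _ (fun u i => (G.nbrL u i).1.val) 0 (by simp; ring) u i

theorem decoderInput_right (v : Fin n) (i : Fin d) :
    (decoderInput H G z).getD (3 + m * d + n * d + (v * d + i)) 0 = (G.nbrR v i).1 := by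
  rw [decoderInput]
  exact List.getD_append_ofFn_append _ _ (fun v i => (G.nbrR v i).1.val) 0 (by simp; ring) v i

theorem decoderInput_word (u : Fin n) (i : Fin d) :
    (decoderInput H G z).getD (3 + m * d + n * d + n * d + (u * d + i)) 0 =
      symbolWord (z (G.edgeL u i)) := by
  rw [decoderInput, ← List.append_nil (_ ++ _)]
  exact List.getD_append_ofFn_append _ _ (fun u i => symbolWord (z (G.edgeL u i))) 0
    (by simp; ring) u i

/-- The arrays of length `S` that represent the input. -/
def inputState (S : ℕ) : HState :=
  ⟨fun _ => 0, fun a i j =>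
    if i < S ∧ j < S then (decoderInput H G z).getD ((a * S + i) * S + j) 0 else 0⟩

theorem inputState_input {S j : ℕ} (hj : j < S) :
    (G.inputState H z S).arr aIn 0 j = (decoderInput H G z).getD j 0 := by
  simp [inputState, hj]
  omega

theorem holdsInput_inputState {S : ℕ} (hS : (G.table hn hd hm H).Fits S) :
    HoldsInput (G.table hn hd hm H) (G.received z) (G.inputState H z S) := by
  have hsize : 3 + m * d + n * d + n * d + n * d < S := input_size hS
  have hedge : ∀ e < n * d, ∃ u i, G.num (G.edgeL u i) = e := by
    intro e he
    obtain ⟨e, rfl⟩ := G.exists_num_eq he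
    obtain ⟨⟨u, i⟩, rfl⟩ := G.edgeL_bijective.surjective e
    exact ⟨u, i, rfl⟩
  refine ⟨?_, ?_, ?_, ?_, ?_, ?_, ?_, ?_⟩
  · exact G.inputState_input H z (by omega)
  · exact G.inputState_input H z (by omega)
  · exact G.inputState_input H z (by omega)
  · intro k hk i hi
    have hlt : k * d + i < m * d := mul_add_lt hk hi
    refine (G.inputState_input H z (j := 3 + (k * d + i)) (by omega)).trans ?_
    exact (G.decoderInput_check H z ⟨k, hk⟩ ⟨i, hi⟩).trans (G.table_H ⟨k, hk⟩ ⟨i, hi⟩).symm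
  · intro e he
    obtain ⟨u, i, rfl⟩ := hedge e he
    have hlt := mul_add_lt u.2 i.2
    refine (congrArg (n + ·) (G.inputState_input H z
      (j := 3 + m * d + G.num (G.edgeL u i)) (by rw [num_edgeL]; omega))).trans ?_
    refine Eq.trans ?_ (G.endNum_right (G.edgeL u i)).symm
    rw [num_edgeL, decoderInput_left]
    rfl
  · intro v hv i hi
    have hlt : v * d + i < n * d := mul_add_lt hv hi
    refine (G.inputState_input H z (j := 3 + m * d + n * d + (v * d + i)) (by omega)).trans ?_
    refine (G.decoderInput_right H z ⟨v, hv⟩ ⟨i, hi⟩).trans ?_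
    have h1 : (G.table hn hd hm H).eid (n + v) i = G.num (G.edgeR ⟨v, hv⟩ ⟨i, hi⟩) :=
      G.edgeNum_right ⟨v, hv⟩ ⟨i, hi⟩
    refine Eq.trans ?_ (congrArg (fun e => G.endNum e 0) h1).symm
    rw [endNum_left]
    rfl
  · intro e he
    obtain ⟨u, i, rfl⟩ := hedge e he
    have hlt := mul_add_lt u.2 i.2
    refine (G.inputState_input H z (j := 3 + m * d + n * d + n * d + G.num (G.edgeL u i))
      (by rw [num_edgeL]; omega)).trans ?_
    rw [received_num, num_edgeL, decoderInput_word]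
  · intro a ha i j
    simp only [inputState]
    split
    · refine List.getD_eq_default _ _ ?_
      rw [length_decoderInput]
      -- For a ≥ 1 the addresses of array a start beyond S, hence beyond the input, where memory is
      -- 0.
      have h1 : 1 * S ≤ (a * S + i) * S := Nat.mul_le_mul_right _ (by
        have : 1 * S ≤ a * S := Nat.mul_le_mul_right _ (by omega)
        omega)
      omega
    · rfl

theorem sim_inputState {S : ℕ} (hS : (G.table hn hd hm H).Fits S) {reg : ℕ → ℕ} (h1 : reg 1 = S)
    (h2 : ∀ x, reg (x + 2) = 0) :
    Sim S (G.inputState H z S) ⟨reg, (State.init (decoderInput H G z)).mem⟩ := by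
  have hsize : 3 + m * d + n * d + n * d + n * d < S := input_size hS
  have hnd : n ≤ n * d := Nat.le_mul_of_pos_right _ hd
  have hnd' : d ≤ n * d := Nat.le_mul_of_pos_left _ (by omega)
  refine ⟨h1, fun x => ⟨h2 x, by change 0 < S; omega⟩, fun a i j hi hj => ?_⟩
  have harr : (G.inputState H z S).arr a i j =
      (decoderInput H G z).getD ((a * S + i) * S + j) 0 := by simp [inputState, hi, hj]
  rw [harr]
  refine ⟨rfl, ?_⟩
  rcases lt_or_ge ((a * S + i) * S + j) (decoderInput H G z).length with hlt | hge
  · rw [List.getD_eq_getElem _ _ hlt]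
    exact G.lt_of_mem_decoderInput H z (by omega) (by omega) (by omega) (by omega)
      (List.getElem_mem hlt)
  · rw [List.getD_eq_default _ _ hge]
    omega

end OrderedRegularGraph

/-! ### The complete program on the word RAM -/

namespace ArrayRAM

open RAM Finset

/-- The size of the arrays. -/
def sizeExpr : Expr :=
  .mul (.mul (.add (.mul (.load (.const 0)) (.load (.const 1))) (.const 2))
    (.add (.mul (.load (.const 0)) (.load (.const 1))) (.const 2)))
  (.mul (.add (.mul (.load (.const 0)) (.load (.const 1))) (.const 2))
    (.add (.mul (.load (.const 0)) (.load (.const 1))) (.const 2)))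

/-- The decoder: it computes the size of the arrays, decodes, and returns the address of the
output. -/
def listDecode : Prog :=
  .seq (.set 1 sizeExpr) (.seq setup (.seq decode
    (.set 0 (.mul (.mul (.const aOut) (.reg 1)) (.reg 1)))))

/-- The array layer presupposes its size S in register 1, so S has to be computed by a bare RAM
expression from the first two input cells. -/
theorem eval_sizeExpr {W n d : ℕ} {σ : State} (h0 : σ.mem 0 = n) (h1 : σ.mem 1 = d) (hn : 2 ≤ n)
    (hd : 0 < d) (hW : ((n * d + 2) ^ 4) ^ 6 ≤ W) : sizeExpr.eval W σ = some ((n * d + 2) ^ 4) := by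
  have hnd : n ≤ n * d := Nat.le_mul_of_pos_right _ hd
  have hnd' : d ≤ n * d := Nat.le_mul_of_pos_left _ (by omega)
  have h2 : (n * d + 2) ^ 4 < W := by
    refine lt_of_lt_of_le ?_ hW
    rw [← pow_mul]
    exact Nat.pow_lt_pow_right (by omega) (by norm_num)
  have h3 : (n * d + 2) * (n * d + 2) ≤ (n * d + 2) ^ 4 := by
    rw [← pow_two]
    exact Nat.pow_le_pow_right (by omega) (by norm_num)
  have h4 : n * d + 2 ≤ (n * d + 2) * (n * d + 2) := Nat.le_mul_of_pos_right _ (by omega)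
  have h5 : (n * d + 2) ^ 4 = (n * d + 2) * (n * d + 2) * ((n * d + 2) * (n * d + 2)) := by ring
  have hA : (Expr.load (.const 0)).eval W σ = some n := by
    simp [Expr.eval, word, h0, show 0 < W by omega, show n < W by omega]
  have hB : (Expr.load (.const 1)).eval W σ = some d := by
    simp [Expr.eval, word, h1, show 1 < W by omega, show d < W by omega]
  have hC : (Expr.add (.mul (.load (.const 0)) (.load (.const 1))) (.const 2)).eval W σ =
      some (n * d + 2) := by
    have hM : (Expr.mul (.load (.const 0)) (.load (.const 1))).eval W σ = some (n * d) := by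
      rw [Expr.eval, hA, hB, Option.bind_some, Option.bind_some, word_of_lt (by omega)]
    rw [Expr.eval, hM, Option.bind_some, Expr.eval, word_of_lt (by omega : 2 < W),
      Option.bind_some, word_of_lt (by omega)]
  have hD : ∀ e : Expr, ∀ v, e.eval W σ = some v → v * v < W →
      (Expr.mul e e).eval W σ = some (v * v) := by
    intro e v he hv
    rw [Expr.eval, he, Option.bind_some, Option.bind_some, word_of_lt hv]
  rw [h5]
  exact hD _ _ (hD _ _ hC (by omega)) (by omega)

theorem eval_outputAddress {S W : ℕ} {σ : State} (hS : 256 ≤ S) (hW : S ^ 6 ≤ W) (h1 : σ.reg 1 = S) :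
    (Expr.mul (.mul (.const aOut) (.reg 1)) (.reg 1)).eval W σ = some (aOut * S * S) := by
  have h2 : aOut * S * S < W := by
    refine lt_of_lt_of_le ?_ hW
    calc aOut * S * S ≤ S * S * S := by gcongr; omega
      _ = S ^ 3 := by ring
      _ < S ^ 6 := Nat.pow_lt_pow_right (by omega) (by norm_num)
  have h3 : aOut * S ≤ aOut * S * S := Nat.le_mul_of_pos_right _ (by omega)
  simp only [Expr.eval, h1]
  rw [word_of_lt (by omega), Option.bind_some, word_of_lt (by omega), Option.bind_some,
    word_of_lt (by omega), Option.bind_some, Option.bind_some, word_of_lt h2]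

end ArrayRAM

namespace OrderedRegularGraph

open ArrayRAM RAM Finset

variable {n d m : ℕ} (G : OrderedRegularGraph n d) {hn : 2 ≤ n} {hd : 0 < d} {hm : m ≤ d}
  (H : Matrix (Fin m) (Fin d) (ZMod 2)) (z : G.Edge → Option (ZMod 2))

/-- The state after the setup is known only through `Ready`, so the expansion property is required
for all such states. -/
theorem exec_listDecode {Q : ℕ} (hQ1 : 1 ≤ Q)
    (hQ : ∀ h, Ready (G.table hn hd hm H) (G.received z) h →
      (G.table hn hd hm H).Expanding Q (unkSet (G.table hn hd hm H) h)) :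
    ∃ (σ : State) (t s : ℕ) (h : HState) (out : ℕ → ℕ),
      Exec ((n * d + 2) ^ 24) listDecode (State.init (decoderInput H G z)) σ t ∧
      s * Q ≤ n * d ∧ t ≤ 20038 * n * d ^ 2 + 400000 * n * d ^ 3 * (d + 1 + s) ^ 2 ∧
      Ready (G.table hn hd hm H) (G.received z) h ∧
      (∀ k < 2 + n * d + n * d * s, σ.mem (σ.reg 0 + k) = out k) ∧
      ((out 0 = 0 ∧ ∀ c, ¬ ((G.table hn hd hm H).IsWord c ∧ Agrees (G.table hn hd hm H) h c)) ∨
        ∃ a ≤ s, ∃ M l, Parametrizes (G.table hn hd hm H) (fun c =>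
          (G.table hn hd hm H).IsWord c ∧ Agrees (G.table hn hd hm H) h c) a M l out) := by
  set S := (n * d + 2) ^ 4 with hSdef
  set W := (n * d + 2) ^ 24 with hWdef
  have hS : (G.table hn hd hm H).Fits S := le_rfl
  have hsize : 3 + m * d + n * d + n * d + n * d < S := input_size hS
  have hS256 : 256 ≤ S := by
    have : 4 ^ 4 ≤ (n * d + 2) ^ 4 :=
      Nat.pow_le_pow_left (by have := Nat.mul_le_mul hn hd; omega) 4
    omega
  have hW : S ^ 6 ≤ W := by rw [hSdef, hWdef, ← pow_mul]
  set σ₀ := State.init (decoderInput H G z) with hσ₀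
  have hset := Exec.set (W := W) (x := 1) (eval_sizeExpr (σ := σ₀) rfl rfl hn hd hW)
  obtain ⟨h₁, σ₁, t₁, T₁, he₁, ht₁, hs₁, hr₁, hT₁⟩ :=
    run_setup hS (G.holdsInput_inputState H z hS) (fun e _ => G.received_lt z e)
      (G.degree_le (by omega)) (fun u hu i hi => G.table_eid_left hu hi)
      (fun e he e' he' => G.table_simple he he') W _ hS256 hW
      (G.sim_inputState H z hS (reg := Function.update σ₀.reg 1 S) (by simp)
        (fun x => by rw [Function.update_of_ne (by omega)]; rfl))
  obtain ⟨h₂, σ₂, t₂, T₂, he₂, ht₂, hs₂, s, hsQ, hT₂, hres⟩ :=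
    run_decode hS hr₁.stat hr₁.width hQ1 (hQ _ hr₁) hr₁.dead hr₁.bits hr₁.kn_lt hr₁.zeroRow hr₁.zero
      W _ hS256 hW hs₁
  have hset' := Exec.set (W := W) (x := 0) (eval_outputAddress hS256 hW hs₂.1)
  refine ⟨_, _, s, h₁, h₂.arr aOut 0, .seq hset (.seq he₁ (.seq he₂ hset')), hsQ, ?_, hr₁, ?_, hres⟩
  · have hT₁' : T₁ ≤ 100 * n * d ^ 2 := hT₁
    have hT₂' : T₂ ≤ 2000 * n * d ^ 3 * (d + 1 + s) ^ 2 := hT₂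
    have h1 : 1 ≤ n * d ^ 2 := Nat.mul_pos (by omega) (by positivity)
    have h2 : sizeExpr.cost = 31 := rfl
    have h3 : (Expr.mul (.mul (.const aOut) (.reg 1)) (.reg 1)).cost = 5 := rfl
    rw [h2, h3]
    -- The constants are 200·100 + 38 and 200·2000. The 38 steps compute the array size (31 + 1) and
    -- the output address (5 + 1), and are absorbed by nd² ≥ 1.
    nlinarith
  · intro k hk
    have hk' : k < S := by
      have hsn : s ≤ n * d := (Nat.le_mul_of_pos_right s hQ1).trans hsQ
      have h1 : n * d * s ≤ n * d * (n * d) := Nat.mul_le_mul_left _ hsn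
      have h2 : (n * d + 2) ^ 2 ≤ S := Nat.pow_le_pow_right (by omega) (by norm_num)
      have h3 : (n * d + 2) ^ 2 = n * d * (n * d) + 4 * (n * d) + 4 := by ring
      omega
    have := (hs₂.2.2 aOut 0 k (by omega) hk').1
    rw [add_zero] at this
    simpa using this

theorem returnsAffine_of_parametrizes {σ : State} {s a : ℕ} {Sol : (ℕ → ZMod 2) → Prop}
    {M : ℕ → ℕ → ZMod 2} {l : ℕ → ZMod 2} {out : ℕ → ℕ}
    (hp : Parametrizes (G.table hn hd hm H) Sol a M l out) (ha : a ≤ s)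
    (hout : ∀ k < 2 + n * d + n * d * s, σ.mem (σ.reg 0 + k) = out k) :
    ReturnsAffine G σ (Matrix.of fun (e : G.Edge) (p : Fin a) => M (G.num e) p)
      fun e => l (G.num e) := by
  have hnd : 0 < n * d := Nat.mul_pos (by omega) hd
  have hle : n * d * a ≤ n * d * s := Nat.mul_le_mul_left _ ha
  refine ⟨?_, ?_, fun u i => ?_, fun u i j => ?_⟩
  · exact (hout 0 (by omega)).trans hp.flag
  · exact (hout 1 (by omega)).trans hp.card
  · have hlt := mul_add_lt u.2 i.2
    rw [add_assoc, hout _ (by omega)]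
    beta_reduce
    rw [num_edgeL]
    exact hp.const _ hlt
  · have hlt := mul_add_lt u.2 i.2
    have hlt' := mul_add_lt hlt j.2
    rw [add_assoc, add_assoc, ← add_assoc 2, hout _ (by omega), Matrix.of_apply, num_edgeL]
    exact hp.coeff _ hlt _ j.2

end OrderedRegularGraph

/-! ### Numerical estimates and the theorem -/

/-- The constant is 40 = (5/2)·4², the inverse of 2/5 times the square of the factor 4 in 2^(r+2).
-/
theorem guesses_bound {s : ℝ} {δ x q : ℝ} {r : ℕ} (hδ : 0 < δ) (hx : 0 < x)
    (hq : 2 / 5 * (δ / 2 ^ (r + 2)) ^ 2 * x ≤ q) (hs : 0 ≤ s) (h : s * q ≤ x) :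
    s ≤ 40 * (2 ^ r / δ) ^ 2 := by
  have h1 : s * (2 / 5 * (δ / 2 ^ (r + 2)) ^ 2) * x ≤ 1 * x := by
    refine le_trans ?_ (h.trans (one_mul x).ge)
    rw [mul_assoc]
    exact mul_le_mul_of_nonneg_left hq hs
  have h2 := le_of_mul_le_mul_right h1 hx
  have h3 : 2 / 5 * (δ / 2 ^ (r + 2)) ^ 2 * (40 * (2 ^ r / δ) ^ 2) = 1 := by
    field_simp
    ring
  have h4 : 0 < 2 / 5 * (δ / 2 ^ (r + 2)) ^ 2 := by positivity
  nlinarith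

/-- The number of guesses gives more than is needed: 40 ≤ 2^7, and ε⁴δ⁴ ≤ δ². -/
theorem dimension_bound {a ε δ : ℝ} {r : ℕ} (hε : 0 < ε) (hε1 : ε ≤ 1) (hδ : 0 < δ) (hδ1 : δ ≤ 1)
    (ha : a ≤ 40 * (2 ^ r / δ) ^ 2) : a ≤ 2 ^ (2 * r + 7) / (ε ^ 4 * δ ^ 4) := by
  refine ha.trans ?_
  have h1 : 40 * ((2 : ℝ) ^ r / δ) ^ 2 ≤ 2 ^ (2 * r + 7) / δ ^ 2 := by
    rw [div_pow, ← mul_div_assoc, show (2 : ℝ) ^ (2 * r + 7) = 128 * (2 ^ r) ^ 2 by ring]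
    gcongr
    norm_num
  refine h1.trans (div_le_div_of_nonneg_left (by positivity) (by positivity) ?_)
  have h2 : ε ^ 4 ≤ 1 := pow_le_one₀ hε.le hε1
  have h3 : δ ^ 4 ≤ δ ^ 2 := pow_le_pow_of_le_one hδ.le hδ1 (by norm_num)
  calc ε ^ 4 * δ ^ 4 ≤ 1 * δ ^ 4 := by gcongr
    _ ≤ δ ^ 2 := by linarith

theorem time_bound {n d s ε δ t : ℝ} {r : ℕ} (hn : 0 ≤ n) (hd : 1 ≤ d) (hε : 0 < ε) (hε1 : ε ≤ 1)
    (hδ : 0 < δ) (hδ1 : δ ≤ 1) (hs0 : 0 ≤ s) (hs : s ≤ 40 * (2 ^ r / δ) ^ 2)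
    (ht : t ≤ 20038 * n * d ^ 2 + 400000 * n * d ^ 3 * (d + 1 + s) ^ 2) :
    t ≤ n * (10 ^ 9 * (2 ^ r * d / (ε * δ)) ^ 7) := by
  set X := 2 ^ r * d / (ε * δ) with hX
  have hr : (1 : ℝ) ≤ 2 ^ r := one_le_pow₀ (by norm_num)
  have hεδ : ε * δ ≤ 1 := by nlinarith
  have hdX : d ≤ X := by
    rw [hX, le_div_iff₀ (by positivity)]
    nlinarith [mul_le_mul_of_nonneg_left hεδ (by linarith : 0 ≤ d)]
  have hX1 : 1 ≤ X := hd.trans hdX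
  have hrX : 2 ^ r / δ ≤ X := by
    rw [hX, div_le_div_iff₀ hδ (by positivity)]
    have : ε ≤ d := hε1.trans hd
    nlinarith [mul_le_mul_of_nonneg_left this (by positivity : 0 ≤ (2 : ℝ) ^ r * δ)]
  -- Both d and 1 are at most X², and s is at most 40X². This makes 400000·42² = 705600000 the
  -- coefficient of X^7.
  have hsX : d + 1 + s ≤ 42 * X ^ 2 := by
    have h1 : (2 ^ r / δ) ^ 2 ≤ X ^ 2 := by gcongr
    nlinarith
  calc t ≤ 20038 * n * d ^ 2 + 400000 * n * d ^ 3 * (d + 1 + s) ^ 2 := ht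
    _ ≤ 20038 * n * X ^ 2 + 400000 * n * X ^ 3 * (42 * X ^ 2) ^ 2 := by gcongr
    _ = n * (20038 * X ^ 2 + 705600000 * X ^ 7) := by ring
    _ ≤ n * (20038 * X ^ 7 + 705600000 * X ^ 7) := by
      have : X ^ 2 ≤ X ^ 7 := pow_le_pow_right₀ hX1 (by norm_num)
      gcongr
    _ = n * (705620038 * X ^ 7) := by ring
    _ ≤ n * (10 ^ 9 * X ^ 7) := by
      gcongr
      norm_num

theorem theorem1 :
    ∃ (ListDecode : RAM.Prog) (k : ℕ) (poly : Polynomial ℝ),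
      ∀ (n d m r : ℕ) (hn : 2 ≤ n) (_ : m ≤ d)
        (C₀ : Submodule (ZMod 2) (Fin d → ZMod 2))
        (H : Matrix (Fin m) (Fin d) (ZMod 2))
        (_ : ∀ x, x ∈ C₀ ↔ H.mulVec x = 0)
        (_ : 1 ≤ r) (_ : r ≤ Module.finrank (ZMod 2) C₀)
        (G : OrderedRegularGraph n d) (ε : ℝ) (_ : 0 < ε)
        (_ : G.expansion hn / d ≤ ε ^ 2 * relDist C₀ ^ 2 / 2 ^ (r + 4))
        (z : G.Edge → Option (ZMod 2))
        (_ : ({e | z e = none}.ncard : ℝ) ≤ (1 - ε) * relDist C₀ * genDist r C₀ * d * n),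
        ∃ (σ : RAM.State) (t : ℕ),
          RAM.Exec ((n * d + 2) ^ k) ListDecode (RAM.State.init (decoderInput H G z)) σ t ∧
          (t : ℝ) ≤ n * poly.eval (2 ^ r * d / (ε * relDist C₀)) ∧
          ((erasureList (G.expanderCode C₀) z = ∅ ∧ ReturnsBot σ) ∨
            ∃ (a : ℕ) (M : Matrix G.Edge (Fin a) (ZMod 2)) (ℓ : G.Edge → ZMod 2),
              ReturnsAffine G σ M ℓ ∧
              erasureList (G.expanderCode C₀) z = {c | ∃ x : Fin a → ZMod 2, c = M.mulVec x + ℓ} ∧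
              a = Module.finrank (ZMod 2)
                (vectorSpan (ZMod 2) (erasureList (G.expanderCode C₀) z)) ∧
              (a : ℝ) ≤ 2 ^ (2 * r + 7) / (ε ^ 4 * relDist C₀ ^ 4)) := by
  -- The exponent is 24 = 4·6: the arrays have side (nd+2)^4, and words range up to the sixth power
  -- of the side.
  refine ⟨ArrayRAM.listDecode, 24, .C (10 ^ 9) * .X ^ 7, ?_⟩
  intro n d m r hn hm C₀ H hC hr1 hr G ε hε hlam z hz
  have hd : 0 < d := by
    rcases Nat.eq_zero_or_pos d with rfl | hd
    · have : Module.finrank (ZMod 2) C₀ = 0 := Module.finrank_zero_of_subsingleton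
      omega
    · exact hd
  have hδ0 : 0 < relDist C₀ := relDist_pos (hr1.trans hr)
  have hδr : relDist C₀ ≤ genDist r C₀ := relDist_le_genDist hr1 hr
  have hδ1 : relDist C₀ ≤ 1 := hδr.trans (genDist_le_one r hr)
  have hn' : (0 : ℝ) < n := by exact_mod_cast (by omega : 0 < n)
  have hd' : (0 : ℝ) < d := by exact_mod_cast hd
  -- The number of erasures is not negative, so its upper bound cannot have a negative factor 1-ε.
  have hε1 : ε ≤ 1 := by
    have h1 : 0 ≤ (1 - ε) * (relDist C₀ * genDist r C₀ * d * n) := by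
      refine (Nat.cast_nonneg _).trans (hz.trans (le_of_eq ?_))
      ring
    have h2 : 0 < relDist C₀ * genDist r C₀ * d * n := by
      have := hδ0.trans_le hδr
      positivity
    linarith [nonneg_of_mul_nonneg_left h1 h2]
  have hdn : (0 : ℝ) < d * n := by positivity
  have hqpos : 0 < 2 / 5 * (relDist C₀ / 2 ^ (r + 2)) ^ 2 * d * n := by positivity
  obtain ⟨σ, t, s, h, out, hexec, hsQ, ht, hready, hout, hres⟩ :=
    G.exec_listDecode (hn := hn) (hd := hd) (hm := hm) H z (Nat.ceil_pos.2 hqpos) fun h hready =>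
      G.table_expanding hC hr1 hr hε hε1 hlam (Finset.filter_subset _ _)
        (le_trans (by exact_mod_cast G.card_unkSet_le_ncard hready) hz)
  have hs : (s : ℝ) ≤ 40 * (2 ^ r / relDist C₀) ^ 2 := by
    refine guesses_bound hδ0 hdn ((mul_assoc _ _ _).ge.trans (Nat.le_ceil _)) (Nat.cast_nonneg s) ?_
    rw [mul_comm (d : ℝ)]
    exact_mod_cast hsQ
  refine ⟨σ, t, hexec, ?_, ?_⟩
  · rw [Polynomial.eval_mul, Polynomial.eval_C, Polynomial.eval_pow, Polynomial.eval_X]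
    exact time_bound hn'.le (by exact_mod_cast hd) hε hε1 hδ0 hδ1 (Nat.cast_nonneg s) hs
      (by exact_mod_cast ht)
  rcases hres with ⟨hflag, hnone⟩ | ⟨a, has, M, l, hp⟩
  · refine Or.inl ⟨Set.eq_empty_iff_forall_notMem.2 fun c hc => ?_, (hout 0 (by omega)).trans hflag⟩
    obtain ⟨c, rfl⟩ := G.exists_comp_num c
    exact hnone c ((G.mem_erasureList_iff hC hready c).1 hc)
  · have hlist := G.erasureList_eq_of_parametrizes hC hready hp
    refine Or.inr ⟨a, _, _, G.returnsAffine_of_parametrizes H hp has hout, hlist, ?_, ?_⟩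
    · rw [hlist, G.finrank_of_parametrizes hp]
    · exact dimension_bound hε hε1 hδ0 hδ1 (le_trans (by exact_mod_cast has) hs)
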